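/- Let $G/K$ be a homogeneous space with $G$ compact semisimple, $\mathfrak g=\mathfrak k\oplus\mathfrak p$ the orthogonal decomposition for $Q=-B$ ($B$ the Killing form of $\mathfrak g$), and identify $G$-invariant metrics with $\mathrm{Ad}(K)$-invariant inner products $g$ on $\mathfrak p$ and $G$-invariant symmetric 2-tensors $g(A\cdot,\cdot)$ with $A\in\mathrm{sym}(\mathfrak p)^K$. Let $\mu_{\mathfrak p}$ be the $\mathfrak p$-component of the bracket on $\mathfrak p$, $\theta(A)\mu=A\mu(\cdot,\cdot)-\mu(A\cdot,\cdot)-\mu(\cdot,A\cdot)$, $\langle M_{\mu_{\mathfrak p}},A\rangle=\frac14\langle\theta(A)\mu_{\mathfrak p},\mu_{\mathfrak p}\rangle$, and let $L_{\mathfrak p}=L_{\mathfrak p}(g)$ be the Lichnerowicz Laplacian on $\mathrm{sym}(\mathfrak p)$, $$\langle L_{\mathfrak p}A,B\rangle=\tfrac12\langle\theta(A)\mu_{\mathfrak p},\theta(B)\mu_{\mathfrak p}\rangle+2\,\mathrm{tr}(M_{\mu_{\mathfrak p}}AB).$$ Let $\mathcal{TT}_g^G$ be the space of $G$-invariant,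 traceless, divergence-free symmetric 2-tensors, and let $\lambda_{\mathfrak p}\le\lambda_{\mathfrak p}^{max}$ be the smallest and the largest eigenvalue of $L_{\mathfrak p}|_{\mathcal{TT}_g^G}$. Let $\mathrm{scal}''_g$ be the Hessian, at an invariant Einstein metric $g$ ($\mathrm{Ric}(g)=\rho g$), of the scalar curvature on the set of invariant metrics of the same volume as $g$. The metric $g$ is $G$-unstable if $\mathrm{scal}''_g(T,T)>0$ for some $T\in\mathcal{TT}_g^G$, $G$-non-degenerate if $\mathrm{scal}''_g|_{\mathcal{TT}_g^G}$ is non-degenerate, and its coindex is the largest dimension of a subspace of $\mathcal{TT}_g^G$ on which $\mathrm{scal}''_g$ is positive definite. "Local minimum" and "saddle" (neither a local minimum nor a local maximum) refer to the scalar curvature on the invariant metrics of fixed volume. **(A)** Let $G/K$ be a generalized Wallach space: $\mathfrak p=\mathfrak p_1\oplus\mathfrak p_2\oplus\mathfrak p_3$, $Q$-orthogonal, with $\mathfrak p_i\neq0$ $\mathrm{Ad}(K)$-invariant and irreducible and $[\mathfrak p_i,\mathfrak p_i]\subset\mathfrak k$. Write $(x_1,x_2,x_3)$ for the metric $\sum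 x_iQ|_{\mathfrak p_i}$, $d_i=\dim\mathfrak p_i$, $[123]=\sum Q([e^1_\alpha,e^2_\beta],e^3_\gamma)^2$ over $Q$-orthonormal bases. Assume $d_1=d_2\ne d_3$ and set $b=[123]/d_1$, $c=[123]/d_3$, $$q^\pm=\frac{1\pm\sqrt{1-4(b+c)(1-2c)}}{2(b+c)},$$ $$p^\pm=\frac{1-2b+8b^2(b+c)\pm\sqrt{(1-2b+8b^2(b+c))^2-4(b+c)^2(1-4b^2)^2}}{2(b+c)(1-4b^2)},$$ $g_q=(1,1,q)$, $g_p=(p,1,2b(p+1))$. If $1-4(b+c)(1-2c)\ge0$ and $q\in\{q^+,q^-\}$ is positive, then $g_q$ is Einstein with $2\rho=1-bq$, and the spectrum of $L_{\mathfrak p}(g_q)$ on the tensors that are scalar on each $\mathfrak p_i$ is $\{0,\ \frac{b(4-q^2)}{q},\ q(b+2c)\}$. If $b>0$, the radicand in $p^\pm$ is non-negative and $p\in\{p^+,p^-\}$ is positive, then $g_p$ is Einstein with $2\rho=\frac{(1+p)(1-4b^2)}{2p}$, and the spectrum of $L_{\mathfrak p}(g_p)$ on the same tensors is $\{0,\lambda_-(p),\lambda_+(p)\}$,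 where $$\lambda_\pm(p)=\frac{4cb^2(p+1)^2+b(p^2+1)\pm\sqrt{2bD(p)}}{2bp(p+1)},\qquad D(p)=c_4p^4+c_3p^3+c_2p^2+c_3p+c_4,$$ $c_4=(b+c)(8b^3c+1-4b^2+8b^4)$, $c_3=8b^2(b+c)(4bc+4b^2-1)$, $c_2=96cb^4-8b^3+48c^2b^3+48b^5-2c-8cb^2$. If the $\mathfrak p_i$ are pairwise inequivalent, these are the spectra on all of $\mathrm{sym}(\mathfrak p)^K$. **(B)** On each of the following spaces, with $b,c,q^\pm,p^\pm$ given by the formulas above, the metrics listed are invariant Einstein metrics, $G$-unstable and $G$-non-degenerate, with the stated values of $\lambda_{\mathfrak p}$, $\lambda_{\mathfrak p}^{max}$ and $2\rho$. In every case in which these are stated, the spectrum of $L_{\mathfrak p}$ on $\mathcal{TT}_g^G$ is $\{\lambda_{\mathfrak p},\lambda_{\mathfrak p}^{max}\}$ unless stated otherwise, and on $\mathrm{sym}(\mathfrak p)^K$ it contains $0$ in addition. Put $T=1-2(2b+c)+16b^2(b+c)$. * $W_1$: $\mathrm{SO}(k+2m)/\mathrm{SO}(k)\times\mathrm{SO}(m)^2$,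 $k\ge1$, $m\ge3$, $k\ne m$; $b=\frac m{2(k+2m-2)}$, $c=\frac k{2(k+2m-2)}$. Here $T\neq0$. Suppose first $k^2>4(m-1)$. For $q=q^+$: $\lambda_{\mathfrak p}=\frac{b(4-q^2)}q$, $\lambda^{max}_{\mathfrak p}=q(b+2c)$, $2\rho=1-bq$, saddle of coindex 1. For $q=q^-$ the spectrum on $\mathcal{TT}_g^G$ and $2\rho$ are given by the same formulas; if $T>0$ the metric is a local minimum of coindex 2, with $\lambda_{\mathfrak p}=\frac{b(4-q^2)}q$ if $k<m$ and $\lambda_{\mathfrak p}=q(b+2c)$ if $k>m$; if $T<0$ it is a saddle of coindex 1 with $\lambda_{\mathfrak p}=q(b+2c)$. If $T>0$ (whether or not $k^2>4(m-1)$), both $g_{p^\pm}$ are saddles of coindex 1 with $\lambda_{\mathfrak p}=\lambda_-(p)$, $\lambda_{\mathfrak p}^{max}=\lambda_+(p)$, $2\rho=\frac{(1+p)(1-4b^2)}{2p}$. * Stiefel manifolds $\mathrm{SO}(k+2)/\mathrm{SO}(k)$, $k\ge3$; $b=\frac1{2k}$, $c=\frac12$: $q^+=\frac{2k}{k+1}$,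 $\lambda_{\mathfrak p}=\frac{2k+1}{k^2(k+1)}$, $\lambda_{\mathfrak p}^{max}=\frac{2k+1}{k+1}$, $2\rho=\frac k{k+1}$, and $g_{q^+}$ is a saddle of coindex 2. * $\mathrm{SO}(4)/\mathrm{SO}(2)$; $b=\frac14$, $c=\frac12$: $q^+=\frac43$, $2\rho=\frac23$, the spectrum of $L_{\mathfrak p}(g_{q^+})$ is $\{0,\frac5{12},\frac53\}$ on the tensors that are scalar on each $\mathfrak p_i$ and $\{\frac13,\frac5{12},\frac53\}$ on $\mathcal{TT}_g^G$, and $g_{q^+}$ is a saddle of coindex 3. The non-diagonal Einstein metric $g_\times$ which is the product metric on $S^2\times S^3$ (up to scaling, $2(x_{14}^2+x_{24}^2+x_{34}^2)+(x_{13}-x_{24})^2+(x_{23}+x_{14})^2$ in the entries of $X\in\mathfrak{so}(4)$, with $\mathrm{SO}(2)$ acting on the coordinates $1,2$) is a $G$-unstable, $G$-non-degenerate saddle of coindex 1. * $W_2$: $\mathrm{SU}(k+2m)/\mathrm{S}(\mathrm U(k)\times\mathrm U(m)^2)$, $k,m\ge1$, $k\neq m$; $b=\frac m{2(k+2m)}$,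 $c=\frac k{2(k+2m)}$. Saddles of coindex 1: $q^+=2$ ($\lambda_{\mathfrak p}=0$, $\lambda_{\mathfrak p}^{max}=\frac{2k+m}{k+2m}$, $2\rho=\frac{k+m}{k+2m}$); $p^+=\frac{k+3m}{k+m}$ ($0$, $\frac{(k+5m)(k+m)}{(k+2m)(k+3m)}$, $\frac{k+m}{k+2m}$); $p^-=\frac{k+m}{k+3m}$ ($0$, $\frac{k+5m}{k+2m}$, $\frac{k+3m}{k+2m}$). For $q^-=\frac{2m}{k+m}$: local minimum of coindex 2, $\lambda_{\mathfrak p},\lambda_{\mathfrak p}^{max}$ are $\frac k{k+m},\frac{m(2k+m)}{(k+2m)(k+m)}$ in this order if $k<m$ and in the opposite order if $k>m$, and $2\rho=\frac{k^2+m^2+3km}{(k+m)(k+2m)}$. * $W_3$: $\mathrm{Sp}(k+2m)/\mathrm{Sp}(k)\times\mathrm{Sp}(m)^2$, $k,m\ge1$, $k\ne m$; $b=\frac m{2(k+2m+1)}$, $c=\frac k{2(k+2m+1)}$. $g_{q^+}$ and $g_{p^\pm}$ are saddles of coindex 1 and $g_{q^-}$ is a local minimum of coindex 2, with $\lambda_{\mathfrak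 p},\lambda_{\mathfrak p}^{max},2\rho$ given by the same formulas in $b,c,q,p$ as for $W_1$ with $T>0$. * $W_5$: $\mathrm{SO}(2l)/\mathrm U(1)\times\mathrm U(l-1)$, $l\ge5$; $b=\frac{l-2}{4(l-1)}$, $c=\frac1{2(l-1)}$. Saddles of coindex 1: $q^+=2$ ($\lambda_{\mathfrak p}=0$, $\lambda_{\mathfrak p}^{max}=\frac{l+2}{2(l-1)}$, $2\rho=\frac l{2(l-1)}$); $p^+=\frac{3l-4}l$ ($0$, $\frac{l(5l-8)}{2(3l^2-7l+4)}$, $\frac l{2(l-1)}$); $p^-=\frac l{3l-4}$ ($0$, $\frac{5l-8}{2(l-1)}$, $\frac{3l-4}{2(l-1)}$). For $q^-=\frac{2(l-2)}l$: local minimum of coindex 2, $\lambda_{\mathfrak p}=\frac2l$, $\lambda_{\mathfrak p}^{max}=\frac{l^2-4}{2l(l-1)}$, $2\rho=\frac{l^2+2l-4}{2l(l-1)}$. -/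

import Mathlib

/-!
Invariant geometry of a homogeneous space `M = G/K`, `G` compact semisimple, in algebraic form.

The data are the Lie algebra `L` of `G`, the Lie subalgebra `𝔨` of `K`, and the set `Ad` of
automorphisms `Ad(h)`, `h ∈ K`, of `L`.  The tangent space at the origin is `𝔭 = tangent 𝔨`, the
orthogonal complement of `𝔨` for the Killing form.  A `G`-invariant metric is an `Ad(K)`-invariant
inner product on `𝔭`, and a `G`-invariant symmetric 2-tensor is `g(A·,·)` with `A` a `g`-symmetric
endomorphism of `𝔭` that commutes with `Ad(K)`.
-/

attribute [local instance 100] LieRing.ofAssociativeRing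

namespace InvGeom

noncomputable section

open LinearMap (BilinForm)

section Algebra

variable {V : Type*} [AddCommGroup V] [Module ℝ V] [FiniteDimensional ℝ V]

/-- The `g`-trace `g^{ij} β(e_i, e_j)` of a bilinear expression `β`; it is `∑ β(X_i, X_i)` for any
`g`-orthonormal basis `X_i`. -/
def gtr (g : BilinForm ℝ V) (β : V → V → ℝ) : ℝ :=
  ∑ i, ∑ j, (LinearMap.BilinForm.toMatrix (Module.finBasis ℝ V) g)⁻¹ i j *
    β (Module.finBasis ℝ V i) (Module.finBasis ℝ V j)

/-- `⟨μ, ν⟩ = ∑ g(μ(X_i, X_j), ν(X_i, X_j))` on brackets. -/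
def innerBracket (g : BilinForm ℝ V) (μ ν : V → V → V) : ℝ :=
  gtr g fun x x' => gtr g fun y y' => g (μ x y) (ν x' y')

/-- `θ(A)μ = A μ(·,·) - μ(A·,·) - μ(·,A·)`. -/
def theta (A : Module.End ℝ V) (μ : V → V → V) : V → V → V :=
  fun x y => A (μ x y) - μ (A x) y - μ x (A y)

/-- The moment map `⟨M_μ X, Y⟩`, whose quadratic form is
`-1/2 ∑ g(μ(X,X_i),X_j)² + 1/4 ∑ g(μ(X_i,X_j),X)²`. -/
def moment (g : BilinForm ℝ V) (μ : V → V → V) (X Y : V) : ℝ :=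
  -(1 / 2) * gtr g (fun u u' => g (μ X u) (μ Y u')) +
    (1 / 4) * gtr g (fun u u' => gtr g fun v v' => g (μ u v) X * g (μ u' v') Y)

/-- The `g`-symmetric endomorphisms `sym(𝔭)`. -/
def symEnd (g : BilinForm ℝ V) : Set (Module.End ℝ V) :=
  {A | ∀ X Y, g (A X) Y = g X (A Y)}

/-- The form `⟨L_𝔭 A, B⟩ = 1/2 ⟨θ(A)μ, θ(B)μ⟩ + 2 tr(M_μ A B)` of the Lichnerowicz Laplacian. -/
def lichForm (g : BilinForm ℝ V) (μ : V → V → V) (A B : Module.End ℝ V) : ℝ :=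
  (1 / 2) * innerBracket g (theta A μ) (theta B μ) +
    2 * gtr g (fun u v => moment g μ (A (B u)) v)

/-- `⟨∇_X Y, Z⟩` for the Levi-Civita connection at the origin:
`1/2 (⟨μ(X,Y),Z⟩ + ⟨μ(Z,X),Y⟩ + ⟨X,μ(Z,Y)⟩)`. -/
def leviCivita (g : BilinForm ℝ V) (μ : V → V → V) (X Y Z : V) : ℝ :=
  (1 / 2) * (g (μ X Y) Z + g (μ Z X) Y + g X (μ Z Y))

/-- The divergence `(δT)(X) = -∑ (∇_{X_i} T)(X_i, X)` of the invariant tensor `T = g(A·,·)`. -/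
def divergence (g : BilinForm ℝ V) (μ : V → V → V) (A : Module.End ℝ V) (X : V) : ℝ :=
  gtr g fun u v => leviCivita g μ u v (A X) + leviCivita g μ u X (A v)

end Algebra

section Homogeneous

variable {L : Type*} [LieRing L] [LieAlgebra ℝ L] [FiniteDimensional ℝ L]

/-- The background inner product `Q = -B`, with `B` the Killing form. -/
def Q (L : Type*) [LieRing L] [LieAlgebra ℝ L] : BilinForm ℝ L := -killingForm ℝ L

open Classical in
/-- The `Q`-orthogonal projection onto `W`
(`W` and its orthogonal are always complementary when `Q` is definite). -/
def qproj (W : Submodule ℝ L) : L →ₗ[ℝ] W :=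
  if h : IsCompl W ((Q L).orthogonal W) then W.projectionOnto _ h else 0

/-- The reductive complement `𝔭` of `𝔨`. -/
def tangent (𝔨 : LieSubalgebra ℝ L) : Submodule ℝ L := (Q L).orthogonal 𝔨.toSubmodule

/-- The bracket `μ_𝔭`: the `𝔭`-component of the Lie bracket on `𝔭`. -/
def bracketP (𝔨 : LieSubalgebra ℝ L) (X Y : tangent 𝔨) : tangent 𝔨 :=
  qproj (tangent 𝔨) ⁅(X : L), (Y : L)⁆

/-- The Ricci tensor `⟨M_{μ_𝔭} X, Y⟩ - 1/2 B(X, Y)`. -/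
def ricci (𝔨 : LieSubalgebra ℝ L) (g : BilinForm ℝ (tangent 𝔨)) (X Y : tangent 𝔨) : ℝ :=
  moment g (bracketP 𝔨) X Y - (1 / 2) * killingForm ℝ L X Y

/-- The scalar curvature `-1/4 |μ_𝔭|² - 1/2 tr_g B`. -/
def scal (𝔨 : LieSubalgebra ℝ L) (g : BilinForm ℝ (tangent 𝔨)) : ℝ :=
  -(1 / 4) * innerBracket g (bracketP 𝔨) (bracketP 𝔨) -
    (1 / 2) * gtr g (fun X Y => killingForm ℝ L X Y)

/-- `Ric(g) = ρ g`. -/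
def IsEinstein (𝔨 : LieSubalgebra ℝ L) (g : BilinForm ℝ (tangent 𝔨)) (ρ : ℝ) : Prop :=
  ∀ X Y, ricci 𝔨 g X Y = ρ * g X Y

/-- `g ∈ M^G`: an `Ad(K)`-invariant inner product on `𝔭`. -/
structure IsInvMetric (𝔨 : LieSubalgebra ℝ L) (Ad : Set (L ≃ₗ⁅ℝ⁆ L))
    (g : BilinForm ℝ (tangent 𝔨)) : Prop where
  symm : ∀ X Y, g X Y = g Y X
  pos : ∀ X, X ≠ 0 → 0 < g X X
  inv : ∀ φ ∈ Ad, ∀ X Y X' Y' : tangent 𝔨,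
    (X' : L) = φ X → (Y' : L) = φ Y → g X' Y' = g X Y

/-- `sym(𝔭)^K`, i.e. the `G`-invariant symmetric 2-tensors. -/
def symEndK (𝔨 : LieSubalgebra ℝ L) (Ad : Set (L ≃ₗ⁅ℝ⁆ L)) (g : BilinForm ℝ (tangent 𝔨)) :
    Set (Module.End ℝ (tangent 𝔨)) :=
  {A | A ∈ symEnd g ∧ ∀ φ ∈ Ad, ∀ X Y : tangent 𝔨, (Y : L) = φ X → (A Y : L) = φ (A X)}

/-- `TT_g^G`: the `G`-invariant, traceless, divergence-free symmetric 2-tensors. -/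
def TT (𝔨 : LieSubalgebra ℝ L) (Ad : Set (L ≃ₗ⁅ℝ⁆ L)) (g : BilinForm ℝ (tangent 𝔨)) :
    Set (Module.End ℝ (tangent 𝔨)) :=
  {A | A ∈ symEndK 𝔨 Ad g ∧ LinearMap.trace ℝ _ A = 0 ∧ ∀ X, divergence g (bracketP 𝔨) A X = 0}

/-- The eigenvalues of `L_𝔭 : sym(𝔭) → sym(𝔭)` with an eigenvector in `S`: `L_𝔭 A = t A` is tested
against all of `sym(𝔭)` with its inner product `tr(AB)`. -/
def lichSpec (𝔨 : LieSubalgebra ℝ L) (g : BilinForm ℝ (tangent 𝔨))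
    (S : Set (Module.End ℝ (tangent 𝔨))) : Set ℝ :=
  {t | ∃ A ∈ S, A ≠ 0 ∧ ∀ B ∈ symEnd g,
    lichForm g (bracketP 𝔨) A B = t * LinearMap.trace ℝ _ (A * B)}

/-- The curve `g((I + tA)·,·)` through `g`, rescaled so that its volume is constant. -/
def volCurve {𝔨 : LieSubalgebra ℝ L} (g : BilinForm ℝ (tangent 𝔨))
    (A : Module.End ℝ (tangent 𝔨)) (t : ℝ) : BilinForm ℝ (tangent 𝔨) :=
  (LinearMap.det (1 + t • A)) ^ (-(1 : ℝ) / Module.finrank ℝ (tangent 𝔨)) • g.compLeft (1 + t • A)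

/-- `scal''_g(T, T)`, `T = g(A·,·)`: the Hessian at a critical point `g` of the scalar curvature on
the invariant metrics of the volume of `g`. -/
def hess (𝔨 : LieSubalgebra ℝ L) (g : BilinForm ℝ (tangent 𝔨))
    (A : Module.End ℝ (tangent 𝔨)) : ℝ :=
  iteratedDeriv 2 (fun t => scal 𝔨 (volCurve g A t)) 0

/-- The symmetric bilinear form of the quadratic form `hess`. -/
def hess₂ (𝔨 : LieSubalgebra ℝ L) (g : BilinForm ℝ (tangent 𝔨))
    (A B : Module.End ℝ (tangent 𝔨)) : ℝ :=
  (hess 𝔨 g (A + B) - hess 𝔨 g (A - B)) / 4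

/-- `G`-instability. -/
def IsUnstable (𝔨 : LieSubalgebra ℝ L) (Ad : Set (L ≃ₗ⁅ℝ⁆ L)) (g : BilinForm ℝ (tangent 𝔨)) :
    Prop :=
  ∃ A ∈ TT 𝔨 Ad g, 0 < hess 𝔨 g A

/-- `G`-non-degeneracy. -/
def IsNondegenerate (𝔨 : LieSubalgebra ℝ L) (Ad : Set (L ≃ₗ⁅ℝ⁆ L))
    (g : BilinForm ℝ (tangent 𝔨)) : Prop :=
  ∀ A ∈ TT 𝔨 Ad g, (∀ B ∈ TT 𝔨 Ad g, hess₂ 𝔨 g A B = 0) → A = 0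

/-- `n` is the coindex: the largest dimension of a subspace of `TT_g^G` on which `scal''_g` is
positive definite. -/
def HasCoindex (𝔨 : LieSubalgebra ℝ L) (Ad : Set (L ≃ₗ⁅ℝ⁆ L)) (g : BilinForm ℝ (tangent 𝔨))
    (n : ℕ) : Prop :=
  IsGreatest {d | ∃ W : Submodule ℝ (Module.End ℝ (tangent 𝔨)),
    (∀ A ∈ W, A ∈ TT 𝔨 Ad g ∧ (A ≠ 0 → 0 < hess 𝔨 g A)) ∧ Module.finrank ℝ W = d} n

/-- `g'` is an invariant metric of the same volume as `g` and `ε`-close to `g`. -/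
structure IsNear (𝔨 : LieSubalgebra ℝ L) (Ad : Set (L ≃ₗ⁅ℝ⁆ L)) (g : BilinForm ℝ (tangent 𝔨))
    (ε : ℝ) (g' : BilinForm ℝ (tangent 𝔨)) : Prop where
  metric : IsInvMetric 𝔨 Ad g'
  volume : (LinearMap.BilinForm.toMatrix (Module.finBasis ℝ (tangent 𝔨)) g').det =
    (LinearMap.BilinForm.toMatrix (Module.finBasis ℝ (tangent 𝔨)) g).det
  close : ∀ X, |g' X X - g X X| ≤ ε * g X X

/-- `g` is a local minimum of `scal` on the invariant metrics of its volume. -/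
def IsLocMin (𝔨 : LieSubalgebra ℝ L) (Ad : Set (L ≃ₗ⁅ℝ⁆ L)) (g : BilinForm ℝ (tangent 𝔨)) :
    Prop :=
  ∃ ε > 0, ∀ g', IsNear 𝔨 Ad g ε g' → scal 𝔨 g ≤ scal 𝔨 g'

/-- `g` is a local maximum of `scal` on the invariant metrics of its volume. -/
def IsLocMax (𝔨 : LieSubalgebra ℝ L) (Ad : Set (L ≃ₗ⁅ℝ⁆ L)) (g : BilinForm ℝ (tangent 𝔨)) :
    Prop :=
  ∃ ε > 0, ∀ g', IsNear 𝔨 Ad g ε g' → scal 𝔨 g' ≤ scal 𝔨 g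

/-- Saddle point (for a critical point `g`). -/
def IsSaddle (𝔨 : LieSubalgebra ℝ L) (Ad : Set (L ≃ₗ⁅ℝ⁆ L)) (g : BilinForm ℝ (tangent 𝔨)) :
    Prop :=
  ¬ IsLocMin 𝔨 Ad g ∧ ¬ IsLocMax 𝔨 Ad g

/-- `g` is an Einstein metric with `2ρ = r` which is `G`-unstable and `G`-non-degenerate; the
spectrum of `L_𝔭` on `TT_g^G` is `S`, with minimum `l` and maximum `u`, and on `sym(𝔭)^K` it is
`S ∪ {0}`. -/
structure EinsteinRow (𝔨 : LieSubalgebra ℝ L) (Ad : Set (L ≃ₗ⁅ℝ⁆ L))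
    (g : BilinForm ℝ (tangent 𝔨)) (S : Set ℝ) (l u r : ℝ) : Prop where
  metric : IsInvMetric 𝔨 Ad g
  einstein : IsEinstein 𝔨 g (r / 2)
  spec : lichSpec 𝔨 g (symEndK 𝔨 Ad g) = insert 0 S
  specTT : lichSpec 𝔨 g (TT 𝔨 Ad g) = S
  least : IsLeast S l
  greatest : IsGreatest S u
  unstable : IsUnstable 𝔨 Ad g
  nondegenerate : IsNondegenerate 𝔨 Ad g

/-! ### Generalized Wallach spaces -/

/-- The metric `(x_0, x_1, x_2) = ∑ x_i Q|_{𝔭_i}` for a decomposition `𝔭 = 𝔭_0 ⊕ 𝔭_1 ⊕ 𝔭_2`. -/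
def diagMetric (𝔨 : LieSubalgebra ℝ L) (p : Fin 3 → Submodule ℝ L) (x : Fin 3 → ℝ) :
    BilinForm ℝ (tangent 𝔨) :=
  ∑ i, x i • (Q L).comp ((p i).subtype ∘ₗ qproj (p i) ∘ₗ (tangent 𝔨).subtype)
    ((p i).subtype ∘ₗ qproj (p i) ∘ₗ (tangent 𝔨).subtype)

/-- The endomorphisms of `𝔭` that act on each `𝔭_i` as a scalar. -/
def diagEnd (𝔨 : LieSubalgebra ℝ L) (p : Fin 3 → Submodule ℝ L) :
    Set (Module.End ℝ (tangent 𝔨)) :=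
  {A | ∀ i, ∃ s : ℝ, ∀ X : tangent 𝔨, (X : L) ∈ p i → A X = s • X}

/-- The structural constant `[UVW] = ∑ Q([e_α, e_β], e_γ)²` over `Q`-orthonormal bases. -/
def strConst (U V W : Submodule ℝ L) : ℝ :=
  gtr ((Q L).restrict U) fun x x' => gtr ((Q L).restrict V) fun y y' =>
    gtr ((Q L).restrict W) fun z z' =>
      Q L ⁅(x : L), (y : L)⁆ (z : L) * Q L ⁅(x' : L), (y' : L)⁆ (z' : L)

/-- `G/K` with `G` compact semisimple is a generalized Wallach space with modules `𝔭_i`.  `Ad` is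
`Ad(K)`; all that is used of it is that it consists of automorphisms of `L` that preserve `𝔨`. -/
structure IsGenWallach (𝔨 : LieSubalgebra ℝ L) (Ad : Set (L ≃ₗ⁅ℝ⁆ L))
    (p : Fin 3 → Submodule ℝ L) : Prop where
  compact : ∀ X : L, X ≠ 0 → killingForm ℝ L X X < 0
  isotropy : ∀ φ ∈ Ad, ∀ X ∈ 𝔨, φ X ∈ 𝔨
  orthogonal : ∀ i j, i ≠ j → ∀ X ∈ p i, ∀ Y ∈ p j, Q L X Y = 0
  span : ⨆ i, p i = tangent 𝔨
  stable : ∀ i, ∀ φ ∈ Ad, ∀ X ∈ p i, φ X ∈ p i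
  ne_bot : ∀ i, p i ≠ ⊥
  irreducible : ∀ i, ∀ W ≤ p i, (∀ φ ∈ Ad, ∀ X ∈ W, φ X ∈ W) → W = ⊥ ∨ W = p i
  bracket : ∀ i, ∀ X ∈ p i, ∀ Y ∈ p i, ⁅X, Y⁆ ∈ 𝔨

/-- The modules `𝔭_i` are pairwise inequivalent. -/
def PairwiseInequivalent (Ad : Set (L ≃ₗ⁅ℝ⁆ L)) (p : Fin 3 → Submodule ℝ L) : Prop :=
  ∀ i j, i ≠ j → ∀ T : p i →ₗ[ℝ] p j,
    (∀ φ ∈ Ad, ∀ X Y : p i, (Y : L) = φ X → (T Y : L) = φ (T X)) → T = 0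

/-- `g` is an Einstein metric with `2ρ = r`, and the spectrum of `L_𝔭` is `{0, l, u}`: on the
diagonal tensors, and on all of `sym(𝔭)^K` if the `𝔭_i` are pairwise inequivalent. -/
structure EinsteinSpec (𝔨 : LieSubalgebra ℝ L) (Ad : Set (L ≃ₗ⁅ℝ⁆ L))
    (p : Fin 3 → Submodule ℝ L) (g : BilinForm ℝ (tangent 𝔨)) (l u r : ℝ) : Prop where
  metric : IsInvMetric 𝔨 Ad g
  einstein : IsEinstein 𝔨 g (r / 2)
  spec : lichSpec 𝔨 g (diagEnd 𝔨 p) = {0, l, u}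
  specFull : PairwiseInequivalent Ad p → lichSpec 𝔨 g (symEndK 𝔨 Ad g) = {0, l, u}

end Homogeneous

/-! ### The explicit Einstein metrics in terms of `b = a_1 = a_2` and `c = a_3` -/

/-- The radicand of `q±`. -/
def discQ (b c : ℝ) : ℝ := 1 - 4 * (b + c) * (1 - 2 * c)

/-- `q⁺` -/
def qPlus (b c : ℝ) : ℝ := (1 + √(discQ b c)) / (2 * (b + c))

/-- `q⁻` -/
def qMinus (b c : ℝ) : ℝ := (1 - √(discQ b c)) / (2 * (b + c))

/-- `T`; the radicand of `p±` is `(1 + 2c) T`. -/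
def wallachT (b c : ℝ) : ℝ := 1 - 2 * (2 * b + c) + 16 * b ^ 2 * (b + c)

/-- The radicand of `p±`. -/
def discP (b c : ℝ) : ℝ :=
  (1 - 2 * b + 8 * b ^ 2 * (b + c)) ^ 2 - 4 * (b + c) ^ 2 * (1 - 4 * b ^ 2) ^ 2

/-- `p⁺` -/
def pPlus (b c : ℝ) : ℝ :=
  (1 - 2 * b + 8 * b ^ 2 * (b + c) + √(discP b c)) / (2 * (b + c) * (1 - 4 * b ^ 2))

/-- `p⁻` -/
def pMinus (b c : ℝ) : ℝ :=
  (1 - 2 * b + 8 * b ^ 2 * (b + c) - √(discP b c)) / (2 * (b + c) * (1 - 4 * b ^ 2))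

/-- The parameters of `g_q = (1, 1, q)`. -/
def gq (q : ℝ) : Fin 3 → ℝ := ![1, 1, q]

/-- The parameters of `g_p = (p, 1, 2b(p + 1))`. -/
def gp (b p : ℝ) : Fin 3 → ℝ := ![p, 1, 2 * b * (p + 1)]

/-- The eigenvalue `b(4 - q²)/q` of `L_𝔭(g_q)`. -/
def lamQ₁ (b q : ℝ) : ℝ := b * (4 - q ^ 2) / q

/-- The eigenvalue `q(b + 2c)` of `L_𝔭(g_q)`. -/
def lamQ₂ (b c q : ℝ) : ℝ := q * (b + 2 * c)

/-- `2ρ` for `g_q`. -/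
def rhoQ (b q : ℝ) : ℝ := 1 - b * q

/-- The polynomial `D(p)` in the spectrum of `L_𝔭(g_p)`. -/
def polyD (b c p : ℝ) : ℝ :=
  let c₄ := (b + c) * (8 * b ^ 3 * c + 1 - 4 * b ^ 2 + 8 * b ^ 4)
  let c₃ := 8 * b ^ 2 * (b + c) * (4 * b * c + 4 * b ^ 2 - 1)
  let c₂ := 96 * c * b ^ 4 - 8 * b ^ 3 + 48 * c ^ 2 * b ^ 3 + 48 * b ^ 5 - 2 * c - 8 * c * b ^ 2
  c₄ * p ^ 4 + c₃ * p ^ 3 + c₂ * p ^ 2 + c₃ * p + c₄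

/-- The smaller eigenvalue of `L_𝔭(g_p)` on traceless tensors. -/
def lamPMin (b c p : ℝ) : ℝ :=
  (4 * c * b ^ 2 * (p + 1) ^ 2 + b * (p ^ 2 + 1) - √(2 * b * polyD b c p)) / (2 * b * p * (p + 1))

/-- The larger eigenvalue of `L_𝔭(g_p)` on traceless tensors. -/
def lamPMax (b c p : ℝ) : ℝ :=
  (4 * c * b ^ 2 * (p + 1) ^ 2 + b * (p ^ 2 + 1) + √(2 * b * polyD b c p)) / (2 * b * p * (p + 1))

/-- `2ρ` for `g_p`. -/
def rhoP (b p : ℝ) : ℝ := (1 + p) * (1 - 4 * b ^ 2) / (2 * p)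

/-! ### The families -/

section Matrices

variable {ι F : Type*} [Fintype ι] [DecidableEq ι] [Ring F] [Algebra ℝ F]

/-- The block diagonal elements of a matrix Lie algebra, for the partition of the indices by
`blk`. -/
def blockSub (𝔤 : LieSubalgebra ℝ (Matrix ι ι F)) (blk : ι → Fin 3) : LieSubalgebra ℝ 𝔤 where
  carrier := {X | ∀ i j, blk i ≠ blk j → (X : Matrix ι ι F) i j = 0}
  add_mem' := by
    intro X Y hX hY i j hij
    simp [hX i j hij, hY i j hij]
  zero_mem' := by
    intro i j _
    simp
  smul_mem' := by
    intro t X hX i j hij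
    simp [hX i j hij]
  lie_mem' := by
    intro X Y hX hY i j hij
    have key : ∀ A B : Matrix ι ι F, (∀ i j, blk i ≠ blk j → A i j = 0) →
        (∀ i j, blk i ≠ blk j → B i j = 0) → (A * B) i j = 0 := by
      intro A B hA hB
      rw [Matrix.mul_apply]
      refine Finset.sum_eq_zero fun s _ => ?_
      by_cases h : blk i = blk s
      · rw [hB s j (fun h' => hij (h.trans h')), mul_zero]
      · rw [hA i s h, zero_mul]
    rw [LieSubalgebra.coe_bracket, Ring.lie_def, Matrix.sub_apply, key _ _ hX hY, key _ _ hY hX,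
      sub_zero]

/-- The elements of a matrix Lie algebra supported in the off-diagonal blocks `(r, s)`, `(s, r)`. -/
def blockMod (𝔤 : LieSubalgebra ℝ (Matrix ι ι F)) (blk : ι → Fin 3) (r s : Fin 3) :
    Submodule ℝ 𝔤 where
  carrier := {X | ∀ i j, ¬ ((blk i = r ∧ blk j = s) ∨ (blk i = s ∧ blk j = r)) →
    (X : Matrix ι ι F) i j = 0}
  add_mem' := by
    intro X Y hX hY i j hij
    simp [hX i j hij, hY i j hij]
  zero_mem' := by
    intro i j _
    simp
  smul_mem' := by
    intro t X hX i j hij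
    simp [hX i j hij]

/-- `𝔭_0, 𝔭_1, 𝔭_2` are the blocks `(0,1)`, `(0,2)`, `(1,2)`. -/
def blockMods (𝔤 : LieSubalgebra ℝ (Matrix ι ι F)) (blk : ι → Fin 3) : Fin 3 → Submodule ℝ 𝔤 :=
  ![blockMod 𝔤 blk 0 1, blockMod 𝔤 blk 0 2, blockMod 𝔤 blk 1 2]

/-- The automorphisms `X ↦ h X h*` of a matrix Lie algebra, `h` in a set `S` of unitary
matrices. -/
def adSet [StarRing F] (𝔤 : LieSubalgebra ℝ (Matrix ι ι F)) (S : Set (Matrix ι ι F)) :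
    Set (𝔤 ≃ₗ⁅ℝ⁆ 𝔤) :=
  {φ | ∃ h ∈ S, ∀ X : 𝔤, (φ X : Matrix ι ι F) = h * (X : Matrix ι ι F) * h.conjTranspose}

end Matrices

/-- Index set of `(k + 2m) × (k + 2m)` matrices. -/
abbrev Idx (k m : ℕ) : Type := Fin k ⊕ (Fin m ⊕ Fin m)

/-- The partition of the indices into parts of sizes `k, m, m`. -/
def blk (k m : ℕ) : Idx k m → Fin 3 := Sum.elim (fun _ => 0) (Sum.elim (fun _ => 1) (fun _ => 2))

/-- The block diagonal matrix `diag(x, y, z)`. -/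
def diag3 {F : Type*} [Zero F] {k m : ℕ} (x : Matrix (Fin k) (Fin k) F)
    (y z : Matrix (Fin m) (Fin m) F) : Matrix (Idx k m) (Idx k m) F :=
  Matrix.fromBlocks x 0 0 (Matrix.fromBlocks y 0 0 z)

/-- `su(ι)`: traceless skew-Hermitian complex matrices. -/
def su (ι : Type*) [Fintype ι] [DecidableEq ι] : LieSubalgebra ℝ (Matrix ι ι ℂ) where
  carrier := {X | X.conjTranspose = -X ∧ X.trace = 0}
  add_mem' := by
    rintro X Y ⟨hX, hX'⟩ ⟨hY, hY'⟩
    refine ⟨?_, ?_⟩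
    · rw [Matrix.conjTranspose_add, hX, hY]; abel
    · rw [Matrix.trace_add, hX', hY', add_zero]
  zero_mem' := by simp
  smul_mem' := by
    rintro t X ⟨hX, hX'⟩
    refine ⟨?_, ?_⟩
    · rw [Matrix.conjTranspose_smul, hX]; simp
    · rw [Matrix.trace_smul, hX', smul_zero]
  lie_mem' := by
    rintro X Y ⟨hX, _⟩ ⟨hY, _⟩
    refine ⟨?_, ?_⟩
    · rw [Ring.lie_def, Matrix.conjTranspose_sub, Matrix.conjTranspose_mul,
        Matrix.conjTranspose_mul, hX, hY]
      simp
    · rw [Ring.lie_def, Matrix.trace_sub, Matrix.trace_mul_comm, sub_self]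

/-- `sp(ι)`: skew-Hermitian quaternionic matrices. -/
def sp (ι : Type*) [Fintype ι] [DecidableEq ι] :
    LieSubalgebra ℝ (Matrix ι ι (Quaternion ℝ)) where
  carrier := {X | X.conjTranspose = -X}
  add_mem' := by
    intro X Y hX hY
    simp only [Set.mem_ofPred_eq] at hX hY ⊢
    rw [Matrix.conjTranspose_add, hX, hY]; abel
  zero_mem' := by simp
  smul_mem' := by
    intro t X hX
    simp only [Set.mem_ofPred_eq] at hX ⊢
    ext1 i j
    have h := congrFun (congrFun hX i) j
    rw [Matrix.conjTranspose_apply] at h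
    rw [Matrix.conjTranspose_apply, Matrix.smul_apply, Quaternion.star_smul, h]
    simp
  lie_mem' := by
    intro X Y hX hY
    simp only [Set.mem_ofPred_eq] at hX hY ⊢
    rw [Ring.lie_def, Matrix.conjTranspose_sub, Matrix.conjTranspose_mul,
      Matrix.conjTranspose_mul, hX, hY]
    simp

/-! `W₁ = SO(k+2m)/SO(k)×SO(m)×SO(m)` -/

/-- `so(k + 2m)` -/
abbrev g₁ (k m : ℕ) : LieSubalgebra ℝ (Matrix (Idx k m) (Idx k m) ℝ) :=
  LieAlgebra.Orthogonal.so (Idx k m) ℝ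

/-- `so(k) ⊕ so(m) ⊕ so(m)` -/
abbrev k₁ (k m : ℕ) : LieSubalgebra ℝ (g₁ k m) := blockSub (g₁ k m) (blk k m)

/-- `Ad` of `SO(k) × SO(m) × SO(m)` -/
abbrev Ad₁ (k m : ℕ) : Set (g₁ k m ≃ₗ⁅ℝ⁆ g₁ k m) :=
  adSet (g₁ k m) {h | ∃ x ∈ Matrix.specialOrthogonalGroup (Fin k) ℝ,
    ∃ y ∈ Matrix.specialOrthogonalGroup (Fin m) ℝ,
    ∃ z ∈ Matrix.specialOrthogonalGroup (Fin m) ℝ, h = diag3 x y z}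

/-- The modules `𝔭_i` of `W₁`. -/
abbrev p₁ (k m : ℕ) : Fin 3 → Submodule ℝ (g₁ k m) := blockMods (g₁ k m) (blk k m)

/-! `W₂ = SU(k+2m)/S(U(k)×U(m)×U(m))` -/

/-- `su(k + 2m)` -/
abbrev g₂ (k m : ℕ) : LieSubalgebra ℝ (Matrix (Idx k m) (Idx k m) ℂ) := su (Idx k m)

/-- `s(u(k) ⊕ u(m) ⊕ u(m))` -/
abbrev k₂ (k m : ℕ) : LieSubalgebra ℝ (g₂ k m) := blockSub (g₂ k m) (blk k m)

/-- `Ad` of `S(U(k) × U(m) × U(m))` -/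
abbrev Ad₂ (k m : ℕ) : Set (g₂ k m ≃ₗ⁅ℝ⁆ g₂ k m) :=
  adSet (g₂ k m) {h | ∃ x ∈ Matrix.unitaryGroup (Fin k) ℂ,
    ∃ y ∈ Matrix.unitaryGroup (Fin m) ℂ, ∃ z ∈ Matrix.unitaryGroup (Fin m) ℂ,
    x.det * y.det * z.det = 1 ∧ h = diag3 x y z}

/-- The modules `𝔭_i` of `W₂`. -/
abbrev p₂ (k m : ℕ) : Fin 3 → Submodule ℝ (g₂ k m) := blockMods (g₂ k m) (blk k m)

/-! `W₃ = Sp(k+2m)/Sp(k)×Sp(m)×Sp(m)` -/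

/-- `sp(k + 2m)` -/
abbrev g₃ (k m : ℕ) : LieSubalgebra ℝ (Matrix (Idx k m) (Idx k m) (Quaternion ℝ)) :=
  sp (Idx k m)

/-- `sp(k) ⊕ sp(m) ⊕ sp(m)` -/
abbrev k₃ (k m : ℕ) : LieSubalgebra ℝ (g₃ k m) := blockSub (g₃ k m) (blk k m)

/-- `Ad` of `Sp(k) × Sp(m) × Sp(m)` -/
abbrev Ad₃ (k m : ℕ) : Set (g₃ k m ≃ₗ⁅ℝ⁆ g₃ k m) :=
  adSet (g₃ k m) {h | ∃ x ∈ unitary (Matrix (Fin k) (Fin k) (Quaternion ℝ)),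
    ∃ y ∈ unitary (Matrix (Fin m) (Fin m) (Quaternion ℝ)),
    ∃ z ∈ unitary (Matrix (Fin m) (Fin m) (Quaternion ℝ)), h = diag3 x y z}

/-- The modules `𝔭_i` of `W₃`. -/
abbrev p₃ (k m : ℕ) : Fin 3 → Submodule ℝ (g₃ k m) := blockMods (g₃ k m) (blk k m)

/-! `W₅ = SO(2l)/U(1)×U(l-1)`.  Here `ℝ^{2l} = ℂ^l` with coordinates `(Re z, Im z)`, `J` is the
complex structure, and `U(1)×U(l-1) ⊂ U(l) ⊂ SO(2l)` preserves the first complex coordinate line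
and its complement. -/

/-- `so(2l)` -/
abbrev g₅ (l : ℕ) : LieSubalgebra ℝ (Matrix (Fin l ⊕ Fin l) (Fin l ⊕ Fin l) ℝ) :=
  LieAlgebra.Orthogonal.so (Fin l ⊕ Fin l) ℝ

/-- The complex structure of `ℝ^{2l}`. -/
def J₅ (l : ℕ) : Matrix (Fin l ⊕ Fin l) (Fin l ⊕ Fin l) ℝ := Matrix.fromBlocks 0 (-1) 1 0

/-- The part `0` is the first complex coordinate, the part `1` all the others. -/
def blk₅ (l : ℕ) (i : Fin l ⊕ Fin l) : Fin 3 :=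
  if Sum.elim Fin.val Fin.val i = 0 then 0 else 1

/-- The elements of `so(2l)` which commute (`s = 1`) or anticommute (`s = -1`) with `J`. -/
def jPart (l : ℕ) (s : ℝ) : Submodule ℝ (g₅ l) where
  carrier := {X | (X : Matrix _ _ ℝ) * J₅ l = s • (J₅ l * (X : Matrix _ _ ℝ))}
  add_mem' := by
    intro X Y hX hY
    simp only [Set.mem_ofPred_eq] at hX hY ⊢
    simp [add_mul, mul_add, hX, hY]
  zero_mem' := by simp
  smul_mem' := by
    intro t X hX
    simp only [Set.mem_ofPred_eq] at hX ⊢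
    simp [hX, smul_comm t s]

/-- `u(1) ⊕ u(l - 1)` -/
def k₅ (l : ℕ) : LieSubalgebra ℝ (g₅ l) :=
  { (blockSub (g₅ l) (blk₅ l)).toSubmodule ⊓ jPart l 1 with
    lie_mem' := by
      rintro X Y ⟨hX, hX'⟩ ⟨hY, hY'⟩
      refine ⟨(blockSub (g₅ l) (blk₅ l)).lie_mem hX hY, ?_⟩
      have h1 : (X : Matrix _ _ ℝ) * J₅ l = J₅ l * (X : Matrix _ _ ℝ) := (show _ = (1 : ℝ) • _ from hX').trans (one_smul _ _)
      have h2 : (Y : Matrix _ _ ℝ) * J₅ l = J₅ l * (Y : Matrix _ _ ℝ) := (show _ = (1 : ℝ) • _ from hY').trans (one_smul _ _)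
      change ((⁅X, Y⁆ : g₅ l) : Matrix _ _ ℝ) * J₅ l = (1 : ℝ) • (J₅ l * ((⁅X, Y⁆ : g₅ l) : Matrix _ _ ℝ))
      have h3 : ∀ A B : Matrix (Fin l ⊕ Fin l) (Fin l ⊕ Fin l) ℝ, A * J₅ l = J₅ l * A →
          B * J₅ l = J₅ l * B → A * B * J₅ l = J₅ l * (A * B) := by
        intro A B hA hB
        rw [mul_assoc, hB, ← mul_assoc, hA, mul_assoc]
      rw [one_smul, LieSubalgebra.coe_bracket, Ring.lie_def, sub_mul, mul_sub, h3 _ _ h1 h2,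
        h3 _ _ h2 h1] }

/-- `Ad` of `U(1) × U(l - 1)` -/
abbrev Ad₅ (l : ℕ) : Set (g₅ l ≃ₗ⁅ℝ⁆ g₅ l) :=
  adSet (g₅ l) {h | h ∈ Matrix.orthogonalGroup (Fin l ⊕ Fin l) ℝ ∧ h * J₅ l = J₅ l * h ∧
    ∀ i j, blk₅ l i ≠ blk₅ l j → h i j = 0}

/-- The modules of `W₅`: the off-diagonal elements commuting resp. anticommuting with `J`, and the
elements of `so(2l - 2)` anticommuting with `J`. -/
abbrev p₅ (l : ℕ) : Fin 3 → Submodule ℝ (g₅ l) :=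
  ![blockMod (g₅ l) (blk₅ l) 0 1 ⊓ jPart l 1, blockMod (g₅ l) (blk₅ l) 0 1 ⊓ jPart l (-1),
    blockMod (g₅ l) (blk₅ l) 1 1 ⊓ jPart l (-1)]

/-! `SO(4)/SO(2) = S² × S³` -/

/-- The non-diagonal Einstein metric `g_×` on `SO(4)/SO(2)`, the unit tangent bundle of `S³`, which
is the product metric of the left trivialization `S³ × S²`.  With `x_{ij}` the matrix entries of
`X ∈ so(4)` it is
`2(x₁₄² + x₂₄² + x₃₄²) + (x₁₃ - x₂₄)² + (x₂₃ + x₁₄)²`, with `SO(2)` acting on the coordinates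
`1, 2`. -/
def gProd : BilinForm ℝ (tangent (k₁ 2 1)) :=
  let x (i j : Idx 2 1) : tangent (k₁ 2 1) →ₗ[ℝ] ℝ :=
    Matrix.entryLinearMap ℝ ℝ i j ∘ₗ (g₁ 2 1).toSubmodule.subtype ∘ₗ (tangent (k₁ 2 1)).subtype
  let sq (f : tangent (k₁ 2 1) →ₗ[ℝ] ℝ) : BilinForm ℝ (tangent (k₁ 2 1)) :=
    LinearMap.BilinForm.linMulLin f f
  let e₁ : Idx 2 1 := Sum.inl 0
  let e₂ : Idx 2 1 := Sum.inl 1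
  let e₃ : Idx 2 1 := Sum.inr (Sum.inl 0)
  let e₄ : Idx 2 1 := Sum.inr (Sum.inr 0)
  (2 : ℝ) • (sq (x e₁ e₄) + sq (x e₂ e₄) + sq (x e₃ e₄)) +
    sq (x e₁ e₃ - x e₂ e₄) + sq (x e₂ e₃ + x e₁ e₄)

end

end InvGeom

open InvGeom

set_option maxRecDepth 100000
set_option linter.unusedSectionVars false

namespace InvGeom

noncomputable section

open Finset (sum_congr mul_sum sum_add_distrib sum_comm mem_univ sum_eq_zero sum_eq_single sum_sub_distrib
  sum_mul sum_ite_eq' sum_ite_eq sum_const_zero sum_neg_distrib sum_const sum_le_sum sum_nonneg)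
open LinearMap (BilinForm trace)
open Matrix (cons_val mul_apply diagonal single conjTranspose_apply conjTranspose_mul cons_val_zero
  specialOrthogonalGroup)
open Function (update_of_ne update update_self)
open Fintype (card sum_prod_type sum_sum_type card_fin card_subtype)
open Equiv (Perm swap swap_apply_of_ne_of_ne swap_apply_left swap_apply_right)
open Relation (EqvGen)
open Sum (inl inr elim_inl elim_inr)
open Real (exp)
open scoped Matrix
open Module
variable {L : Type*} [LieRing L] [LieAlgebra ℝ L] [FiniteDimensional ℝ L] {K : LieSubalgebra ℝ L}
  {Ad : Set (L ≃ₗ⁅ℝ⁆ L)} {p : Fin 3 → Submodule ℝ L} {ι : Type*} [Fintype ι] [DecidableEq ι]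
  {e : Basis ι ℝ (tangent K)} {s : ι → Fin 3} {w : ℝ} {W : ι → ℝ} {g : BilinForm ℝ (tangent K)}
  {F κ I : Type*} [Ring F] [StarRing F] [Algebra ℝ F] [FiniteDimensional ℝ F] [Fintype κ]
  [DecidableEq κ] [Fintype I] [DecidableEq I] {u : κ → F} {re : F →ₗ[ℝ] ℝ} {k m : ℕ}

/-! ### Traces in orthogonal bases -/

section Coordinates
variable {V : Type*} [AddCommGroup V] [Module ℝ V]

/-- Bilinearity of an unbundled map. -/
structure IsBilin {M : Type*} [AddCommGroup M] [Module ℝ M] (β : V → V → M) : Prop where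
  add_left : ∀ x y z, β (x + y) z = β x z + β y z
  smul_left : ∀ (r : ℝ) x z, β (r • x) z = r • β x z
  add_right : ∀ x y z, β z (x + y) = β z x + β z y
  smul_right : ∀ (r : ℝ) x z, β z (r • x) = r • β z x

namespace IsBilin
variable {M : Type*} [AddCommGroup M] [Module ℝ M] {β : V → V → M}

theorem zero_left (h : IsBilin β) (z : V) : β 0 z = 0 := by
  simpa using h.smul_left 0 0 z

theorem zero_right (h : IsBilin β) (z : V) : β z 0 = 0 := by
  simpa using h.smul_right 0 0 z

theorem sum_left (h : IsBilin β) {ι : Type*} (s : Finset ι) (f : ι → V) (z : V) :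
    β (∑ i ∈ s, f i) z = ∑ i ∈ s, β (f i) z := by
  classical
  induction s using Finset.induction_on with
  | empty => simpa using h.zero_left z
  | insert a s ha ih => rw [Finset.sum_insert ha, Finset.sum_insert ha, h.add_left, ih]

theorem sum_right (h : IsBilin β) {ι : Type*} (s : Finset ι) (f : ι → V) (z : V) :
    β z (∑ i ∈ s, f i) = ∑ i ∈ s, β z (f i) := by
  classical
  induction s using Finset.induction_on with
  | empty => simpa using h.zero_right z
  | insert a s ha ih => rw [Finset.sum_insert ha, Finset.sum_insert ha, h.add_right, ih]

theorem sum_const_mul {ι : Type*} {s : Finset ι} {c : ι → ℝ} {b : ι → V → V → ℝ}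
    (h : ∀ i, IsBilin (b i)) : IsBilin fun x y => ∑ i ∈ s, c i * b i x y where
  add_left x y z := by simp [(h _).add_left, mul_add, sum_add_distrib]
  smul_left r x z := by simp [(h _).smul_left, mul_sum, mul_left_comm]
  add_right x y z := by simp [(h _).add_right, mul_add, sum_add_distrib]
  smul_right r x z := by simp [(h _).smul_right, mul_sum, mul_left_comm]

theorem bracket_left {g : BilinForm ℝ V} {μ ν : V → V → V} (hμ : IsBilin μ) (hν : IsBilin ν)
    (y y' : V) : IsBilin fun x x' => g (μ x y) (ν x' y') where
  add_left _ _ _ := by simp [hμ.add_left]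
  smul_left _ _ _ := by simp [hμ.smul_left]
  add_right _ _ _ := by simp [hν.add_left]
  smul_right _ _ _ := by simp [hν.smul_left]

theorem bracket_right {g : BilinForm ℝ V} {μ ν : V → V → V} (hμ : IsBilin μ) (hν : IsBilin ν)
    (x x' : V) : IsBilin fun y y' => g (μ x y) (ν x' y') where
  add_left _ _ _ := by simp [hμ.add_right]
  smul_left _ _ _ := by simp [hμ.smul_right]
  add_right _ _ _ := by simp [hν.add_right]
  smul_right _ _ _ := by simp [hν.smul_right]

theorem mul_left {g : BilinForm ℝ V} {μ ν : V → V → V} (hμ : IsBilin μ) (hν : IsBilin ν)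
    (y y' X Y : V) : IsBilin fun x x' => g (μ x y) X * g (ν x' y') Y where
  add_left _ _ _ := by simp [hμ.add_left, add_mul]
  smul_left _ _ _ := by simp [hμ.smul_left, mul_assoc]
  add_right _ _ _ := by simp [hν.add_left, mul_add]
  smul_right _ _ _ := by simp [hν.smul_left, mul_left_comm]

theorem mul_right {g : BilinForm ℝ V} {μ ν : V → V → V} (hμ : IsBilin μ) (hν : IsBilin ν)
    (x x' X Y : V) : IsBilin fun y y' => g (μ x y) X * g (ν x' y') Y where
  add_left _ _ _ := by simp [hμ.add_right, add_mul]
  smul_left _ _ _ := by simp [hμ.smul_right, mul_assoc]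
  add_right _ _ _ := by simp [hν.add_right, mul_add]
  smul_right _ _ _ := by simp [hν.smul_right, mul_left_comm]
end IsBilin

theorem isBilin_bilinForm (b : BilinForm ℝ V) : IsBilin fun x y => b x y where
  add_left _ _ _ := by simp
  smul_left _ _ _ := by simp
  add_right _ _ _ := by simp
  smul_right _ _ _ := by simp

theorem IsBilin.ext_basis {M : Type*} [AddCommGroup M] [Module ℝ M] {β γ : V → V → M}
    (hβ : IsBilin β) (hγ : IsBilin γ) {ι : Type*} [Fintype ι] (e : Basis ι ℝ V)
    (h : ∀ i j, β (e i) (e j) = γ (e i) (e j)) (x y : V) : β x y = γ x y := by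
  rw [← e.sum_repr x, ← e.sum_repr y]
  simp only [hβ.sum_left, hβ.sum_right, hγ.sum_left, hγ.sum_right, hβ.smul_left, hβ.smul_right,
    hγ.smul_left, hγ.smul_right, h]

theorem isBilin_theta {A : End ℝ V} {μ : V → V → V} (hμ : IsBilin μ) : IsBilin (theta A μ) where
  add_left x y z := by simp only [theta, hμ.add_left, map_add]; abel
  smul_left r x z := by simp only [theta, hμ.smul_left, map_smul, smul_sub]
  add_right x y z := by simp only [theta, hμ.add_right, map_add]; abel
  smul_right r x z := by simp only [theta, hμ.smul_right, map_smul, smul_sub]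

/-- `e` is a `g`-orthogonal basis with `g(e_i, e_i) = W i > 0`. -/
structure OrthBasis {ι : Type*} [DecidableEq ι] (g : BilinForm ℝ V) (e : Basis ι ℝ V) (W : ι → ℝ) :
    Prop where
  gram : ∀ i j, g (e i) (e j) = if i = j then W i else 0
  pos : ∀ i, 0 < W i
variable {ι : Type*} [Fintype ι] [DecidableEq ι] {g : BilinForm ℝ V} {e : Basis ι ℝ V} {W : ι → ℝ}

namespace OrthBasis

section
variable (h : OrthBasis g e W)
include h

theorem ne (i : ι) : W i ≠ 0 := (h.pos i).ne'

theorem apply_right (x : V) (i : ι) : g x (e i) = W i * e.repr x i := by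
  conv_lhs => rw [← e.sum_repr x]
  simp only [map_sum, map_smul, LinearMap.sum_apply, LinearMap.smul_apply, h.gram, smul_eq_mul,
    mul_ite, mul_zero]
  rw [sum_ite_eq' Finset.univ i, if_pos (mem_univ _), mul_comm]

theorem apply_left (x : V) (i : ι) : g (e i) x = W i * e.repr x i := by
  conv_lhs => rw [← e.sum_repr x]
  simp only [map_sum, map_smul, h.gram, smul_eq_mul, mul_ite, mul_zero]
  rw [sum_ite_eq Finset.univ i, if_pos (mem_univ _), mul_comm]

theorem apply (x y : V) : g x y = ∑ i, W i * (e.repr x i * e.repr y i) := by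
  conv_lhs => rw [← e.sum_repr y]
  simp only [map_sum, map_smul, h.apply_right, smul_eq_mul]
  exact sum_congr rfl fun i _ => by ring

theorem symm (x y : V) : g x y = g y x := by
  rw [h.apply, h.apply]
  exact sum_congr rfl fun i _ => by ring

theorem self_pos (x : V) (hx : x ≠ 0) : 0 < g x x := by
  rw [h.apply]
  have h0 : ∀ i, 0 ≤ W i * (e.repr x i * e.repr x i) := fun i =>
    mul_nonneg (h.pos i).le (mul_self_nonneg _)
  obtain ⟨i, hi⟩ : ∃ i, e.repr x i ≠ 0 := by
    by_contra! hc
    exact hx (e.repr.map_eq_zero_iff.1 (Finsupp.ext hc))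
  exact Finset.sum_pos' (fun i _ => h0 i)
    ⟨i, mem_univ _, mul_pos (h.pos i) (mul_self_pos.2 hi)⟩
end

theorem mem_symEnd (_h : OrthBasis g e W) {A : End ℝ V}
    (hA : ∀ i j, g (A (e i)) (e j) = g (e i) (A (e j))) : A ∈ symEnd g :=
  (IsBilin.ext_basis (β := fun x y => g (A x) y) (γ := fun x y => g x (A y))
    ⟨by simp, by simp, by simp, by simp⟩ ⟨by simp, by simp, by simp, by simp⟩ e hA ·)
variable [FiniteDimensional ℝ V]

section
variable (h : OrthBasis g e W)
include h

theorem gtr_eq {β : V → V → ℝ} (hβ : IsBilin β) :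
    gtr g β = ∑ i, (W i)⁻¹ * β (e i) (e i) := by
  set f := finBasis ℝ V
  have h1 : (f.toMatrix e).transpose * LinearMap.BilinForm.toMatrix f g * f.toMatrix e =
      diagonal W := by
    rw [LinearMap.BilinForm.toMatrix_mul_basis_toMatrix]
    ext i j
    rw [LinearMap.BilinForm.toMatrix_apply, h.gram, Matrix.diagonal_apply]
  have h2 : f.toMatrix e * e.toMatrix f = 1 := Basis.toMatrix_mul_toMatrix_flip _ _
  have h3 : (LinearMap.BilinForm.toMatrix f g)⁻¹ =
      f.toMatrix e * diagonal (fun i => (W i)⁻¹) * (f.toMatrix e).transpose := by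
    refine Matrix.inv_eq_left_inv ?_
    have h4 : diagonal (fun i => (W i)⁻¹) * diagonal W = 1 := by
      rw [Matrix.diagonal_mul_diagonal, ← Matrix.diagonal_one]
      exact congrArg _ (funext fun i => inv_mul_cancel₀ (h.ne i))
    calc f.toMatrix e * diagonal (fun i => (W i)⁻¹) * (f.toMatrix e).transpose *
          LinearMap.BilinForm.toMatrix f g
        = f.toMatrix e * diagonal (fun i => (W i)⁻¹) * ((f.toMatrix e).transpose *
          LinearMap.BilinForm.toMatrix f g * f.toMatrix e) * e.toMatrix f := by
          simp only [Matrix.mul_assoc, h2, Matrix.mul_one]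
      _ = 1 := by rw [h1, Matrix.mul_assoc (f.toMatrix e), h4, Matrix.mul_one, h2]
  have h5 : ∀ i, e i = ∑ a, f.toMatrix e a i • f a := fun i => (f.sum_toMatrix_smul_self e i).symm
  unfold gtr
  simp only [show finBasis ℝ V = f from rfl]
  rw [h3]
  have h6 : ∀ a b, (f.toMatrix e * diagonal (fun i => (W i)⁻¹) *
      (f.toMatrix e).transpose) a b = ∑ i, (W i)⁻¹ * (f.toMatrix e a i * f.toMatrix e b i) := by
    intro a b
    rw [mul_apply]
    refine sum_congr rfl fun i _ => ?_
    rw [Matrix.mul_diagonal, Matrix.transpose_apply]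
    ring
  simp only [h6]
  conv_rhs => simp only [h5, hβ.sum_left, hβ.sum_right, hβ.smul_left, hβ.smul_right, smul_eq_mul]
  simp only [sum_mul, mul_sum]
  rw [sum_congr rfl fun a _ => sum_comm, sum_comm]
  refine sum_congr rfl fun i _ => ?_
  exact sum_congr rfl fun a _ => sum_congr rfl fun b _ => by ring

theorem innerBracket_eq {μ ν : V → V → V} (hμ : IsBilin μ) (hν : IsBilin ν) :
    innerBracket g μ ν = ∑ i, (W i)⁻¹ * ∑ j, (W j)⁻¹ * g (μ (e i) (e j)) (ν (e i) (e j)) := by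
  unfold innerBracket
  simp only [h.gtr_eq (hμ.bracket_right hν _ _)]
  rw [h.gtr_eq (IsBilin.sum_const_mul fun j => hμ.bracket_left hν _ _)]

theorem moment_eq {μ : V → V → V} (hμ : IsBilin μ) (X Y : V) :
    moment g μ X Y = -(1 / 2) * ∑ u, (W u)⁻¹ * g (μ X (e u)) (μ Y (e u)) +
      (1 / 4) * ∑ u, (W u)⁻¹ * ∑ v, (W v)⁻¹ * (g (μ (e u) (e v)) X * g (μ (e u) (e v)) Y) := by
  unfold moment
  simp only [h.gtr_eq (hμ.mul_right hμ _ _ _ _)]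
  rw [h.gtr_eq (hμ.bracket_right hμ _ _),
    h.gtr_eq (IsBilin.sum_const_mul fun j => hμ.mul_left hμ _ _ _ _)]

theorem isBilin_moment {μ : V → V → V} (hμ : IsBilin μ) :
    IsBilin (moment g μ) := by
  refine ⟨fun x y z => ?_, fun r x z => ?_, fun x y z => ?_, fun r x z => ?_⟩ <;>
  · simp only [h.moment_eq hμ, hμ.add_left, hμ.smul_left, map_add, map_smul, LinearMap.add_apply,
      LinearMap.smul_apply, smul_eq_mul, mul_add, sum_add_distrib, mul_sum, add_mul]
    first
    | ring1
    | exact congrArg₂ _ (sum_congr rfl fun _ _ => by ring)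
        (sum_congr rfl fun _ _ => sum_congr rfl fun _ _ => by ring)

theorem lichForm_eq {μ : V → V → V} (hμ : IsBilin μ) (A B : End ℝ V) :
    lichForm g μ A B = (1 / 2) * ∑ i, (W i)⁻¹ * ∑ j, (W j)⁻¹ *
      g (theta A μ (e i) (e j)) (theta B μ (e i) (e j)) +
      2 * ∑ i, (W i)⁻¹ * moment g μ (A (B (e i))) (e i) := by
  have hM := h.isBilin_moment hμ
  unfold lichForm
  rw [h.innerBracket_eq (isBilin_theta hμ) (isBilin_theta hμ), h.gtr_eq]
  exact ⟨by simp [hM.add_left], by simp [hM.smul_left], by simp [hM.add_right],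
    by simp [hM.smul_right]⟩

theorem trace_eq (A : End ℝ V) :
    trace ℝ V A = ∑ i, (W i)⁻¹ * g (A (e i)) (e i) := by
  rw [LinearMap.trace_eq_matrix_trace ℝ e, Matrix.trace]
  refine sum_congr rfl fun i _ => ?_
  rw [h.apply_right, inv_mul_cancel_left₀ (h.ne i), Matrix.diag_apply, LinearMap.toMatrix_apply]
end
end OrthBasis

/-- A positive definite symmetric form and a symmetric endomorphism are simultaneously
diagonalizable. -/
theorem exists_orthBasis_eigen [FiniteDimensional ℝ V] (hs : ∀ x y, g x y = g y x)
    (hp : ∀ x, x ≠ 0 → 0 < g x x) {A : End ℝ V} (hA : A ∈ symEnd g) :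
    ∃ (e : Basis (Fin (finrank ℝ V)) ℝ V) (α : Fin (finrank ℝ V) → ℝ),
      OrthBasis g e (fun _ => 1) ∧ ∀ i, A (e i) = α i • e i := by
  have hp' : ∀ x, 0 ≤ g x x := fun x => by
    by_cases hx : x = 0
    · simp [hx]
    · exact (hp x hx).le
  let c : InnerProductSpace.Core ℝ V :=
    { inner := fun x y => g x y
      conj_inner_symm := fun x y => by simpa using hs y x
      re_inner_nonneg := fun x => by simpa using hp' x
      add_left := fun x y z => by simp
      smul_left := fun x y r => by simp
      definite := fun x hx => by
        by_contra hne
        exact (hp x hne).ne' hx }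
  let : NormedAddCommGroup V := c.toNormedAddCommGroup
  let : InnerProductSpace ℝ V := InnerProductSpace.ofCore c.toCore
  have hsym : LinearMap.IsSymmetric (𝕜 := ℝ) A := fun x y => hA x y
  let b := hsym.eigenvectorBasis (n := finrank ℝ V) rfl
  refine ⟨b.toBasis, hsym.eigenvalues rfl, ⟨fun i j => ?_, fun _ => one_pos⟩, fun i => ?_⟩
  · have := orthonormal_iff_ite.1 b.orthonormal i j
    rw [OrthonormalBasis.coe_toBasis]
    exact this
  · rw [OrthonormalBasis.coe_toBasis]
    exact hsym.apply_eigenvectorBasis rfl i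

theorem exists_orthBasis [FiniteDimensional ℝ V] (hs : ∀ x y, g x y = g y x)
    (hp : ∀ x, x ≠ 0 → 0 < g x x) :
    ∃ e : Basis (Fin (finrank ℝ V)) ℝ V, OrthBasis g e (fun _ => 1) := by
  obtain ⟨e, _, he, _⟩ := exists_orthBasis_eigen hs hp (A := 1) (fun _ _ => rfl)
  exact ⟨e, he⟩
end Coordinates

/-! ### Structure constants -/

section Structure
variable {V : Type*} [AddCommGroup V] [Module ℝ V] [FiniteDimensional ℝ V]
  {ι : Type*} [Fintype ι] [DecidableEq ι] {g : BilinForm ℝ V} {e : Basis ι ℝ V} {W : ι → ℝ}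
  {μ : V → V → V}

theorem repr_theta_diag (hμ : IsBilin μ) {A : End ℝ V} {α : ι → ℝ} (hA : ∀ i, A (e i) = α i • e i)
    (i j k : ι) : e.repr (theta A μ (e i) (e j)) k =
      (α k - α i - α j) * e.repr (μ (e i) (e j)) k := by
  have h1 : ∀ x, e.repr (A x) k = α k * e.repr x k := by
    intro x
    conv_lhs => rw [← e.sum_repr x]
    simp only [map_sum, map_smul, hA, Finsupp.coe_finsetSum, Finset.sum_apply, Finsupp.smul_apply,
      Basis.repr_self, smul_eq_mul, Finsupp.single_apply, mul_ite, mul_one, mul_zero,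
      sum_ite_eq', mem_univ, if_true]
    ring
  simp only [theta, hA, hμ.smul_left, hμ.smul_right, map_sub, map_smul, Finsupp.sub_apply,
    Finsupp.smul_apply, smul_eq_mul, h1]
  ring

theorem OrthBasis.moment_self (h : OrthBasis g e W) (hμ : IsBilin μ) (a : ι) :
    moment g μ (e a) (e a) = -(1 / 2) * ∑ u, ∑ k, (W u)⁻¹ * W k * e.repr (μ (e a) (e u)) k ^ 2 +
      (1 / 4) * ∑ u, ∑ v, (W u)⁻¹ * (W v)⁻¹ * W a ^ 2 * e.repr (μ (e u) (e v)) a ^ 2 := by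
  rw [h.moment_eq hμ]
  simp only [h.apply_right]
  congr 2
  · refine sum_congr rfl fun u _ => ?_
    rw [h.apply, mul_sum]
    exact sum_congr rfl fun k _ => by ring
  · refine sum_congr rfl fun u _ => ?_
    rw [mul_sum]
    exact sum_congr rfl fun k _ => by ring

theorem OrthBasis.lichForm_diag (h : OrthBasis g e W) (hμ : IsBilin μ) {A B : End ℝ V}
    {α β : ι → ℝ} (hA : ∀ i, A (e i) = α i • e i) (hB : ∀ i, B (e i) = β i • e i) :
    lichForm g μ A B = (1 / 2) * ∑ i, ∑ j, ∑ k, e.repr (μ (e i) (e j)) k ^ 2 *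
      (W k / (W i * W j)) * ((α k - α i - α j) * (β k - β i - β j)) +
      2 * ∑ a, α a * β a * (moment g μ (e a) (e a) / W a) := by
  rw [h.lichForm_eq hμ]
  congr 2
  · refine sum_congr rfl fun i _ => ?_
    rw [mul_sum]
    refine sum_congr rfl fun j _ => ?_
    rw [h.apply, mul_sum, mul_sum]
    refine sum_congr rfl fun k _ => ?_
    rw [repr_theta_diag hμ hA, repr_theta_diag hμ hB, div_eq_mul_inv, mul_inv]
    ring
  · refine sum_congr rfl fun i _ => ?_
    rw [hB, map_smul, hA, (h.isBilin_moment hμ).smul_left, (h.isBilin_moment hμ).smul_left]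
    simp only [smul_eq_mul]
    ring

theorem sum_theta_diag (c : ι → ι → ι → ℝ) (hc : ∀ i j k, c i j k = c j i k) (v : ι → ℝ) :
    ∑ i, ∑ j, ∑ k, (v k - v i - v j) * c i j k =
      ∑ a, v a * (∑ u, ∑ w, c u w a - 2 * ∑ u, ∑ k, c a u k) := by
  have h1 : ∑ i, ∑ j, ∑ k, v k * c i j k = ∑ a, ∑ u, ∑ w, v a * c u w a := by
    rw [sum_congr rfl fun _ _ => sum_comm, sum_comm]
  have h2 : ∑ i, ∑ j, ∑ k, v j * c i j k = ∑ a, ∑ u, ∑ k, v a * c a u k := by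
    rw [sum_comm]
    simp only [fun i j => hc i j]
  simp only [sub_mul, sum_sub_distrib, h1, h2, mul_sub, mul_sum, two_mul, mul_add, sum_add_distrib]
  ring

/-- The identity is in the kernel of the Lichnerowicz Laplacian. -/
theorem lichForm_one (hs : ∀ x y, g x y = g y x) (hp : ∀ x, x ≠ 0 → 0 < g x x) (hμ : IsBilin μ)
    (hμ' : ∀ x y, μ x y = -μ y x) {B : End ℝ V} (hB : B ∈ symEnd g) : lichForm g μ 1 B = 0 := by
  obtain ⟨e, β, he, hβ⟩ := exists_orthBasis_eigen hs hp hB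
  have h1 : ∀ i, (1 : End ℝ V) (e i) = (fun _ => (1 : ℝ)) i • e i := fun i => by simp
  rw [he.lichForm_diag hμ h1 hβ]
  have h2 := sum_theta_diag (fun i j k => e.repr (μ (e i) (e j)) k ^ 2)
    (fun i j k => by rw [hμ' (e i) (e j)]; simp) β
  have h3 : ∑ i, ∑ j, ∑ k, e.repr (μ (e i) (e j)) k ^ 2 * ((1 : ℝ) / (1 * 1)) *
      (((1 : ℝ) - 1 - 1) * (β k - β i - β j)) =
      -∑ i, ∑ j, ∑ k, (β k - β i - β j) * e.repr (μ (e i) (e j)) k ^ 2 := by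
    simp only [← sum_neg_distrib]
    exact sum_congr rfl fun i _ => sum_congr rfl fun j _ => sum_congr rfl
      fun k _ => by ring
  rw [h3, h2, mul_neg, neg_add_eq_zero, mul_sum, mul_sum]
  refine sum_congr rfl fun a _ => ?_
  rw [he.moment_self hμ]
  simp only [inv_one, one_mul, one_pow, div_one]
  ring

theorem OrthBasis.isBilin_lichForm (h : OrthBasis g e W) (hμ : IsBilin μ) :
    IsBilin (lichForm g μ) := by
  have hM := h.isBilin_moment hμ
  have ta : ∀ A B : End ℝ V, theta (A + B) μ = fun x y => theta A μ x y + theta B μ x y := by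
    intro A B; funext x y; simp only [theta, LinearMap.add_apply, hμ.add_left, hμ.add_right]; abel
  have ts : ∀ (r : ℝ) (A : End ℝ V), theta (r • A) μ = fun x y => r • theta A μ x y := by
    intro r A; funext x y
    simp only [theta, LinearMap.smul_apply, hμ.smul_left, hμ.smul_right, smul_sub]
  refine ⟨fun x y z => ?_, fun r x z => ?_, fun x y z => ?_, fun r x z => ?_⟩
  · simp only [h.lichForm_eq hμ, ta, map_add, LinearMap.add_apply, hM.add_left, mul_add,
      sum_add_distrib]
    ring
  · simp only [h.lichForm_eq hμ, ts, map_smul, LinearMap.smul_apply, smul_eq_mul, hM.smul_left,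
      mul_left_comm _ r, ← mul_sum, mul_add]
  · simp only [h.lichForm_eq hμ, ta, map_add, LinearMap.add_apply, hM.add_left, mul_add,
      sum_add_distrib]
    ring
  · simp only [h.lichForm_eq hμ, ts, map_smul, LinearMap.smul_apply, smul_eq_mul, hM.smul_left,
      mul_left_comm _ r, ← mul_sum, mul_add]

theorem trace_mul_self_pos (hs : ∀ x y, g x y = g y x) (hp : ∀ x, x ≠ 0 → 0 < g x x)
    {A : End ℝ V} (hA : A ∈ symEnd g) (h0 : A ≠ 0) : 0 < trace ℝ V (A * A) := by
  obtain ⟨e, α, he, hα⟩ := exists_orthBasis_eigen hs hp hA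
  have h1 : ∀ i, (1 : ℝ)⁻¹ * g ((A * A) (e i)) (e i) = α i * α i := by
    intro i
    rw [End.mul_apply, hα, map_smul, hα, map_smul, map_smul, LinearMap.smul_apply, LinearMap.smul_apply, he.gram]
    simp
  rw [he.trace_eq, sum_congr rfl fun i _ => h1 i]
  obtain ⟨i, hi⟩ : ∃ i, α i ≠ 0 := by
    by_contra! hc
    exact h0 (e.ext fun i => by rw [hα, hc, zero_smul, LinearMap.zero_apply])
  exact Finset.sum_pos' (fun i _ => mul_self_nonneg _) ⟨i, mem_univ _, mul_self_pos.2 hi⟩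
end Structure

/-! ### The scalar curvature along diagonal metrics -/

theorem isBilin_bracketP (K : LieSubalgebra ℝ L) : IsBilin (bracketP K) where
  add_left x y z := by simp [bracketP]
  smul_left r x z := by simp [bracketP]
  add_right x y z := by simp [bracketP]
  smul_right r x z := by simp [bracketP]

theorem bracketP_skew (x y : tangent K) : bracketP K x y = -bracketP K y x := by
  rw [bracketP, bracketP, ← map_neg, lie_skew]

theorem isBilin_killing : IsBilin fun X Y : tangent K => killingForm ℝ L X Y where
  add_left _ _ _ := by simp
  smul_left _ _ _ := by simp
  add_right _ _ _ := by simp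
  smul_right _ _ _ := by simp

/-- The structure constants `[e_i, e_j]_𝔭 = ∑ m_{ijk} e_k`. -/
def sconst (e : Basis ι ℝ (tangent K)) (i j k : ι) : ℝ :=
  e.repr (bracketP K (e i) (e j)) k

theorem sconst_skew (e : Basis ι ℝ (tangent K)) (i j k : ι) : sconst e i j k = -sconst e j i k := by
  rw [sconst, bracketP_skew]; simp [sconst]

theorem OrthBasis.scal_eq (h : OrthBasis g e W) :
    scal K g = -(1 / 4) * ∑ i, ∑ j, ∑ k, sconst e i j k ^ 2 * (W k / (W i * W j)) -
      (1 / 2) * ∑ i, killingForm ℝ L (e i) (e i) / W i := by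
  have hb := isBilin_bracketP K
  unfold scal
  rw [h.innerBracket_eq hb hb, h.gtr_eq isBilin_killing]
  congr 2
  · refine sum_congr rfl fun i _ => ?_
    rw [mul_sum]
    refine sum_congr rfl fun j _ => ?_
    rw [h.apply, mul_sum, mul_sum]
    refine sum_congr rfl fun k _ => ?_
    rw [sconst, div_eq_mul_inv, mul_inv]
    ring
  · exact sum_congr rfl fun i _ => by rw [div_eq_inv_mul]

/-- The scalar curvature of the metric with weights `exp (v i)`. -/
def expScal (e : Basis ι ℝ (tangent K)) (W : ι → ℝ) (v : ι → ℝ) : ℝ :=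
  -(1 / 4) * ∑ i, ∑ j, ∑ k, sconst e i j k ^ 2 * (W k / (W i * W j)) *
      exp (v k - v i - v j) -
    (1 / 2) * ∑ i, killingForm ℝ L (e i) (e i) / W i * exp (-v i)

theorem scal_eq_expScal {v : ι → ℝ} (h : OrthBasis g e (fun i => W i * exp (v i))) :
    scal K g = expScal e W v := by
  rw [h.scal_eq, expScal]
  congr 2
  · refine sum_congr rfl fun i _ => sum_congr rfl fun j _ =>
      sum_congr rfl fun k _ => ?_
    rw [Real.exp_sub, Real.exp_sub, div_div, mul_assoc (_ ^ 2), div_mul_div_comm,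
      mul_mul_mul_comm (W i)]
  · refine sum_congr rfl fun i _ => ?_
    rw [Real.exp_neg, ← div_eq_mul_inv, div_div]

/-- The Einstein equation as the first variation of the scalar curvature. -/
theorem OrthBasis.first_variation (h : OrthBasis g e W) {ρ : ℝ} (hE : IsEinstein K g ρ)
    (v : ι → ℝ) :
    -(1 / 4) * ∑ i, ∑ j, ∑ k, sconst e i j k ^ 2 * (W k / (W i * W j)) * (v k - v i - v j) -
      (1 / 2) * ∑ i, killingForm ℝ L (e i) (e i) / W i * (-v i) = -ρ * ∑ i, v i := by
  have h1 := sum_theta_diag (fun i j k => sconst e i j k ^ 2 * (W k / (W i * W j)))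
    (fun i j k => by rw [sconst_skew, neg_sq, mul_comm (W i)]) v
  have h2 : ∀ i j k, sconst e i j k ^ 2 * (W k / (W i * W j)) * (v k - v i - v j) =
    (v k - v i - v j) * (sconst e i j k ^ 2 * (W k / (W i * W j))) := fun i j k => mul_comm _ _
  simp only [h2, h1]
  rw [mul_sum, mul_sum, mul_sum, ← sum_sub_distrib]
  refine sum_congr rfl fun a _ => ?_
  have h3 := hE (e a) (e a)
  rw [ricci, h.moment_self (isBilin_bracketP K), h.gram, if_pos rfl] at h3
  have h4 : ∑ u, ∑ k, (W u)⁻¹ * W k * e.repr (bracketP K (e a) (e u)) k ^ 2 =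
      W a * ∑ u, ∑ k, sconst e a u k ^ 2 * (W k / (W a * W u)) := by
    simp only [mul_sum]
    refine sum_congr rfl fun u _ => sum_congr rfl fun k _ => ?_
    have := h.ne a
    have := h.ne u
    rw [sconst]; field_simp
  have h5 : ∑ u, ∑ w, (W u)⁻¹ * (W w)⁻¹ * W a ^ 2 * e.repr (bracketP K (e u) (e w)) a ^ 2 =
      W a * ∑ u, ∑ w, sconst e u w a ^ 2 * (W a / (W u * W w)) := by
    simp only [mul_sum]
    refine sum_congr rfl fun u _ => sum_congr rfl fun k _ => ?_
    have := h.ne k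
    have := h.ne u
    rw [sconst]; field_simp
  rw [h4, h5] at h3
  have := h.ne a
  generalize (∑ u, ∑ k, sconst e a u k ^ 2 * (W k / (W a * W u))) = x at *
  generalize (∑ u, ∑ w, sconst e u w a ^ 2 * (W a / (W u * W w))) = y at *
  field_simp
  linear_combination (-8 * v a) * h3

/-- `e^v` along a curve of traceless logarithms `v` has a second derivative computed termwise. -/
theorem iteratedDeriv_two_expScal (e : Basis ι ℝ (tangent K)) (W : ι → ℝ) {v v' : ι → ℝ → ℝ}
    {v'' : ι → ℝ} (h1 : ∀ i, ∀ᶠ t in nhds (0 : ℝ), HasDerivAt (v i) (v' i t) t)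
    (h2 : ∀ i, HasDerivAt (v' i) (v'' i) 0) (h0 : ∀ i, v i 0 = 0) :
    iteratedDeriv 2 (fun t => expScal e W fun i => v i t) 0 =
      (-(1 / 4) * ∑ i, ∑ j, ∑ k, sconst e i j k ^ 2 * (W k / (W i * W j)) *
        (v'' k - v'' i - v'' j) -
      (1 / 2) * ∑ i, killingForm ℝ L (e i) (e i) / W i * (-v'' i)) +
      (-(1 / 4) * ∑ i, ∑ j, ∑ k, sconst e i j k ^ 2 * (W k / (W i * W j)) *
        (v' k 0 - v' i 0 - v' j 0) ^ 2 -
      (1 / 2) * ∑ i, killingForm ℝ L (e i) (e i) / W i * v' i 0 ^ 2) := by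
  set f' : ℝ → ℝ := fun t => -(1 / 4) * ∑ i, ∑ j, ∑ k, sconst e i j k ^ 2 * (W k / (W i * W j)) *
      (exp (v k t - v i t - v j t) * (v' k t - v' i t - v' j t)) -
    (1 / 2) * ∑ i, killingForm ℝ L (e i) (e i) / W i * (exp (-v i t) * (-v' i t)) with hf'
  have h3 : ∀ᶠ t in nhds (0 : ℝ), HasDerivAt (fun t => expScal e W fun i => v i t) (f' t) t := by
    filter_upwards [Filter.eventually_all.2 h1] with t ht
    unfold expScal
    refine HasDerivAt.sub (HasDerivAt.const_mul _ ?_) (HasDerivAt.const_mul _ ?_)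
    · refine HasDerivAt.fun_sum fun i _ => HasDerivAt.fun_sum fun j _ => HasDerivAt.fun_sum
        fun k _ => HasDerivAt.const_mul _ ?_
      exact (((ht k).sub (ht i)).sub (ht j)).exp
    · exact HasDerivAt.fun_sum fun i _ => HasDerivAt.const_mul _ (ht i).neg.exp
  have h4 : deriv (fun t => expScal e W fun i => v i t) =ᶠ[nhds 0] f' :=
    h3.mono fun t ht => ht.deriv
  rw [iteratedDeriv_succ, iteratedDeriv_one, h4.deriv_eq]
  have h1' : ∀ i, HasDerivAt (v i) (v' i 0) 0 := fun i => (h1 i).self_of_nhds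
  refine HasDerivAt.deriv ?_
  have h5 := HasDerivAt.sub
    (HasDerivAt.const_mul (-(1 / 4) : ℝ) (HasDerivAt.fun_sum fun i (_ : i ∈ Finset.univ) =>
      HasDerivAt.fun_sum fun j (_ : j ∈ Finset.univ) => HasDerivAt.fun_sum
        fun k (_ : k ∈ Finset.univ) =>
        HasDerivAt.const_mul (sconst e i j k ^ 2 * (W k / (W i * W j)))
          ((((h1' k).sub (h1' i)).sub (h1' j)).exp.mul (((h2 k).sub (h2 i)).sub (h2 j)))))
    (HasDerivAt.const_mul (1 / 2 : ℝ) (HasDerivAt.fun_sum fun i (_ : i ∈ Finset.univ) =>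
      HasDerivAt.const_mul (killingForm ℝ L (e i) (e i) / W i)
        ((h1' i).neg.exp.mul (h2 i).neg)))
  refine (h5.congr_deriv ?_).congr_of_eventuallyEq (Filter.Eventually.of_forall fun t => ?_)
  · simp only [Pi.sub_apply, Pi.neg_apply, h0, sub_zero, neg_zero, Real.exp_zero, one_mul, mul_add,
      sum_add_distrib, neg_mul, mul_neg, ← sq]
    ring_nf
  · simp [hf']

theorem OrthBasis.det_eq {V : Type*} [AddCommGroup V] [Module ℝ V] (e : Basis ι ℝ V) {A : End ℝ V}
    {α : ι → ℝ} (hA : ∀ i, A (e i) = α i • e i) : LinearMap.det A = ∏ i, α i := by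
  rw [← LinearMap.det_toMatrix e, show LinearMap.toMatrix e e A = diagonal α from ?_,
    Matrix.det_diagonal]
  ext i j
  rw [LinearMap.toMatrix_apply, hA, Matrix.diagonal_apply]
  simp [Finsupp.single_apply, eq_comm]
  grind

/-- The logarithms of the weights of `volCurve`. -/
def logCurve (α : ι → ℝ) (i : ι) (t : ℝ) : ℝ :=
  Real.log (1 + t * α i) + -(1 : ℝ) / card ι * ∑ l, Real.log (1 + t * α l)

/-- The derivative of `logCurve`. -/
def logCurve' (α : ι → ℝ) (i : ι) (t : ℝ) : ℝ :=
  α i / (1 + t * α i) + -(1 : ℝ) / card ι * ∑ l, α l / (1 + t * α l)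

theorem eventually_one_add_pos (α : ι → ℝ) : ∀ᶠ t in nhds (0 : ℝ), ∀ i, 0 < 1 + t * α i := by
  refine Filter.eventually_all.2 fun i => ?_
  have : ContinuousAt (fun t : ℝ => 1 + t * α i) 0 := by fun_prop
  exact this.eventually (lt_mem_nhds (by simp))

theorem logCurve_zero (α : ι → ℝ) (i : ι) : logCurve α i 0 = 0 := by simp [logCurve]

theorem hasDerivAt_one_add (a t : ℝ) : HasDerivAt (fun t : ℝ => 1 + t * a) a t := by
  simpa using ((hasDerivAt_id t).mul_const a).const_add 1

theorem hasDerivAt_logCurve (α : ι → ℝ) (i : ι) :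
    ∀ᶠ t in nhds (0 : ℝ), HasDerivAt (logCurve α i) (logCurve' α i t) t := by
  filter_upwards [eventually_one_add_pos α] with t ht
  exact ((hasDerivAt_one_add (α i) t).log (ht i).ne').add (HasDerivAt.const_mul _
    (HasDerivAt.fun_sum fun l _ => (hasDerivAt_one_add (α l) t).log (ht l).ne'))

theorem hasDerivAt_logCurve' (α : ι → ℝ) (i : ι) : HasDerivAt (logCurve' α i)
    (-α i ^ 2 + -(1 : ℝ) / card ι * ∑ l, -α l ^ 2) 0 := by
  have h : ∀ i, HasDerivAt (fun t : ℝ => α i / (1 + t * α i)) (-α i ^ 2) 0 := fun i => by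
    have := (hasDerivAt_const (0 : ℝ) (α i)).div (hasDerivAt_one_add (α i) 0) (by simp)
    refine this.congr_deriv ?_
    simp [sq]
  exact (h i).add (HasDerivAt.const_mul _ (HasDerivAt.fun_sum fun l _ => h l))

theorem sum_add_mean (x : ι → ℝ) : ∑ i, (x i + -(1 : ℝ) / card ι * ∑ l, x l) = 0 := by
  rw [sum_add_distrib, sum_const, Finset.card_univ, nsmul_eq_mul]
  rcases isEmpty_or_nonempty ι with h | h
  · simp
  · have : (card ι : ℝ) ≠ 0 := by positivity
    field_simp
    ring

theorem sum_logCurve (α : ι → ℝ) (t : ℝ) : ∑ i, logCurve α i t = 0 :=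
  sum_add_mean fun i => Real.log (1 + t * α i)

theorem OrthBasis.volCurve (h : OrthBasis g e W) {A : End ℝ (tangent K)} {α : ι → ℝ}
    (hα : ∀ i, A (e i) = α i • e i) : ∀ᶠ t in nhds (0 : ℝ),
      OrthBasis (volCurve g A t) e (fun i => W i * exp (logCurve α i t)) := by
  filter_upwards [eventually_one_add_pos α] with t ht
  refine ⟨fun i j => ?_, fun i => mul_pos (h.pos i) (Real.exp_pos _)⟩
  have hAt : ∀ i, (1 + t • A) (e i) = (1 + t * α i) • e i := fun i => by
    simp [hα, add_smul, mul_smul]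
  have hprod : 0 < ∏ l, (1 + t * α l) := Finset.prod_pos fun l _ => ht l
  rw [InvGeom.volCurve, LinearMap.smul_apply, LinearMap.smul_apply, BilinForm.compLeft_apply, hAt,
    map_smul, LinearMap.smul_apply, h.gram, OrthBasis.det_eq e hAt]
  by_cases hij : i = j
  · subst hij
    simp only [if_true, smul_eq_mul, logCurve]
    rw [Real.exp_add, Real.exp_log (ht i), Real.rpow_def_of_pos hprod,
      Real.log_prod fun l _ => (ht l).ne', finrank_eq_card_basis e, mul_comm (Finset.sum _ _)]
    ring
  · simp [hij]

theorem OrthBasis.scal_volCurve (h : OrthBasis g e W) {A : End ℝ (tangent K)} {α : ι → ℝ}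
    (hα : ∀ i, A (e i) = α i • e i) : (fun t => scal K (InvGeom.volCurve g A t)) =ᶠ[nhds 0]
      fun t => expScal e W fun i => logCurve α i t :=
  (h.volCurve hα).mono fun _ ht => scal_eq_expScal ht

/-- The second variation of the scalar curvature along diagonal metrics. -/
theorem OrthBasis.second_variation (h : OrthBasis g e W) {ρ : ℝ} (hE : IsEinstein K g ρ)
    {A : End ℝ (tangent K)} {α : ι → ℝ} (hα : ∀ i, A (e i) = α i • e i) :
    -(1 / 4) * ∑ i, ∑ j, ∑ k, sconst e i j k ^ 2 * (W k / (W i * W j)) * (α k - α i - α j) ^ 2 -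
      (1 / 2) * ∑ i, killingForm ℝ L (e i) (e i) / W i * α i ^ 2 =
    ρ * trace ℝ _ (A * A) - (1 / 2) * lichForm g (bracketP K) A A := by
  have hsq : trace ℝ _ (A * A) = ∑ i, α i ^ 2 := by
    rw [h.trace_eq]
    exact sum_congr rfl fun i _ => by
      have := h.ne i
      simp only [End.mul_apply, hα, map_smul, LinearMap.smul_apply, h.gram, smul_eq_mul, if_true]
      field_simp
  have hB : ∀ a, moment g (bracketP K) (e a) (e a) / W a =
      ρ + (1 / 2) * (killingForm ℝ L (e a) (e a) / W a) := by
    intro a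
    have h1 := hE (e a) (e a)
    have h2 := h.ne a
    rw [ricci, h.gram, if_pos rfl] at h1
    field_simp
    linear_combination 2 * h1
  rw [h.lichForm_diag (isBilin_bracketP K) hα hα, hsq]
  simp only [← sq, hB]
  have h7 : ∑ i, killingForm ℝ L (e i) (e i) / W i * α i ^ 2 =
      2 * ∑ a, α a ^ 2 * (ρ + 1 / 2 * (killingForm ℝ L (e a) (e a) / W a)) -
        2 * ρ * ∑ i, α i ^ 2 := by
    simp only [mul_sum, ← sum_sub_distrib]
    exact sum_congr rfl fun i _ => by ring
  rw [h7]
  unfold sconst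
  ring

/-- The Hessian of the scalar curvature at an Einstein metric is `1/2 ⟨(2ρ - L_𝔭) A, A⟩`. -/
theorem hess_eq (hs : ∀ x y, g x y = g y x) (hp : ∀ x, x ≠ 0 → 0 < g x x) {ρ : ℝ}
    (hE : IsEinstein K g ρ) {A : End ℝ (tangent K)} (hA : A ∈ symEnd g)
    (htr : trace ℝ _ A = 0) :
    hess K g A = ρ * trace ℝ _ (A * A) - (1 / 2) * lichForm g (bracketP K) A A := by
  obtain ⟨e, α, he, hα⟩ := exists_orthBasis_eigen hs hp hA
  have hsum : ∑ i, α i = 0 := by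
    rw [he.trace_eq] at htr
    simpa [hα, he.gram] using htr
  have h0' : ∀ i, logCurve' α i 0 = α i := fun i => by simp [logCurve', hsum]
  rw [hess, (he.scal_volCurve hα).iteratedDeriv_eq 2,
    iteratedDeriv_two_expScal e _ (hasDerivAt_logCurve α) (hasDerivAt_logCurve' α)
      (logCurve_zero α),
    he.first_variation hE, sum_add_mean, ← he.second_variation hE hα, mul_zero, zero_add]
  simp only [h0']

/-! ### Nearby metrics and saddle points -/

theorem OrthBasis.det_gram (h : OrthBasis g e W) :
    (LinearMap.BilinForm.toMatrix (finBasis ℝ (tangent K)) g).det *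
      (((finBasis ℝ (tangent K)).toMatrix e).transpose * (finBasis ℝ (tangent K)).toMatrix e).det =
      ∏ i, W i := by
  set f := finBasis ℝ (tangent K)
  have h1 : (f.toMatrix e).transpose * LinearMap.BilinForm.toMatrix f g * f.toMatrix e =
      diagonal W := by
    rw [LinearMap.BilinForm.toMatrix_mul_basis_toMatrix]
    ext i j
    rw [LinearMap.BilinForm.toMatrix_apply, h.gram, Matrix.diagonal_apply]
  have h2 : f.toMatrix e * e.toMatrix f = 1 := Basis.toMatrix_mul_toMatrix_flip _ _
  have hc : card ι = card (Fin (finrank ℝ (tangent K))) := by rw [card_fin, finrank_eq_card_basis e]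
  let σ : ι ≃ Fin (finrank ℝ (tangent K)) := Fintype.equivOfCardEq hc
  set P := (f.toMatrix e).submatrix id σ.symm
  have h3 : P.transpose * LinearMap.BilinForm.toMatrix f g * P =
      diagonal (W ∘ σ.symm) := by
    have := congrArg (fun M => Matrix.submatrix M σ.symm σ.symm) h1
    simp only [Matrix.submatrix_diagonal_equiv] at this
    rw [← this]
    rfl
  have h4 : ((f.toMatrix e).transpose * f.toMatrix e).det = (P.transpose * P).det := by
    rw [← Matrix.det_submatrix_equiv_self σ.symm]
    rfl
  have h5 := congrArg Matrix.det h3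
  rw [Matrix.det_mul, Matrix.det_mul, Matrix.det_diagonal] at h5
  rw [h4, Matrix.det_mul, ← Equiv.prod_comp σ.symm W]
  simp only [Function.comp_apply] at h5
  rw [← h5]
  ring

theorem OrthBasis.gram_transition_ne (e : Basis ι ℝ (tangent K)) :
    (((finBasis ℝ (tangent K)).toMatrix e).transpose *
      (finBasis ℝ (tangent K)).toMatrix e).det ≠ 0 := by
  set f := finBasis ℝ (tangent K)
  have h2 : f.toMatrix e * e.toMatrix f = 1 := Basis.toMatrix_mul_toMatrix_flip _ _
  have h2' : e.toMatrix f * f.toMatrix e = 1 := Basis.toMatrix_mul_toMatrix_flip _ _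
  have h3 : ((f.toMatrix e).transpose * f.toMatrix e) *
      (e.toMatrix f * (e.toMatrix f).transpose) = 1 := by
    rw [Matrix.mul_assoc, ← Matrix.mul_assoc (f.toMatrix e), h2, Matrix.one_mul,
      ← Matrix.transpose_mul, h2', Matrix.transpose_one]
  intro h0
  have := congrArg Matrix.det h3
  rw [Matrix.det_mul, h0, zero_mul, Matrix.det_one] at this
  exact zero_ne_one this

theorem OrthBasis.volume_eq_iff {g' : BilinForm ℝ (tangent K)} {W' : ι → ℝ} (h : OrthBasis g e W)
    (h' : OrthBasis g' e W') :
    (LinearMap.BilinForm.toMatrix (finBasis ℝ (tangent K)) g').det =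
      (LinearMap.BilinForm.toMatrix (finBasis ℝ (tangent K)) g).det ↔ ∏ i, W' i = ∏ i, W i := by
  rw [← h.det_gram, ← h'.det_gram]
  exact (mul_left_inj' (OrthBasis.gram_transition_ne e)).symm

theorem IsInvMetric.volCurve {A : End ℝ (tangent K)} (hg : IsInvMetric K Ad g)
    (hA : A ∈ symEndK K Ad g) (t : ℝ) (φ : L ≃ₗ⁅ℝ⁆ L) (hφ : φ ∈ Ad) (X Y X' Y' : tangent K)
    (hX : (X' : L) = φ X) (hY : (Y' : L) = φ Y) :
    volCurve g A t X' Y' = volCurve g A t X Y := by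
  simp only [InvGeom.volCurve, LinearMap.smul_apply, BilinForm.compLeft_apply]
  congr 1
  refine hg.inv φ hφ _ _ _ _ ?_ hY
  simp [hX, hA.2 φ hφ X X' hX]

theorem eventually_isNear {A : End ℝ (tangent K)} (hg : IsInvMetric K Ad g)
    (hA : A ∈ symEndK K Ad g) {ε : ℝ} (hε : 0 < ε) :
    ∀ᶠ t in nhds (0 : ℝ), IsNear K Ad g ε (volCurve g A t) := by
  obtain ⟨e, α, he, hα⟩ := exists_orthBasis_eigen hg.symm hg.pos hA.1
  have hc : ∀ᶠ t in nhds (0 : ℝ), ∀ i, |exp (logCurve α i t) - 1| < ε := by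
    refine Filter.eventually_all.2 fun i => ?_
    have h1 : ContinuousAt (logCurve α i) 0 := (hasDerivAt_logCurve α i).self_of_nhds.continuousAt
    have h2 : ContinuousAt (fun t => |exp (logCurve α i t) - 1|) 0 :=
      (h1.rexp.sub continuousAt_const).abs
    exact h2.eventually (gt_mem_nhds (by simpa [logCurve_zero] using hε))
  filter_upwards [he.volCurve hα, hc] with t ht hct
  refine ⟨⟨ht.symm, ht.self_pos, hg.volCurve hA t⟩, ?_, fun X => ?_⟩
  · rw [he.volume_eq_iff ht, Finset.prod_mul_distrib, ← Real.exp_sum, sum_logCurve, Real.exp_zero,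
      mul_one]
  · rw [ht.apply, he.apply, ← sum_sub_distrib, mul_sum]
    refine (Finset.abs_sum_le_sum_abs _ _).trans (sum_le_sum fun i _ => ?_)
    have : 1 * exp (logCurve α i t) * (e.repr X i * e.repr X i) -
        1 * (e.repr X i * e.repr X i) =
        (exp (logCurve α i t) - 1) * (e.repr X i * e.repr X i) := by ring
    rw [this, abs_mul, abs_mul_self, one_mul]
    exact mul_le_mul_of_nonneg_right (hct i).le (mul_self_nonneg _)

theorem volCurve_zero (g : BilinForm ℝ (tangent K)) (A : End ℝ (tangent K)) :
    volCurve g A 0 = g := by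
  ext x y
  simp [volCurve]

theorem not_isLocMin {A : End ℝ (tangent K)} (hg : IsInvMetric K Ad g) (hA : A ∈ symEndK K Ad g)
    (hh : hess K g A < 0) : ¬ IsLocMin K Ad g := by
  rintro ⟨ε, hε, hmin⟩
  obtain ⟨e, α, he, hα⟩ := exists_orthBasis_eigen hg.symm hg.pos hA.1
  set f := fun t => scal K (volCurve g A t) with hf
  have h1 : IsLocalMin f 0 := (eventually_isNear hg hA hε).mono fun t ht => by
    simpa [hf, volCurve_zero] using hmin _ ht
  have hcont : ContinuousAt f 0 := by
    refine ContinuousAt.congr ?_ (he.scal_volCurve hα).symm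
    have hc : ∀ i, ContinuousAt (logCurve α i) 0 := fun i =>
      (hasDerivAt_logCurve α i).self_of_nhds.continuousAt
    unfold expScal
    fun_prop
  have h2 : deriv (deriv f) 0 < 0 := by
    have := hh
    rwa [hess, iteratedDeriv_succ, iteratedDeriv_one] at this
  have h3 : IsLocalMax f 0 := isLocalMax_of_deriv_deriv_neg h2 h1.deriv_eq_zero hcont
  have h4 : f =ᶠ[nhds 0] fun _ => f 0 := by
    filter_upwards [h1, h3] with t h5 h6 using le_antisymm h6 h5
  have h5 : deriv f =ᶠ[nhds 0] fun _ => 0 := by simpa using h4.deriv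
  rw [h5.deriv_eq] at h2
  simp at h2

theorem not_isLocMax {A : End ℝ (tangent K)} (hg : IsInvMetric K Ad g) (hA : A ∈ symEndK K Ad g)
    (hh : 0 < hess K g A) : ¬ IsLocMax K Ad g := by
  rintro ⟨ε, hε, hmax⟩
  obtain ⟨e, α, he, hα⟩ := exists_orthBasis_eigen hg.symm hg.pos hA.1
  set f := fun t => scal K (volCurve g A t) with hf
  have h1 : IsLocalMax f 0 := (eventually_isNear hg hA hε).mono fun t ht => by
    simpa [hf, volCurve_zero] using hmax _ ht
  have hcont : ContinuousAt f 0 := by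
    refine ContinuousAt.congr ?_ (he.scal_volCurve hα).symm
    have hc : ∀ i, ContinuousAt (logCurve α i) 0 := fun i =>
      (hasDerivAt_logCurve α i).self_of_nhds.continuousAt
    unfold expScal
    fun_prop
  have h2 : 0 < deriv (deriv f) 0 := by
    have := hh
    rwa [hess, iteratedDeriv_succ, iteratedDeriv_one] at this
  have h3 : IsLocalMin f 0 := isLocalMin_of_deriv_deriv_pos h2 h1.deriv_eq_zero hcont
  have h4 : f =ᶠ[nhds 0] fun _ => f 0 := by
    filter_upwards [h1, h3] with t h5 h6 using le_antisymm h5 h6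
  have h5 : deriv f =ᶠ[nhds 0] fun _ => 0 := by simpa using h4.deriv
  rw [h5.deriv_eq] at h2
  simp at h2

/-! ### Eigenbases of `TT` -/

/-- An orthogonal basis of `TT` of eigenvectors of `L_𝔭` at an Einstein metric. -/
structure EigenFrame (K : LieSubalgebra ℝ L) (Ad : Set (L ≃ₗ⁅ℝ⁆ L)) (g : BilinForm ℝ (tangent K))
    {κ : Type*} [Fintype κ] (A : κ → End ℝ (tangent K)) (t : κ → ℝ) (ρ : ℝ) : Prop where
  metric : IsInvMetric K Ad g
  einstein : IsEinstein K g ρ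
  eigen : ∀ i, ∀ B ∈ symEnd g,
    lichForm g (bracketP K) (A i) B = t i * trace ℝ _ (A i * B)
  ne : ∀ i, A i ≠ 0
  orth : ∀ i j, i ≠ j → trace ℝ _ (A i * A j) = 0
  mem : ∀ c : κ → ℝ, ∑ i, c i • A i ∈ TT K Ad g
  span : ∀ B ∈ TT K Ad g, ∃ c : κ → ℝ, B = ∑ i, c i • A i

namespace EigenFrame
variable {κ : Type*} [Fintype κ] {A : κ → End ℝ (tangent K)} {t : κ → ℝ} {ρ : ℝ}

section
variable (h : EigenFrame K Ad g A t ρ)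
include h

theorem mem_TT (i : κ) : A i ∈ TT K Ad g := by
  classical
  have := h.mem (Pi.single i 1)
  rwa [sum_eq_single i (fun j _ hj => by simp [hj]) (by simp), Pi.single_eq_same,
    one_smul] at this

theorem trace_pos (i : κ) : 0 < trace ℝ _ (A i * A i) :=
  trace_mul_self_pos h.metric.symm h.metric.pos (h.mem_TT i).1.1 (h.ne i)

theorem trace_sum_left (c : κ → ℝ) (i : κ) :
    trace ℝ _ (A i * ∑ j, c j • A j) = c i * trace ℝ _ (A i * A i) := by
  classical
  rw [mul_sum, map_sum, sum_eq_single i (fun j _ hj => ?_) (by simp)]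
  · rw [mul_smul_comm, map_smul, smul_eq_mul]
  · rw [mul_smul_comm, map_smul, h.orth i j hj.symm, smul_zero]

theorem lichForm_sum (c : κ → ℝ) {B : End ℝ (tangent K)}
    (hB : B ∈ symEnd g) : lichForm g (bracketP K) (∑ i, c i • A i) B =
      ∑ i, c i * (t i * trace ℝ _ (A i * B)) := by
  obtain ⟨e, he⟩ := exists_orthBasis h.metric.symm h.metric.pos
  have hl := he.isBilin_lichForm (isBilin_bracketP K)
  rw [hl.sum_left]
  exact sum_congr rfl fun i _ => by rw [hl.smul_left, smul_eq_mul, h.eigen i B hB]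

theorem trace_sum_sum (c d : κ → ℝ) :
    trace ℝ _ ((∑ i, c i • A i) * ∑ i, d i • A i) = ∑ i, c i * (d i * trace ℝ _ (A i * A i)) := by
  rw [sum_mul, map_sum]
  exact sum_congr rfl fun i _ => by
    rw [smul_mul_assoc, map_smul, h.trace_sum_left, smul_eq_mul]

theorem hess_sum (c : κ → ℝ) : hess K g (∑ i, c i • A i) =
    ∑ i, c i ^ 2 * ((ρ - t i / 2) * trace ℝ _ (A i * A i)) := by
  rw [hess_eq h.metric.symm h.metric.pos h.einstein (h.mem c).1.1 (h.mem c).2.1,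
    h.lichForm_sum c (h.mem c).1.1, h.trace_sum_sum, mul_sum, mul_sum,
    ← sum_sub_distrib]
  exact sum_congr rfl fun i _ => by rw [h.trace_sum_left]; ring

theorem hess_single (i : κ) : hess K g (A i) =
    (ρ - t i / 2) * trace ℝ _ (A i * A i) := by
  classical
  have := h.hess_sum (Pi.single i 1)
  rwa [sum_eq_single i (fun j _ hj => by simp [hj]) (by simp),
    sum_eq_single i (fun j _ hj => by simp [hj]) (by simp), Pi.single_eq_same, one_smul,
    one_pow, one_mul] at this

theorem coeff_eq_zero {c : κ → ℝ} (hc : ∑ i, c i • A i = 0) (i : κ) :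
    c i = 0 := by
  have := h.trace_sum_left c i
  rw [hc, mul_zero, map_zero] at this
  exact (mul_eq_zero.1 this.symm).resolve_right (h.trace_pos i).ne'

theorem lichSpec_TT : lichSpec K g (TT K Ad g) = Set.range t := by
  ext s
  constructor
  · rintro ⟨B, hB, h0, hs⟩
    obtain ⟨c, rfl⟩ := h.span B hB
    obtain ⟨i, hi⟩ : ∃ i, c i ≠ 0 := by
      by_contra! hc
      exact h0 (by simp [hc])
    refine ⟨i, ?_⟩
    have h1 := hs (A i) (h.mem_TT i).1.1
    have h2 := h.trace_sum_left c i
    rw [LinearMap.trace_mul_comm] at h2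
    rw [h.lichForm_sum c (h.mem_TT i).1.1, h2, sum_eq_single i
      (fun j _ hj => by rw [h.orth j i hj, mul_zero, mul_zero]) (by simp)] at h1
    have h3 : (t i - s) * (c i * trace ℝ _ (A i * A i)) = 0 := by linear_combination h1
    have h4 := (mul_eq_zero.1 h3).resolve_right (mul_ne_zero hi (h.trace_pos i).ne')
    linarith
  · rintro ⟨i, rfl⟩
    exact ⟨A i, h.mem_TT i, h.ne i, h.eigen i⟩

/-- With the identity, the eigenbasis gives the spectrum on all invariant tensors. -/
theorem lichSpec_symEndK (hne : Nontrivial (tangent K))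
    (hspan : ∀ B ∈ symEndK K Ad g, trace ℝ _ B = 0 → B ∈ TT K Ad g) :
    lichSpec K g (symEndK K Ad g) = insert 0 (Set.range t) := by
  obtain ⟨e, he⟩ := exists_orthBasis h.metric.symm h.metric.pos
  have hl := he.isBilin_lichForm (isBilin_bracketP K)
  have hone : ∀ B ∈ symEnd g, lichForm g (bracketP K) 1 B = 0 := fun B hB =>
    lichForm_one h.metric.symm h.metric.pos (isBilin_bracketP K) bracketP_skew hB
  have hfr : (finrank ℝ (tangent K) : ℝ) ≠ 0 := by
    exact_mod_cast (finrank_pos (R := ℝ) (M := tangent K)).ne'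
  have h1K : (1 : End ℝ (tangent K)) ∈ symEndK K Ad g :=
    ⟨fun _ _ => rfl, fun φ _ X Y hXY => by simpa using hXY⟩
  ext s
  constructor
  · rintro ⟨B, hB, h0, hs⟩
    set r := trace ℝ _ B / finrank ℝ (tangent K) with hr
    have hB' : B - r • 1 ∈ symEndK K Ad g := by
      refine ⟨fun X Y => ?_, fun φ hφ X Y hXY => ?_⟩
      · simp [hB.1 X Y]
      · simp [hB.2 φ hφ X Y hXY, hXY]
    have htr : trace ℝ _ (B - r • 1) = 0 := by
      rw [map_sub, map_smul, LinearMap.trace_one, hr, smul_eq_mul, div_mul_cancel₀ _ hfr, sub_self]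
    obtain ⟨c, hc⟩ := h.span _ (hspan _ hB' htr)
    have hBc : B = r • 1 + ∑ i, c i • A i := by rw [← hc]; abel
    by_cases hc0 : ∀ i, c i = 0
    · left
      have hBr : B = r • 1 := by simp [hBc, hc0]
      have h2 := hs 1 h1K.1
      have hr0 : r ≠ 0 := fun h0' => h0 (by rw [hBr, h0', zero_smul])
      rw [hBr, hl.smul_left, hone 1 h1K.1, smul_zero, mul_one, map_smul, LinearMap.trace_one,
        smul_eq_mul] at h2
      exact (mul_eq_zero.1 h2.symm).resolve_right (mul_ne_zero hr0 hfr)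
    · right
      push Not at hc0
      obtain ⟨i, hi⟩ := hc0
      refine ⟨i, ?_⟩
      have h1 := hs (A i) (h.mem_TT i).1.1
      have h2 := h.trace_sum_left c i
      rw [LinearMap.trace_mul_comm] at h2
      rw [hBc, hl.add_left, hl.smul_left, hone _ (h.mem_TT i).1.1, h.lichForm_sum c
        (h.mem_TT i).1.1, add_mul, map_add, h2, sum_eq_single i
        (fun j _ hj => by rw [h.orth j i hj, mul_zero, mul_zero]) (by simp), smul_mul_assoc,
        one_mul, map_smul, (h.mem_TT i).2.1] at h1
      have h3 : (t i - s) * (c i * trace ℝ _ (A i * A i)) = 0 := by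
        simp only [smul_zero, zero_add] at h1
        linear_combination h1
      have h4 := (mul_eq_zero.1 h3).resolve_right (mul_ne_zero hi (h.trace_pos i).ne')
      linarith
  · rintro (rfl | ⟨i, rfl⟩)
    · exact ⟨1, h1K, one_ne_zero, fun B hB => by rw [hone B hB, zero_mul]⟩
    · exact ⟨A i, (h.mem_TT i).1, h.ne i, h.eigen i⟩

theorem isUnstable {i : κ} (hi : t i < 2 * ρ) :
    IsUnstable K Ad g := by
  refine ⟨A i, h.mem_TT i, ?_⟩
  rw [h.hess_single]
  exact mul_pos (by linarith) (h.trace_pos i)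

theorem isNondegenerate (ht : ∀ i, t i ≠ 2 * ρ) :
    IsNondegenerate K Ad g := by
  classical
  intro B hB hdeg
  obtain ⟨c, rfl⟩ := h.span B hB
  suffices hc : ∀ i, c i = 0 by simp [hc]
  intro i
  have h1 := hdeg (A i) (h.mem_TT i)
  have h2 : ∀ r : ℝ, ∑ j, c j • A j + r • A i = ∑ j, (c j + if j = i then r else 0) • A j := by
    intro r
    simp only [add_smul, sum_add_distrib, ite_smul, zero_smul, sum_ite_eq', mem_univ, if_true]
  have h3 := h2 1
  have h4 : ∑ j, c j • A j - A i = ∑ j, (c j + if j = i then -1 else 0) • A j := by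
    rw [← h2 (-1), neg_one_smul ℝ (A i), sub_eq_add_neg]
  rw [one_smul] at h3
  rw [hess₂, h3, h4, h.hess_sum, h.hess_sum, ← sum_sub_distrib, sum_eq_single i
    (fun j _ hj => by simp [hj]) (by simp)] at h1
  simp only [if_true] at h1
  have h5 : c i * ((ρ - t i / 2) * trace ℝ _ (A i * A i)) = 0 := by linear_combination h1
  refine (mul_eq_zero.1 h5).resolve_right (mul_ne_zero ?_ (h.trace_pos i).ne')
  intro h6
  exact ht i (by linarith)

theorem isSaddle {i j : κ} (hi : t i < 2 * ρ) (hj : 2 * ρ < t j) :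
    IsSaddle K Ad g := by
  refine ⟨not_isLocMin h.metric (h.mem_TT j).1 ?_, not_isLocMax h.metric (h.mem_TT i).1 ?_⟩
  · rw [h.hess_single]
    exact mul_neg_of_neg_of_pos (by linarith) (h.trace_pos j)
  · rw [h.hess_single]
    exact mul_pos (by linarith) (h.trace_pos i)

theorem hasCoindex {n : ℕ}
    (hn : Nat.card {i // t i < 2 * ρ} = n) : HasCoindex K Ad g n := by
  classical
  rw [Nat.card_eq_fintype_card] at hn
  constructor
  · have hsum : ∀ c : {i // t i < 2 * ρ} → ℝ, ∑ i, c i • A i =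
        ∑ i, (if hi : t i < 2 * ρ then c ⟨i, hi⟩ else 0) • A i := by
      intro c
      rw [← Fintype.sum_subtype_add_sum_subtype (fun i => t i < 2 * ρ)]
      have h1 : ∀ i : {i // t i < 2 * ρ},
          (if hi : t i < 2 * ρ then c ⟨i, hi⟩ else 0) = c i := fun i => dif_pos i.2
      have h2 : ∀ i : {i // ¬ t i < 2 * ρ},
          (if hi : t i < 2 * ρ then c ⟨i, hi⟩ else 0) = 0 := fun i => dif_neg i.2
      simp only [h1, h2, zero_smul, sum_const_zero, add_zero]
    refine ⟨LinearMap.range (Fintype.linearCombination ℝ fun i : {i // t i < 2 * ρ} => A i), ?_, ?_⟩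
    · rintro _ ⟨c, rfl⟩
      rw [Fintype.linearCombination_apply, hsum]
      refine ⟨h.mem _, fun h0 => ?_⟩
      rw [h.hess_sum]
      have h3 : ∀ i, 0 ≤ (if hi : t i < 2 * ρ then c ⟨i, hi⟩ else 0) ^ 2 *
          ((ρ - t i / 2) * trace ℝ _ (A i * A i)) := by
        intro i
        by_cases hi : t i < 2 * ρ
        · exact mul_nonneg (sq_nonneg _) (mul_nonneg (by linarith) (h.trace_pos i).le)
        · simp [hi]
      refine lt_of_le_of_ne (sum_nonneg fun i _ => h3 i) fun h4 => h0 ?_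
      have h5 := (Finset.sum_eq_zero_iff_of_nonneg fun i _ => h3 i).1 h4.symm
      refine sum_eq_zero fun i _ => ?_
      by_cases hi : t i < 2 * ρ
      · have h6 := h5 i (mem_univ _)
        have h7 : (ρ - t i / 2) * trace ℝ _ (A i * A i) ≠ 0 :=
          (mul_pos (by linarith) (h.trace_pos i)).ne'
        rw [pow_eq_zero_iff two_ne_zero |>.1 ((mul_eq_zero.1 h6).resolve_right h7), zero_smul]
      · rw [dif_neg hi, zero_smul]
    · rw [LinearMap.finrank_range_of_inj, finrank_fintype_fun_eq_card, hn]
      refine (injective_iff_map_eq_zero _).2 fun c hc => ?_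
      rw [Fintype.linearCombination_apply, hsum] at hc
      funext i
      simpa [i.2] using h.coeff_eq_zero hc i
  · rintro d ⟨W, hW, rfl⟩
    let S : W →ₗ[ℝ] ({i // t i < 2 * ρ} → ℝ) := LinearMap.pi fun i =>
      trace ℝ _ ∘ₗ LinearMap.mulLeft ℝ (A i) ∘ₗ W.subtype
    have hinj : Function.Injective S := by
      refine (injective_iff_map_eq_zero _).2 fun B hB => ?_
      obtain ⟨hT, hpos⟩ := hW B B.2
      by_contra h0
      have h1 := hpos (by simpa using h0)
      obtain ⟨c, hc⟩ := h.span _ hT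
      have h2 : ∀ i, t i < 2 * ρ → c i = 0 := by
        intro i hi
        have h3 : trace ℝ _ (A i * (B : End ℝ (tangent K))) = 0 := congrFun hB ⟨i, hi⟩
        rw [hc, h.trace_sum_left] at h3
        exact (mul_eq_zero.1 h3).resolve_right (h.trace_pos i).ne'
      rw [hc, h.hess_sum] at h1
      refine absurd h1 (not_lt.2 (Finset.sum_nonpos fun i _ => ?_))
      by_cases hi : t i < 2 * ρ
      · simp [h2 i hi]
      · exact mul_nonpos_of_nonneg_of_nonpos (sq_nonneg _)
          (mul_nonpos_of_nonpos_of_nonneg (by linarith) (h.trace_pos i).le)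
    calc finrank ℝ W ≤ finrank ℝ ({i // t i < 2 * ρ} → ℝ) :=
          LinearMap.finrank_le_finrank_of_injective hinj
      _ = n := by rw [finrank_fintype_fun_eq_card, hn]
end
end EigenFrame

section Frame
/-! ### The background inner product -/

theorem Q_comm (X Y : L) : Q L X Y = Q L Y X := by
  simp only [Q, LinearMap.neg_apply]
  rw [LieModule.traceForm_comm]

theorem Q_lie (X Y Z : L) : Q L ⁅X, Y⁆ Z = Q L X ⁅Y, Z⁆ := by
  simp only [Q, LinearMap.neg_apply]
  rw [LieModule.traceForm_apply_lie_apply]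

theorem Q_equiv (φ : L ≃ₗ⁅ℝ⁆ L) (X Y : L) : Q L (φ X) (φ Y) = Q L X Y := by
  simp only [Q, LinearMap.neg_apply, LieAlgebra.killingForm_of_equiv_apply]

theorem Q_self_pos (hc : ∀ X : L, X ≠ 0 → killingForm ℝ L X X < 0) {X : L} (hX : X ≠ 0) :
    0 < Q L X X := by
  simpa [Q] using hc X hX

theorem mem_orthogonal_Q {U : Submodule ℝ L} {X : L} :
    X ∈ (Q L).orthogonal U ↔ ∀ Y ∈ U, Q L Y X = 0 := by
  rw [BilinForm.mem_orthogonal_iff]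

theorem mem_tangent {X : L} : X ∈ tangent K ↔ ∀ Y ∈ K, Q L Y X = 0 := mem_orthogonal_Q

section
variable (hc : ∀ X : L, X ≠ 0 → killingForm ℝ L X X < 0)
include hc

theorem isCompl_orthogonal_Q (U : Submodule ℝ L) :
    IsCompl U ((Q L).orthogonal U) := by
  refine BilinForm.isCompl_orthogonal_of_restrict_nondegenerate
    (fun x y h => by rw [Q_comm]; exact h) ?_
  refine ⟨fun x hx => ?_, fun x hx => ?_⟩ <;>
  · by_contra h0
    exact (Q_self_pos hc (X := (x : L)) (by simpa using h0)).ne' (hx x)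

theorem qproj_of_mem {U : Submodule ℝ L} {X : L}
    (hX : X ∈ U) : (qproj U X : L) = X := by
  rw [qproj, dif_pos (isCompl_orthogonal_Q hc U)]
  exact congrArg Subtype.val (Submodule.projectionOnto_apply_left _ ⟨X, hX⟩)

theorem qproj_of_orthogonal {U : Submodule ℝ L}
    {X : L} (hX : ∀ Y ∈ U, Q L Y X = 0) : qproj U X = 0 := by
  rw [qproj, dif_pos (isCompl_orthogonal_Q hc U)]
  exact Submodule.projectionOnto_apply_right _ ⟨X, mem_orthogonal_Q.2 hX⟩

theorem Q_qproj {U : Submodule ℝ L} (X : L) {Y : L}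
    (hY : Y ∈ U) : Q L (qproj U X) Y = Q L X Y := by
  have h := isCompl_orthogonal_Q hc U
  obtain ⟨X₁, h1, X₂, h2, rfl⟩ : ∃ X₁ ∈ U, ∃ X₂ ∈ (Q L).orthogonal U, X₁ + X₂ = X :=
    Submodule.mem_sup.1 (h.sup_eq_top ▸ Submodule.mem_top)
  rw [map_add, qproj_of_orthogonal hc (mem_orthogonal_Q.1 h2), add_zero, qproj_of_mem hc h1,
    map_add, LinearMap.add_apply, Q_comm X₂, mem_orthogonal_Q.1 h2 Y hY, add_zero]
end

/-- A `Q`-orthogonal family in `𝔭` with trivial orthogonal complement in `𝔭` is a basis. -/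
theorem exists_basis_of_orthogonal {ι : Type*} [Fintype ι] [DecidableEq ι] (v : ι → L) {w : ℝ}
    (hw : w ≠ 0) (hmem : ∀ i, v i ∈ tangent K) (hv : ∀ i j, Q L (v i) (v j) = if i = j then w else 0)
    (htop : ∀ X ∈ tangent K, (∀ i, Q L X (v i) = 0) → X = 0) :
    ∃ e : Basis ι ℝ (tangent K), ∀ i, (e i : L) = v i := by
  let u : ι → tangent K := fun i => ⟨v i, hmem i⟩
  have hli : LinearIndependent ℝ u := by
    rw [Fintype.linearIndependent_iff]
    intro c hc i
    have h1 := congrArg (fun x : tangent K => Q L (x : L) (v i)) hc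
    simp only [AddSubmonoidClass.coe_finsetSum, Submodule.coe_smul, map_sum, map_smul,
      LinearMap.sum_apply, LinearMap.smul_apply, u, hv, smul_eq_mul, mul_ite, mul_zero,
      sum_ite_eq', mem_univ, if_true, Submodule.coe_zero, map_zero,
      LinearMap.zero_apply] at h1
    exact (mul_eq_zero.1 h1).resolve_right hw
  have hsp : ⊤ ≤ Submodule.span ℝ (Set.range u) := by
    rintro ⟨X, hX⟩ -
    have h2 : X - ∑ i, (Q L X (v i) / w) • v i = 0 := by
      refine htop _ (Submodule.sub_mem _ hX (Submodule.sum_mem _ fun i _ =>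
        Submodule.smul_mem _ _ (hmem i))) fun j => ?_
      simp only [map_sub, map_sum, map_smul, LinearMap.sub_apply, LinearMap.sum_apply,
        LinearMap.smul_apply, hv, smul_eq_mul, mul_ite, mul_zero, sum_ite_eq',
        mem_univ, if_true]
      rw [div_mul_cancel₀ _ hw, sub_self]
    have h3 : (⟨X, hX⟩ : tangent K) = ∑ i, (Q L X (v i) / w) • u i := by
      ext
      simpa [u] using sub_eq_zero.1 h2
    rw [h3]
    exact Submodule.sum_mem _ fun i _ => Submodule.smul_mem _ _ (Submodule.subset_span ⟨i, rfl⟩)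
  exact ⟨Basis.mk hli hsp, fun i => by rw [Basis.mk_apply]⟩

/-! ### Frames adapted to a generalized Wallach space -/

/-- A basis `e` of `𝔭` adapted to `𝔭 = 𝔭_0 ⊕ 𝔭_1 ⊕ 𝔭_2`, with `e_i ∈ 𝔭_{s i}`, which is `Q`-orthogonal
with vectors of the same length, for a generalized Wallach space. -/
structure WallachFrame {ι : Type*} [Fintype ι] [DecidableEq ι] (K : LieSubalgebra ℝ L)
    (p : Fin 3 → Submodule ℝ L) (e : Basis ι ℝ (tangent K)) (s : ι → Fin 3) (w : ℝ) : Prop where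
  compact : ∀ X : L, X ≠ 0 → killingForm ℝ L X X < 0
  orthogonal : ∀ i j, i ≠ j → ∀ X ∈ p i, ∀ Y ∈ p j, Q L X Y = 0
  bracket : ∀ i, ∀ X ∈ p i, ∀ Y ∈ p i, ⁅X, Y⁆ ∈ K
  wpos : 0 < w
  gram : ∀ i j, Q L (e i) (e j) = if i = j then w else 0
  mem : ∀ i, (e i : L) ∈ p (s i)
  le : ∀ r, p r ≤ tangent K
  surj : ∀ r, ∃ i, s i = r
variable {a : Fin 3 → ℝ}

/-- The partial traces of the structure constants are governed by `a`. -/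
def IsIsotropic (e : Basis ι ℝ (tangent K)) (s : ι → Fin 3) (w : ℝ) (a : Fin 3 → ℝ) : Prop :=
  ∀ i i', s i = s i' →
    ∑ j, ∑ k, sconst e i j k * sconst e i' j k = if i = i' then 2 * a (s i) * w else 0

/-- The background metric on `𝔭`. -/
def Qp (K : LieSubalgebra ℝ L) : BilinForm ℝ (tangent K) := (Q L).restrict (tangent K)

namespace WallachFrame

section
variable (H : WallachFrame K p e s w)
include H

theorem wne : w ≠ 0 := H.wpos.ne'

theorem nontrivial : Nontrivial (tangent K) := by
  obtain ⟨i, -⟩ := H.surj 0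
  exact ⟨e i, 0, e.ne_zero i⟩

theorem orthQ : OrthBasis (Qp K) e fun _ => w :=
  ⟨fun i j => by rw [← H.gram]; rfl, fun _ => H.wpos⟩

theorem sconst_eq (i j k : ι) :
    sconst e i j k = Q L ⁅(e i : L), (e j : L)⁆ (e k) / w := by
  have h1 := H.orthQ.apply_right (bracketP K (e i) (e j)) k
  rw [sconst, eq_div_iff H.wne, mul_comm, ← h1]
  exact Q_qproj H.compact _ (e k).2

theorem sconst_skew_right (i j k : ι) :
    sconst e i j k = -sconst e i k j := by
  rw [H.sconst_eq, H.sconst_eq, ← lie_skew, map_neg, LinearMap.neg_apply, Q_lie, Q_comm, neg_div]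

theorem sconst_cycle (i j k : ι) :
    sconst e i j k = sconst e k i j := by
  rw [H.sconst_skew_right, sconst_skew e k i j]

theorem sconst_eq_zero {i j k : ι} (h : s i = s j) :
    sconst e i j k = 0 := by
  rw [H.sconst_eq, Q_comm]
  have h1 : ⁅(e i : L), (e j : L)⁆ ∈ K := H.bracket (s i) _ (H.mem i) _ (h ▸ H.mem j)
  rw [Q_comm, mem_tangent.1 (e k).2 _ h1, zero_div]

theorem sconst_support {i j k : ι} (h : sconst e i j k ≠ 0) :
    (s j = s i + 1 ∧ s k = s i + 2) ∨ (s j = s i + 2 ∧ s k = s i + 1) := by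
  have h1 : s i ≠ s j := fun h' => h (H.sconst_eq_zero h')
  have h2 : s k ≠ s i := fun h' => h (by rw [H.sconst_cycle]; exact H.sconst_eq_zero h')
  have h3 : s j ≠ s k := fun h' => h (by
    rw [H.sconst_cycle, H.sconst_cycle]; exact H.sconst_eq_zero h')
  generalize s i = x at *
  generalize s j = y at *
  generalize s k = z at *
  revert x y z
  decide

theorem contract (hI : IsIsotropic e s w a)
    (f : Fin 3 → Fin 3 → ℝ) (i i' : ι) :
    ∑ j, ∑ k, f (s j) (s k) * (sconst e i j k * sconst e i' j k) =
      if i = i' then a (s i) * w * (f (s i + 1) (s i + 2) + f (s i + 2) (s i + 1)) else 0 := by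
  by_cases hs : s i = s i'
  · set S : Fin 3 → Fin 3 → ℝ := fun r r' =>
      ∑ j, ∑ k, if s j = r ∧ s k = r' then sconst e i j k * sconst e i' j k else 0 with hH
    have hsymm : S (s i + 2) (s i + 1) = S (s i + 1) (s i + 2) := by
      simp only [hH]
      rw [sum_comm]
      refine sum_congr rfl fun j _ => sum_congr rfl fun k _ => ?_
      rw [H.sconst_skew_right i k j, H.sconst_skew_right i' k j, neg_mul_neg]
      simp only [and_comm]
    have hsplit : ∀ f : Fin 3 → Fin 3 → ℝ,
        ∑ j, ∑ k, f (s j) (s k) * (sconst e i j k * sconst e i' j k) =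
          f (s i + 1) (s i + 2) * S (s i + 1) (s i + 2) +
            f (s i + 2) (s i + 1) * S (s i + 2) (s i + 1) := by
      intro f
      simp only [hH, mul_sum, ← sum_add_distrib]
      refine sum_congr rfl fun j _ => sum_congr rfl fun k _ => ?_
      by_cases h0 : sconst e i j k = 0
      · simp [h0]
      · have hne : s i + 1 ≠ s i + 2 := by generalize s i = x; revert x; decide
        rcases H.sconst_support h0 with ⟨h1, h2⟩ | ⟨h1, h2⟩
        · rw [h1, h2]; simp [hne]
        · rw [h1, h2]; simp [hne.symm]
    have h1 := hsplit fun _ _ => 1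
    simp only [one_mul] at h1
    rw [hI i i' hs, hsymm] at h1
    rw [hsplit f, hsymm]
    split_ifs at h1 ⊢ <;>
      linear_combination (-(f (s i + 1) (s i + 2) + f (s i + 2) (s i + 1)) / 2) * h1
  · have hi : i ≠ i' := fun h => hs (h ▸ rfl)
    rw [if_neg hi]
    refine sum_eq_zero fun j _ => sum_eq_zero fun k _ => ?_
    by_cases h0 : sconst e i j k = 0
    · simp [h0]
    by_cases h0' : sconst e i' j k = 0
    · simp [h0']
    exfalso
    have h1 := H.sconst_support h0
    have h2 := H.sconst_support h0'
    clear h0 h0'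
    generalize s i = x at *
    generalize s i' = x' at *
    generalize s j = y at *
    generalize s k = z at *
    revert x x' y z
    decide
end

/-! ### Diagonal metrics -/

section
variable (H : WallachFrame K p e s w)
include H

theorem mem_of_mem {r : Fin 3} {X : tangent K} (hX : (X : L) ∈ p r)
    {i : ι} (hi : s i ≠ r) : e.repr X i = 0 := by
  have h1 := H.orthQ.apply_right X i
  rw [show Qp K X (e i) = Q L X (e i) from rfl, H.orthogonal r (s i) hi.symm _ hX _ (H.mem i)] at h1
  exact (mul_eq_zero.1 h1.symm).resolve_left H.wne

theorem qproj_basis (r : Fin 3) (i : ι) :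
    (qproj (p r) (e i : L) : L) = if s i = r then (e i : L) else 0 := by
  by_cases h : s i = r
  · rw [if_pos h, qproj_of_mem H.compact (h ▸ H.mem i)]
  · rw [if_neg h, qproj_of_orthogonal H.compact fun Y hY => H.orthogonal r (s i) (Ne.symm h) _ hY _
      (H.mem i), Submodule.coe_zero]

theorem diagMetric_apply (x : Fin 3 → ℝ) (i j : ι) :
    diagMetric K p x (e i) (e j) = if i = j then w * x (s i) else 0 := by
  simp only [diagMetric, LinearMap.sum_apply, LinearMap.smul_apply, BilinForm.comp_apply,
    LinearMap.comp_apply, Submodule.subtype_apply, H.qproj_basis, smul_eq_mul]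
  rw [sum_eq_single (s i) (fun r _ hr => by simp [hr.symm]) (by simp), if_pos rfl]
  by_cases hij : s j = s i
  · rw [if_pos hij, H.gram]
    split_ifs <;> ring
  · rw [if_neg hij, if_neg (fun h : i = j => hij (h ▸ rfl)), map_zero, mul_zero]

theorem orthBasis {x : Fin 3 → ℝ} (hx : ∀ r, 0 < x r) :
    OrthBasis (diagMetric K p x) e fun i => w * x (s i) :=
  ⟨H.diagMetric_apply x, fun _ => mul_pos H.wpos (hx _)⟩

theorem qproj_equiv (hst : ∀ r, ∀ φ ∈ Ad, ∀ X ∈ p r, φ X ∈ p r)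
    (r : Fin 3) {φ : L ≃ₗ⁅ℝ⁆ L} (hφ : φ ∈ Ad) {X X' : tangent K} (hX : (X' : L) = φ X) :
    (qproj (p r) (X' : L) : L) = φ (qproj (p r) (X : L)) := by
  rw [hX]
  conv_lhs => rw [← e.sum_repr X]
  conv_rhs => rw [← e.sum_repr X]
  simp only [AddSubmonoidClass.coe_finsetSum, Submodule.coe_smul, map_sum, map_smul]
  refine sum_congr rfl fun i _ => ?_
  congr 1
  have h2 := hst (s i) φ hφ _ (H.mem i)
  rw [H.qproj_basis]
  by_cases h : s i = r
  · rw [if_pos h, qproj_of_mem H.compact (h ▸ h2)]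
  · rw [if_neg h, qproj_of_orthogonal H.compact fun Y hY => H.orthogonal r (s i) (Ne.symm h) _ hY
      _ h2, Submodule.coe_zero, map_zero]

theorem isInvMetric (hst : ∀ r, ∀ φ ∈ Ad, ∀ X ∈ p r, φ X ∈ p r)
    {x : Fin 3 → ℝ} (hx : ∀ r, 0 < x r) : IsInvMetric K Ad (diagMetric K p x) := by
  refine ⟨(H.orthBasis hx).symm, (H.orthBasis hx).self_pos, fun φ hφ X Y X' Y' hX hY => ?_⟩
  simp only [diagMetric, LinearMap.sum_apply, LinearMap.smul_apply, BilinForm.comp_apply,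
    LinearMap.comp_apply, Submodule.subtype_apply, H.qproj_equiv hst _ hφ hX,
    H.qproj_equiv hst _ hφ hY, Q_equiv]
end

/-- The endomorphism acting as `α r` on `𝔭_r`. -/
def diagOp (e : Basis ι ℝ (tangent K)) (s : ι → Fin 3) (α : Fin 3 → ℝ) :
    End ℝ (tangent K) := e.constr ℝ fun i => α (s i) • e i

theorem diagOp_apply (α : Fin 3 → ℝ) (i : ι) : diagOp e s α (e i) = α (s i) • e i := by
  rw [diagOp, Basis.constr_basis]

theorem eq_diagOp {A : End ℝ (tangent K)} {α : Fin 3 → ℝ} (h : ∀ i, A (e i) = α (s i) • e i) :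
    A = diagOp e s α := e.ext fun i => by rw [h, diagOp_apply]

theorem mem_diagEnd (H : WallachFrame K p e s w) {A : End ℝ (tangent K)} :
    A ∈ diagEnd K p ↔ ∃ α, A = diagOp e s α := by
  constructor
  · intro h
    choose α hα using h
    exact ⟨α, eq_diagOp fun i => hα (s i) (e i) (H.mem i)⟩
  · rintro ⟨α, rfl⟩ r
    refine ⟨α r, fun X hX => ?_⟩
    conv_lhs => rw [← e.sum_repr X]
    conv_rhs => rw [← e.sum_repr X]
    rw [map_sum, Finset.smul_sum]
    refine sum_congr rfl fun i _ => ?_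
    rw [map_smul, diagOp_apply]
    by_cases h : s i = r
    · rw [h, smul_comm]
    · rw [H.mem_of_mem hX h, zero_smul, zero_smul, smul_zero]

theorem diagOp_ne_zero (H : WallachFrame K p e s w) {α : Fin 3 → ℝ} (h : α ≠ 0) :
    diagOp e s α ≠ 0 := by
  intro h0
  refine h (funext fun r => ?_)
  obtain ⟨i, rfl⟩ := H.surj r
  have h1 := diagOp_apply (e := e) (s := s) α i
  rw [h0, LinearMap.zero_apply] at h1
  exact (smul_eq_zero.1 h1.symm).resolve_right (e.ne_zero i)

theorem trace_diagOp_mul (α : Fin 3 → ℝ) (B : End ℝ (tangent K)) :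
    trace ℝ _ (diagOp e s α * B) = ∑ i, α (s i) * e.repr (B (e i)) i := by
  rw [LinearMap.trace_mul_comm, LinearMap.trace_eq_matrix_trace ℝ e, Matrix.trace]
  refine sum_congr rfl fun i _ => ?_
  rw [Matrix.diag_apply, LinearMap.toMatrix_apply, End.mul_apply, diagOp_apply, map_smul,
    map_smul, Finsupp.smul_apply, smul_eq_mul]

theorem diagOp_mem_symEnd (H : WallachFrame K p e s w) {x : Fin 3 → ℝ} (hx : ∀ r, 0 < x r)
    (α : Fin 3 → ℝ) : diagOp e s α ∈ symEnd (diagMetric K p x) := by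
  refine (H.orthBasis hx).mem_symEnd fun i j => ?_
  rw [diagOp_apply, diagOp_apply, map_smul, map_smul, LinearMap.smul_apply, H.diagMetric_apply]
  by_cases h : i = j
  · subst h; rfl
  · simp [h]

/-- `w_r = x_r / (x_{r+1} x_{r+2})` -/
def wt (x : Fin 3 → ℝ) (r : Fin 3) : ℝ := x r / (x (r + 1) * x (r + 2))

/-- The eigenvalue of the moment map on `𝔭_r`, in units of the metric. -/
def mom (a x : Fin 3 → ℝ) (r : Fin 3) : ℝ :=
  a r / 2 * (wt x r - wt x (r + 1) - wt x (r + 2))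

/-- The Lichnerowicz Laplacian on diagonal tensors. -/
def kap (a x α : Fin 3 → ℝ) (r : Fin 3) : ℝ :=
  a r * (wt x r * (2 * α r - α (r + 1) - α (r + 2)) +
    (wt x (r + 1) - wt x (r + 2)) * (α (r + 2) - α (r + 1)))

theorem fin3_add (r : Fin 3) : r + 1 + 1 = r + 2 ∧ r + 1 + 2 = r ∧ r + 2 + 1 = r ∧
    r + 2 + 2 = r + 1 := by revert r; decide

theorem moment_basis (H : WallachFrame K p e s w) (hI : IsIsotropic e s w a) {x : Fin 3 → ℝ}
    (hx : ∀ r, 0 < x r) (i i' : ι) : moment (diagMetric K p x) (bracketP K) (e i) (e i') =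
      if i = i' then w * x (s i) * mom a x (s i) else 0 := by
  have h := H.orthBasis hx
  have hw := H.wne
  have hx' : ∀ r, x r ≠ 0 := fun r => (hx r).ne'
  have e1 : ∑ u, (w * x (s u))⁻¹ * diagMetric K p x (bracketP K (e i) (e u))
      (bracketP K (e i') (e u)) = ∑ u, ∑ k, (fun r r' => x r' / x r) (s u) (s k) *
        (sconst e i u k * sconst e i' u k) := by
    refine sum_congr rfl fun u _ => ?_
    rw [h.apply, mul_sum]
    refine sum_congr rfl fun k _ => ?_
    have := hx' (s u)
    simp only [sconst]
    field_simp
  have e2 : ∑ u, (w * x (s u))⁻¹ * ∑ v, (w * x (s v))⁻¹ *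
      (diagMetric K p x (bracketP K (e u) (e v)) (e i) *
        diagMetric K p x (bracketP K (e u) (e v)) (e i')) =
      ∑ u, ∑ k, (fun r r' => x (s i) * x (s i') / (x r * x r')) (s u) (s k) *
        (sconst e i u k * sconst e i' u k) := by
    refine sum_congr rfl fun u _ => ?_
    rw [mul_sum]
    refine sum_congr rfl fun k _ => ?_
    have := hx' (s u)
    have := hx' (s k)
    have hc : ∀ i, diagMetric K p x (bracketP K (e u) (e k)) (e i) =
        w * x (s i) * sconst e i u k := fun i => by
      rw [h.apply_right, H.sconst_cycle i u k, H.sconst_cycle k i u]; rfl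
    rw [hc, hc]
    field_simp
  rw [h.moment_eq (isBilin_bracketP K), e1, e2, H.contract hI fun r r' => x r' / x r,
    H.contract hI fun r r' => x (s i) * x (s i') / (x r * x r')]
  by_cases hi : i = i'
  · subst hi
    simp only [if_true, mom, wt, fin3_add]
    have := hx' (s i)
    have := hx' (s i + 1)
    have := hx' (s i + 2)
    field_simp
    ring
  · simp [hi]
end WallachFrame
end Frame

section FrameSpectrum
variable {a x α : Fin 3 → ℝ}

namespace WallachFrame

/-! ### Ricci curvature and Lichnerowicz Laplacian in a frame -/

theorem isEinstein (H : WallachFrame K p e s w) (hI : IsIsotropic e s w a) (hx : ∀ r, 0 < x r)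
    {ρ : ℝ} (hρ : ∀ r, x r * mom a x r + 1 / 2 = ρ * x r) :
    IsEinstein K (diagMetric K p x) ρ := by
  have h := H.orthBasis hx
  have hM := h.isBilin_moment (isBilin_bracketP K)
  have hR : IsBilin fun X Y => ricci K (diagMetric K p x) X Y := by
    refine ⟨fun X Y Z => ?_, fun r X Z => ?_, fun X Y Z => ?_, fun r X Z => ?_⟩ <;>
    · simp only [ricci, hM.add_left, hM.add_right, hM.smul_left, hM.smul_right, Submodule.coe_add,
        Submodule.coe_smul, map_add, map_smul, LinearMap.add_apply, LinearMap.smul_apply,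
        smul_eq_mul]
      ring
  have hg : IsBilin fun X Y => ρ * diagMetric K p x X Y := by
    refine ⟨fun X Y Z => ?_, fun r X Z => ?_, fun X Y Z => ?_, fun r X Z => ?_⟩ <;>
    · simp only [map_add, map_smul, LinearMap.add_apply, LinearMap.smul_apply, smul_eq_mul]
      ring
  refine hR.ext_basis hg e fun i j => ?_
  have hB : killingForm ℝ L (e i) (e j) = if i = j then -w else 0 := by
    have := H.gram i j
    simp only [Q, LinearMap.neg_apply] at this
    rw [← neg_neg (killingForm ℝ L (e i) (e j)), this]
    split_ifs <;> simp
  simp only [ricci]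
  rw [H.moment_basis hI hx, hB, H.diagMetric_apply]
  split_ifs
  · linear_combination w * hρ (s i)
  · ring

theorem sconst_self_right (H : WallachFrame K p e s w) (X : tangent K) (i : ι) :
    e.repr (bracketP K X (e i)) i = 0 := by
  have h1 := H.orthQ.apply_right (bracketP K X (e i)) i
  have h2 : Qp K (bracketP K X (e i)) (e i) = 0 := by
    refine (Q_qproj H.compact _ (e i).2).trans ?_
    rw [Q_lie, lie_self, map_zero]
  rw [h2] at h1
  exact (mul_eq_zero.1 h1.symm).resolve_left H.wne

theorem divergence_eq_zero (H : WallachFrame K p e s w) (hx : ∀ r, 0 < x r)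
    {A : End ℝ (tangent K)} {α : ι → ℝ} (hA : ∀ i, A (e i) = α i • e i) (X : tangent K) :
    divergence (diagMetric K p x) (bracketP K) A X = 0 := by
  have h := H.orthBasis hx
  have hμ := isBilin_bracketP K
  have hself : ∀ i, bracketP K (e i) (e i) = 0 := fun i => by simp [bracketP]
  have h0 : ∀ Y i, diagMetric K p x (bracketP K Y (e i)) (e i) = 0 := fun Y i => by
    rw [h.apply_right, H.sconst_self_right, mul_zero]
  have h0' : ∀ Y i, diagMetric K p x (e i) (bracketP K Y (e i)) = 0 := fun Y i => by
    rw [h.symm, h0]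
  have hskew : ∀ Y i, bracketP K (e i) Y = -bracketP K Y (e i) := fun Y i => bracketP_skew _ _
  unfold divergence
  rw [h.gtr_eq]
  · refine sum_eq_zero fun i _ => ?_
    simp [leviCivita, hA, hself, h0, h0', hskew X i, hμ.smul_left]
  · constructor <;> intros <;>
    simp only [leviCivita, map_add, map_smul, hμ.add_left, hμ.add_right, hμ.smul_left,
      hμ.smul_right, LinearMap.add_apply, LinearMap.smul_apply, smul_eq_mul] <;> ring

theorem repr_theta_basis (B : End ℝ (tangent K)) (i j k : ι) :
    e.repr (theta B (bracketP K) (e i) (e j)) k =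
      ∑ l, (sconst e i j l * e.repr (B (e l)) k - e.repr (B (e i)) l * sconst e l j k -
        e.repr (B (e j)) l * sconst e i l k) := by
  have hμ := isBilin_bracketP K
  have h1 : B (bracketP K (e i) (e j)) = ∑ l, sconst e i j l • B (e l) := by
    conv_lhs => rw [← e.sum_repr (bracketP K (e i) (e j)), map_sum]
    simp only [map_smul, sconst]
  have h2 : ∀ y, bracketP K (B (e i)) y = ∑ l, e.repr (B (e i)) l • bracketP K (e l) y := by
    intro y
    conv_lhs => rw [← e.sum_repr (B (e i)), hμ.sum_left]
    simp only [hμ.smul_left]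
  have h3 : ∀ y, bracketP K y (B (e j)) = ∑ l, e.repr (B (e j)) l • bracketP K y (e l) := by
    intro y
    conv_lhs => rw [← e.sum_repr (B (e j)), hμ.sum_right]
    simp only [hμ.smul_right]
  simp only [theta, h1, h2, h3, map_sub, map_sum, map_smul, Finsupp.sub_apply,
    Finsupp.coe_finsetSum, Finset.sum_apply, Finsupp.smul_apply, smul_eq_mul,
    sum_sub_distrib, sconst]

theorem lichForm_diagOp (H : WallachFrame K p e s w) (hI : IsIsotropic e s w a)
    (hx : ∀ r, 0 < x r) (B : End ℝ (tangent K)) :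
    lichForm (diagMetric K p x) (bracketP K) (diagOp e s α) B =
      ∑ i, kap a x α (s i) * e.repr (B (e i)) i := by
  have h := H.orthBasis hx
  have hμ := isBilin_bracketP K
  have hM := h.isBilin_moment hμ
  have hw := H.wne
  have hx' : ∀ r, x r ≠ 0 := fun r => (hx r).ne'
  set b : ι → ι → ℝ := fun l i => e.repr (B (e i)) l with hb
  set φ : Fin 3 → Fin 3 → Fin 3 → ℝ := fun r r' r'' =>
    x r'' / (w * x r * x r') * (α r'' - α r - α r') with hφ
  have e1 : ∀ i j, (w * x (s i))⁻¹ * ((w * x (s j))⁻¹ * diagMetric K p x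
      (theta (diagOp e s α) (bracketP K) (e i) (e j)) (theta B (bracketP K) (e i) (e j))) =
      ∑ k, ∑ l, (φ (s i) (s j) (s k) * (sconst e i j k * sconst e i j l) * b k l -
        φ (s i) (s j) (s k) * (sconst e i j k * sconst e l j k) * b l i -
        φ (s i) (s j) (s k) * (sconst e i j k * sconst e i l k) * b l j) := by
    intro i j
    rw [h.apply, mul_sum, mul_sum]
    refine sum_congr rfl fun k _ => ?_
    rw [repr_theta_diag hμ (diagOp_apply α), repr_theta_basis, mul_sum, mul_sum, mul_sum, mul_sum]
    refine sum_congr rfl fun l _ => ?_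
    have := hx' (s i)
    have := hx' (s j)
    simp only [hφ, hb, sconst]
    field_simp
  have s1 : ∑ i, ∑ j, ∑ k, ∑ l, φ (s i) (s j) (s k) * (sconst e i j k * sconst e i j l) * b k l =
      ∑ k, a (s k) * w * (φ (s k + 1) (s k + 2) (s k) + φ (s k + 2) (s k + 1) (s k)) * b k k := by
    have : ∀ i j, ∑ k, ∑ l, φ (s i) (s j) (s k) * (sconst e i j k * sconst e i j l) * b k l =
      ∑ k, ∑ l, b k l * ((fun r r' => φ r r' (s k)) (s i) (s j) *
        (sconst e k i j * sconst e l i j)) := fun i j =>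
      sum_congr rfl fun k _ => sum_congr rfl fun l _ => by
        rw [H.sconst_cycle i j k, H.sconst_cycle i j l]; ring
    simp only [this]
    have h4 : ∀ f : ι → ι → ι → ι → ℝ, ∑ i, ∑ j, ∑ k, ∑ l, f i j k l =
        ∑ k, ∑ l, ∑ i, ∑ j, f i j k l := fun f => by
      rw [sum_congr rfl fun i _ => sum_comm, sum_comm]
      refine sum_congr rfl fun k _ => ?_
      rw [sum_congr rfl fun i _ => sum_comm, sum_comm]
    rw [h4]
    refine sum_congr rfl fun k _ => ?_
    simp only [← mul_sum]
    rw [sum_eq_single k (fun l _ hl => by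
      rw [H.contract hI (fun r r' => φ r r' (s k)), if_neg hl.symm, mul_zero]) (by simp),
      H.contract hI (fun r r' => φ r r' (s k)), if_pos rfl]
    ring
  have s2 : ∑ i, ∑ j, ∑ k, ∑ l, φ (s i) (s j) (s k) * (sconst e i j k * sconst e l j k) * b l i =
      ∑ k, a (s k) * w * (φ (s k) (s k + 1) (s k + 2) + φ (s k) (s k + 2) (s k + 1)) * b k k := by
    refine sum_congr rfl fun i _ => ?_
    rw [sum_congr rfl fun j _ => sum_comm, sum_comm]
    have : ∀ l, ∑ j, ∑ k, φ (s i) (s j) (s k) * (sconst e i j k * sconst e l j k) * b l i =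
        b l i * ∑ j, ∑ k, (fun r r' => φ (s i) r r') (s j) (s k) *
          (sconst e i j k * sconst e l j k) := fun l => by
      simp only [mul_sum]
      exact sum_congr rfl fun j _ => sum_congr rfl fun k _ => by ring
    rw [sum_congr rfl fun l _ => this l, sum_eq_single i (fun l _ hl => by
      rw [H.contract hI (fun r r' => φ (s i) r r'), if_neg hl.symm, mul_zero]) (by simp),
      H.contract hI (fun r r' => φ (s i) r r'), if_pos rfl]
    ring
  have s3 : ∑ i, ∑ j, ∑ k, ∑ l, φ (s i) (s j) (s k) * (sconst e i j k * sconst e i l k) * b l j =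
      ∑ k, a (s k) * w * (φ (s k) (s k + 1) (s k + 2) + φ (s k) (s k + 2) (s k + 1)) * b k k := by
    rw [← s2, sum_comm]
    refine sum_congr rfl fun i _ => sum_congr rfl fun j _ =>
      sum_congr rfl fun k _ => sum_congr rfl fun l _ => ?_
    rw [sconst_skew e j i k, sconst_skew e j l k, neg_mul_neg]
    simp only [hφ, mul_right_comm w, sub_right_comm]
  have s4 : ∀ i, (w * x (s i))⁻¹ * moment (diagMetric K p x) (bracketP K)
      (diagOp e s α (B (e i))) (e i) = α (s i) * mom a x (s i) * b i i := by
    intro i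
    have h1 : diagOp e s α (B (e i)) = ∑ l, (b l i * α (s l)) • e l := by
      conv_lhs => rw [← e.sum_repr (B (e i)), map_sum]
      simp only [map_smul, diagOp_apply, smul_smul, hb]
    rw [h1, hM.sum_left]
    simp only [hM.smul_left, H.moment_basis hI hx, smul_eq_mul, mul_ite, mul_zero,
      sum_ite_eq', mem_univ, if_true]
    have := hx' (s i)
    field_simp
  rw [h.lichForm_eq hμ]
  simp only [mul_sum _ _ (_ : ℝ)⁻¹, e1, s4, sum_sub_distrib, s1, s2, s3]
  rw [← sum_sub_distrib, ← sum_sub_distrib, mul_sum, mul_sum, ← sum_add_distrib]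
  refine sum_congr rfl fun i _ => ?_
  have := hx' (s i)
  have := hx' (s i + 1)
  have := hx' (s i + 2)
  simp only [hφ, mom, kap, wt, fin3_add, hb]
  field_simp
  ring

theorem lichForm_eigen (H : WallachFrame K p e s w) (hI : IsIsotropic e s w a)
    (hx : ∀ r, 0 < x r) {t : ℝ} (ht : ∀ r, kap a x α r = t * α r) (B : End ℝ (tangent K)) :
    lichForm (diagMetric K p x) (bracketP K) (diagOp e s α) B =
      t * trace ℝ _ (diagOp e s α * B) := by
  rw [H.lichForm_diagOp hI hx, trace_diagOp_mul, mul_sum]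
  exact sum_congr rfl fun i _ => by rw [ht, mul_assoc]

/-- `∑_r d_r α_r β_r`, with `d_r = dim 𝔭_r`. -/
def pair (s : ι → Fin 3) (α β : Fin 3 → ℝ) : ℝ := ∑ i, α (s i) * β (s i)

theorem trace_diagOp_diagOp (α β : Fin 3 → ℝ) :
    trace ℝ _ (diagOp e s α * diagOp e s β) = pair s α β := by
  rw [trace_diagOp_mul]
  exact sum_congr rfl fun i _ => by rw [diagOp_apply]; simp

theorem trace_diagOp (α : Fin 3 → ℝ) : trace ℝ _ (diagOp e s α) = pair s α 1 := by
  have : (1 : End ℝ (tangent K)) = diagOp e s 1 := eq_diagOp fun i => by simp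
  rw [← mul_one (diagOp e s α), this, trace_diagOp_diagOp]

theorem pair_eq (α β : Fin 3 → ℝ) : pair s α β = ∑ r, (card {i // s i = r} : ℝ) * (α r * β r) := by
  rw [pair, ← Finset.sum_fiberwise (g := s) (s := Finset.univ)]
  refine sum_congr rfl fun r _ => ?_
  rw [sum_congr rfl fun i hi => by rw [(Finset.mem_filter.1 hi).2], sum_const,
    nsmul_eq_mul, card_subtype]

/-! ### Isotropy from Schur's lemma -/

theorem exists_equiv (H : WallachFrame K p e s w) (hst : ∀ r, ∀ φ ∈ Ad, ∀ X ∈ p r, φ X ∈ p r)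
    {φ : L ≃ₗ⁅ℝ⁆ L} (hφ : φ ∈ Ad) : ∃ Φ : tangent K ≃ₗ[ℝ] tangent K, ∀ X, (Φ X : L) = φ X := by
  have h1 : ∀ X ∈ tangent K, (φ : L →ₗ[ℝ] L) X ∈ tangent K := by
    intro X hX
    have : X = ∑ i, e.repr ⟨X, hX⟩ i • (e i : L) := by
      conv_lhs => rw [show X = ((⟨X, hX⟩ : tangent K) : L) from rfl, ← e.sum_repr ⟨X, hX⟩]
      simp only [AddSubmonoidClass.coe_finsetSum, Submodule.coe_smul]
    rw [this, map_sum]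
    refine Submodule.sum_mem _ fun i _ => ?_
    rw [map_smul]
    exact Submodule.smul_mem _ _ (H.le _ (hst _ φ hφ _ (H.mem i)))
  refine ⟨LinearEquiv.ofInjectiveEndo ((φ : L →ₗ[ℝ] L).restrict h1) fun X Y h => ?_, fun X => rfl⟩
  exact Subtype.ext (φ.injective (congrArg Subtype.val h))

theorem bracketP_equiv (H : WallachFrame K p e s w) {φ : L ≃ₗ⁅ℝ⁆ L}
    {Φ : tangent K ≃ₗ[ℝ] tangent K} (hΦ : ∀ X, (Φ X : L) = φ X) (X Y : tangent K) :
    bracketP K (Φ X) (Φ Y) = Φ (bracketP K X Y) := by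
  have h1 : ∀ Z : tangent K, Q L (bracketP K (Φ X) (Φ Y) - Φ (bracketP K X Y) : tangent K) Z = 0 := by
    intro Z
    obtain ⟨Z, rfl⟩ := Φ.surjective Z
    rw [Submodule.coe_sub, map_sub, LinearMap.sub_apply, bracketP, Q_qproj H.compact _ (Φ Z).2, hΦ,
      hΦ, hΦ, hΦ, ← LieEquiv.map_lie, Q_equiv, Q_equiv, bracketP, Q_qproj H.compact _ Z.2, sub_self]
  by_contra hne
  have h2 := sub_ne_zero.2 hne
  exact (Q_self_pos H.compact fun h => h2 (Subtype.ext h)).ne' (h1 _)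

/-- The form `X, Y ↦ ∑ Q([X, e_j]_𝔭, [Y, e_j]_𝔭)` -/
def isoForm (e : Basis ι ℝ (tangent K)) : BilinForm ℝ (tangent K) :=
  LinearMap.mk₂ ℝ (fun X Y => ∑ j, Qp K (bracketP K X (e j)) (bracketP K Y (e j)))
    (fun X Y Z => by
      simp only [(isBilin_bracketP K).add_left, map_add, LinearMap.add_apply, sum_add_distrib])
    (fun r X Z => by
      simp only [(isBilin_bracketP K).smul_left, map_smul, LinearMap.smul_apply, Finset.smul_sum])
    (fun X Y Z => by
      simp only [(isBilin_bracketP K).add_left, map_add, sum_add_distrib])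
    (fun r X Z => by
      simp only [(isBilin_bracketP K).smul_left, map_smul, Finset.smul_sum])

theorem isoForm_apply (X Y : tangent K) :
    isoForm e X Y = ∑ j, Qp K (bracketP K X (e j)) (bracketP K Y (e j)) := rfl

theorem isoForm_basis (H : WallachFrame K p e s w) (i i' : ι) :
    isoForm e (e i) (e i') = w * ∑ j, ∑ k, sconst e i j k * sconst e i' j k := by
  rw [isoForm_apply, mul_sum]
  refine sum_congr rfl fun j _ => ?_
  rw [H.orthQ.apply, mul_sum]
  rfl

theorem isoForm_symm (H : WallachFrame K p e s w) (X Y : tangent K) :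
    isoForm e X Y = isoForm e Y X :=
  sum_congr rfl fun _ _ => H.orthQ.symm _ _

theorem isoForm_inv (H : WallachFrame K p e s w) (hst : ∀ r, ∀ φ ∈ Ad, ∀ X ∈ p r, φ X ∈ p r)
    (φ : L ≃ₗ⁅ℝ⁆ L) (hφ : φ ∈ Ad) (X Y X' Y' : tangent K) (hX : (X' : L) = φ X)
    (hY : (Y' : L) = φ Y) : isoForm e X' Y' = isoForm e X Y := by
  obtain ⟨Φ, hΦ⟩ := H.exists_equiv hst hφ
  have hQ : ∀ X Y, Qp K (Φ X) (Φ Y) = Qp K X Y := fun X Y => by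
    change Q L (Φ X) (Φ Y) = Q L X Y
    rw [hΦ, hΦ, Q_equiv]
  obtain rfl : X' = Φ X := Subtype.ext (hX.trans (hΦ X).symm)
  obtain rfl : Y' = Φ Y := Subtype.ext (hY.trans (hΦ Y).symm)
  have h' : OrthBasis (Qp K) (e.map Φ) fun _ => w :=
    ⟨fun i j => by rw [Basis.map_apply, Basis.map_apply, hQ, H.orthQ.gram], fun _ => H.wpos⟩
  have hB : ∀ X Y : tangent K, IsBilin fun u u' => Qp K (bracketP K X u) (bracketP K Y u') :=
    fun X Y => (isBilin_bracketP K).bracket_right (isBilin_bracketP K) _ _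
  have h1 := H.orthQ.gtr_eq (hB (Φ X) (Φ Y))
  rw [h'.gtr_eq (hB (Φ X) (Φ Y))] at h1
  simp only [Basis.map_apply, H.bracketP_equiv hΦ, hQ, ← mul_sum] at h1
  exact (mul_left_cancel₀ (inv_ne_zero H.wne) h1).symm
end WallachFrame

/-- Schur's lemma for symmetric invariant forms on `𝔭`: they are scalar on the `𝔭_r`. -/
def IsSchur (Ad : Set (L ≃ₗ⁅ℝ⁆ L)) (e : Basis ι ℝ (tangent K)) (s : ι → Fin 3) : Prop :=
  ∀ β : BilinForm ℝ (tangent K), (∀ X Y, β X Y = β Y X) →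
    (∀ φ ∈ Ad, ∀ X Y X' Y' : tangent K, (X' : L) = φ X → (Y' : L) = φ Y → β X' Y' = β X Y) →
    ∃ y : Fin 3 → ℝ, ∀ i j, β (e i) (e j) = if i = j then y (s i) else 0

/-- Schur's lemma for symmetric invariant forms on each `𝔭_r`. -/
def IsBlockSchur (Ad : Set (L ≃ₗ⁅ℝ⁆ L)) (e : Basis ι ℝ (tangent K)) (s : ι → Fin 3) : Prop :=
  ∀ β : BilinForm ℝ (tangent K), (∀ X Y, β X Y = β Y X) →
    (∀ φ ∈ Ad, ∀ X Y X' Y' : tangent K, (X' : L) = φ X → (Y' : L) = φ Y → β X' Y' = β X Y) →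
    ∃ y : Fin 3 → ℝ, ∀ i j, s i = s j → β (e i) (e j) = if i = j then y (s i) else 0

theorem IsSchur.isBlockSchur (h : IsSchur Ad e s) : IsBlockSchur Ad e s := fun β h1 h2 => by
  obtain ⟨y, hy⟩ := h β h1 h2
  exact ⟨y, fun i j _ => hy i j⟩

namespace WallachFrame

section
variable (H : WallachFrame K p e s w)
include H

theorem exists_isIsotropic
    (hst : ∀ r, ∀ φ ∈ Ad, ∀ X ∈ p r, φ X ∈ p r) (hS : IsBlockSchur Ad e s) :
    ∃ a, IsIsotropic e s w a := by
  obtain ⟨y, hy⟩ := hS (isoForm e) H.isoForm_symm (H.isoForm_inv hst)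
  refine ⟨fun r => y r / (2 * w ^ 2), fun i i' hi => ?_⟩
  have h1 := hy i i' hi
  have hw := H.wne
  rw [H.isoForm_basis] at h1
  split_ifs at h1 ⊢
  · field_simp
    linear_combination h1
  · exact (mul_eq_zero.1 h1).resolve_left hw

theorem card_mul_eq (hI : IsIsotropic e s w a) {r r' : Fin 3}
    (hr : r ≠ r') : card {i // s i = r} * a r = card {i // s i = r'} * a r' := by
  set G : Fin 3 → Fin 3 → ℝ := fun r r' =>
    ∑ i, ∑ j, ∑ k, if s i = r ∧ s j = r' then sconst e i j k ^ 2 else 0 with hG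
  have hsymm : ∀ r r', G r r' = G r' r := by
    intro r r'
    simp only [hG]
    rw [sum_comm]
    refine sum_congr rfl fun i _ => sum_congr rfl fun j _ =>
      sum_congr rfl fun k _ => ?_
    simp only [sconst_skew e j i k, neg_sq, and_comm]
  have key : ∀ r r', r ≠ r' → card {i // s i = r} * (2 * a r * w) = 2 * G r r' := by
    intro r r' hr
    have h1 : ∑ i, (if s i = r then ∑ j, ∑ k, sconst e i j k ^ 2 else 0) =
        card {i // s i = r} * (2 * a r * w) := by
      rw [← Finset.sum_filter, sum_congr rfl fun i hi => by
        rw [show ∑ j, ∑ k, sconst e i j k ^ 2 = 2 * a r * w by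
          have := hI i i rfl
          rw [if_pos rfl, (Finset.mem_filter.1 hi).2] at this
          simpa only [sq] using this], sum_const, nsmul_eq_mul, card_subtype]
    have h2 : G r r' = ∑ i, ∑ j, ∑ k, if s i = r ∧ s k = r' then sconst e i j k ^ 2 else 0 := by
      refine sum_congr rfl fun i _ => ?_
      rw [sum_comm]
      refine sum_congr rfl fun j _ => sum_congr rfl fun k _ => ?_
      rw [H.sconst_skew_right i k j, neg_sq]
    rw [← h1, two_mul]
    nth_rw 2 [h2]
    simp only [hG, ← sum_add_distrib]
    refine sum_congr rfl fun i _ => ?_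
    split_ifs with hi
    · refine sum_congr rfl fun j _ => sum_congr rfl fun k _ => ?_
      by_cases h0 : sconst e i j k = 0
      · simp [h0]
      have h3 := H.sconst_support h0
      rw [hi] at h3
      have h4 : (s j = r' ∧ s k ≠ r') ∨ (s j ≠ r' ∧ s k = r') := by
        clear h0 h1 h2 hi
        generalize s j = y at *
        generalize s k = z at *
        revert r r' y z
        decide
      rcases h4 with ⟨h5, h6⟩ | ⟨h5, h6⟩ <;> simp [hi, h5, h6]
    · simp [hi]
  have h1 := key r r' hr
  have h2 := key r' r hr.symm
  rw [hsymm r' r] at h2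
  have : (2 * w) * (card {i // s i = r} * a r) =
      (2 * w) * (card {i // s i = r'} * a r') := by linear_combination h1 - h2
  exact mul_left_cancel₀ (mul_ne_zero two_ne_zero H.wne) this

theorem symEndK_eq (hst : ∀ r, ∀ φ ∈ Ad, ∀ X ∈ p r, φ X ∈ p r)
    (hx : ∀ r, 0 < x r) (hS : IsSchur Ad e s) {A : End ℝ (tangent K)}
    (hA : A ∈ symEndK K Ad (diagMetric K p x)) : ∃ α, A = diagOp e s α := by
  have h := H.orthBasis hx
  have hm := H.isInvMetric hst hx
  obtain ⟨y, hy⟩ := hS ((diagMetric K p x).compLeft A)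
    (fun X Y => by
      rw [BilinForm.compLeft_apply, BilinForm.compLeft_apply, hA.1, hm.symm])
    (fun φ hφ X Y X' Y' hX hY => by
      rw [BilinForm.compLeft_apply, BilinForm.compLeft_apply]
      exact hm.inv φ hφ _ _ _ _ (hA.2 φ hφ X X' hX) hY)
  refine ⟨fun r => y r / (w * x r), eq_diagOp fun i => e.ext_elem fun j => ?_⟩
  have h1 := hy i j
  rw [BilinForm.compLeft_apply, h.apply_right] at h1
  have hw := h.ne i
  have hw' := h.ne j
  rw [map_smul, Finsupp.smul_apply, Basis.repr_self, Finsupp.single_apply, smul_eq_mul]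
  split_ifs at h1 ⊢ with hij
  · subst hij
    rw [mul_one, eq_div_iff hw, mul_comm, h1]
  · rw [mul_zero]
    exact (mul_eq_zero.1 h1).resolve_left hw'

theorem diagOp_mem_symEndK
    (hst : ∀ r, ∀ φ ∈ Ad, ∀ X ∈ p r, φ X ∈ p r) (hx : ∀ r, 0 < x r) (α : Fin 3 → ℝ) :
    diagOp e s α ∈ symEndK K Ad (diagMetric K p x) := by
  refine ⟨H.diagOp_mem_symEnd hx α, fun φ hφ X Y hXY => ?_⟩
  have h1 : ∀ X, (diagOp e s α X : L) = ∑ r, α r • (qproj (p r) (X : L) : L) := by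
    intro X
    conv_lhs => rw [← e.sum_repr X]
    conv_rhs => rw [← e.sum_repr X]
    simp only [map_sum, map_smul, AddSubmonoidClass.coe_finsetSum, Submodule.coe_smul,
      Finset.smul_sum, diagOp_apply]
    rw [sum_comm]
    refine sum_congr rfl fun i _ => ?_
    rw [sum_eq_single (s i) (fun r _ hr => by
      rw [H.qproj_basis, if_neg hr.symm, smul_zero, smul_zero]) (by simp), H.qproj_basis,
      if_pos rfl, smul_comm]
  rw [h1, h1, map_sum]
  exact sum_congr rfl fun r _ => by rw [H.qproj_equiv hst r hφ hXY, map_smul]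

theorem diagOp_mem_TT
    (hst : ∀ r, ∀ φ ∈ Ad, ∀ X ∈ p r, φ X ∈ p r) (hx : ∀ r, 0 < x r) (hα : pair s α 1 = 0) :
    diagOp e s α ∈ TT K Ad (diagMetric K p x) :=
  ⟨H.diagOp_mem_symEndK hst hx α, by rw [trace_diagOp, hα],
    H.divergence_eq_zero hx fun i => diagOp_apply α i⟩
end
end WallachFrame
end FrameSpectrum

section LocalMinimum
variable {a x α : Fin 3 → ℝ}

/-! ### Local minima -/

theorem abs_exp_taylor_two {z : ℝ} (hz : |z| ≤ 1) :
    |exp z - 1 - z - z ^ 2 / 2| ≤ |z| ^ 3 := by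
  have h := Real.exp_bound hz (n := 3) (by norm_num)
  have h1 : exp z - ∑ m ∈ Finset.range 3, z ^ m / m.factorial =
      exp z - 1 - z - z ^ 2 / 2 := by
    simp [Finset.sum_range_succ, Nat.factorial]; ring
  rw [h1] at h
  refine h.trans ?_
  have h2 : (0 : ℝ) ≤ |z| ^ 3 := by positivity
  norm_num [Nat.factorial]
  linarith

theorem expScal_taylor (e : Basis ι ℝ (tangent K)) (W : ι → ℝ) :
    ∃ C, 0 ≤ C ∧ ∀ η ≤ 1 / 3, ∀ v : ι → ℝ, (∀ i, |v i| ≤ η) →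
      |expScal e W v - expScal e W 0 -
        (-(1 / 4) * ∑ i, ∑ j, ∑ k, sconst e i j k ^ 2 * (W k / (W i * W j)) * (v k - v i - v j) -
          (1 / 2) * ∑ i, killingForm ℝ L (e i) (e i) / W i * (-v i)) -
        1 / 2 * (-(1 / 4) * ∑ i, ∑ j, ∑ k, sconst e i j k ^ 2 * (W k / (W i * W j)) *
          (v k - v i - v j) ^ 2 - (1 / 2) * ∑ i, killingForm ℝ L (e i) (e i) / W i * v i ^ 2)| ≤
      C * η * ∑ i, v i ^ 2 := by
  set c : ι → ι → ι → ℝ := fun i j k => sconst e i j k ^ 2 * (W k / (W i * W j)) with hc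
  set B : ι → ℝ := fun i => killingForm ℝ L (e i) (e i) / W i with hB
  refine ⟨27 / 4 * ∑ i, ∑ j, ∑ k, |c i j k| + 1 / 2 * ∑ i, |B i|, by positivity,
    fun η hη v hv => ?_⟩
  set S := ∑ i, v i ^ 2 with hS
  have hle : ∀ i, v i ^ 2 ≤ S := fun i =>
    Finset.single_le_sum (f := fun i => v i ^ 2) (fun j _ => sq_nonneg _) (mem_univ i)
  have h1 : ∀ i j k, |exp (v k - v i - v j) - 1 - (v k - v i - v j) -
      (v k - v i - v j) ^ 2 / 2| ≤ 27 * η * S := by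
    intro i j k
    have hz : |v k - v i - v j| ≤ 3 * η := by
      have := abs_sub (v k - v i) (v j)
      have := abs_sub (v k) (v i)
      linarith [hv i, hv j, hv k]
    refine (abs_exp_taylor_two (by linarith)).trans ?_
    rw [pow_succ, sq_abs]
    have h2 : (v k - v i - v j) ^ 2 ≤ 9 * S := by
      nlinarith [hle i, hle j, hle k, sq_nonneg (v k + v i), sq_nonneg (v k + v j),
        sq_nonneg (v i - v j)]
    calc (v k - v i - v j) ^ 2 * |v k - v i - v j| ≤ 9 * S * (3 * η) :=
          mul_le_mul h2 hz (abs_nonneg _) (by positivity)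
      _ = 27 * η * S := by ring
  have h2 : ∀ i, |exp (-v i) - 1 - (-v i) - (-v i) ^ 2 / 2| ≤ η * S := by
    intro i
    refine (abs_exp_taylor_two (by rw [abs_neg]; linarith [hv i])).trans ?_
    rw [pow_succ, sq_abs, neg_sq, abs_neg, mul_comm]
    exact mul_le_mul (hv i) (hle i) (sq_nonneg _) ((abs_nonneg _).trans (hv i))
  have h3 : expScal e W v - expScal e W 0 -
      (-(1 / 4) * ∑ i, ∑ j, ∑ k, c i j k * (v k - v i - v j) - (1 / 2) * ∑ i, B i * (-v i)) -
      1 / 2 * (-(1 / 4) * ∑ i, ∑ j, ∑ k, c i j k * (v k - v i - v j) ^ 2 -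
        (1 / 2) * ∑ i, B i * v i ^ 2) =
      -(1 / 4) * ∑ i, ∑ j, ∑ k, c i j k * (exp (v k - v i - v j) - 1 - (v k - v i - v j) -
        (v k - v i - v j) ^ 2 / 2) -
      1 / 2 * ∑ i, B i * (exp (-v i) - 1 - (-v i) - (-v i) ^ 2 / 2) := by
    have r1 : ∀ c E z : ι → ι → ι → ℝ,
        ∑ i, ∑ j, ∑ k, c i j k * (E i j k - 1 - z i j k - z i j k ^ 2 / 2) =
          ∑ i, ∑ j, ∑ k, c i j k * E i j k - ∑ i, ∑ j, ∑ k, c i j k -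
            ∑ i, ∑ j, ∑ k, c i j k * z i j k - (∑ i, ∑ j, ∑ k, c i j k * z i j k ^ 2) / 2 :=
      fun c E z => by
        simp only [mul_sub, mul_one, mul_div_assoc', sum_sub_distrib, Finset.sum_div]
    have r2 : ∀ c E z : ι → ℝ, ∑ i, c i * (E i - 1 - z i - z i ^ 2 / 2) =
        ∑ i, c i * E i - ∑ i, c i - ∑ i, c i * z i - (∑ i, c i * z i ^ 2) / 2 := fun c E z => by
      simp only [mul_sub, mul_one, mul_div_assoc', sum_sub_distrib, Finset.sum_div]
    rw [r1 c (fun i j k => exp (v k - v i - v j)), r2 B (fun i => exp (-v i))]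
    simp only [expScal, Pi.zero_apply, sub_zero, neg_zero, Real.exp_zero, mul_one, neg_sq]
    ring
  rw [h3]
  have h4 : |∑ i, ∑ j, ∑ k, c i j k * (exp (v k - v i - v j) - 1 - (v k - v i - v j) -
      (v k - v i - v j) ^ 2 / 2)| ≤ (∑ i, ∑ j, ∑ k, |c i j k|) * (27 * η * S) := by
    simp only [sum_mul]
    refine (Finset.abs_sum_le_sum_abs _ _).trans (sum_le_sum fun i _ => ?_)
    refine (Finset.abs_sum_le_sum_abs _ _).trans (sum_le_sum fun j _ => ?_)
    refine (Finset.abs_sum_le_sum_abs _ _).trans (sum_le_sum fun k _ => ?_)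
    rw [abs_mul]
    exact mul_le_mul_of_nonneg_left (h1 i j k) (abs_nonneg _)
  have h5 : |∑ i, B i * (exp (-v i) - 1 - (-v i) - (-v i) ^ 2 / 2)| ≤
      (∑ i, |B i|) * (η * S) := by
    simp only [sum_mul]
    refine (Finset.abs_sum_le_sum_abs _ _).trans (sum_le_sum fun i _ => ?_)
    rw [abs_mul]
    exact mul_le_mul_of_nonneg_left (h2 i) (abs_nonneg _)
  generalize (∑ i, ∑ j, ∑ k, c i j k * (exp (v k - v i - v j) - 1 - (v k - v i - v j) -
      (v k - v i - v j) ^ 2 / 2)) = X at *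
  generalize (∑ i, B i * (exp (-v i) - 1 - (-v i) - (-v i) ^ 2 / 2)) = Y at *
  rw [abs_le] at h4 h5 ⊢
  constructor <;> nlinarith

theorem EigenFrame.exists_hess_ge {g : BilinForm ℝ (tangent K)} {κ : Type*} [Fintype κ]
    {A : κ → End ℝ (tangent K)} {t : κ → ℝ} {ρ : ℝ} (h : EigenFrame K Ad g A t ρ)
    (ht : ∀ i, t i < 2 * ρ) :
    ∃ δ > 0, ∀ B ∈ TT K Ad g, δ * trace ℝ _ (B * B) ≤ hess K g B := by
  have h1 : ∀ᶠ δ in nhdsWithin (0 : ℝ) (Set.Ioi 0), ∀ i, δ < ρ - t i / 2 :=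
    Filter.eventually_all.2 fun i =>
      Filter.Eventually.filter_mono nhdsWithin_le_nhds (gt_mem_nhds (by linarith [ht i]))
  obtain ⟨δ, hδ, hpos⟩ := (h1.and self_mem_nhdsWithin).exists
  refine ⟨δ, hpos, fun B hB => ?_⟩
  obtain ⟨c, rfl⟩ := h.span B hB
  rw [h.trace_sum_sum, h.hess_sum, mul_sum]
  refine sum_le_sum fun i _ => ?_
  have h2 : 0 ≤ c i ^ 2 * trace ℝ _ (A i * A i) := mul_nonneg (sq_nonneg _) (h.trace_pos i).le
  nlinarith [mul_le_mul_of_nonneg_right (hδ i).le h2]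

theorem WallachFrame.isLocMin (F : WallachFrame K p e s w)
    (hst : ∀ r, ∀ φ ∈ Ad, ∀ X ∈ p r, φ X ∈ p r) (hx : ∀ r, 0 < x r) (hS : IsSchur Ad e s)
    {κ : Type*} [Fintype κ] {A : κ → End ℝ (tangent K)} {t : κ → ℝ} {ρ : ℝ}
    (h : EigenFrame K Ad (diagMetric K p x) A t ρ) (ht : ∀ i, t i < 2 * ρ) :
    IsLocMin K Ad (diagMetric K p x) := by
  obtain ⟨δ, hδ, hhess⟩ := h.exists_hess_ge ht
  set W : ι → ℝ := fun i => w * x (s i) with hW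
  have hO : OrthBasis (diagMetric K p x) e W := F.orthBasis hx
  obtain ⟨C, hC, htay⟩ := expScal_taylor e W
  set ε := min (1 / 6) (δ / (4 * (C + 1))) with hε
  have hε0 : 0 < ε := lt_min (by norm_num) (by positivity)
  have hε1 : ε ≤ 1 / 6 := min_le_left _ _
  have hε2 : C * (2 * ε) ≤ δ / 2 := by
    have h1 : ε ≤ δ / (4 * (C + 1)) := min_le_right _ _
    rw [le_div_iff₀ (by positivity)] at h1
    nlinarith
  refine ⟨ε, hε0, fun g' hg' => ?_⟩
  obtain ⟨y, hy⟩ := hS g' hg'.metric.symm hg'.metric.inv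
  have hypos : ∀ i, 0 < y (s i) := fun i => by
    have := hg'.metric.pos (e i) (e.ne_zero i)
    rwa [hy, if_pos rfl] at this
  set v : Fin 3 → ℝ := fun r => Real.log (y r / (w * x r)) with hv
  have hexp : ∀ i, W i * exp (v (s i)) = y (s i) := fun i => by
    rw [hv, Real.exp_log (div_pos (hypos i) (hO.pos i)), mul_div_cancel₀ _ (hO.ne i)]
  have hO' : OrthBasis g' e (fun i => W i * exp (v (s i))) := by
    simp only [hexp]
    exact ⟨hy, hypos⟩
  have hsum : pair s v 1 = 0 := by
    have h1 := (hO.volume_eq_iff hO').1 hg'.volume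
    rw [Finset.prod_mul_distrib, ← Real.exp_sum] at h1
    have h2 := mul_left_cancel₀ (Finset.prod_ne_zero_iff.2 fun i _ => hO.ne i) (h1.trans (mul_one _).symm)
    rw [Real.exp_eq_one_iff] at h2
    simpa [WallachFrame.pair] using h2
  have hbound : ∀ i, |v (s i)| ≤ 2 * ε := fun i => by
    have h1 := hg'.close (e i)
    rw [hy, if_pos rfl, hO.gram, if_pos rfl, abs_le] at h1
    have hWi := hO.pos i
    have hu : 0 < y (s i) / (w * x (s i)) := div_pos (hypos i) hWi
    have h2 : y (s i) / (w * x (s i)) ≤ 1 + ε := by rw [div_le_iff₀ hWi]; linarith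
    have h3 : 1 - ε ≤ y (s i) / (w * x (s i)) := by rw [le_div_iff₀ hWi]; linarith
    have h4 := Real.log_le_sub_one_of_pos hu
    have h5 := Real.one_sub_inv_le_log_of_pos hu
    rw [abs_le]
    refine ⟨?_, by linarith⟩
    have h6 : (y (s i) / (w * x (s i)))⁻¹ ≤ 1 + 2 * ε := by
      refine inv_le_of_inv_le₀ (by positivity) (le_trans ?_ h3)
      rw [inv_le_iff_one_le_mul₀ (by positivity)]
      nlinarith
    linarith
  have h0 : scal K (diagMetric K p x) = expScal e W 0 := scal_eq_expScal (by simpa using hO)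
  have h1 := htay (2 * ε) (by linarith) (fun i => v (s i)) hbound
  rw [hO.first_variation h.einstein, hO.second_variation h.einstein (A := diagOp e s v)
    (diagOp_apply v)] at h1
  have hTT := F.diagOp_mem_TT hst hx hsum
  rw [← hess_eq hO.symm hO.self_pos h.einstein hTT.1.1 hTT.2.1] at h1
  have h2 := hhess _ hTT
  rw [trace_diagOp_diagOp] at h2
  have h3 : ∑ i, v (s i) = 0 := by simpa [WallachFrame.pair] using hsum
  have h4 : ∑ i, v (s i) ^ 2 = pair s v v := sum_congr rfl fun i _ => sq _
  have h5 : 0 ≤ pair s v v := sum_nonneg fun i _ => mul_self_nonneg _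
  rw [h3, h4] at h1
  rw [h0, scal_eq_expScal hO']
  have h6 := (abs_le.1 h1).1
  have h7 := mul_le_mul_of_nonneg_right hε2 h5
  nlinarith
end LocalMinimum

/-! ### Diagonal eigentensors -/

/-- Orthogonal eigenvectors of the symmetric operator `(P, nR; R, S)`. -/
theorem exists_eigen_pair {P S R n l u : ℝ} (hsum : l + u = P + S)
    (hprod : l * u = P * S - n * R ^ 2) :
    ∃ y z : Fin 2 → ℝ, (∀ i, P * y i + n * R * z i = ![l, u] i * y i ∧
      R * y i + S * z i = ![l, u] i * z i ∧ (y i ≠ 0 ∨ z i ≠ 0)) ∧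
      y 0 * y 1 + n * (z 0 * z 1) = 0 := by
  by_cases hR : R = 0
  · subst hR
    have h0 : (l - P) * (l - S) = 0 := by linear_combination l * hsum - hprod
    rcases mul_eq_zero.1 h0 with h | h
    · refine ⟨![1, 0], ![0, 1], fun i => ?_, by simp⟩
      fin_cases i
      · simp only [Fin.zero_eta, cons_val_zero]
        exact ⟨by linarith, by linarith, Or.inl one_ne_zero⟩
      · simp only [Fin.mk_one, Matrix.cons_val_one, cons_val_zero]
        exact ⟨by linarith, by linarith, Or.inr one_ne_zero⟩
    · refine ⟨![0, 1], ![1, 0], fun i => ?_, by simp⟩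
      fin_cases i
      · simp only [Fin.zero_eta, cons_val_zero]
        exact ⟨by linarith, by linarith, Or.inr one_ne_zero⟩
      · simp only [Fin.mk_one, Matrix.cons_val_one, cons_val_zero]
        exact ⟨by linarith, by linarith, Or.inl one_ne_zero⟩
  · refine ⟨![l - S, u - S], ![R, R], fun i => ?_, ?_⟩
    · fin_cases i
      · simp only [Fin.zero_eta, cons_val_zero]
        exact ⟨by linear_combination (-l) * hsum + hprod, by ring, Or.inr hR⟩
      · simp only [Fin.mk_one, Matrix.cons_val_one, cons_val_zero]
        exact ⟨by linear_combination (-u) * hsum + hprod, by ring, Or.inr hR⟩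
    · simp only [Matrix.cons_val_one, cons_val_zero]
      linear_combination hprod - S * hsum

section Data
variable {b c : ℝ} {x : Fin 3 → ℝ}

/-- A frame of a generalized Wallach space with `a_1 = a_2 = b`, `a_3 = c` and `d_1 = d_2`. -/
structure WallachData (K : LieSubalgebra ℝ L) (Ad : Set (L ≃ₗ⁅ℝ⁆ L)) (p : Fin 3 → Submodule ℝ L)
    (e : Basis ι ℝ (tangent K)) (s : ι → Fin 3) (w b c : ℝ) : Prop
    extends WallachFrame K p e s w where
  stable : ∀ r, ∀ φ ∈ Ad, ∀ X ∈ p r, φ X ∈ p r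
  isotropic : IsIsotropic e s w ![b, b, c]
  b_pos : 0 < b
  c_pos : 0 < c
  card_eq : card {i // s i = 0} = card {i // s i = 1}

/-- The sum of the eigenvalues of the Lichnerowicz Laplacian on diagonal tensors. -/
def eigSum (b c : ℝ) (x : Fin 3 → ℝ) : ℝ :=
  2 * b * (x 0 / (x 1 * x 2) + x 1 / (x 2 * x 0)) + 2 * c * (x 2 / (x 0 * x 1))

/-- The product of its eigenvalues on traceless diagonal tensors. -/
def eigProd (b c : ℝ) (x : Fin 3 → ℝ) : ℝ :=
  let w₀ := x 0 / (x 1 * x 2)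
  let w₁ := x 1 / (x 2 * x 0)
  let w₂ := x 2 / (x 0 * x 1)
  b * (b + 2 * c) * (2 * w₀ * w₂ + 2 * w₁ * w₂ + 2 * w₀ * w₁ - w₂ ^ 2 - w₀ ^ 2 - w₁ ^ 2)

namespace WallachData

open WallachFrame

section
variable (D : WallachData K Ad p e s w b c)
include D

theorem ratio :
    (card {i // s i = 0} : ℝ) * b = card {i // s i = 2} * c := by
  have := D.card_mul_eq D.isotropic (r := 0) (r' := 2) (by decide)
  simpa using this

theorem card_pos (r : Fin 3) :
    (0 : ℝ) < card {i // s i = r} := by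
  obtain ⟨i, hi⟩ := D.surj r
  exact Nat.cast_pos.2 (Fintype.card_pos_iff.2 ⟨⟨i, hi⟩⟩)

theorem pair_eq_card (α β : Fin 3 → ℝ) :
    pair s α β = card {i // s i = 0} * (α 0 * β 0 + α 1 * β 1 + b / c * (α 2 * β 2)) := by
  have := D.c_pos.ne'
  rw [pair_eq, Fin.sum_univ_three, ← D.card_eq]
  field_simp
  linear_combination (-α 2 * β 2) * D.ratio

theorem pair_one_eq_zero_iff (α : Fin 3 → ℝ) :
    pair s α 1 = 0 ↔ α 2 = -(c / b) * (α 0 + α 1) := by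
  have hb := D.b_pos.ne'
  have hc := D.c_pos.ne'
  rw [D.pair_eq_card, mul_eq_zero, or_iff_right (D.card_pos 0).ne']
  simp only [Pi.one_apply, mul_one]
  field_simp
  constructor <;> intro h <;> linear_combination h

theorem pair_self_eq_zero {α : Fin 3 → ℝ} (h : pair s α α = 0) :
    α = 0 := by
  funext r
  obtain ⟨i, rfl⟩ := D.surj r
  have := (Finset.sum_eq_zero_iff_of_nonneg (fun i _ => mul_self_nonneg _)).1 h i (mem_univ i)
  simpa using this

/-- Eigenvectors of the Lichnerowicz Laplacian on traceless diagonal tensors. -/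
theorem exists_eigenvectors {l u : ℝ}
    (hsum : l + u = eigSum b c x) (hprod : l * u = eigProd b c x) :
    ∃ α : Fin 2 → Fin 3 → ℝ, (∀ i r, kap ![b, b, c] x (α i) r = ![l, u] i * α i r) ∧
      (∀ i, α i ≠ 0) ∧ (∀ i, pair s (α i) 1 = 0) ∧ pair s (α 0) (α 1) = 0 ∧
      ∀ β, pair s β 1 = 0 → ∃ k : Fin 2 → ℝ, β = ∑ i, k i • α i := by
  have hb := D.b_pos
  have hc := D.c_pos
  have hb' := hb.ne'
  have hc' := hc.ne'
  set w₀ := x 0 / (x 1 * x 2) with h₀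
  set w₁ := x 1 / (x 2 * x 0) with h₁
  set w₂ := x 2 / (x 0 * x 1) with h₂
  have hn : 0 < (b + 2 * c) / b := by positivity
  obtain ⟨y, z, hyz, horth⟩ := exists_eigen_pair (P := b * (2 * w₀ + 2 * w₁ - w₂))
    (S := (b + 2 * c) * w₂) (R := b * (w₀ - w₁)) (n := (b + 2 * c) / b)
    (l := l) (u := u) (by rw [hsum, eigSum]; ring) (by
      have hP : eigProd b c x = b * (b + 2 * c) *
        (2 * w₀ * w₂ + 2 * w₁ * w₂ + 2 * w₀ * w₁ - w₂ ^ 2 - w₀ ^ 2 - w₁ ^ 2) := rfl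
      rw [hprod, hP]
      clear_value w₀ w₁ w₂
      field_simp
      ring)
  set α : Fin 2 → Fin 3 → ℝ := fun i => ![y i + z i, -y i + z i, -(2 * c / b) * z i] with hα
  have htr : ∀ i, pair s (α i) 1 = 0 := fun i => by
    rw [D.pair_one_eq_zero_iff]
    simp only [hα, cons_val]
    field_simp
    ring
  have hdet : y 0 * z 1 - y 1 * z 0 ≠ 0 := by
    intro h0
    have hpos : ∀ i, 0 < y i ^ 2 + (b + 2 * c) / b * z i ^ 2 := fun i => by
      rcases (hyz i).2.2 with h | h
      · have := sq_pos_of_ne_zero h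
        positivity
      · have := sq_pos_of_ne_zero h
        positivity
    have := mul_pos (hpos 0) (hpos 1)
    have h2 : (y 0 ^ 2 + (b + 2 * c) / b * z 0 ^ 2) * (y 1 ^ 2 + (b + 2 * c) / b * z 1 ^ 2) =
        (y 0 * y 1 + (b + 2 * c) / b * (z 0 * z 1)) ^ 2 +
          (b + 2 * c) / b * (y 0 * z 1 - y 1 * z 0) ^ 2 := by ring
    rw [h2, horth, h0] at this
    simp at this
  refine ⟨α, fun i r => ?_, fun i h0 => ?_, htr, ?_, fun β hβ => ?_⟩
  · obtain ⟨h3, h4, -⟩ := hyz i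
    fin_cases r
    · simp only [kap, wt, hα, Fin.zero_eta, cons_val, Fin.reduceAdd, zero_add]
      rw [← h₀, ← h₁, ← h₂]
      have : ![l, u] i * (y i + z i) = b * (2 * w₀ + 2 * w₁ - w₂) * y i +
          (b + 2 * c) / b * (b * (w₀ - w₁)) * z i +
          (b * (w₀ - w₁) * y i + (b + 2 * c) * w₂ * z i) := by rw [h3, h4]; ring
      rw [this]
      field_simp
      ring
    · simp only [kap, wt, hα, Fin.mk_one, cons_val, Fin.reduceAdd]
      rw [← h₀, ← h₁, ← h₂]
      have : ![l, u] i * (-y i + z i) = -(b * (2 * w₀ + 2 * w₁ - w₂) * y i +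
          (b + 2 * c) / b * (b * (w₀ - w₁)) * z i) +
          (b * (w₀ - w₁) * y i + (b + 2 * c) * w₂ * z i) := by rw [h3, h4]; ring
      rw [this]
      field_simp
      ring
    · simp only [kap, wt, hα, Fin.reduceFinMk, cons_val, Fin.reduceAdd]
      rw [← h₀, ← h₁, ← h₂]
      have : ![l, u] i * (-(2 * c / b) * z i) = -(2 * c / b) *
          (b * (w₀ - w₁) * y i + (b + 2 * c) * w₂ * z i) := by rw [h4]; ring
      rw [this]
      field_simp
      ring
  · have h3 := congrFun h0 0
    have h4 := congrFun h0 1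
    simp only [hα, cons_val, Pi.zero_apply] at h3 h4
    rcases (hyz i).2.2 with h | h <;> exact h (by linarith)
  · rw [D.pair_eq_card]
    simp only [hα, cons_val]
    have h5 : (y 0 + z 0) * (y 1 + z 1) + (-y 0 + z 0) * (-y 1 + z 1) +
        b / c * (-(2 * c / b) * z 0 * (-(2 * c / b) * z 1)) =
        2 * (y 0 * y 1 + (b + 2 * c) / b * (z 0 * z 1)) := by
      field_simp
      ring
    rw [h5, horth, mul_zero, mul_zero]
  · rw [D.pair_one_eq_zero_iff] at hβ
    obtain ⟨y', hy'⟩ : ∃ y', y' = (β 0 - β 1) / 2 := ⟨_, rfl⟩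
    obtain ⟨z', hz'⟩ : ∃ z', z' = (β 0 + β 1) / 2 := ⟨_, rfl⟩
    refine ⟨![(y' * z 1 - y 1 * z') / (y 0 * z 1 - y 1 * z 0),
      (y 0 * z' - y' * z 0) / (y 0 * z 1 - y 1 * z 0)], funext fun r => ?_⟩
    have h5 : (y' * z 1 - y 1 * z') / (y 0 * z 1 - y 1 * z 0) * y 0 +
        (y 0 * z' - y' * z 0) / (y 0 * z 1 - y 1 * z 0) * y 1 = y' := by
      rw [div_mul_eq_mul_div, div_mul_eq_mul_div, ← add_div, div_eq_iff hdet]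
      ring
    have h6 : (y' * z 1 - y 1 * z') / (y 0 * z 1 - y 1 * z 0) * z 0 +
        (y 0 * z' - y' * z 0) / (y 0 * z 1 - y 1 * z 0) * z 1 = z' := by
      rw [div_mul_eq_mul_div, div_mul_eq_mul_div, ← add_div, div_eq_iff hdet]
      ring
    simp only [Fin.sum_univ_two, Pi.add_apply, Pi.smul_apply, smul_eq_mul, hα, cons_val]
    fin_cases r
    · simp only [Fin.zero_eta, cons_val]
      linear_combination -h5 - h6 - hy' - hz'
    · simp only [Fin.mk_one, cons_val]
      linear_combination h5 - h6 + hy' - hz'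
    · simp only [Fin.reduceFinMk, cons_val]
      rw [hβ]
      linear_combination (2 * c / b) * h6 + (2 * c / b) * hz'
end

theorem sum_smul_diagOp (α : Fin 2 → Fin 3 → ℝ) (k : Fin 2 → ℝ) :
    ∑ i, k i • diagOp e s (α i) = diagOp e s (∑ i, k i • α i) :=
  eq_diagOp fun i => by
    simp [diagOp_apply, add_smul, smul_smul]

theorem pair_sum (α : Fin 2 → Fin 3 → ℝ) (k : Fin 2 → ℝ) (β : Fin 3 → ℝ) :
    pair s (∑ i, k i • α i) β = ∑ i, k i * pair s (α i) β := by
  simp only [pair, Fin.sum_univ_two, Pi.add_apply, Pi.smul_apply, smul_eq_mul, add_mul,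
    sum_add_distrib, mul_sum, mul_assoc]

section
variable (D : WallachData K Ad p e s w b c)
include D

theorem exists_eigenFrame (hS : IsSchur Ad e s)
    (hx : ∀ r, 0 < x r) {ρ l u : ℝ}
    (hρ : ∀ r, x r * mom ![b, b, c] x r + 1 / 2 = ρ * x r)
    (hsum : l + u = eigSum b c x) (hprod : l * u = eigProd b c x) :
    ∃ A : Fin 2 → End ℝ (tangent K), EigenFrame K Ad (diagMetric K p x) A ![l, u] ρ := by
  obtain ⟨α, hk, h0, htr, horth, hspan⟩ := D.exists_eigenvectors hsum hprod
  refine ⟨fun i => diagOp e s (α i), D.isInvMetric D.stable hx, D.isEinstein D.isotropic hx hρ,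
    fun i B _ => D.lichForm_eigen D.isotropic hx (hk i) B, fun i => D.diagOp_ne_zero (h0 i),
    fun i j hij => ?_, fun k => ?_, fun B hB => ?_⟩
  · rw [trace_diagOp_diagOp]
    fin_cases i <;> fin_cases j
    · exact absurd rfl hij
    · exact horth
    · exact (sum_congr rfl fun _ _ => mul_comm _ _).trans horth
    · exact absurd rfl hij
  · rw [sum_smul_diagOp]
    refine D.diagOp_mem_TT D.stable hx ?_
    rw [pair_sum]
    simp [htr]
  · obtain ⟨β, rfl⟩ := D.symEndK_eq D.stable hx hS hB.1
    obtain ⟨k, rfl⟩ := hspan β (by rw [← trace_diagOp (e := e)]; exact hB.2.1)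
    exact ⟨k, (sum_smul_diagOp α k).symm⟩

theorem lichSpec_diagEnd (hx : ∀ r, 0 < x r) {l u : ℝ}
    (hsum : l + u = eigSum b c x) (hprod : l * u = eigProd b c x) :
    lichSpec K (diagMetric K p x) (diagEnd K p) = {0, l, u} := by
  obtain ⟨α, hk, h0, htr, horth, hspan⟩ := D.exists_eigenvectors hsum hprod
  have hF := D.toWallachFrame
  ext t
  constructor
  · rintro ⟨B, hB, hne, ht⟩
    obtain ⟨β, rfl⟩ := hF.mem_diagEnd.1 hB
    have hpair : ∀ γ, pair s (kap ![b, b, c] x β) γ = t * pair s β γ := by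
      intro γ
      have h1 := ht (diagOp e s γ) (hF.diagOp_mem_symEnd hx γ)
      rw [hF.lichForm_diagOp D.isotropic hx, trace_diagOp_diagOp] at h1
      rw [← h1]
      exact sum_congr rfl fun i _ => by rw [diagOp_apply]; simp
    have hadj : ∀ γ, pair s (kap ![b, b, c] x β) γ = pair s β (kap ![b, b, c] x γ) := by
      intro γ
      have := D.c_pos.ne'
      rw [D.pair_eq_card, D.pair_eq_card]
      simp only [kap, cons_val, Fin.reduceAdd, zero_add]
      congr 1
      field_simp
      ring
    have h1 : t * pair s β 1 = 0 := by
      rw [← hpair, hadj]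
      have : kap ![b, b, c] x 1 = 0 := funext fun r => by
        simp only [kap, Pi.one_apply, Pi.zero_apply]; ring
      simp [this, pair]
    by_cases ht0 : t = 0
    · exact Or.inl ht0
    right
    obtain ⟨k, rfl⟩ := hspan β ((mul_eq_zero.1 h1).resolve_left ht0)
    have h2 : ∀ i, k i * pair s (α i) (α i) * (![l, u] i - t) = 0 := by
      intro i
      have h3 := hpair (α i)
      rw [hadj, show kap ![b, b, c] x (α i) = ![l, u] i • α i from funext (hk i)] at h3
      have h4 : ∀ γ δ : Fin 3 → ℝ, ∀ r : ℝ, pair s γ (r • δ) = r * pair s γ δ := fun γ δ r => by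
        simp only [pair, mul_sum, Pi.smul_apply, smul_eq_mul]
        exact sum_congr rfl fun _ _ => by ring
      have h5 : pair s (∑ i, k i • α i) (α i) = k i * pair s (α i) (α i) := by
        rw [pair_sum, Fin.sum_univ_two]
        have h6 : pair s (α 1) (α 0) = 0 := (sum_congr rfl fun _ _ => mul_comm _ _).trans horth
        fin_cases i
        · simp [h6]
        · simp [horth]
      rw [h4, h5] at h3
      linear_combination h3
    have h3 : ∀ i, k i ≠ 0 → t = ![l, u] i := fun i hi => by
      have h4 := (mul_eq_zero.1 (h2 i)).resolve_left
        (mul_ne_zero hi fun h => h0 i (D.pair_self_eq_zero h))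
      linarith
    by_cases hk0 : k 0 = 0
    · by_cases hk1 : k 1 = 0
      · refine absurd ?_ hne
        rw [← sum_smul_diagOp]
        simp [hk0, hk1]
      · exact Or.inr (h3 1 hk1)
    · exact Or.inl (h3 0 hk0)
  · have hmem : ∀ t β, β ≠ 0 → (∀ r, kap ![b, b, c] x β r = t * β r) →
        t ∈ lichSpec K (diagMetric K p x) (diagEnd K p) := fun t β h1 h2 =>
      ⟨diagOp e s β, hF.mem_diagEnd.2 ⟨β, rfl⟩, hF.diagOp_ne_zero h1, fun B _ =>
        hF.lichForm_eigen D.isotropic hx h2 B⟩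
    rintro (rfl | rfl | rfl)
    · exact hmem 0 1 one_ne_zero fun r => by simp only [kap, Pi.one_apply]; ring
    · exact hmem _ (α 0) (h0 0) (hk 0)
    · exact hmem _ (α 1) (h0 1) (hk 1)

theorem symEndK_eq_diagEnd (hS : IsSchur Ad e s)
    (hx : ∀ r, 0 < x r) : symEndK K Ad (diagMetric K p x) = diagEnd K p := by
  ext A
  rw [D.mem_diagEnd]
  constructor
  · exact D.symEndK_eq D.stable hx hS
  · rintro ⟨α, rfl⟩
    exact D.diagOp_mem_symEndK D.stable hx α

theorem lichSpec_symEndK (hS : IsSchur Ad e s)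
    (hx : ∀ r, 0 < x r) {κ : Type*} [Fintype κ] {A : κ → End ℝ (tangent K)} {t : κ → ℝ} {ρ : ℝ}
    (h : EigenFrame K Ad (diagMetric K p x) A t ρ) :
    lichSpec K (diagMetric K p x) (symEndK K Ad (diagMetric K p x)) = insert 0 (Set.range t) := by
  refine h.lichSpec_symEndK D.nontrivial fun B hB htr => ?_
  obtain ⟨α, rfl⟩ := D.symEndK_eq D.stable hx hS hB
  rw [trace_diagOp] at htr
  exact D.diagOp_mem_TT D.stable hx htr
end
end WallachData
end Data

/-! ### The metrics `g_q` and `g_p` -/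

section Numbers
variable {b c q t : ℝ}

open WallachFrame

theorem gq_pos (hq : 0 < q) (r : Fin 3) : 0 < gq q r := by
  fin_cases r <;> simp [gq, hq]

theorem gp_pos (hb : 0 < b) (ht : 0 < t) (r : Fin 3) : 0 < gp b t r := by
  fin_cases r
  · simpa [gp] using ht
  · simp [gp]
  · simp only [gp, Fin.reduceFinMk, cons_val]
    positivity

theorem gq_einstein (hq : 0 < q) (h : (b + c) * q ^ 2 - q + 1 - 2 * c = 0) (r : Fin 3) :
    gq q r * mom ![b, b, c] (gq q) r + 1 / 2 = rhoQ b q / 2 * gq q r := by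
  have := hq.ne'
  fin_cases r
  · simp only [mom, wt, gq, rhoQ, Fin.zero_eta, cons_val, Fin.reduceAdd, zero_add]
    field_simp
    ring
  · simp only [mom, wt, gq, rhoQ, Fin.mk_one, cons_val, Fin.reduceAdd]
    field_simp
    ring
  · simp only [mom, wt, gq, rhoQ, Fin.reduceFinMk, cons_val, Fin.reduceAdd]
    field_simp
    linear_combination h

theorem gq_sum (hq : q ≠ 0) : lamQ₁ b q + lamQ₂ b c q = eigSum b c (gq q) := by
  simp only [lamQ₁, lamQ₂, eigSum, gq, cons_val]
  field_simp
  ring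

theorem gq_prod (hq : q ≠ 0) : lamQ₁ b q * lamQ₂ b c q = eigProd b c (gq q) := by
  simp only [lamQ₁, lamQ₂, eigProd, gq, cons_val]
  field_simp
  ring

theorem gp_einstein (hb : 0 < b) (ht : 0 < t)
    (h : (b + c) * (1 - 4 * b ^ 2) * (t ^ 2 + 1) = t * (1 - 2 * b + 8 * b ^ 2 * (b + c)))
    (r : Fin 3) : gp b t r * mom ![b, b, c] (gp b t) r + 1 / 2 = rhoP b t / 2 * gp b t r := by
  have h1 := ht.ne'
  have h2 := hb.ne'
  have h3 : t + 1 ≠ 0 := by positivity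
  fin_cases r
  · simp only [mom, wt, gp, rhoP, Fin.zero_eta, cons_val, Fin.reduceAdd, zero_add]
    field_simp
    ring
  · simp only [mom, wt, gp, rhoP, Fin.mk_one, cons_val, Fin.reduceAdd]
    field_simp
    ring
  · simp only [mom, wt, gp, rhoP, Fin.reduceFinMk, cons_val, Fin.reduceAdd]
    field_simp
    linear_combination (-1) * h

theorem polyD_nonneg (hb : 0 < b) (hc : 0 < c) (ht : 0 < t) : 0 ≤ 2 * b * polyD b c t := by
  have h1 : 2 * b * polyD b c t = (b * t * (t + 1)) ^ 2 * ((b * (2 * (t / (2 * b * (t + 1))) + 2 * (1 / (2 * b * (t + 1) * t)) -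
        2 * b * (t + 1) / t) - (b + 2 * c) * (2 * b * (t + 1) / t)) ^ 2 +
      4 * (b * (b + 2 * c)) * (t / (2 * b * (t + 1)) - 1 / (2 * b * (t + 1) * t)) ^ 2) := by
    have h3 : t + 1 ≠ 0 := by positivity
    simp only [polyD]
    field_simp
    ring
  rw [h1]
  positivity

theorem gp_sum (hb : 0 < b) (ht : 0 < t) : lamPMin b c t + lamPMax b c t = eigSum b c (gp b t) := by
  have h1 := ht.ne'
  have h2 := hb.ne'
  have h3 : t + 1 ≠ 0 := by positivity
  simp only [lamPMin, lamPMax, eigSum, gp, cons_val]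
  field_simp
  ring

theorem gp_prod (hb : 0 < b) (hc : 0 < c) (ht : 0 < t) :
    lamPMin b c t * lamPMax b c t = eigProd b c (gp b t) := by
  have h1 := ht.ne'
  have h2 := hb.ne'
  have h3 : t + 1 ≠ 0 := by positivity
  have h4 := Real.sq_sqrt (polyD_nonneg hb hc ht)
  rw [lamPMin, lamPMax, div_mul_div_comm, show ∀ x y : ℝ, (x - y) * (x + y) = x ^ 2 - y ^ 2 from fun x y => by ring, h4]
  simp only [eigProd, gp, polyD, cons_val]
  field_simp
  ring

theorem lamPMin_le (hb : 0 < b) (ht : 0 < t) : lamPMin b c t ≤ lamPMax b c t := by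
  have := Real.sqrt_nonneg (2 * b * polyD b c t)
  exact div_le_div_of_nonneg_right (by linarith) (by positivity)

theorem discP_eq : discP b c = (1 + 2 * c) * wallachT b c := by
  simp only [discP, wallachT]; ring

/-- The characteristic polynomial of the Lichnerowicz Laplacian of `g_p` at `2ρ`. -/
theorem gp_charpoly (hb : 0 < b) (ht : 0 < t)
    (h : (b + c) * (1 - 4 * b ^ 2) * (t ^ 2 + 1) = t * (1 - 2 * b + 8 * b ^ 2 * (b + c))) {l u : ℝ}
    (hsum : l + u = eigSum b c (gp b t)) (hprod : l * u = eigProd b c (gp b t)) :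
    (rhoP b t - l) * (rhoP b t - u) = -wallachT b c / (2 * b * t) := by
  have h1 := ht.ne'
  have h2 := hb.ne'
  have h3 : t + 1 ≠ 0 := by positivity
  have h4 : (rhoP b t - l) * (rhoP b t - u) =
      rhoP b t ^ 2 - eigSum b c (gp b t) * rhoP b t + eigProd b c (gp b t) := by
    rw [← hsum, ← hprod]; ring
  rw [h4]
  simp only [rhoP, eigSum, eigProd, gp, wallachT, cons_val]
  field_simp
  linear_combination (-2 * (t + 1) ^ 2) * h

theorem quadratic_of_root {A B C D x : ℝ} (hA : A ≠ 0) (hD : 0 ≤ D) (hD' : D = B ^ 2 - 4 * A * C)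
    (hx : x = (B + √D) / (2 * A) ∨ x = (B - √D) / (2 * A)) : A * x ^ 2 - B * x + C = 0 := by
  have h1 := Real.sq_sqrt hD
  rcases hx with rfl | rfl <;>
  · field_simp
    nlinarith

theorem gq_quadratic (hbc : b + c ≠ 0) (hd : 0 ≤ discQ b c) (hq : q = qPlus b c ∨ q = qMinus b c) :
    (b + c) * q ^ 2 - q + 1 - 2 * c = 0 := by
  have := quadratic_of_root (A := b + c) (B := 1) (C := 1 - 2 * c) hbc hd
    (by simp only [discQ]; ring) hq
  linear_combination this

theorem gp_quadratic (hA : (b + c) * (1 - 4 * b ^ 2) ≠ 0) (hd : 0 ≤ discP b c)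
    (ht : t = pPlus b c ∨ t = pMinus b c) :
    (b + c) * (1 - 4 * b ^ 2) * (t ^ 2 + 1) = t * (1 - 2 * b + 8 * b ^ 2 * (b + c)) := by
  have := quadratic_of_root (A := (b + c) * (1 - 4 * b ^ 2)) (B := 1 - 2 * b + 8 * b ^ 2 * (b + c))
    (C := (b + c) * (1 - 4 * b ^ 2)) (x := t) hA hd (by simp only [discP]; ring) (by
      simpa only [pPlus, pMinus, mul_assoc] using ht)
  linear_combination this

theorem sub_lamQ₁ (hq : q ≠ 0) : rhoQ b q - lamQ₁ b q = (q - 4 * b) / q := by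
  simp only [rhoQ, lamQ₁]; field_simp; ring

theorem sub_lamQ₂ : rhoQ b q - lamQ₂ b c q = 1 - 2 * (b + c) * q := by
  simp only [rhoQ, lamQ₂]; ring

section
variable (hb : 0 < b)
include hb

/-- The position of `q⁺` relative to `2ρ`. -/
theorem qPlus_lt (hc : 0 < c) (h8 : 8 * b * (b + c) < 1) (hd : 0 < discQ b c)
    (hq : q = qPlus b c) : 0 < q ∧ lamQ₁ b q < rhoQ b q ∧ rhoQ b q < lamQ₂ b c q := by
  have hs := Real.sqrt_pos.2 hd
  have hbc : 0 < 2 * (b + c) := by positivity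
  have h1 : 2 * (b + c) * q = 1 + √(discQ b c) := by rw [hq, qPlus]; field_simp
  have hq0 : 0 < q := by rw [hq, qPlus]; positivity
  refine ⟨hq0, ?_, ?_⟩
  · rw [← sub_pos, sub_lamQ₁ hq0.ne']
    refine div_pos ?_ hq0
    nlinarith
  · have := sub_lamQ₂ (b := b) (c := c) (q := q)
    linarith

theorem qMinus_lt (hc : 0 < c) (hc' : 2 * c < 1) (hd : 0 < discQ b c)
    (hq : q = qMinus b c) : 0 < q ∧ lamQ₂ b c q < rhoQ b q := by
  have hs := Real.sqrt_pos.2 hd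
  have hbc : 0 < 2 * (b + c) := by positivity
  have h1 : 2 * (b + c) * q = 1 - √(discQ b c) := by rw [hq, qMinus]; field_simp
  have h2 : √(discQ b c) < 1 := by
    rw [Real.sqrt_lt' one_pos, discQ]
    nlinarith [mul_pos hbc (sub_pos.2 hc')]
  refine ⟨pos_of_mul_pos_right (h1 ▸ by linarith : 0 < 2 * (b + c) * q) hbc.le, ?_⟩
  have := sub_lamQ₂ (b := b) (c := c) (q := q)
  linarith

theorem qMinus_sub (hc : 0 < c) (hd : 0 < discQ b c)
    (hq : q = qMinus b c) (y : ℝ) (hy : 2 * (b + c) * y ≤ 1) :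
    ((b + c) * y ^ 2 - y + 1 - 2 * c) * (q - y) ≥ 0 ∧
      ((b + c) * y ^ 2 - y + 1 - 2 * c ≠ 0 → q ≠ y) := by
  have hs := Real.sqrt_pos.2 hd
  have h0 := gq_quadratic (by positivity) hd.le (Or.inr hq)
  have h1 : 2 * (b + c) * q = 1 - √(discQ b c) := by
    have : 0 < b + c := by positivity
    rw [hq, qMinus]; field_simp
  have h2 : (b + c) * y ^ 2 - y + 1 - 2 * c = (q - y) * (1 - (b + c) * (q + y)) := by
    linear_combination h0
  refine ⟨?_, fun h h' => h (by rw [h2, h', sub_self, zero_mul])⟩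
  rw [h2]
  have h3 : 0 ≤ 1 - (b + c) * (q + y) := by nlinarith
  nlinarith [mul_nonneg (sq_nonneg (q - y)) h3]

theorem qMinus_lamQ₁ (hc : 0 < c) (hc' : 2 * c < 1) (h8 : 8 * b * (b + c) < 1)
    (hd : 0 < discQ b c) (hq : q = qMinus b c) :
    (0 < wallachT b c → lamQ₁ b q < rhoQ b q) ∧ (wallachT b c < 0 → rhoQ b q < lamQ₁ b q) := by
  have hq0 := (qMinus_lt hb hc hc' hd hq).1
  obtain ⟨h1, h2⟩ := qMinus_sub hb hc hd hq (4 * b) (by linarith)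
  have hT : (b + c) * (4 * b) ^ 2 - 4 * b + 1 - 2 * c = wallachT b c := by
    simp only [wallachT]; ring
  rw [hT] at h1 h2
  have h3 := sub_lamQ₁ (b := b) hq0.ne'
  constructor
  · intro h
    have h4 : 0 ≤ q - 4 * b := nonneg_of_mul_nonneg_right h1 h
    have h5 : 0 < (q - 4 * b) / q := div_pos (lt_of_le_of_ne h4 fun h' => h2 h.ne' (by linarith)) hq0
    linarith
  · intro h
    have h4 : q - 4 * b ≤ 0 := by nlinarith
    have h5 : (q - 4 * b) / q < 0 :=
      div_neg_of_neg_of_pos (lt_of_le_of_ne h4 fun h' => h2 h.ne (by linarith)) hq0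
    linarith

/-- The order of the two eigenvalues at `q⁻`. -/
theorem qMinus_order (hc : 0 < c) (hc' : 2 * c < 1) (hd : 0 < discQ b c)
    (hq : q = qMinus b c) (h1 : 1 < 4 * (b + c) * (1 + b - c)) :
    (c < b → 2 * (b + c) * (1 + 2 * (b - c)) ≤ 1 → lamQ₁ b q ≤ lamQ₂ b c q) ∧
      (b < c → lamQ₂ b c q ≤ lamQ₁ b q) := by
  have hq0 := (qMinus_lt hb hc hc' hd hq).1
  have h0 := gq_quadratic (by positivity) hd.le (Or.inr hq)
  have hs := Real.sqrt_pos.2 hd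
  have h2 : lamQ₂ b c q - lamQ₁ b q = 2 * (q - (1 + 2 * (b - c))) / q := by
    simp only [lamQ₂, lamQ₁]
    field_simp
    linear_combination 2 * h0
  have h3 : (b + c) * (1 + 2 * (b - c)) ^ 2 - (1 + 2 * (b - c)) + 1 - 2 * c =
      (b - c) * (4 * (b + c) * (1 + b - c) - 1) := by ring
  constructor
  · intro h h'
    have h4 := (qMinus_sub hb hc hd hq _ h').1
    rw [h3] at h4
    have h5 := nonneg_of_mul_nonneg_right h4 (mul_pos (sub_pos.2 h) (by linarith))
    have : 0 ≤ 2 * (q - (1 + 2 * (b - c))) / q := div_nonneg (by linarith) hq0.le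
    linarith
  · intro h
    have h6 : 2 * (b + c) * q ≤ 1 := by
      have : 2 * (b + c) * q = 1 - √(discQ b c) := by
        have : 0 < b + c := by positivity
        rw [hq, qMinus]; field_simp
      linarith
    have h5 : q - (1 + 2 * (b - c)) ≤ 0 := by
      by_contra! hlt
      have h4 := (qMinus_sub hb hc hd hq (1 + 2 * (b - c)) (by nlinarith)).1
      rw [h3] at h4
      have : (b - c) * (4 * (b + c) * (1 + b - c) - 1) < 0 :=
        mul_neg_of_neg_of_pos (by linarith) (by linarith)
      nlinarith
    have : 2 * (q - (1 + 2 * (b - c))) / q ≤ 0 :=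
      div_nonpos_of_nonpos_of_nonneg (by linarith) hq0.le
    linarith

theorem pPlusMinus_pos (hc : 0 < c) (hb' : 2 * b < 1)
    (ht : t = pPlus b c ∨ t = pMinus b c) : 0 < t := by
  have h1 : 0 < 1 - 4 * b ^ 2 := by nlinarith
  have h2 : 0 < 2 * (b + c) * (1 - 4 * b ^ 2) := by positivity
  have h3 : 0 < 1 - 2 * b + 8 * b ^ 2 * (b + c) := by
    have : 0 < 8 * b ^ 2 * (b + c) := by positivity
    linarith
  have h4 := Real.sqrt_nonneg (discP b c)
  rcases ht with rfl | rfl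
  · exact div_pos (by linarith) h2
  · refine div_pos (sub_pos.2 ?_) h2
    rw [Real.sqrt_lt' h3, discP]
    have : 0 < ((b + c) * (1 - 4 * b ^ 2)) ^ 2 := by positivity
    nlinarith
end
end Numbers

/-! ### Rows of the table -/

section Rows
variable {b c q t : ℝ} {x : Fin 3 → ℝ}

namespace WallachData

open WallachFrame

section
variable (D : WallachData K Ad p e s w b c)
include D

theorem row (hS : IsSchur Ad e s) (hx : ∀ r, 0 < x r)
    {r l u : ℝ} (hρ : ∀ i, x i * mom ![b, b, c] x i + 1 / 2 = r / 2 * x i)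
    (hsum : l + u = eigSum b c x) (hprod : l * u = eigProd b c x) (hlu : l ≤ u) (hl : l < r)
    (hu : u ≠ r) : EinsteinRow K Ad (diagMetric K p x) {l, u} l u r ∧
      (r < u → IsSaddle K Ad (diagMetric K p x) ∧ HasCoindex K Ad (diagMetric K p x) 1) ∧
      (u < r → IsLocMin K Ad (diagMetric K p x) ∧ HasCoindex K Ad (diagMetric K p x) 2) := by
  obtain ⟨A, hA⟩ := D.exists_eigenFrame hS hx hρ hsum hprod
  have hr : 2 * (r / 2) = r := by ring
  have hrange : Set.range ![l, u] = {l, u} := by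
    rw [Matrix.range_cons, Matrix.range_cons, Matrix.range_empty, Set.union_empty]; rfl
  refine ⟨⟨hA.metric, hA.einstein, ?_, ?_, ⟨by simp, ?_⟩, ⟨by simp, ?_⟩, ?_, ?_⟩, fun h => ⟨?_, ?_⟩,
    fun h => ⟨?_, ?_⟩⟩
  · rw [D.lichSpec_symEndK hS hx hA, hrange]
  · rw [hA.lichSpec_TT, hrange]
  · rintro _ (rfl | rfl)
    · exact le_rfl
    · exact hlu
  · rintro _ (rfl | rfl)
    · exact hlu
    · exact le_rfl
  · exact hA.isUnstable (i := 0) (by simpa [hr] using hl)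
  · refine hA.isNondegenerate fun i => ?_
    rw [hr]
    fin_cases i
    · exact hl.ne
    · exact hu
  · exact hA.isSaddle (i := 0) (j := 1) (by simpa [hr] using hl) (by simpa [hr] using h)
  · refine hA.hasCoindex ?_
    rw [hr, Nat.card_eq_fintype_card, Fintype.card_eq_one_iff]
    refine ⟨⟨0, hl⟩, fun ⟨i, hi⟩ => Subtype.ext ?_⟩
    fin_cases i
    · rfl
    · exact absurd h (not_lt.2 (le_of_lt hi))
  · refine D.isLocMin D.stable hx hS hA fun i => ?_
    rw [hr]
    fin_cases i
    · exact hl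
    · exact h
  · refine hA.hasCoindex ?_
    have : ∀ i, ![l, u] i < 2 * (r / 2) := fun i => by
      rw [hr]
      fin_cases i
      · exact hl
      · exact h
    simp [this]

theorem row_qPlus (hS : IsSchur Ad e s)
    (h8 : 8 * b * (b + c) < 1) (hd : 0 < discQ b c) (hq : q = qPlus b c) :
    EinsteinRow K Ad (diagMetric K p (gq q)) {lamQ₁ b q, lamQ₂ b c q} (lamQ₁ b q) (lamQ₂ b c q)
      (rhoQ b q) ∧ IsSaddle K Ad (diagMetric K p (gq q)) ∧
      HasCoindex K Ad (diagMetric K p (gq q)) 1 := by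
  obtain ⟨hq0, h1, h2⟩ := qPlus_lt D.b_pos D.c_pos h8 hd hq
  have hbc := (add_pos D.b_pos D.c_pos).ne'
  obtain ⟨h3, h4, -⟩ := D.row hS (gq_pos hq0)
    (gq_einstein hq0 (gq_quadratic hbc hd.le (Or.inl hq)))
    (gq_sum hq0.ne') (gq_prod hq0.ne') (h1.trans h2).le h1 h2.ne'
  exact ⟨h3, h4 h2⟩

theorem row_qMinus (hS : IsSchur Ad e s) (hc : 2 * c < 1)
    (h8 : 8 * b * (b + c) < 1) (hd : 0 < discQ b c) (hT : 0 < wallachT b c)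
    (hq : q = qMinus b c) (ho : 1 < 4 * (b + c) * (1 + b - c))
    (ho' : c < b → 2 * (b + c) * (1 + 2 * (b - c)) ≤ 1) (hne : b ≠ c) :
    (c < b → EinsteinRow K Ad (diagMetric K p (gq q)) {lamQ₁ b q, lamQ₂ b c q} (lamQ₁ b q)
      (lamQ₂ b c q) (rhoQ b q)) ∧
    (b < c → EinsteinRow K Ad (diagMetric K p (gq q)) {lamQ₂ b c q, lamQ₁ b q} (lamQ₂ b c q)
      (lamQ₁ b q) (rhoQ b q)) ∧
    IsLocMin K Ad (diagMetric K p (gq q)) ∧ HasCoindex K Ad (diagMetric K p (gq q)) 2 := by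
  obtain ⟨hq0, h2⟩ := qMinus_lt D.b_pos D.c_pos hc hd hq
  have h1 := (qMinus_lamQ₁ D.b_pos D.c_pos hc h8 hd hq).1 hT
  have hbc := (add_pos D.b_pos D.c_pos).ne'
  obtain ⟨h5, h6⟩ := qMinus_order D.b_pos D.c_pos hc hd hq ho
  have hE := gq_einstein hq0 (gq_quadratic hbc hd.le (Or.inr hq))
  have hs := gq_sum (b := b) (c := c) hq0.ne'
  have hp := gq_prod (b := b) (c := c) hq0.ne'
  rcases lt_or_gt_of_ne hne with h | h
  · obtain ⟨h3, -, h4⟩ := D.row hS (gq_pos hq0) hE (by rw [add_comm, hs]) (by rw [mul_comm, hp])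
      (h6 h) h2 h1.ne
    exact ⟨fun h' => absurd h' h.not_gt, fun _ => h3, h4 h1⟩
  · obtain ⟨h3, -, h4⟩ := D.row hS (gq_pos hq0) hE hs hp (h5 h (ho' h)) h1 h2.ne
    exact ⟨fun _ => h3, fun h' => absurd h' h.not_gt, h4 h2⟩

theorem row_qMinus' (hS : IsSchur Ad e s) (hc : 2 * c < 1)
    (h8 : 8 * b * (b + c) < 1) (hd : 0 < discQ b c) (hT : wallachT b c < 0)
    (hq : q = qMinus b c) :
    EinsteinRow K Ad (diagMetric K p (gq q)) {lamQ₂ b c q, lamQ₁ b q} (lamQ₂ b c q)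
      (lamQ₁ b q) (rhoQ b q) ∧ IsSaddle K Ad (diagMetric K p (gq q)) ∧
      HasCoindex K Ad (diagMetric K p (gq q)) 1 := by
  obtain ⟨hq0, h2⟩ := qMinus_lt D.b_pos D.c_pos hc hd hq
  have h1 := (qMinus_lamQ₁ D.b_pos D.c_pos hc h8 hd hq).2 hT
  have hbc := (add_pos D.b_pos D.c_pos).ne'
  obtain ⟨h3, h4, -⟩ := D.row hS (gq_pos hq0)
    (gq_einstein hq0 (gq_quadratic hbc hd.le (Or.inr hq)))
    (by rw [add_comm, gq_sum hq0.ne']) (by rw [mul_comm, gq_prod hq0.ne'])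
    (h2.trans h1).le h2 h1.ne'
  exact ⟨h3, h4 h1⟩

theorem row_p (hS : IsSchur Ad e s) (hb : 2 * b < 1)
    (hT : 0 < wallachT b c) (ht : t = pPlus b c ∨ t = pMinus b c) {l u : ℝ}
    (hsum : l + u = eigSum b c (gp b t)) (hprod : l * u = eigProd b c (gp b t)) (hlu : l ≤ u) :
    EinsteinRow K Ad (diagMetric K p (gp b t)) {l, u} l u (rhoP b t) ∧
      IsSaddle K Ad (diagMetric K p (gp b t)) ∧ HasCoindex K Ad (diagMetric K p (gp b t)) 1 := by
  have hb0 := D.b_pos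
  have hc0 := D.c_pos
  have hd : 0 ≤ discP b c := by rw [discP_eq]; positivity
  have ht0 := pPlusMinus_pos hb0 hc0 hb ht
  have hA : (b + c) * (1 - 4 * b ^ 2) ≠ 0 := by
    have : 0 < 1 - 4 * b ^ 2 := by nlinarith
    positivity
  have hquad := gp_quadratic hA hd ht
  have h1 := gp_charpoly hb0 ht0 hquad hsum hprod
  have h2 : (rhoP b t - l) * (rhoP b t - u) < 0 := by
    rw [h1, neg_div]
    exact neg_neg_of_pos (by positivity)
  have hl : l < rhoP b t := by
    by_contra! h
    nlinarith
  have hu : rhoP b t < u := by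
    by_contra! h
    nlinarith
  obtain ⟨h3, h4, -⟩ := D.row hS (gp_pos hb0 ht0) (gp_einstein hb0 ht0 hquad) hsum hprod hlu hl hu.ne'
  exact ⟨h3, h4 hu⟩

theorem row_lamP (hS : IsSchur Ad e s) (hb : 2 * b < 1)
    (hT : 0 < wallachT b c) (ht : t = pPlus b c ∨ t = pMinus b c) :
    EinsteinRow K Ad (diagMetric K p (gp b t)) {lamPMin b c t, lamPMax b c t} (lamPMin b c t)
      (lamPMax b c t) (rhoP b t) ∧
      IsSaddle K Ad (diagMetric K p (gp b t)) ∧ HasCoindex K Ad (diagMetric K p (gp b t)) 1 := by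
  have ht0 := pPlusMinus_pos D.b_pos D.c_pos hb ht
  exact D.row_p hS hb hT ht (gp_sum D.b_pos ht0) (gp_prod D.b_pos D.c_pos ht0)
    (lamPMin_le D.b_pos ht0)

/-- The closed formulas for the spectra. -/
theorem einsteinSpec_q
    (hS : PairwiseInequivalent Ad p → IsSchur Ad e s) (hd : 0 ≤ discQ b c)
    (hq : q = qPlus b c ∨ q = qMinus b c) (hq0 : 0 < q) :
    EinsteinSpec K Ad p (diagMetric K p (gq q)) (lamQ₁ b q) (lamQ₂ b c q) (rhoQ b q) := by
  have hx := gq_pos hq0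
  have hbc := (add_pos D.b_pos D.c_pos).ne'
  have h1 := D.lichSpec_diagEnd hx (gq_sum hq0.ne') (gq_prod hq0.ne')
  refine ⟨D.isInvMetric D.stable hx, D.isEinstein D.isotropic hx
    (gq_einstein hq0 (gq_quadratic hbc hd hq)), h1, fun hin => ?_⟩
  rw [D.symEndK_eq_diagEnd (hS hin) hx, h1]

theorem einsteinSpec_p
    (hS : PairwiseInequivalent Ad p → IsSchur Ad e s) (hd : 0 ≤ discP b c)
    (ht : t = pPlus b c ∨ t = pMinus b c) (ht0 : 0 < t) :
    EinsteinSpec K Ad p (diagMetric K p (gp b t)) (lamPMin b c t) (lamPMax b c t) (rhoP b t) := by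
  have hx := gp_pos D.b_pos ht0
  have h1 := D.lichSpec_diagEnd hx (gp_sum D.b_pos ht0) (gp_prod D.b_pos D.c_pos ht0)
  have hA : (b + c) * (1 - 4 * b ^ 2) ≠ 0 := by
    intro h0
    refine ht0.ne' ?_
    rcases ht with rfl | rfl
    · rw [pPlus, mul_assoc 2 (b + c), h0, mul_zero, div_zero]
    · rw [pMinus, mul_assoc 2 (b + c), h0, mul_zero, div_zero]
  refine ⟨D.isInvMetric D.stable hx, D.isEinstein D.isotropic hx
    (gp_einstein D.b_pos ht0 (gp_quadratic hA hd ht)), h1, fun hin => ?_⟩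
  rw [D.symEndK_eq_diagEnd (hS hin) hx, h1]
end
end WallachData
end Rows

/-! ### Generalized Wallach spaces -/

theorem exists_orthBasis_Q (hc : ∀ X : L, X ≠ 0 → killingForm ℝ L X X < 0) (U : Submodule ℝ L) :
    ∃ f : Basis (Fin (finrank ℝ U)) ℝ U, OrthBasis ((Q L).restrict U) f fun _ => 1 :=
  exists_orthBasis (fun _ _ => Q_comm _ _)
    fun _ hX => Q_self_pos hc fun h => hX (Subtype.ext h)

namespace IsGenWallach

section
variable (h : IsGenWallach K Ad p)
include h

theorem le (r : Fin 3) : p r ≤ tangent K := h.span ▸ le_iSup p r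

/-- An invariant pairing of two modules is represented by an equivariant map. -/
theorem exists_represent {β : BilinForm ℝ (tangent K)} (r r' : Fin 3) :
    ∃ T : p r →ₗ[ℝ] p r', ∀ (X : p r) (Y : p r'), Q L (T X) (Y : L) =
      β (Submodule.inclusion (h.le r) X) (Submodule.inclusion (h.le r') Y) := by
  obtain ⟨f, hf⟩ := exists_orthBasis_Q h.compact (p r')
  refine ⟨∑ i, (β.flip (Submodule.inclusion (h.le r') (f i)) ∘ₗ
    Submodule.inclusion (h.le r)).smulRight (f i), fun X Y => ?_⟩
  conv_rhs => rw [← f.sum_repr Y]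
  rw [LinearMap.sum_apply]
  simp only [LinearMap.smulRight_apply, AddSubmonoidClass.coe_finsetSum, Submodule.coe_smul,
    map_sum, map_smul, LinearMap.sum_apply, LinearMap.smul_apply, smul_eq_mul, LinearMap.comp_apply]
  refine sum_congr rfl fun i _ => ?_
  have := hf.apply_left Y i
  rw [one_mul] at this
  rw [show Q L (f i : L) (Y : L) = (Q L).restrict (p r') (f i) Y from rfl, this, mul_comm]
  rfl

theorem exists_preimage (r : Fin 3) {φ : L ≃ₗ⁅ℝ⁆ L} (hφ : φ ∈ Ad)
    (Y : p r) : ∃ X : p r, (Y : L) = φ X := by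
  let Φ := (φ : L →ₗ[ℝ] L).restrict (h.stable r φ hφ)
  have hinj : Function.Injective Φ := fun X Y h =>
    Subtype.ext (φ.injective (congrArg Subtype.val h))
  obtain ⟨X, hX⟩ := (LinearMap.injective_iff_surjective.1 hinj) Y
  exact ⟨X, (congrArg Subtype.val hX).symm⟩

/-- Schur's lemma on the irreducible module `𝔭_r`. -/
theorem exists_eq_smul_Q {β : BilinForm ℝ (tangent K)}
    (hs : ∀ X Y, β X Y = β Y X)
    (hβ : ∀ φ ∈ Ad, ∀ X Y X' Y' : tangent K, (X' : L) = φ X → (Y' : L) = φ Y → β X' Y' = β X Y)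
    (r : Fin 3) : ∃ y : ℝ, ∀ X Y : tangent K, (X : L) ∈ p r → (Y : L) ∈ p r →
      β X Y = y * Q L X Y := by
  obtain ⟨T, hT⟩ := h.exists_represent (β := β) r r
  have hTs : T ∈ symEnd ((Q L).restrict (p r)) := fun X Y => by
    change Q L (T X) Y = Q L X (T Y)
    rw [Q_comm (X : L), hT, hT, hs]
  obtain ⟨f, α, hf, hα⟩ := exists_orthBasis_eigen (V := p r) (fun X Y => Q_comm _ _)
    (fun X hX => Q_self_pos h.compact fun h => hX (Subtype.ext h)) hTs
  have : Nontrivial (p r) := Submodule.nontrivial_iff_ne_bot.2 (h.ne_bot r)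
  let i₀ : Fin (finrank ℝ (p r)) := ⟨0, finrank_pos⟩
  let W : Submodule ℝ L :=
    { carrier := {X | ∃ hX : X ∈ p r, T ⟨X, hX⟩ = α i₀ • ⟨X, hX⟩}
      add_mem' := by
        rintro X Y ⟨hX, hX'⟩ ⟨hY, hY'⟩
        refine ⟨add_mem hX hY, ?_⟩
        have := map_add T ⟨X, hX⟩ ⟨Y, hY⟩
        rw [hX', hY', ← smul_add] at this
        exact this
      zero_mem' := ⟨zero_mem _, (map_zero T).trans (smul_zero _).symm⟩
      smul_mem' := by
        rintro t X ⟨hX, hX'⟩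
        refine ⟨Submodule.smul_mem _ t hX, ?_⟩
        have := map_smul T t ⟨X, hX⟩
        rw [hX', smul_comm] at this
        exact this }
  have hW : W = ⊥ ∨ W = p r := by
    refine h.irreducible r W (fun X hX => hX.1) ?_
    rintro φ hφ X ⟨hX, hX'⟩
    have hφX := h.stable r φ hφ X hX
    refine ⟨hφX, ?_⟩
    have h1 : ∀ Y : p r, Q L ((T ⟨φ X, hφX⟩ - α i₀ • ⟨φ X, hφX⟩ : p r) : L) Y = 0 := by
      intro Y
      obtain ⟨Y', hY'⟩ := h.exists_preimage r hφ Y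
      rw [Submodule.coe_sub, map_sub, LinearMap.sub_apply, hT, Submodule.coe_smul, map_smul,
        LinearMap.smul_apply,
        hβ φ hφ (Submodule.inclusion (h.le r) ⟨X, hX⟩) (Submodule.inclusion (h.le r) Y') _ _ rfl hY',
        ← hT, hX', hY', Q_equiv, Submodule.coe_smul, map_smul, LinearMap.smul_apply, sub_self]
    by_contra hne
    exact (Q_self_pos h.compact fun h' => sub_ne_zero.2 hne (Subtype.ext h')).ne' (h1 _)
  have hWr : W = p r := hW.resolve_left fun h0 => by
    have h1 : (f i₀ : L) ∈ W := ⟨(f i₀).2, hα i₀⟩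
    rw [h0, Submodule.mem_bot] at h1
    exact f.ne_zero i₀ (Subtype.ext h1)
  refine ⟨α i₀, fun X Y hX hY => ?_⟩
  have h1 := hT ⟨X, hX⟩ ⟨Y, hY⟩
  obtain ⟨_, h2⟩ : (X : L) ∈ W := hWr ▸ hX
  rw [h2, Submodule.coe_smul, map_smul] at h1
  exact h1.symm

theorem eq_zero_of_inequivalent (hin : PairwiseInequivalent Ad p)
    {β : BilinForm ℝ (tangent K)}
    (hβ : ∀ φ ∈ Ad, ∀ X Y X' Y' : tangent K, (X' : L) = φ X → (Y' : L) = φ Y → β X' Y' = β X Y)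
    {r r' : Fin 3} (hr : r ≠ r') {X Y : tangent K} (hX : (X : L) ∈ p r) (hY : (Y : L) ∈ p r') :
    β X Y = 0 := by
  obtain ⟨T, hT⟩ := h.exists_represent (β := β) r r'
  have h0 : T = 0 := by
    refine hin r r' hr T fun φ hφ X X' hX => ?_
    have hmem := h.stable r' φ hφ _ (T X).2
    have h1 : ∀ Y : p r', Q L ((T X' - ⟨φ (T X), hmem⟩ : p r') : L) Y = 0 := by
      intro Y
      obtain ⟨Y', hY'⟩ := h.exists_preimage r' hφ Y
      rw [Submodule.coe_sub, map_sub, LinearMap.sub_apply, hT,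
        hβ φ hφ (Submodule.inclusion (h.le r) X) (Submodule.inclusion (h.le r') Y') _ _ hX hY',
        ← hT, hY', Q_equiv, sub_self]
    by_contra hne
    refine (Q_self_pos h.compact fun h' => ?_).ne' (h1 _)
    exact hne (congrArg Subtype.val (sub_eq_zero.1 (Subtype.ext h' :
      (T X' - ⟨φ (T X), hmem⟩ : p r') = 0)))
  have h1 := hT ⟨X, hX⟩ ⟨Y, hY⟩
  rw [h0, LinearMap.zero_apply, Submodule.coe_zero, map_zero, LinearMap.zero_apply] at h1
  exact h1.symm

/-- The frame of a generalized Wallach space. -/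
theorem exists_frame :
    ∃ e : Basis (Σ r, Fin (finrank ℝ (p r))) ℝ (tangent K),
      WallachFrame K p e Sigma.fst 1 ∧ IsBlockSchur Ad e Sigma.fst ∧
      (PairwiseInequivalent Ad p → IsSchur Ad e Sigma.fst) ∧
      strConst (p 0) (p 1) (p 2) = ∑ i, ∑ j, ∑ k, sconst e ⟨0, i⟩ ⟨1, j⟩ ⟨2, k⟩ ^ 2 := by
  choose f hf using fun r => exists_orthBasis_Q h.compact (p r)
  have hgram : ∀ i j : Σ r, Fin (finrank ℝ (p r)),
      Q L (f i.1 i.2 : L) (f j.1 j.2 : L) = if i = j then 1 else 0 := by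
    rintro ⟨r, i⟩ ⟨r', j⟩
    by_cases hr : r = r'
    · subst hr
      have := (hf r).gram i j
      simpa using this
    · rw [h.orthogonal r r' hr _ (f r i).2 _ (f r' j).2, if_neg fun h' => hr (congrArg Sigma.fst h')]
  obtain ⟨e, he⟩ := exists_basis_of_orthogonal (K := K)
    (fun i : Σ r, Fin (finrank ℝ (p r)) => (f i.1 i.2 : L)) one_ne_zero
    (fun i => h.le _ (f i.1 i.2).2) hgram (fun X hX hX' => by
      by_contra hne
      refine (Q_self_pos h.compact hne).ne' ?_
      have h1 : ⨆ r, p r ≤ LinearMap.ker (Q L X) := by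
        refine iSup_le fun r Y hY => ?_
        rw [LinearMap.mem_ker]
        have h2 : (Y : L) = ∑ i, (f r).repr ⟨Y, hY⟩ i • (f r i : L) := by
          conv_lhs => rw [show Y = ((⟨Y, hY⟩ : p r) : L) from rfl, ← (f r).sum_repr ⟨Y, hY⟩]
          simp only [AddSubmonoidClass.coe_finsetSum, Submodule.coe_smul]
        rw [h2, map_sum]
        refine sum_eq_zero fun i _ => ?_
        rw [map_smul, hX' ⟨r, i⟩, smul_zero]
      exact h1 (h.span ▸ hX))
  have F : WallachFrame K p e Sigma.fst 1 :=
    { compact := h.compact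
      orthogonal := h.orthogonal
      bracket := h.bracket
      wpos := one_pos
      gram := fun i j => by rw [he, he, hgram]
      mem := fun i => he i ▸ (f i.1 i.2).2
      le := h.le
      surj := fun r => by
        have : Nontrivial (p r) := Submodule.nontrivial_iff_ne_bot.2 (h.ne_bot r)
        exact ⟨⟨r, ⟨0, finrank_pos⟩⟩, rfl⟩ }
  have hB : IsBlockSchur Ad e Sigma.fst := by
    intro β hs hβ
    choose y hy using h.exists_eq_smul_Q hs hβ
    refine ⟨y, fun i j hij => ?_⟩
    rw [hy i.1 _ _ (F.mem i) (hij ▸ F.mem j), F.gram]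
    split_ifs <;> simp
  refine ⟨e, F, hB, fun hin β hs hβ => ?_, ?_⟩
  · obtain ⟨y, hy⟩ := hB β hs hβ
    refine ⟨y, fun i j => ?_⟩
    by_cases hij : i.1 = j.1
    · exact hy i j hij
    · rw [h.eq_zero_of_inequivalent hin hβ hij (F.mem i) (F.mem j),
        if_neg fun h' => hij (congrArg Sigma.fst h')]
  · have hlin : ∀ (U : Submodule ℝ L) (a b : L → ℝ),
        (∀ X Y, a (X + Y) = a X + a Y) → (∀ (t : ℝ) X, a (t • X) = t * a X) →
        (∀ X Y, b (X + Y) = b X + b Y) → (∀ (t : ℝ) X, b (t • X) = t * b X) →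
        IsBilin fun x x' : U => a x * b x' := by
      intro U a b h1 h2 h3 h4
      constructor <;> intros <;>
      simp only [Submodule.coe_add, Submodule.coe_smul, h1, h2, h3, h4, smul_eq_mul] <;> ring
    unfold strConst
    have e3 : ∀ x x' : p 0, ∀ y y' : p 1, (gtr ((Q L).restrict (p 2)) fun z z' =>
        Q L ⁅(x : L), (y : L)⁆ (z : L) * Q L ⁅(x' : L), (y' : L)⁆ (z' : L)) =
        ∑ k, (1 : ℝ)⁻¹ * (Q L ⁅(x : L), (y : L)⁆ (f 2 k : L) *
          Q L ⁅(x' : L), (y' : L)⁆ (f 2 k : L)) := fun x x' y y' =>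
      (hf 2).gtr_eq (hlin _ (fun z => Q L ⁅(x : L), (y : L)⁆ z)
        (fun z => Q L ⁅(x' : L), (y' : L)⁆ z) (fun _ _ => map_add _ _ _) (fun _ _ => map_smul _ _ _)
        (fun _ _ => map_add _ _ _) (fun _ _ => map_smul _ _ _))
    have e2 : ∀ x x' : p 0, (gtr ((Q L).restrict (p 1)) fun y y' =>
        ∑ k, (1 : ℝ)⁻¹ * (Q L ⁅(x : L), (y : L)⁆ (f 2 k : L) *
          Q L ⁅(x' : L), (y' : L)⁆ (f 2 k : L))) =
        ∑ j, (1 : ℝ)⁻¹ * ∑ k, (1 : ℝ)⁻¹ * (Q L ⁅(x : L), (f 1 j : L)⁆ (f 2 k : L) *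
          Q L ⁅(x' : L), (f 1 j : L)⁆ (f 2 k : L)) := fun x x' => by
      rw [(hf 1).gtr_eq]
      exact IsBilin.sum_const_mul fun k => hlin _ (fun y => Q L ⁅(x : L), y⁆ (f 2 k : L))
        (fun y => Q L ⁅(x' : L), y⁆ (f 2 k : L)) (fun _ _ => by simp) (fun _ _ => by simp)
        (fun _ _ => by simp) (fun _ _ => by simp)
    simp only [e3, e2]
    rw [(hf 0).gtr_eq]
    · simp only [inv_one, one_mul]
      refine sum_congr rfl fun i _ => sum_congr rfl fun j _ =>
        sum_congr rfl fun k _ => ?_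
      rw [F.sconst_eq, he, he, he, div_one, sq]
    · exact IsBilin.sum_const_mul fun j => IsBilin.sum_const_mul fun k =>
        hlin _ (fun x => Q L ⁅x, (f 1 j : L)⁆ (f 2 k : L))
          (fun x => Q L ⁅x, (f 1 j : L)⁆ (f 2 k : L)) (fun _ _ => by simp) (fun _ _ => by simp)
          (fun _ _ => by simp) (fun _ _ => by simp)

theorem strConst_nonneg : 0 ≤ strConst (p 0) (p 1) (p 2) := by
  obtain ⟨e, -, -, -, he⟩ := h.exists_frame
  rw [he]
  positivity

theorem exists_data (hd : finrank ℝ (p 0) = finrank ℝ (p 1)) {b c : ℝ}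
    (hb : b = strConst (p 0) (p 1) (p 2) / finrank ℝ (p 0))
    (hc : c = strConst (p 0) (p 1) (p 2) / finrank ℝ (p 2)) (hb0 : 0 < b) :
    ∃ e : Basis (Σ r, Fin (finrank ℝ (p r))) ℝ (tangent K), WallachData K Ad p e Sigma.fst 1 b c ∧
      (PairwiseInequivalent Ad p → IsSchur Ad e Sigma.fst) := by
  obtain ⟨e, F, hB, hS, hconst⟩ := h.exists_frame
  have hcard : ∀ r, card {i : Σ r, Fin (finrank ℝ (p r)) // i.1 = r} = finrank ℝ (p r) := by
    intro r
    rw [Fintype.card_congr (Equiv.sigmaSubtype r), card_fin]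
  have hdpos : ∀ r, (0 : ℝ) < finrank ℝ (p r) := fun r => by
    have : Nontrivial (p r) := Submodule.nontrivial_iff_ne_bot.2 (h.ne_bot r)
    exact_mod_cast finrank_pos (R := ℝ) (M := p r)
  obtain ⟨a, hI⟩ := F.exists_isIsotropic h.stable hB
  have h0 : finrank ℝ (p 0) * a 0 = strConst (p 0) (p 1) (p 2) := by
    have h1 : ∀ i : Fin (finrank ℝ (p 0)),
        ∑ j, ∑ k, sconst e ⟨0, i⟩ ⟨1, j⟩ ⟨2, k⟩ ^ 2 = a 0 := by
      intro i
      have h2 := F.contract hI (fun r r' => if r = 1 ∧ r' = 2 then 1 else 0) ⟨0, i⟩ ⟨0, i⟩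
      rw [if_pos rfl, Fintype.sum_sigma, Fin.sum_univ_three] at h2
      simp only [Fintype.sum_sigma, Fin.sum_univ_three] at h2
      simpa [← sq] using h2
    rw [hconst]
    simp only [h1]
    simp
  have hr : ∀ r, a r = strConst (p 0) (p 1) (p 2) / finrank ℝ (p r) := by
    intro r
    rw [eq_div_iff (hdpos r).ne', mul_comm]
    by_cases hr : r = 0
    · rw [hr, h0]
    · rw [← h0, ← hcard r, ← hcard 0]
      exact F.card_mul_eq hI hr
  have ha : a = ![b, b, c] := by
    funext r
    rw [hr]
    fin_cases r
    · simp [hb]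
    · simp [hb, hd]
    · simp [hc]
  have hpos : 0 < strConst (p 0) (p 1) (p 2) := by
    rw [hb] at hb0
    exact (div_pos_iff_of_pos_right (hdpos 0)).1 hb0
  refine ⟨e, ⟨F, h.stable, ha ▸ hI, hb0, hc ▸ div_pos hpos (hdpos 2), ?_⟩, hS⟩
  rw [hcard, hcard, hd]

theorem einsteinSpec_q (hd : finrank ℝ (p 0) = finrank ℝ (p 1)) {b c : ℝ}
    (hb : b = strConst (p 0) (p 1) (p 2) / finrank ℝ (p 0))
    (hc : c = strConst (p 0) (p 1) (p 2) / finrank ℝ (p 2)) {q : ℝ}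
    (hq : q = qPlus b c ∨ q = qMinus b c) (hdisc : 0 ≤ discQ b c) (hq0 : 0 < q) :
    EinsteinSpec K Ad p (diagMetric K p (gq q)) (lamQ₁ b q) (lamQ₂ b c q) (rhoQ b q) := by
  have hb0 : 0 < b := by
    have h1 := h.strConst_nonneg
    refine lt_of_le_of_ne (hb ▸ by positivity) fun h0 => ?_
    have hne : (finrank ℝ (p 0) : ℝ) ≠ 0 := by
      have : Nontrivial (p 0) := Submodule.nontrivial_iff_ne_bot.2 (h.ne_bot 0)
      exact_mod_cast (finrank_pos (R := ℝ) (M := p 0)).ne'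
    have h2 : strConst (p 0) (p 1) (p 2) = 0 := by
      rw [hb, eq_comm, div_eq_zero_iff] at h0
      exact h0.resolve_right hne
    rw [h2, zero_div] at hb hc
    subst hb hc
    rcases hq with rfl | rfl <;> simp [qPlus, qMinus] at hq0
  obtain ⟨e, D, hS⟩ := h.exists_data hd hb hc hb0
  exact D.einsteinSpec_q hS hdisc hq hq0

theorem einsteinSpec_p (hd : finrank ℝ (p 0) = finrank ℝ (p 1)) {b c : ℝ}
    (hb : b = strConst (p 0) (p 1) (p 2) / finrank ℝ (p 0))
    (hc : c = strConst (p 0) (p 1) (p 2) / finrank ℝ (p 2)) {t : ℝ}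
    (ht : t = pPlus b c ∨ t = pMinus b c) (hdisc : 0 ≤ discP b c) (hb0 : 0 < b) (ht0 : 0 < t) :
    EinsteinSpec K Ad p (diagMetric K p (gp b t)) (lamPMin b c t) (lamPMax b c t) (rhoP b t) := by
  obtain ⟨e, D, hS⟩ := h.exists_data hd hb hc hb0
  exact D.einsteinSpec_p hS hdisc ht ht0
end
end IsGenWallach

/-! ### Matrices over the real division algebras -/

/-- `u` is an orthonormal basis, consisting of anticommuting units, of a real division algebra with
real part `re`. -/
structure StarFrame {F κ : Type*} [Ring F] [StarRing F] [Algebra ℝ F] [Fintype κ] [DecidableEq κ]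
    (u : κ → F) (re : F →ₗ[ℝ] ℝ) : Prop where
  re_star : ∀ z, re (star z) = re z
  re_comm : ∀ x y, re (x * y) = re (y * x)
  star_smul : ∀ (t : ℝ) (z : F), star (t • z) = t • star z
  gram : ∀ a b, re (star (u a) * u b) = if a = b then 1 else 0
  expand : ∀ z, ∑ a, re (star (u a) * z) • u a = z
  inv_left : ∀ a, star (u a) * u a = 1
  inv_right : ∀ a, u a * star (u a) = 1
  twist : ∀ z, ∑ a, star (u a) * z * star (u a) = (2 - card κ : ℝ) • star z
  rot : ∀ a b, a ≠ b → u b * star (u a) * (u b * star (u a)) = -1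

section Matrices
namespace StarFrame

section
variable (S : StarFrame u re)
include S

theorem re_mul_self (x y : F) :
    re (star x * y) = ∑ a, re (star (u a) * x) * re (star (u a) * y) := by
  conv_lhs => rw [← S.expand x, star_sum, sum_mul, map_sum]
  refine sum_congr rfl fun a _ => ?_
  rw [S.star_smul, smul_mul_assoc, map_smul, smul_eq_mul]

theorem eq_zero_of_forall {z : F} (h : ∀ a, re (star (u a) * z) = 0) :
    z = 0 := by
  rw [← S.expand z]
  exact sum_eq_zero fun a _ => by rw [h, zero_smul]

theorem re_mul_self_nonneg (z : F) : 0 ≤ re (star z * z) := by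
  rw [S.re_mul_self]
  exact sum_nonneg fun a _ => mul_self_nonneg _

theorem eq_zero_of_re {z : F} (h : re (star z * z) = 0) : z = 0 := by
  rw [S.re_mul_self, Finset.sum_eq_zero_iff_of_nonneg fun a _ => mul_self_nonneg _] at h
  exact S.eq_zero_of_forall fun a => mul_self_eq_zero.1 (h a (mem_univ a))

theorem re_star_mul_comm (x y : F) : re (star x * y) = re (star y * x) := by
  rw [← S.re_star, star_mul, star_star]

theorem sum_re_mul (z : F) : ∑ a, re (star (u a) * z * u a) =
    card κ * re z := by
  rw [sum_congr rfl fun a _ => by rw [S.re_comm, ← mul_assoc, S.inv_right, one_mul],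
    sum_const, nsmul_eq_mul, Finset.card_univ]
end

theorem trace_eq_sum {V α : Type*} [AddCommGroup V] [Module ℝ V] [FiniteDimensional ℝ V]
    [Fintype α] (f : End ℝ V) (ξ : α → V →ₗ[ℝ] ℝ) (v : α → V) (h : ∀ x, ∑ i, ξ i x • v i = x) :
    trace ℝ V f = ∑ i, ξ i (f (v i)) := by
  have h1 : f = ∑ i, (ξ i).smulRight (f (v i)) := by
    ext x
    conv_lhs => rw [← h x, map_sum]
    simp
  conv_lhs => rw [h1, map_sum]
  exact sum_congr rfl fun i _ => LinearMap.trace_smulRight _ _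

theorem trace_matrix_eq (S : StarFrame u re) (f : End ℝ (Matrix I I F)) : trace ℝ _ f =
      ∑ i, ∑ j, ∑ a, re (star (u a) * f (single i j (u a)) i j) := by
  have := trace_eq_sum f
    (fun q : I × I × κ => re ∘ₗ LinearMap.mulLeft ℝ (star (u q.2.2)) ∘ₗ
      Matrix.entryLinearMap ℝ F q.1 q.2.1)
    (fun q => single q.1 q.2.1 (u q.2.2)) (fun X => by
      rw [sum_prod_type]
      conv_rhs => rw [Matrix.matrix_eq_sum_single X]
      refine sum_congr rfl fun i _ => ?_
      rw [sum_prod_type]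
      refine sum_congr rfl fun j _ => ?_
      conv_rhs => rw [← S.expand (X i j)]
      change _ = Matrix.singleLinearMap ℝ i j _
      rw [map_sum]
      refine sum_congr rfl fun a _ => ?_
      simp [Matrix.smul_single])
  rw [this, sum_prod_type]
  refine sum_congr rfl fun i _ => ?_
  rw [sum_prod_type]
  rfl

theorem _root_.InvGeom.mul_single_mul_apply (A B : Matrix I I F) (i j k l : I) (z : F) :
    (A * single i j z * B) k l = A k i * z * B j l := by
  rw [mul_apply, sum_eq_single j (fun b _ hb => by
    rw [Matrix.mul_single_apply_of_ne _ _ _ _ _ hb, zero_mul]) (by simp),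
    Matrix.mul_single_apply_same]

theorem trace_mul_mul (S : StarFrame u re) {f : End ℝ (Matrix I I F)} (A B : Matrix I I F)
    (hf : ∀ Z, f Z = A * Z * B) :
    trace ℝ _ f = ∑ a, re (star (u a) * A.trace * u a * B.trace) := by
  rw [S.trace_matrix_eq]
  simp only [hf, mul_single_mul_apply]
  simp only [Matrix.trace, Matrix.diag, mul_sum, sum_mul, map_sum]
  rw [sum_congr rfl fun i _ => sum_comm, sum_comm]
  refine sum_congr rfl fun a _ => ?_
  rw [sum_comm]
  refine sum_congr rfl fun i _ => sum_congr rfl fun j _ => ?_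
  simp only [mul_assoc]

theorem trace_mul_star_mul (S : StarFrame u re) {f : End ℝ (Matrix I I F)} (A B : Matrix I I F)
    (hf : ∀ Z, f Z = A * Zᴴ * B) :
    trace ℝ _ f = (2 - card κ) * ∑ i, ∑ j, re (star (A i j) * B i j) := by
  rw [S.trace_matrix_eq, mul_sum]
  refine sum_congr rfl fun i _ => ?_
  rw [mul_sum]
  refine sum_congr rfl fun j _ => ?_
  simp only [hf, Matrix.conjTranspose_single, mul_single_mul_apply]
  rw [← map_sum, ← smul_eq_mul, ← map_smul, ← smul_mul_assoc, ← S.twist, sum_mul]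
  simp only [mul_assoc]

theorem _root_.InvGeom.sum_re_star_mul {X : Matrix I I F} (hX : Xᴴ = -X)
    (Y : Matrix I I F) : ∑ i, ∑ j, re (star (X i j) * Y i j) = -re (X * Y).trace := by
  simp only [Matrix.trace, Matrix.diag, mul_apply, map_sum]
  rw [sum_comm, ← sum_neg_distrib]
  refine sum_congr rfl fun i _ => ?_
  rw [← sum_neg_distrib]
  refine sum_congr rfl fun j _ => ?_
  have := congrFun (congrFun hX i) j
  rw [conjTranspose_apply, Matrix.neg_apply] at this
  rw [this, neg_mul, map_neg]
end StarFrame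

/-- The elementary skew-Hermitian matrices. -/
def skewE (i j : I) (z : F) : Matrix I I F := single i j z - single j i (star z)

/-- A Lie algebra of skew-Hermitian matrices that differs from the algebra of all of them only by
a condition on the trace. -/
structure SkewModel (u : κ → F) (re : F →ₗ[ℝ] ℝ) (G : LieSubalgebra ℝ (Matrix I I F)) :
    Prop where
  skew : ∀ X ∈ G, Xᴴ = -X
  lie : ∀ X ∈ G, ∀ Z : Matrix I I F, Zᴴ = -Z → ⁅X, Z⁆ ∈ G
  skewE_mem : ∀ i j z, i ≠ j → skewE i j z ∈ G
  conj : ∀ h X, hᴴ * h = 1 → h * hᴴ = 1 → X ∈ G →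
    h * X * hᴴ ∈ G
  trace_twist : ∀ X ∈ G, ∀ z, ∑ a, re (star (u a) * X.trace * u a * z) = 0
variable {G : LieSubalgebra ℝ (Matrix I I F)}

/-- The Killing form is this multiple of the trace form. -/
def killConst (I κ : Type*) [Fintype I] [Fintype κ] : ℝ :=
  card I * card κ + 2 * card κ - 4

namespace SkewModel

open LinearMap in
theorem killingForm_eq (M : SkewModel u re G) (S : StarFrame u re) (X Y : G) :
    killingForm ℝ G X Y = killConst I κ * re ((X : Matrix I I F) * (Y : Matrix I I F)).trace := by
  obtain ⟨X, hX⟩ := X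
  obtain ⟨Y, hY⟩ := Y
  let LR : Matrix I I F → Matrix I I F → End ℝ (Matrix I I F) := fun A B =>
    LinearMap.mulRight ℝ B ∘ₗ LinearMap.mulLeft ℝ A
  have hLR : ∀ A B Z, LR A B Z = A * Z * B := fun A B Z => rfl
  let C : End ℝ (Matrix I I F) :=
    { toFun := Matrix.conjTranspose
      map_add' := Matrix.conjTranspose_add
      map_smul' := fun t Z => by
        ext i j
        simp [S.star_smul] }
  have hC : ∀ Z, C Z = Zᴴ := fun Z => rfl
  let P : End ℝ (Matrix I I F) := LR (X * Y) 1 - LR X Y - LR Y X + LR 1 (Y * X)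
  have hP : ∀ Z, P Z = ⁅X, ⁅Y, Z⁆⁆ := fun Z => by
    simp only [P, LinearMap.add_apply, LinearMap.sub_apply, hLR, Ring.lie_def]
    noncomm_ring
  let T : End ℝ (Matrix I I F) := (1 / 2 : ℝ) • (P - P ∘ₗ C)
  have hT : ∀ Z, T Z = ⁅X, ⁅Y, (1 / 2 : ℝ) • (Z - Zᴴ)⁆⁆ := fun Z => by
    simp only [T, LinearMap.smul_apply, LinearMap.sub_apply, LinearMap.comp_apply, hP, hC, lie_smul, lie_sub]
  have hmem : ∀ Z, T Z ∈ G.toSubmodule := fun Z => by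
    rw [hT, ← hT, show T Z = ⁅X, (1 / 2 : ℝ) • ⁅Y, Z - Zᴴ⁆⁆ by rw [hT, lie_smul]]
    refine G.lie_mem hX (G.smul_mem _ (M.lie Y hY _ ?_))
    rw [Matrix.conjTranspose_sub, Matrix.conjTranspose_conjTranspose, neg_sub]
  have hkill : killingForm ℝ G ⟨X, hX⟩ ⟨Y, hY⟩ = trace ℝ _ T := by
    rw [LieModule.traceForm_apply_apply,
      ← LinearMap.trace_restrict_eq_of_forall_mem G.toSubmodule T (fun Z => hmem Z)]
    congr 1
    ext Z : 2
    have hZ := M.skew Z Z.2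
    change ⁅X, ⁅Y, (Z : Matrix I I F)⁆⁆ = T Z
    rw [hT, hZ, sub_neg_eq_add, ← two_smul ℝ, smul_smul]
    norm_num
  have h1 : trace ℝ _ (LR (X * Y) 1) = card I * card κ * re (X * Y).trace := by
    rw [S.trace_mul_mul (X * Y) 1 (hLR _ _), Matrix.trace_one]
    simp only [← Nat.smul_one_eq_cast, mul_smul_comm, mul_one, map_nsmul]
    rw [← Finset.smul_sum, S.sum_re_mul, nsmul_eq_mul]
    ring
  have hcomm : re (Y * X).trace = re (X * Y).trace := by
    simp only [Matrix.trace, Matrix.diag, mul_apply, map_sum]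
    rw [sum_comm]
    exact sum_congr rfl fun i _ => sum_congr rfl fun j _ => S.re_comm _ _
  have h2 : trace ℝ _ (LR 1 (Y * X)) = card I * card κ * re (X * Y).trace := by
    rw [S.trace_mul_mul 1 (Y * X) (hLR _ _), Matrix.trace_one, ← hcomm]
    have : ∀ a, re (star (u a) * (card I : F) * u a * (Y * X).trace) =
        card I * re (Y * X).trace := fun a => by
      rw [← (Nat.cast_commute _ _).eq, mul_assoc, mul_assoc, ← mul_assoc (star (u a)), S.inv_left,
        one_mul, ← nsmul_eq_mul, map_nsmul, nsmul_eq_mul]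
    rw [sum_congr rfl fun a _ => this a, sum_const, nsmul_eq_mul, Finset.card_univ]
    ring
  have h3 : trace ℝ _ (LR X Y) = 0 := by rw [S.trace_mul_mul X Y (hLR _ _), M.trace_twist X hX]
  have h4 : trace ℝ _ (LR Y X) = 0 := by rw [S.trace_mul_mul Y X (hLR _ _), M.trace_twist Y hY]
  have hone : ∀ A : Matrix I I F, ∑ i, ∑ j, re (star (A i j) * (1 : Matrix I I F) i j) =
      re A.trace := fun A => by
    rw [Matrix.trace, map_sum]
    refine sum_congr rfl fun i _ => ?_
    rw [sum_eq_single i (fun j _ hj => by rw [Matrix.one_apply_ne hj.symm, mul_zero,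
      map_zero]) (by simp), Matrix.one_apply_eq, mul_one, S.re_star]
    rfl
  have h5 : trace ℝ _ (LR (X * Y) 1 ∘ₗ C) = (2 - card κ) * re (X * Y).trace := by
    rw [S.trace_mul_star_mul (X * Y) 1 fun Z => rfl, hone]
  have h6 : trace ℝ _ (LR 1 (Y * X) ∘ₗ C) = (2 - card κ) * re (X * Y).trace := by
    rw [S.trace_mul_star_mul 1 (Y * X) fun Z => rfl]
    congr 1
    rw [← hcomm, ← hone]
    exact sum_congr rfl fun i _ => sum_congr rfl fun j _ => S.re_star_mul_comm _ _
  have h7 : trace ℝ _ (LR X Y ∘ₗ C) = (2 - card κ) * -re (X * Y).trace := by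
    rw [S.trace_mul_star_mul X Y fun Z => rfl, sum_re_star_mul (M.skew X hX)]
  have h8 : trace ℝ _ (LR Y X ∘ₗ C) = (2 - card κ) * -re (X * Y).trace := by
    rw [S.trace_mul_star_mul Y X fun Z => rfl, sum_re_star_mul (M.skew Y hY), hcomm]
  rw [hkill]
  simp only [T, P, map_smul, map_sub, map_add, LinearMap.sub_comp, LinearMap.add_comp, h1, h2, h3,
    h4, h5, h6, h7, h8, killConst, smul_eq_mul]
  ring

theorem Q_eq (M : SkewModel u re G) (S : StarFrame u re) (X Y : G) :
    Q G X Y = killConst I κ * ∑ i, ∑ j, re (star ((X : Matrix I I F) i j) *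
      (Y : Matrix I I F) i j) := by
  rw [sum_re_star_mul (M.skew X X.2), Q, LinearMap.neg_apply, LinearMap.neg_apply, M.killingForm_eq S]
  ring

theorem compact (M : SkewModel u re G) (S : StarFrame u re) (hK : 0 < killConst I κ) (X : G)
    (hX : X ≠ 0) : killingForm ℝ G X X < 0 := by
  have h1 := M.Q_eq S X X
  rw [Q, LinearMap.neg_apply, LinearMap.neg_apply] at h1
  rw [← neg_pos, h1]
  refine mul_pos hK (lt_of_le_of_ne (sum_nonneg fun i _ => sum_nonneg fun j _ =>
    S.re_mul_self_nonneg _) fun h => hX ?_)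
  refine Subtype.ext (Matrix.ext fun i j => ?_)
  have h2 := (Finset.sum_eq_zero_iff_of_nonneg fun i _ => sum_nonneg fun j _ =>
    S.re_mul_self_nonneg _).1 h.symm i (mem_univ i)
  have h3 := (Finset.sum_eq_zero_iff_of_nonneg fun j _ => S.re_mul_self_nonneg _).1 h2 j
    (mem_univ j)
  exact S.eq_zero_of_re h3
end SkewModel
end Matrices

section Matrices
theorem skewE_apply (i j p q : I) (z : F) : skewE i j z p q =
    (if i = p ∧ j = q then z else 0) - if j = p ∧ i = q then star z else 0 := by
  simp [skewE, Matrix.single_apply]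

theorem skewE_neg (i j : I) (z : F) : skewE i j (-z) = -skewE i j z := by
  ext p q
  simp only [Matrix.neg_apply, skewE_apply, star_neg]
  split_ifs <;> simp [neg_add_eq_sub]

namespace SkewModel
variable {G : LieSubalgebra ℝ (Matrix I I F)}

theorem Q_eq_zero (M : SkewModel u re G) (S : StarFrame u re) {X Y : G}
    (h : ∀ i j, (X : Matrix I I F) i j = 0 ∨ (Y : Matrix I I F) i j = 0) : Q G X Y = 0 := by
  rw [M.Q_eq S]
  refine mul_eq_zero_of_right _ (sum_eq_zero fun i _ => sum_eq_zero fun j _ => ?_)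
  rcases h i j with h1 | h1 <;> simp [h1]

theorem Q_skewE (M : SkewModel u re G) (S : StarFrame u re) (X : G) {Y : G} {i j : I}
    {z : F} (hY : (Y : Matrix I I F) = skewE i j z) :
    Q G X Y = 2 * killConst I κ * re (star z * (X : Matrix I I F) i j) := by
  obtain ⟨X, hX⟩ := X
  rw [M.Q_eq S, mul_comm 2, mul_assoc]
  congr 1
  have h1 : ∀ p q, re (star (X p q) * skewE i j z p q) =
      (if i = p then if j = q then re (star z * X i j) else 0 else 0) +
      if j = p then if i = q then re (star z * X i j) else 0 else 0 := by
    intro p q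
    rw [skewE_apply, mul_sub, map_sub, sub_eq_add_neg]
    congr 1
    · by_cases hp : i = p
      · by_cases hq : j = q
        · subst hp hq
          simp only [and_self, if_true]
          exact S.re_star_mul_comm _ _
        · simp [hq]
      · simp [hp]
    · by_cases hp : j = p
      · by_cases hq : i = q
        · subst hp hq
          simp only [and_self, if_true]
          have := congrFun (congrFun (M.skew X hX) i) j
          rw [conjTranspose_apply, Matrix.neg_apply] at this
          rw [this, neg_mul, map_neg, neg_neg, S.re_comm]
        · simp [hq]
      · simp [hp]
  change ∑ p, ∑ q, re (star (X p q) * (Y : Matrix I I F) p q) = _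
  simp only [hY, h1, sum_add_distrib, Finset.sum_ite_irrel, sum_ite_eq, mem_univ, if_true,
    sum_const_zero]
  ring
end SkewModel
variable (G : LieSubalgebra ℝ (Matrix I I F)) {b : I → Fin 3}

theorem mem_blockMods {r : Fin 3} {X : G} : X ∈ blockMods G b r ↔
    ∀ i j, ¬ (b i ≠ b j ∧ b i + b j = r + 1) → (X : Matrix I I F) i j = 0 := by
  have h : ∀ r : Fin 3, ∀ s s' : Fin 3, blockMods G b r = blockMod G b s s' →
      (∀ x y : Fin 3, ((x = s ∧ y = s') ∨ (x = s' ∧ y = s)) ↔ (x ≠ y ∧ x + y = r + 1)) →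
      (X ∈ blockMods G b r ↔
        ∀ i j, ¬ (b i ≠ b j ∧ b i + b j = r + 1) → (X : Matrix I I F) i j = 0) := by
    intro r s s' h1 h2
    rw [h1]
    change (∀ i j, ¬ _ → _) ↔ _
    simp only [h2]
  fin_cases r
  · exact h 0 0 1 rfl (by decide)
  · exact h 1 0 2 rfl (by decide)
  · exact h 2 1 2 rfl (by decide)
variable {G}

theorem blockMods_orthogonal (M : SkewModel u re G) (S : StarFrame u re) (r r' : Fin 3) (h : r ≠ r')
    (X : G) (hX : X ∈ blockMods G b r) (Y : G) (hY : Y ∈ blockMods G b r') : Q G X Y = 0 := by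
  refine M.Q_eq_zero S fun i j => ?_
  by_cases h1 : b i ≠ b j ∧ b i + b j = r + 1
  · exact Or.inr ((mem_blockMods G).1 hY i j fun h2 => h (add_right_cancel (h1.2.symm.trans h2.2)))
  · exact Or.inl ((mem_blockMods G).1 hX i j h1)

theorem blockMods_bracket (r : Fin 3) (X : G) (hX : X ∈ blockMods G b r) (Y : G)
    (hY : Y ∈ blockMods G b r) : ⁅X, Y⁆ ∈ blockSub G b := by
  have key : ∀ X Y : G, X ∈ blockMods G b r → Y ∈ blockMods G b r → ∀ i j, b i ≠ b j →
      ((X : Matrix I I F) * (Y : Matrix I I F)) i j = 0 := by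
    intro X Y hX hY i j hij
    rw [mul_apply]
    refine sum_eq_zero fun t _ => ?_
    by_cases h1 : b i ≠ b t ∧ b i + b t = r + 1
    · rw [(mem_blockMods G).1 hY t j fun h2 =>
        hij (add_right_cancel (h1.2.trans (h2.2.symm.trans (add_comm _ _)))), mul_zero]
    · rw [(mem_blockMods G).1 hX i t h1, zero_mul]
  intro i j hij
  rw [LieSubalgebra.coe_bracket, Ring.lie_def, Matrix.sub_apply, key X Y hX hY i j hij,
    key Y X hY hX i j hij, sub_zero]

theorem blockMods_le (M : SkewModel u re G) (S : StarFrame u re) (r : Fin 3) :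
    blockMods G b r ≤ tangent (blockSub G b) := fun X hX =>
  mem_tangent.2 fun Y hY => M.Q_eq_zero S fun i j => by
    by_cases h : b i = b j
    · exact Or.inr ((mem_blockMods G).1 hX i j fun h' => h'.1 h)
    · exact Or.inl (hY i j h)

theorem blockMods_stable {T : Set (Matrix I I F)} (hT : ∀ h ∈ T, ∀ i j, b i ≠ b j → h i j = 0)
    (r : Fin 3) (φ : G ≃ₗ⁅ℝ⁆ G) (hφ : φ ∈ adSet G T) (X : G) (hX : X ∈ blockMods G b r) :
    φ X ∈ blockMods G b r := by
  obtain ⟨h, hh, h1⟩ := hφ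
  rw [mem_blockMods]
  intro i j hij
  rw [h1, mul_apply]
  refine sum_eq_zero fun t _ => ?_
  rw [mul_apply, sum_mul]
  refine sum_eq_zero fun t' _ => ?_
  by_cases hi : b i = b t'
  · by_cases hj : b j = b t
    · rw [(mem_blockMods G).1 hX t' t (by rwa [hi, hj] at hij), mul_zero, zero_mul]
    · rw [conjTranspose_apply, hT h hh j t hj, star_zero, mul_zero]
  · rw [hT h hh i t' hi, zero_mul, zero_mul]
end Matrices

/-! ### The frame of a flag space -/

/-- Indices of the matrix entries above the block diagonal. -/
abbrev Pos (k m : ℕ) : Type := (Fin k × Fin m) ⊕ ((Fin k × Fin m) ⊕ (Fin m × Fin m))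

/-- The row of an entry above the block diagonal. -/
def Pos.src {k m : ℕ} : Pos k m → Idx k m :=
  Sum.elim (fun x => inl x.1) (Sum.elim (fun x => inl x.1) fun x => inr (inl x.1))

/-- The column of an entry above the block diagonal. -/
def Pos.tgt {k m : ℕ} : Pos k m → Idx k m :=
  Sum.elim (fun x => inr (inl x.2))
    (Sum.elim (fun x => inr (inr x.2)) fun x => inr (inr x.2))

/-- The block that contains an entry above the block diagonal. -/
def Pos.sec {k m : ℕ} : Pos k m → Fin 3 := Sum.elim (fun _ => 0) (Sum.elim (fun _ => 1) fun _ => 2)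

namespace Pos
theorem blk_lt (p : Pos k m) : blk k m p.src < blk k m p.tgt := by
  rcases p with p | p | p <;> simp [src, tgt, blk]

theorem blk_ne (p : Pos k m) : blk k m p.src ≠ blk k m p.tgt := p.blk_lt.ne

theorem src_ne_tgt (p q : Pos k m) (h : p.src = q.tgt) : p.tgt ≠ q.src := fun h' => by
  have h1 := p.blk_lt
  have h2 := q.blk_lt
  rw [h, h'] at h1
  exact absurd h1 h2.asymm

theorem ne (p : Pos k m) : p.src ≠ p.tgt := fun h => p.blk_ne (congrArg _ h)

theorem ext_iff {p q : Pos k m} : p = q ↔ p.src = q.src ∧ p.tgt = q.tgt := by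
  rcases p with p | p | p <;> rcases q with q | q | q <;> simp [src, tgt, Prod.ext_iff]

theorem exists_of_lt {i j : Idx k m} (h : blk k m i < blk k m j) :
    ∃ p : Pos k m, p.src = i ∧ p.tgt = j := by
  rcases i with i | i | i <;> rcases j with j | j | j <;> simp [blk] at h
  · exact ⟨inl (i, j), rfl, rfl⟩
  · exact ⟨inr (inl (i, j)), rfl, rfl⟩
  · exact ⟨inr (inr (i, j)), rfl, rfl⟩

theorem blk_add (p : Pos k m) : blk k m p.src + blk k m p.tgt = p.sec + 1 := by
  rcases p with p | p | p <;> simp [src, tgt, blk, sec]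
end Pos

section FlagFrame
variable {G : LieSubalgebra ℝ (Matrix (Idx k m) (Idx k m) F)}

/-- The elementary matrices as a frame of the flag space. -/
structure IsFlagFrame (u : κ → F) (e : Basis (Pos k m × κ) ℝ (tangent (blockSub G (blk k m)))) :
    Prop where
  coe : ∀ q, (e q).1.1 = skewE q.1.src q.1.tgt (u q.2)

theorem exists_flagFrame [Nonempty κ] (M : SkewModel u re G) (S : StarFrame u re)
    (hK : 0 < killConst (Idx k m) κ) (hk : 0 < k) (hm : 0 < m) :
    ∃ e : Basis (Pos k m × κ) ℝ (tangent (blockSub G (blk k m))), IsFlagFrame u e ∧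
      WallachFrame (blockSub G (blk k m)) (blockMods G (blk k m)) e (fun q => q.1.sec)
        (2 * killConst (Idx k m) κ) := by
  let v : Pos k m × κ → G := fun q =>
    ⟨skewE q.1.src q.1.tgt (u q.2), M.skewE_mem _ _ _ q.1.ne⟩
  have hv : ∀ q, (v q).1 = skewE q.1.src q.1.tgt (u q.2) := fun q => rfl
  have hw : 0 < 2 * killConst (Idx k m) κ := by positivity
  have hmem : ∀ q, v q ∈ blockMods G (blk k m) q.1.sec := fun q => by
    rw [mem_blockMods]
    intro i j hij
    rw [hv, skewE_apply, ← q.1.blk_add] at *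
    rw [if_neg, if_neg, sub_zero]
    · rintro ⟨rfl, rfl⟩
      exact hij ⟨q.1.blk_ne.symm, add_comm _ _⟩
    · rintro ⟨rfl, rfl⟩
      exact hij ⟨q.1.blk_ne, rfl⟩
  have hgram : ∀ q q', Q G (v q) (v q') = if q = q' then 2 * killConst (Idx k m) κ else 0 := by
    intro q q'
    rw [M.Q_skewE S (v q) (hv q'), hv, skewE_apply,
      if_neg (fun h : q.1.tgt = q'.1.src ∧ q.1.src = q'.1.tgt => q.1.src_ne_tgt _ h.2 h.1), sub_zero]
    simp only [← Pos.ext_iff]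
    rcases eq_or_ne q.1 q'.1 with h | h
    · rw [if_pos h, S.gram]
      by_cases h' : q.2 = q'.2
      · rw [if_pos h'.symm, if_pos (Prod.ext h h'), mul_one]
      · rw [if_neg (Ne.symm h'), if_neg (fun h'' => h' (congrArg Prod.snd h'')), mul_zero]
    · rw [if_neg h, if_neg (fun h'' => h (congrArg Prod.fst h'')), mul_zero, map_zero, mul_zero]
  have htop : ∀ X ∈ tangent (blockSub G (blk k m)), (∀ q, Q G X (v q) = 0) → X = 0 := by
    intro X hX h
    have h1 : ∀ i j, blk k m i < blk k m j → X.1 i j = 0 := by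
      intro i j hij
      obtain ⟨p, rfl, rfl⟩ := Pos.exists_of_lt hij
      refine S.eq_zero_of_forall fun a => ?_
      have := h (p, a)
      rw [M.Q_skewE S X (hv (p, a))] at this
      exact (mul_eq_zero.1 this).resolve_left hw.ne'
    have h2 : X ∈ blockSub G (blk k m) := by
      intro i j hij
      rcases lt_or_gt_of_ne hij with h' | h'
      · exact h1 i j h'
      · have h3 := congrFun (congrFun (M.skew X X.2) i) j
        rw [conjTranspose_apply, h1 j i h', star_zero, Matrix.neg_apply] at h3
        exact neg_eq_zero.1 h3.symm
    by_contra hne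
    exact (Q_self_pos (M.compact S hK) hne).ne' (mem_tangent.1 hX X h2)
  obtain ⟨e, he⟩ := exists_basis_of_orthogonal v hw.ne'
    (fun q => blockMods_le M S _ (hmem q)) hgram htop
  refine ⟨e, ⟨fun q => by rw [he]⟩, M.compact S hK, blockMods_orthogonal M S, blockMods_bracket, hw,
    fun q q' => by rw [he, he, hgram], fun q => by rw [he]; exact hmem q, blockMods_le M S,
    fun r => ?_⟩
  obtain ⟨a⟩ := ‹Nonempty κ›
  fin_cases r
  · exact ⟨(inl (⟨0, hk⟩, ⟨0, hm⟩), a), rfl⟩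
  · exact ⟨(inr (inl (⟨0, hk⟩, ⟨0, hm⟩)), a), rfl⟩
  · exact ⟨(inr (inr (⟨0, hm⟩, ⟨0, hm⟩)), a), rfl⟩

theorem card_sec (r : Fin 3) : card {q : Pos k m × κ // q.1.sec = r} =
    ![k * m, k * m, m * m] r * card κ := by
  rw [card_subtype, Finset.card_filter, sum_prod_type]
  simp only [sum_sum_type, Pos.sec, elim_inl, elim_inr]
  fin_cases r <;> simp
variable {e : Basis (Pos k m × κ) ℝ (tangent (blockSub G (blk k m)))}

theorem IsFlagFrame.sconst_zero_one_two (E : IsFlagFrame u e) (M : SkewModel u re G)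
    (S : StarFrame u re)
    (W : WallachFrame (blockSub G (blk k m)) (blockMods G (blk k m)) e (fun q => q.1.sec)
        (2 * killConst (Idx k m) κ)) (i i' : Fin k) (j j' r r' : Fin m) (a b c : κ) :
    sconst e (inl (i, j), a) (inr (inl (i', r)), b) (inr (inr (j', r')), c) =
      if i = i' ∧ j = j' ∧ r = r' then -re (star (u c) * (star (u a) * u b)) else 0 := by
  rw [W.sconst_eq, M.Q_skewE S _ (E.coe _), mul_div_cancel_left₀ _ W.wne,
    LieSubalgebra.coe_bracket, Ring.lie_def, Matrix.sub_apply, E.coe, E.coe]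
  simp only [mul_apply, skewE_apply, Pos.src, Pos.tgt, elim_inl, elim_inr,
    sum_sum_type, reduceCtorEq, Sum.inl.injEq, Sum.inr.injEq, false_and, and_false,
    if_false, sub_zero, zero_sub, mul_zero, neg_mul, sum_const_zero, add_zero,
    neg_zero]
  by_cases h : i = i' ∧ j = j' ∧ r = r'
  · obtain ⟨rfl, rfl, rfl⟩ := h
    simp
  · rw [if_neg h, sum_eq_zero, mul_zero, map_zero]
    intro t _
    split_ifs <;> simp_all

theorem IsFlagFrame.isotropy (E : IsFlagFrame u e) (M : SkewModel u re G)
    (S : StarFrame u re) [Nonempty κ]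
    (W : WallachFrame (blockSub G (blk k m)) (blockMods G (blk k m)) e (fun q => q.1.sec)
        (2 * killConst (Idx k m) κ)) (hk : 0 < k) (hm : 0 < m) {a : Fin 3 → ℝ}
    (hI : IsIsotropic e (fun q => q.1.sec) (2 * killConst (Idx k m) κ) a) :
    a = ![m * card κ / (2 * killConst (Idx k m) κ), m * card κ / (2 * killConst (Idx k m) κ),
      k * card κ / (2 * killConst (Idx k m) κ)] := by
  obtain ⟨α⟩ := ‹Nonempty κ›
  have hw := W.wpos
  have h0 : a 0 * (2 * killConst (Idx k m) κ) = m * card κ := by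
    have h1 := W.contract hI (fun r r' => if r = 1 ∧ r' = 2 then 1 else 0)
      (inl (⟨0, hk⟩, ⟨0, hm⟩), α) (inl (⟨0, hk⟩, ⟨0, hm⟩), α)
    rw [if_pos rfl] at h1
    have h2 : ∀ b, ∑ c, (re (star (u c) * (star (u α) * u b))) ^ 2 = 1 := fun b => by
      simp only [sq]
      rw [← S.re_mul_self, star_mul, star_star, mul_assoc, ← mul_assoc (u α), S.inv_right, one_mul,
        S.gram, if_pos rfl]
    simp only [sum_prod_type, sum_sum_type, Pos.sec, elim_inl, elim_inr,
      E.sconst_zero_one_two M S W, mul_ite, mul_zero] at h1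
    simp only [Fin.isValue, zero_ne_one, false_and, if_false, zero_mul,
      sum_const_zero, and_self, if_true, one_mul, and_false, add_zero, zero_add,
      Fin.reduceEq, mul_one] at h1
    rw [← h1]
    simp only [ite_mul, zero_mul, ← sq]
    simp [ite_and, h2]
  have hc := fun r r' (h : r ≠ r') => W.card_mul_eq hI h
  have h1 := hc 0 1 (by decide)
  have h2 := hc 0 2 (by decide)
  rw [card_sec, card_sec] at h1 h2
  have hκ : (0 : ℝ) < card κ := Nat.cast_pos.2 (Fintype.card_pos_iff.2 ⟨α⟩)
  have hk' : (0 : ℝ) < k := Nat.cast_pos.2 hk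
  have hm' : (0 : ℝ) < m := Nat.cast_pos.2 hm
  simp only [cons_val, Nat.cast_mul] at h1 h2
  have h3 : a 1 = a 0 := (mul_left_cancel₀ (by positivity) h1).symm
  have h4 : k * a 0 = m * a 2 :=
    mul_left_cancel₀ (a := (m : ℝ) * card κ) (by positivity) (by linear_combination h2)
  have h5 : a 0 = m * card κ / (2 * killConst (Idx k m) κ) := by rw [eq_div_iff hw.ne', h0]
  have h6 : a 2 = k * card κ / (2 * killConst (Idx k m) κ) := by
    rw [eq_div_iff hw.ne']
    refine mul_left_cancel₀ hm'.ne' ?_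
    linear_combination k * h0 - 2 * killConst (Idx k m) κ * h4
  funext r
  fin_cases r
  · exact h5
  · exact h3.trans h5
  · exact h6
end FlagFrame

/-! ### Schur's lemma from monomial isometries -/

/-- `e_i` and `e_j` are orthogonal for all symmetric invariant forms, because an automorphism
fixes one and reflects the other, or is a quarter turn of their plane. -/
def Separated (Ad : Set (L ≃ₗ⁅ℝ⁆ L)) (e : Basis ι ℝ (tangent K)) (i j : ι) : Prop :=
  ∃ φ ∈ Ad, (φ (e i) = e i ∧ φ (e j) = -(e j : L)) ∨ (φ (e i) = -(e i : L) ∧ φ (e j) = e j) ∨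
    (φ (e i) = e j ∧ φ (e j) = -(e i : L))

/-- An automorphism carries `e_i` to `± e_j`. -/
def Related (Ad : Set (L ≃ₗ⁅ℝ⁆ L)) (e : Basis ι ℝ (tangent K)) (i j : ι) : Prop :=
  ∃ φ ∈ Ad, φ (e i) = e j ∨ φ (e i) = -(e j : L)

/-- Invariant symmetric forms. -/
structure IsInvForm (Ad : Set (L ≃ₗ⁅ℝ⁆ L)) (β : BilinForm ℝ (tangent K)) : Prop where
  symm : ∀ X Y, β X Y = β Y X
  inv : ∀ φ ∈ Ad, ∀ X Y X' Y' : tangent K, (X' : L) = φ X → (Y' : L) = φ Y → β X' Y' = β X Y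

theorem Separated.apply_eq_zero {β : BilinForm ℝ (tangent K)} (hβ : IsInvForm Ad β) {i j : ι}
    (h : Separated Ad e i j) : β (e i) (e j) = 0 := by
  obtain ⟨φ, hφ, ⟨h1, h2⟩ | ⟨h1, h2⟩ | ⟨h1, h2⟩⟩ := h
  · have := hβ.inv φ hφ (e i) (e j) (e i) (-e j) h1.symm (by rw [h2]; rfl)
    rw [map_neg] at this
    linarith
  · have := hβ.inv φ hφ (e i) (e j) (-e i) (e j) (by rw [h1]; rfl) h2.symm
    rw [map_neg, LinearMap.neg_apply] at this
    linarith
  · have := hβ.inv φ hφ (e i) (e j) (e j) (-e i) h1.symm (by rw [h2]; rfl)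
    rw [map_neg, hβ.symm] at this
    linarith

theorem Related.apply_eq {β : BilinForm ℝ (tangent K)} (hβ : IsInvForm Ad β) {i j : ι}
    (h : Related Ad e i j) : β (e i) (e i) = β (e j) (e j) := by
  obtain ⟨φ, hφ, h1 | h1⟩ := h
  · exact (hβ.inv φ hφ _ _ _ _ h1.symm h1.symm).symm
  · have := hβ.inv φ hφ (e i) (e i) (-e j) (-e j) (by rw [h1]; rfl) (by rw [h1]; rfl)
    rw [map_neg, map_neg, LinearMap.neg_apply, neg_neg] at this
    exact this.symm

theorem exists_diag {β : BilinForm ℝ (tangent K)} (hβ : IsInvForm Ad β)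
    (hrel : ∀ i j, s i = s j → EqvGen (Related Ad e) i j) :
    ∃ y : Fin 3 → ℝ, ∀ i, β (e i) (e i) = y (s i) := by
  have h : ∀ i j, s i = s j → β (e i) (e i) = β (e j) (e j) := fun i j hij => by
    have h1 := hrel i j hij
    clear hij
    induction h1 with
    | rel _ _ h => exact h.apply_eq hβ
    | refl _ => rfl
    | symm _ _ _ ih => exact ih.symm
    | trans _ _ _ _ _ ih1 ih2 => exact ih1.trans ih2
  classical
  refine ⟨fun r => if h : ∃ i, s i = r then β (e h.choose) (e h.choose) else 0, fun i => ?_⟩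
  have h1 : ∃ j, s j = s i := ⟨i, rfl⟩
  change _ = dite _ _ _
  rw [dif_pos h1]
  exact h _ _ h1.choose_spec.symm

theorem isSchur_of_separated (hsep : ∀ i j, i ≠ j → Separated Ad e i j)
    (hrel : ∀ i j, s i = s j → EqvGen (Related Ad e) i j) : IsSchur Ad e s := by
  intro β h1 h2
  obtain ⟨y, hy⟩ := exists_diag ⟨h1, h2⟩ hrel
  refine ⟨y, fun i j => ?_⟩
  split_ifs with h
  · rw [← h, hy]
  · exact (hsep i j h).apply_eq_zero ⟨h1, h2⟩

theorem isBlockSchur_of_separated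
    (hsep : ∀ i j, i ≠ j → s i = s j → Separated Ad e i j)
    (hrel : ∀ i j, s i = s j → EqvGen (Related Ad e) i j) : IsBlockSchur Ad e s := by
  intro β h1 h2
  obtain ⟨y, hy⟩ := exists_diag ⟨h1, h2⟩ hrel
  refine ⟨y, fun i j hij => ?_⟩
  split_ifs with h
  · rw [← h, hy]
  · exact (hsep i j h hij).apply_eq_zero ⟨h1, h2⟩

/-! ### Monomial matrices -/

section Mono
variable {F I : Type*} [Ring F] [StarRing F] [Fintype I] [DecidableEq I]

/-- The monomial matrix with entries `d j` at `(σ j, j)`. -/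
def mono (σ : Perm I) (d : I → F) : Matrix I I F :=
  Matrix.of fun x y => if x = σ y then d y else 0

theorem mono_apply (σ : Perm I) (d : I → F) (x y : I) :
    mono σ d x y = if x = σ y then d y else 0 := rfl

theorem mono_mul_single (σ : Perm I) (d : I → F) (i j : I) (z : F) :
    mono σ d * single i j z = single (σ i) j (d i * z) := by
  ext x y
  rcases eq_or_ne y j with rfl | hy
  · rw [Matrix.mul_single_apply_same, mono_apply, Matrix.single_apply, ite_mul, zero_mul]
    simp [eq_comm]
  · rw [Matrix.mul_single_apply_of_ne _ _ _ _ _ hy, Matrix.single_apply, if_neg fun h => hy h.2.symm]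

theorem mono_conj_skewE (σ : Perm I) (d : I → F) (i j : I) (z : F) :
    mono σ d * skewE i j z * (mono σ d)ᴴ =
      skewE (σ i) (σ j) (d i * z * star (d j)) := by
  have h : ∀ i j z, mono σ d * single i j z * (mono σ d)ᴴ =
      single (σ i) (σ j) (d i * z * star (d j)) := fun i j z => by
    rw [mono_mul_single, ← Matrix.conjTranspose_conjTranspose (single _ _ _),
      ← conjTranspose_mul, Matrix.conjTranspose_single, mono_mul_single,
      Matrix.conjTranspose_single, star_mul, star_star]
  rw [skewE, mul_sub, sub_mul, h, h, skewE, star_mul, star_mul, star_star, mul_assoc (d j)]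

theorem mono_mul_mono (σ τ : Perm I) (d c : I → F) :
    mono σ d * mono τ c = mono (σ * τ) fun y => d (τ y) * c y := by
  ext x y
  rw [mul_apply, sum_eq_single (τ y) (fun z _ hz => by
    rw [mono_apply τ, if_neg hz, mul_zero]) (by simp), mono_apply, mono_apply, if_pos rfl,
    mono_apply, ite_mul, zero_mul]
  rfl

theorem mono_one : mono (1 : Perm I) (1 : I → F) = 1 := by
  ext x y
  rw [mono_apply, Matrix.one_apply]
  rfl

theorem conjTranspose_mono (σ : Perm I) (d : I → F) :
    (mono σ d)ᴴ = mono σ⁻¹ fun y => star (d (σ⁻¹ y)) := by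
  ext x y
  rw [conjTranspose_apply, mono_apply, mono_apply]
  by_cases h : y = σ x
  · rw [if_pos h, if_pos (by simp [h])]
    simp [h]
  · rw [if_neg h, if_neg fun h' => h (by simp [h']), star_zero]

theorem conjTranspose_mono_mul {σ : Perm I} {d : I → F} (h : ∀ i, star (d i) * d i = 1) :
    (mono σ d)ᴴ * mono σ d = 1 := by
  rw [conjTranspose_mono, mono_mul_mono, ← mono_one, inv_mul_cancel]
  congr 1
  funext y
  simp [h]

theorem mono_mul_conjTranspose {σ : Perm I} {d : I → F} (h : ∀ i, d i * star (d i) = 1) :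
    mono σ d * (mono σ d)ᴴ = 1 := by
  rw [conjTranspose_mono, mono_mul_mono, ← mono_one, mul_inv_cancel]
  congr 1
  funext y
  simp [h]

theorem diag3_mono {k m : ℕ} (σ₀ : Perm (Fin k)) (σ₁ σ₂ : Perm (Fin m)) (d₀ : Fin k → F)
    (d₁ d₂ : Fin m → F) : diag3 (mono σ₀ d₀) (mono σ₁ d₁) (mono σ₂ d₂) =
      mono (Perm.sumCongr σ₀ (Perm.sumCongr σ₁ σ₂)) (Sum.elim d₀ (Sum.elim d₁ d₂)) := by
  ext (i | i | i) (j | j | j) <;> simp [diag3, mono_apply]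

theorem diag3_eq_zero {k m : ℕ} (x : Matrix (Fin k) (Fin k) F) (y z : Matrix (Fin m) (Fin m) F)
    (i j : Idx k m) (h : blk k m i ≠ blk k m j) : diag3 x y z i j = 0 := by
  rcases i with i | i | i <;> rcases j with j | j | j <;> simp [diag3, blk] at h ⊢
end Mono

theorem det_mono {F I : Type*} [CommRing F] [Fintype I] [DecidableEq I] (σ : Perm I)
    (d : I → F) : (Matrix.of fun x y => if x = σ y then d y else 0).det =
      Perm.sign σ * ∏ i, d i := by
  have : (Matrix.of fun x y => if x = σ y then d y else 0) =
      (σ⁻¹).permMatrix F * diagonal d := by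
    ext x y
    rw [Matrix.mul_diagonal, Matrix.of_apply, Equiv.Perm.permMatrix, PEquiv.toMatrix_apply]
    simp [Equiv.symm_apply_eq]
  rw [this, Matrix.det_mul, Matrix.det_permutation, Matrix.det_diagonal, Equiv.Perm.sign_inv]

/-- The permutations with signs that are used as isometries in a block: the identity, quarter
turns and their squares. -/
inductive IsTurn {F I : Type*} [Ring F] [DecidableEq I] : Perm I → (I → F) → Prop
  | one : IsTurn 1 1
  | quarter (a b : I) (h : a ≠ b) : IsTurn (swap a b) (update 1 b (-1))
  | half (a b : I) (h : a ≠ b) : IsTurn 1 (update (update 1 a (-1)) b (-1))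

theorem IsTurn.sign_mul_prod {F I : Type*} [CommRing F] [Fintype I] [DecidableEq I]
    {σ : Perm I} {d : I → F} (h : IsTurn σ d) :
    ((Perm.sign σ : ℤ) : F) * ∏ i, d i = 1 := by
  have h1 : ∀ (d : I → F) (b : I), d b = 1 → ∏ i, update d b (-1) i = -∏ i, d i := by
    intro d b hb
    rw [Finset.prod_update_of_mem (mem_univ b), ← Finset.mul_prod_erase Finset.univ d
      (mem_univ b), hb, Finset.sdiff_singleton_eq_erase]
    ring
  cases h with
  | one => simp
  | quarter a b h =>
    rw [Equiv.Perm.sign_swap h, h1 _ _ rfl]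
    simp
  | half a b h =>
    rw [h1 _ _ (by rw [update_of_ne h.symm]; rfl), h1 _ _ rfl]
    simp

theorem IsTurn.star_mul_self {F I : Type*} [Ring F] [StarRing F] [DecidableEq I]
    {σ : Perm I} {d : I → F} (h : IsTurn σ d) (i : I) :
    star (d i) * d i = 1 ∧ d i * star (d i) = 1 := by
  have : d i = 1 ∨ d i = -1 := by
    cases h with
    | one => exact Or.inl rfl
    | quarter a b h => by_cases hi : i = b <;> simp [hi]
    | half a b h => by_cases hi : i = b <;> by_cases hi' : i = a <;> simp [hi, hi', Function.update_apply]
  rcases this with h | h <;> simp [h]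

section FlagMoves
variable {G : LieSubalgebra ℝ (Matrix I I F)} {T : Set (Matrix I I F)}

theorem SkewModel.exists_adSet (M : SkewModel u re G) {h : Matrix I I F} (hT : h ∈ T)
    (h1 : hᴴ * h = 1) (h2 : h * hᴴ = 1) :
    ∃ φ ∈ adSet G T, ∀ X : G, (φ X : Matrix I I F) = h * (X : Matrix I I F) * hᴴ := by
  have hl : ∀ A B : Matrix I I F, hᴴ * h = 1 →
      h * ⁅A, B⁆ * hᴴ = ⁅h * A * hᴴ, h * B * hᴴ⁆ := by
    intro A B h1
    have key : ∀ A B : Matrix I I F, h * A * hᴴ * (h * B * hᴴ) =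
        h * (A * B) * hᴴ := fun A B => by
      rw [show h * A * hᴴ * (h * B * hᴴ) =
        h * A * (hᴴ * h) * B * hᴴ by noncomm_ring, h1]
      noncomm_ring
    rw [Ring.lie_def, Ring.lie_def, key, key]
    noncomm_ring
  have hinv : ∀ X, hᴴ * (h * X * hᴴ) * h = X := fun X => by
    rw [show hᴴ * (h * X * hᴴ) * h =
      (hᴴ * h) * X * (hᴴ * h) by noncomm_ring, h1]
    simp
  have hinv' : ∀ X, h * (hᴴ * X * h) * hᴴ = X := fun X => by
    rw [show h * (hᴴ * X * h) * hᴴ =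
      (h * hᴴ) * X * (h * hᴴ) by noncomm_ring, h2]
    simp
  let φ : G ≃ₗ⁅ℝ⁆ G :=
    { toFun := fun X => ⟨h * (X : Matrix I I F) * hᴴ, M.conj h X h1 h2 X.2⟩
      invFun := fun X => ⟨hᴴ * (X : Matrix I I F) * h, by
        have := M.conj hᴴ X (by rwa [Matrix.conjTranspose_conjTranspose])
          (by rwa [Matrix.conjTranspose_conjTranspose]) X.2
        rwa [Matrix.conjTranspose_conjTranspose] at this⟩
      map_add' := fun X Y => Subtype.ext (by
        change h * ((X : Matrix I I F) + (Y : Matrix I I F)) * hᴴ = _ + _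
        rw [mul_add, add_mul])
      map_smul' := fun t X => Subtype.ext (by
        change h * (t • (X : Matrix I I F)) * hᴴ = t • _
        rw [mul_smul_comm, smul_mul_assoc])
      map_lie' := fun {X Y} => Subtype.ext (hl X Y h1)
      left_inv := fun X => Subtype.ext (hinv X)
      right_inv := fun X => Subtype.ext (hinv' X) }
  exact ⟨φ, ⟨h, hT, fun X => rfl⟩, fun X => rfl⟩

/-- Conjugation by the monomial matrix belongs to `Ad`. -/
def HasMono (G : LieSubalgebra ℝ (Matrix I I F)) (Ad : Set (G ≃ₗ⁅ℝ⁆ G)) (σ : Perm I)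
    (d : I → F) : Prop :=
  ∃ φ ∈ Ad, ∀ X : G, ∀ i j z, (X : Matrix I I F) = skewE i j z →
    (φ X : Matrix I I F) = skewE (σ i) (σ j) (d i * z * star (d j))

theorem SkewModel.hasMono (M : SkewModel u re G) {σ : Perm I} {d : I → F}
    (hT : mono σ d ∈ T) (h1 : ∀ i, star (d i) * d i = 1) (h2 : ∀ i, d i * star (d i) = 1) :
    HasMono G (adSet G T) σ d := by
  obtain ⟨φ, hφ, h⟩ := M.exists_adSet hT (conjTranspose_mono_mul h1) (mono_mul_conjTranspose h2)
  exact ⟨φ, hφ, fun X i j z hX => by rw [h, hX, mono_conj_skewE]⟩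
end FlagMoves

section FlagSchur
variable {G : LieSubalgebra ℝ (Matrix (Idx k m) (Idx k m) F)} {Ad : Set (G ≃ₗ⁅ℝ⁆ G)}
  {e : Basis (Pos k m × κ) ℝ (tangent (blockSub G (blk k m)))} {σ : Perm (Idx k m)} {d : Idx k m → F}

namespace IsFlagFrame

section
variable (E : IsFlagFrame u e)
include E

theorem map_eq {φ : G ≃ₗ⁅ℝ⁆ G}
    (hφ : ∀ X : G, ∀ i j z, (X : Matrix _ _ F) = skewE i j z →
      (φ X : Matrix _ _ F) = skewE (σ i) (σ j) (d i * z * star (d j)))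
    {q q' : Pos k m × κ} (h1 : σ q.1.src = q'.1.src) (h2 : σ q.1.tgt = q'.1.tgt)
    (h3 : d q.1.src * u q.2 * star (d q.1.tgt) = u q'.2) : φ (e q) = e q' := by
  refine Subtype.ext ?_
  rw [hφ _ _ _ _ (E.coe q), E.coe, h1, h2, h3]

theorem map_eq_neg {φ : G ≃ₗ⁅ℝ⁆ G}
    (hφ : ∀ X : G, ∀ i j z, (X : Matrix _ _ F) = skewE i j z →
      (φ X : Matrix _ _ F) = skewE (σ i) (σ j) (d i * z * star (d j)))
    {q q' : Pos k m × κ} (h1 : σ q.1.src = q'.1.src) (h2 : σ q.1.tgt = q'.1.tgt)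
    (h3 : d q.1.src * u q.2 * star (d q.1.tgt) = -u q'.2) : φ (e q) = -(e q' : G) := by
  refine Subtype.ext ?_
  rw [hφ _ _ _ _ (E.coe q), h1, h2, h3, skewE_neg, ← E.coe]
  rfl

theorem related (h : HasMono G Ad σ d) {q q' : Pos k m × κ}
    (h1 : σ q.1.src = q'.1.src) (h2 : σ q.1.tgt = q'.1.tgt)
    (h3 : d q.1.src * u q.2 * star (d q.1.tgt) = u q'.2 ∨
      d q.1.src * u q.2 * star (d q.1.tgt) = -u q'.2) : Related Ad e q q' := by
  obtain ⟨φ, hφ, h⟩ := h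
  exact ⟨φ, hφ, h3.imp (E.map_eq h h1 h2) (E.map_eq_neg h h1 h2)⟩

theorem separated_sign (h : HasMono G Ad 1 d) {q q' : Pos k m × κ}
    (h1 : d q.1.src * u q.2 * star (d q.1.tgt) = u q.2 ∧
      d q'.1.src * u q'.2 * star (d q'.1.tgt) = -u q'.2 ∨
      d q.1.src * u q.2 * star (d q.1.tgt) = -u q.2 ∧
      d q'.1.src * u q'.2 * star (d q'.1.tgt) = u q'.2) : Separated Ad e q q' := by
  obtain ⟨φ, hφ, h⟩ := h
  refine ⟨φ, hφ, h1.imp ?_ fun h1 => Or.inl ?_⟩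
  · exact fun h1 => ⟨E.map_eq h rfl rfl h1.1, E.map_eq_neg h rfl rfl h1.2⟩
  · exact ⟨E.map_eq_neg h rfl rfl h1.1, E.map_eq h rfl rfl h1.2⟩

theorem separated_turn (h : HasMono G Ad σ d) {q q' : Pos k m × κ}
    (h1 : σ q.1.src = q'.1.src) (h2 : σ q.1.tgt = q'.1.tgt)
    (h3 : d q.1.src * u q.2 * star (d q.1.tgt) = u q'.2) (h4 : σ q'.1.src = q.1.src)
    (h5 : σ q'.1.tgt = q.1.tgt) (h6 : d q'.1.src * u q'.2 * star (d q'.1.tgt) = -u q.2) :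
    Separated Ad e q q' := by
  obtain ⟨φ, hφ, h⟩ := h
  exact ⟨φ, hφ, Or.inr (Or.inr ⟨E.map_eq h h1 h2 h3, E.map_eq_neg h h4 h5 h6⟩)⟩

/-- Quarter turns within the blocks relate the vectors of a module with the same unit. -/
theorem eqvGen (hT : ∀ a b, a ≠ b → blk k m a = blk k m b →
      HasMono G Ad (swap a b) (update 1 b (-1)))
    (hu : ∀ (p : Pos k m) (a a' : κ), a ≠ a' →
      ∃ d, HasMono G Ad 1 d ∧ d p.src * u a * star (d p.tgt) = u a')
    {q q' : Pos k m × κ} (h : q.1.sec = q'.1.sec) : EqvGen (Related Ad e) q q' := by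
  have hsrc : ∀ (p p' : Pos k m) (a : κ), p.tgt = p'.tgt → blk k m p.src = blk k m p'.src →
      EqvGen (Related Ad e) (p, a) (p', a) := by
    intro p p' a h1 h2
    by_cases h3 : p.src = p'.src
    · rw [Pos.ext_iff.2 ⟨h3, h1⟩]
      exact Relation.EqvGen.refl _
    · refine Relation.EqvGen.rel _ _ (E.related (hT _ _ h3 h2) (swap_apply_left _ _) ?_
        (Or.inl ?_))
      · rw [← h1]
        exact swap_apply_of_ne_of_ne p.ne.symm (h1 ▸ p'.ne.symm)
      · rw [update_of_ne h3, update_of_ne (h1 ▸ p'.ne.symm)]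
        simp
  have htgt : ∀ (p p' : Pos k m) (a : κ), p.src = p'.src → blk k m p.tgt = blk k m p'.tgt →
      EqvGen (Related Ad e) (p, a) (p', a) := by
    intro p p' a h1 h2
    by_cases h3 : p.tgt = p'.tgt
    · rw [Pos.ext_iff.2 ⟨h1, h3⟩]
      exact Relation.EqvGen.refl _
    · refine Relation.EqvGen.rel _ _ (E.related (hT _ _ h3 h2) ?_ (swap_apply_left _ _)
        (Or.inl ?_))
      · rw [← h1]
        exact swap_apply_of_ne_of_ne p.ne (h1 ▸ p'.ne)
      · rw [update_of_ne h3, update_of_ne (h1 ▸ p'.ne)]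
        simp
  have hpos : ∀ (p p' : Pos k m) (a : κ), p.sec = p'.sec →
      EqvGen (Related Ad e) (p, a) (p', a) := by
    rintro (⟨i, j⟩ | ⟨i, j⟩ | ⟨i, j⟩) (⟨i', j'⟩ | ⟨i', j'⟩ | ⟨i', j'⟩) a h <;>
      simp [Pos.sec] at h
    · exact (hsrc (.inl (i, j)) (.inl (i', j)) a rfl rfl).trans _ _ _
        (htgt (.inl (i', j)) (.inl (i', j')) a rfl rfl)
    · exact (hsrc (.inr (.inl (i, j))) (.inr (.inl (i', j))) a rfl rfl).trans _ _ _
        (htgt (.inr (.inl (i', j))) (.inr (.inl (i', j'))) a rfl rfl)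
    · exact (hsrc (.inr (.inr (i, j))) (.inr (.inr (i', j))) a rfl rfl).trans _ _ _
        (htgt (.inr (.inr (i', j))) (.inr (.inr (i', j'))) a rfl rfl)
  refine (hpos q.1 q'.1 q.2 h).trans _ _ _ ?_
  by_cases h1 : q.2 = q'.2
  · rw [h1]
    exact Relation.EqvGen.refl _
  · obtain ⟨d, h2, h3⟩ := hu q'.1 _ _ h1
    exact Relation.EqvGen.rel _ _ (E.related h2 rfl rfl (Or.inl h3))
end
end IsFlagFrame

/-- Conjugations by turns within the blocks belong to `Ad`. -/
def HasTurns (G : LieSubalgebra ℝ (Matrix (Idx k m) (Idx k m) F)) (Ad : Set (G ≃ₗ⁅ℝ⁆ G)) : Prop :=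
  ∀ (σ₀ : Perm (Fin k)) (σ₁ σ₂ : Perm (Fin m)) (d₀ : Fin k → F) (d₁ d₂ : Fin m → F),
    IsTurn σ₀ d₀ → IsTurn σ₁ d₁ → IsTurn σ₂ d₂ →
    HasMono G Ad (Perm.sumCongr σ₀ (Perm.sumCongr σ₁ σ₂))
      (Sum.elim d₀ (Sum.elim d₁ d₂))

theorem sumElim_update_inl {α β γ : Type*} [DecidableEq α] [DecidableEq β] (f : α → γ) (g : β → γ)
    (a : α) (c : γ) : Sum.elim (update f a c) g = update (Sum.elim f g) (inl a) c := by
  rw [Sum.update_elim_inl]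

theorem sumElim_one {α β γ : Type*} [One γ] : Sum.elim (1 : α → γ) (1 : β → γ) = 1 := by
  funext x
  rcases x with x | x <;> rfl

theorem HasTurns.quarter (H : HasTurns G Ad) (a b : Idx k m) (hab : a ≠ b)
    (h : blk k m a = blk k m b) : HasMono G Ad (swap a b) (update 1 b (-1)) := by
  rcases a with a | a | a <;> rcases b with b | b | b <;> simp [blk] at h
  · have := H _ _ _ _ _ _ (.quarter a b fun h => hab (by rw [h])) .one .one
    rwa [Equiv.Perm.sumCongr_one, Equiv.Perm.sumCongr_swap_one, sumElim_one, sumElim_update_inl,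
      sumElim_one] at this
  · have := H _ _ _ _ _ _ .one (.quarter a b fun h => hab (by rw [h])) .one
    rwa [Equiv.Perm.sumCongr_swap_one, Equiv.Perm.sumCongr_one_swap, sumElim_update_inl,
      sumElim_one, ← Sum.update_elim_inr, sumElim_one] at this
  · have := H _ _ _ _ _ _ .one .one (.quarter a b fun h => hab (by rw [h]))
    rwa [Equiv.Perm.sumCongr_one_swap, Equiv.Perm.sumCongr_one_swap, ← Sum.update_elim_inr,
      sumElim_one, ← Sum.update_elim_inr, sumElim_one] at this

theorem HasTurns.half (H : HasTurns G Ad) (a b : Idx k m) (hab : a ≠ b)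
    (h : blk k m a = blk k m b) :
    HasMono G Ad 1 (update (update 1 a (-1)) b (-1)) := by
  rcases a with a | a | a <;> rcases b with b | b | b <;> simp [blk] at h
  · have := H _ _ _ _ _ _ (.half a b fun h => hab (by rw [h])) .one .one
    rwa [Equiv.Perm.sumCongr_one, Equiv.Perm.sumCongr_one, sumElim_one, sumElim_update_inl,
      sumElim_update_inl, sumElim_one] at this
  · have := H _ _ _ _ _ _ .one (.half a b fun h => hab (by rw [h])) .one
    rwa [Equiv.Perm.sumCongr_one, Equiv.Perm.sumCongr_one, sumElim_update_inl,
      sumElim_update_inl, sumElim_one, ← Sum.update_elim_inr, ← Sum.update_elim_inr,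
      sumElim_one] at this
  · have := H _ _ _ _ _ _ .one .one (.half a b fun h => hab (by rw [h]))
    simpa only [Equiv.Perm.sumCongr_one, ← Sum.update_elim_inr, sumElim_one] using this
end FlagSchur

/-! ### The real division algebras and the classical Lie algebras -/

/-- The basis of `ℝ`. -/
@[simp] def unitsR (_ : Unit) : ℝ := 1

theorem starFrame_real : StarFrame unitsR LinearMap.id where
  re_star _ := rfl
  re_comm := mul_comm
  star_smul t z := by simp
  gram _ _ := by simp
  expand z := by simp
  inv_left _ := by simp
  inv_right _ := by simp
  twist z := by norm_num
  rot a b h := absurd (Subsingleton.elim a b) h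

/-- The basis of `ℂ`. -/
def unitsC : Fin 2 → ℂ := ![1, Complex.I]

theorem starFrame_complex : StarFrame unitsC Complex.reLm where
  re_star _ := rfl
  re_comm x y := by rw [mul_comm]
  star_smul t z := by simp
  gram a b := by fin_cases a <;> fin_cases b <;> simp [unitsC]
  expand z := by apply Complex.ext <;> simp [unitsC]
  inv_left a := by fin_cases a <;> simp [unitsC]
  inv_right a := by fin_cases a <;> simp [unitsC]
  twist z := by apply Complex.ext <;> simp [unitsC]
  rot a b := by fin_cases a <;> fin_cases b <;> simp [unitsC]

/-- The basis of the quaternions. -/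
def unitsH (a : Fin 4) : Quaternion ℝ :=
  ⟨![1, 0, 0, 0] a, ![0, 1, 0, 0] a, ![0, 0, 1, 0] a, ![0, 0, 0, 1] a⟩

@[simp] theorem unitsH_re (a : Fin 4) : (unitsH a).re = ![1, 0, 0, 0] a := rfl

@[simp] theorem unitsH_imI (a : Fin 4) : (unitsH a).imI = ![0, 1, 0, 0] a := rfl

@[simp] theorem unitsH_imJ (a : Fin 4) : (unitsH a).imJ = ![0, 0, 1, 0] a := rfl

@[simp] theorem unitsH_imK (a : Fin 4) : (unitsH a).imK = ![0, 0, 0, 1] a := rfl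

/-- The real part of a quaternion. -/
def reH : Quaternion ℝ →ₗ[ℝ] ℝ where
  toFun z := z.re
  map_add' _ _ := rfl
  map_smul' _ _ := rfl

@[simp] theorem reH_apply (z : Quaternion ℝ) : reH z = z.re := rfl

theorem re_star_unitsH_mul (a b : Fin 4) :
    reH (star (unitsH a) * unitsH b) = if a = b then 1 else 0 := by
  fin_cases a <;> fin_cases b <;> simp

theorem star_unitsH_mul_self (a : Fin 4) : star (unitsH a) * unitsH a = 1 := by
  fin_cases a <;> ext <;> simp [Quaternion.re_one, Quaternion.imI_one, Quaternion.imJ_one, Quaternion.imK_one]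

theorem unitsH_mul_star_self (a : Fin 4) : unitsH a * star (unitsH a) = 1 := by
  fin_cases a <;> ext <;> simp [Quaternion.re_one, Quaternion.imI_one, Quaternion.imJ_one, Quaternion.imK_one]

theorem reH_comm (x y : Quaternion ℝ) : reH (x * y) = reH (y * x) := by
  simp only [reH_apply, Quaternion.re_mul]
  ring

theorem starFrame_quaternion : StarFrame unitsH reH where
  re_star z := by simp
  re_comm := reH_comm
  star_smul t z := Quaternion.star_smul t z
  gram := re_star_unitsH_mul
  expand z := by ext <;> simp [Fin.sum_univ_four]
  inv_left := star_unitsH_mul_self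
  inv_right := unitsH_mul_star_self
  twist z := by ext <;> simp [Fin.sum_univ_four] <;> ring
  rot a b h := by
    have h1 : (unitsH b * star (unitsH a)).re = 0 := by
      have := re_star_unitsH_mul a b
      rwa [if_neg h, reH_comm] at this
    have h2 : star (unitsH b * star (unitsH a)) * (unitsH b * star (unitsH a)) = 1 := by
      rw [star_mul, star_star, mul_assoc, ← mul_assoc (star (unitsH b)), star_unitsH_mul_self,
        one_mul, unitsH_mul_star_self]
    have h3 : star (unitsH b * star (unitsH a)) = -(unitsH b * star (unitsH a)) := by
      ext
      · rw [Quaternion.re_star, Quaternion.re_neg, h1, neg_zero]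
      all_goals rfl
    rwa [h3, neg_mul, neg_eq_iff_eq_neg] at h2

theorem conjTranspose_lie {X Z : Matrix I I F} (hX : Xᴴ = -X)
    (hZ : Zᴴ = -Z) : (⁅X, Z⁆)ᴴ = -⁅X, Z⁆ := by
  rw [Ring.lie_def, Matrix.conjTranspose_sub, conjTranspose_mul, conjTranspose_mul, hX, hZ]
  simp

theorem conjTranspose_skewE (i j : I) (z : F) : (skewE i j z)ᴴ = -skewE i j z := by
  rw [skewE, Matrix.conjTranspose_sub, Matrix.conjTranspose_single, Matrix.conjTranspose_single,
    star_star, neg_sub]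

theorem conjTranspose_conj (h : Matrix I I F) {X : Matrix I I F} (hX : Xᴴ = -X) :
    (h * X * hᴴ)ᴴ = -(h * X * hᴴ) := by
  rw [conjTranspose_mul, conjTranspose_mul, hX, Matrix.conjTranspose_conjTranspose,
    ← mul_assoc, mul_neg, neg_mul]

theorem trace_skewE {i j : I} (h : i ≠ j) (z : F) : (skewE i j z).trace = 0 := by
  rw [skewE, Matrix.trace_sub, Matrix.trace_single_eq_of_ne _ _ _ h,
    Matrix.trace_single_eq_of_ne _ _ _ h.symm, sub_zero]

theorem SkewModel.of_mem_iff {G : LieSubalgebra ℝ (Matrix I I F)}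
    (h : ∀ X, X ∈ G ↔ Xᴴ = -X)
    (ht : ∀ t : F, star t = -t → ∀ z, ∑ a, re (star (u a) * t * u a * z) = 0) :
    SkewModel u re G where
  skew X hX := (h X).1 hX
  lie X hX Z hZ := (h _).2 (conjTranspose_lie ((h X).1 hX) hZ)
  skewE_mem i j z _ := (h _).2 (conjTranspose_skewE i j z)
  conj a X _ _ hX := (h _).2 (conjTranspose_conj a ((h X).1 hX))
  trace_twist X hX := ht _ (by rw [← Matrix.trace_conjTranspose, (h X).1 hX, Matrix.trace_neg])

theorem skewModel_so : SkewModel unitsR LinearMap.id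
    (LieAlgebra.Orthogonal.so I ℝ) :=
  SkewModel.of_mem_iff (fun X => by
      rw [LieAlgebra.Orthogonal.mem_so, Matrix.conjTranspose_eq_transpose_of_trivial])
    (fun t ht z => by
      rw [star_trivial] at ht
      rw [show t = 0 by linarith]
      simp)

theorem skewModel_su : SkewModel unitsC Complex.reLm (su I) where
  skew X hX := hX.1
  lie X hX Z hZ := ⟨conjTranspose_lie hX.1 hZ, by
    rw [Ring.lie_def, Matrix.trace_sub, Matrix.trace_mul_comm, sub_self]⟩
  skewE_mem i j z h := ⟨conjTranspose_skewE i j z, trace_skewE h z⟩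
  conj h X h1 _ hX := ⟨conjTranspose_conj h hX.1, by
    rw [Matrix.trace_mul_comm, ← mul_assoc, h1, one_mul, hX.2]⟩
  trace_twist X hX z := by simp [hX.2]

theorem skewModel_sp : SkewModel unitsH reH (sp I) :=
  SkewModel.of_mem_iff (fun X => Iff.rfl) (fun t ht z => by
    have h0 : t.re = 0 := by
      have := congrArg QuaternionAlgebra.re ht
      simp at this
      linarith
    have h1 : ∑ a, star (unitsH a) * t * unitsH a = 0 := by
      ext <;> simp [Fin.sum_univ_four, h0,
        Quaternion.re_zero, Quaternion.imI_zero, Quaternion.imJ_zero, Quaternion.imK_zero]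
    rw [← map_sum, ← sum_mul, h1, zero_mul, map_zero])

/-! ### The flag spaces -/

theorem Pos.eq_of_mem {k m : ℕ} {p p' : Pos k m} (h : p.src = p'.src ∨ p.src = p'.tgt)
    (h' : p.tgt = p'.src ∨ p.tgt = p'.tgt) : p = p' := by
  rcases h with h | h
  · rcases h' with h' | h'
    · exact absurd (h.trans h'.symm) p.ne
    · exact Pos.ext_iff.2 ⟨h, h'⟩
  · rcases h' with h' | h'
    · exact absurd h' (p.src_ne_tgt p' h)
    · exact absurd (h.trans h'.symm) p.ne

section FlagData
variable {G : LieSubalgebra ℝ (Matrix (Idx k m) (Idx k m) F)}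
  {T : Set (Matrix (Idx k m) (Idx k m) F)}
  {e : Basis (Pos k m × κ) ℝ (tangent (blockSub G (blk k m)))}

/-- The frame of elementary matrices has all that is needed in a generalized Wallach space. -/
theorem exists_flagData [Nonempty κ] (M : SkewModel u re G) (S : StarFrame u re)
    (hK : 0 < killConst (Idx k m) κ) (hk : 0 < k) (hm : 0 < m)
    (hT : ∀ h ∈ T, ∀ i j, blk k m i ≠ blk k m j → h i j = 0)
    (H : HasTurns G (adSet G T))
    (hu : ∀ (p : Pos k m) (a a' : κ), a ≠ a' →
      ∃ d, HasMono G (adSet G T) 1 d ∧ d p.src * u a * star (d p.tgt) = u a')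
    (hsep : ∀ e : Basis (Pos k m × κ) ℝ (tangent (blockSub G (blk k m))), IsFlagFrame u e →
      ∀ q q', q ≠ q' → q.1.sec = q'.1.sec → Separated (adSet G T) e q q') {b c : ℝ}
    (hb : b = m * card κ / (2 * killConst (Idx k m) κ))
    (hc : c = k * card κ / (2 * killConst (Idx k m) κ)) :
    ∃ e : Basis (Pos k m × κ) ℝ (tangent (blockSub G (blk k m))), IsFlagFrame u e ∧
      WallachData (blockSub G (blk k m)) (adSet G T) (blockMods G (blk k m)) e
        (fun q => q.1.sec) (2 * killConst (Idx k m) κ) b c := by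
  obtain ⟨e, E, W⟩ := exists_flagFrame M S hK hk hm
  have hst := blockMods_stable (G := G) hT
  obtain ⟨a, ha⟩ := W.exists_isIsotropic hst
    (isBlockSchur_of_separated (hsep e E) fun _ _ h => E.eqvGen H.quarter hu h)
  have hk' : (0 : ℝ) < k := Nat.cast_pos.2 hk
  have hm' : (0 : ℝ) < m := Nat.cast_pos.2 hm
  have hκ : (0 : ℝ) < card κ := Nat.cast_pos.2 Fintype.card_pos
  have ha' := E.isotropy M S W hk hm ha
  rw [← hb, ← hc] at ha'
  exact ⟨e, E, W, hst, ha' ▸ ha, by rw [hb]; positivity, by rw [hc]; positivity, by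
    rw [card_sec, card_sec]; rfl⟩

theorem IsFlagFrame.isSchur (E : IsFlagFrame u e) (H : HasTurns G (adSet G T))
    (hu : ∀ (p : Pos k m) (a a' : κ), a ≠ a' →
      ∃ d, HasMono G (adSet G T) 1 d ∧ d p.src * u a * star (d p.tgt) = u a')
    (hsep : ∀ q q', q ≠ q' → Separated (adSet G T) e q q') :
    IsSchur (adSet G T) e fun q => q.1.sec :=
  isSchur_of_separated hsep fun _ _ h => E.eqvGen H.quarter hu h

/-- Vectors in the same matrix entry are separated by a unit. -/
theorem IsFlagFrame.separated_unit (S : StarFrame u re) (E : IsFlagFrame u e) (p : Pos k m)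
    {a a' : κ} (h : a ≠ a') {d : Idx k m → F} (hd : HasMono G (adSet G T) 1 d)
    (h1 : d p.src = u a' * star (u a)) (h2 : d p.tgt = 1) :
    Separated (adSet G T) e (p, a) (p, a') := by
  refine E.separated_turn hd rfl rfl ?_ rfl rfl ?_
  · rw [h1, h2, star_one, mul_one, mul_assoc, S.inv_left, mul_one]
  · rw [h1, h2, star_one, mul_one]
    have h3 : u a' * star (u a) * u a = u a' := by rw [mul_assoc, S.inv_left, mul_one]
    have h4 := congrArg (· * u a) (S.rot a a' h)
    simp only [neg_one_mul] at h4
    rwa [mul_assoc, h3] at h4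
end FlagData

theorem killConst_idx (k m : ℕ) (κ : Type*) [Fintype κ] : killConst (Idx k m) κ =
    (k + 2 * m) * card κ + 2 * card κ - 4 := by
  simp only [killConst, Fintype.card_sum, card_fin]
  push_cast
  ring

/-! #### Real flags -/

section Real
theorem mono_mem_specialOrthogonal {n : ℕ} {σ : Perm (Fin n)} {d : Fin n → ℝ}
    (h : IsTurn σ d) : mono σ d ∈ specialOrthogonalGroup (Fin n) ℝ := by
  rw [Matrix.mem_specialOrthogonalGroup_iff, Matrix.mem_orthogonalGroup_iff]
  exact ⟨mono_mul_conjTranspose fun i => (h.star_mul_self i).2, (det_mono σ d).trans h.sign_mul_prod⟩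

theorem hasTurns₁ : HasTurns (g₁ k m) (Ad₁ k m) := by
  intro σ₀ σ₁ σ₂ d₀ d₁ d₂ h₀ h₁ h₂
  refine skewModel_so.hasMono ⟨_, mono_mem_specialOrthogonal h₀, _, mono_mem_specialOrthogonal h₁, _,
    mono_mem_specialOrthogonal h₂, (diag3_mono _ _ _ _ _ _).symm⟩ ?_ ?_
  · rintro (i | i | i)
    exacts [(h₀.star_mul_self i).1, (h₁.star_mul_self i).1, (h₂.star_mul_self i).1]
  · rintro (i | i | i)
    exacts [(h₀.star_mul_self i).2, (h₁.star_mul_self i).2, (h₂.star_mul_self i).2]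
variable {e : Basis (Pos k m × Unit) ℝ (tangent (k₁ k m))}

theorem separated₁_of_sec_eq (E : IsFlagFrame unitsR e)
    (hm : ∀ j j' : Fin m, j ≠ j' → ∃ c, c ≠ j ∧ c ≠ j') (q q' : Pos k m × Unit) (hq : q ≠ q')
    (h : q.1.sec = q'.1.sec) : Separated (Ad₁ k m) e q q' := by
  have hquarter : ∀ {p p' : Pos k m}, p.src ≠ p'.src → p.tgt = p'.tgt →
      blk k m p.src = blk k m p'.src → Separated (Ad₁ k m) e (p, ()) (p', ()) := by
    intro p p' h1 h2 h3
    have h4 : p.tgt ≠ p.src := p.ne.symm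
    have h5 : p.tgt ≠ p'.src := h2 ▸ p'.ne.symm
    have h6 := swap_apply_of_ne_of_ne h4 h5
    refine E.separated_turn (hasTurns₁.quarter _ _ h1 h3) (swap_apply_left _ _) ?_ ?_
      (swap_apply_right _ _) ?_ ?_
    · exact h6.trans h2
    · simp [update_of_ne h1, update_of_ne h5]
    · change swap p.src p'.src p'.tgt = p.tgt
      rw [← h2, h6]
    · simp [← h2, update_of_ne h5]
  have hhalf : ∀ {p p' : Pos k m} (c : Idx k m), p.tgt ≠ c → p'.tgt ≠ p.tgt → p'.tgt ≠ c →
      blk k m p.tgt = blk k m c → blk k m p'.tgt = blk k m p.tgt →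
      Separated (Ad₁ k m) e (p, ()) (p', ()) := by
    intro p p' c h1 h2 h3 h4 h5
    have h6 : p.src ≠ p.tgt := p.ne
    have h7 : p.src ≠ c := fun h => p.blk_ne (by rw [h4, h])
    have h8 : p'.src ≠ p.tgt := fun h => p'.blk_ne (by rw [h, h5])
    have h9 : p'.src ≠ c := fun h => p'.blk_ne (by rw [h, h5, h4])
    refine E.separated_sign (hasTurns₁.half _ _ h1 h4) (Or.inr ⟨?_, ?_⟩)
    · simp [update_of_ne h6, update_of_ne h7, update_of_ne h1]
    · simp [update_of_ne h2, update_of_ne h3, update_of_ne h8, update_of_ne h9]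
  obtain ⟨p, ⟨⟩⟩ := q
  obtain ⟨p', ⟨⟩⟩ := q'
  have hne : p ≠ p' := fun h => hq (by rw [h])
  rcases p with ⟨i, j⟩ | ⟨i, j⟩ | ⟨i, j⟩ <;> rcases p' with ⟨i', j'⟩ | ⟨i', j'⟩ | ⟨i', j'⟩ <;>
    simp [Pos.sec] at h <;> by_cases hj : j = j'
  · exact hquarter (fun h => hne (by cases h; rw [hj])) (by rw [hj]; rfl) rfl
  · obtain ⟨c, h1, h2⟩ := hm j j' hj
    exact hhalf (.inr (.inl c)) (fun h => h1 (by cases h; rfl)) (fun h => hj (by cases h; rfl))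
      (fun h => h2 (by cases h; rfl)) rfl rfl
  · exact hquarter (fun h => hne (by cases h; rw [hj])) (by rw [hj]; rfl) rfl
  · obtain ⟨c, h1, h2⟩ := hm j j' hj
    exact hhalf (.inr (.inr c)) (fun h => h1 (by cases h; rfl)) (fun h => hj (by cases h; rfl))
      (fun h => h2 (by cases h; rfl)) rfl rfl
  · exact hquarter (fun h => hne (by cases h; rw [hj])) (by rw [hj]; rfl) rfl
  · obtain ⟨c, h1, h2⟩ := hm j j' hj
    exact hhalf (.inr (.inr c)) (fun h => h1 (by cases h; rfl)) (fun h => hj (by cases h; rfl))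
      (fun h => h2 (by cases h; rfl)) rfl rfl

theorem separated₁ (E : IsFlagFrame unitsR e)
    (hm : ∀ j j' : Fin m, j ≠ j' → ∃ c, c ≠ j ∧ c ≠ j') (hm' : ∀ j : Fin m, ∃ c, c ≠ j)
    (q q' : Pos k m × Unit) (hq : q ≠ q') : Separated (Ad₁ k m) e q q' := by
  by_cases h : q.1.sec = q'.1.sec
  · exact separated₁_of_sec_eq E hm q q' hq h
  obtain ⟨p, ⟨⟩⟩ := q
  obtain ⟨p', ⟨⟩⟩ := q'
  have key : ∀ p p' : Pos k m, p.sec < p'.sec →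
      (∃ d, HasMono (g₁ k m) (Ad₁ k m) 1 d ∧ (d p.src * d p.tgt = 1 ∧ d p'.src * d p'.tgt = -1 ∨
        d p.src * d p.tgt = -1 ∧ d p'.src * d p'.tgt = 1)) := by
    rintro (⟨i, j⟩ | ⟨i, j⟩ | ⟨i, j⟩) (⟨i', j'⟩ | ⟨i', j'⟩ | ⟨i', j'⟩) h <;> simp [Pos.sec] at h
    · obtain ⟨c, hc⟩ := hm' j
      refine ⟨_, hasTurns₁.half (.inr (.inl j)) (.inr (.inl c)) (by simpa using hc.symm) rfl, ?_⟩
      right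
      simp [Pos.src, Pos.tgt, hc.symm]
    · obtain ⟨c, hc⟩ := hm' j'
      refine ⟨_, hasTurns₁.half (.inr (.inr j')) (.inr (.inr c)) (by simpa using hc.symm) rfl, ?_⟩
      left
      simp [Pos.src, Pos.tgt, hc.symm]
    · obtain ⟨c, hc⟩ := hm' i'
      refine ⟨_, hasTurns₁.half (.inr (.inl i')) (.inr (.inl c)) (by simpa using hc.symm) rfl, ?_⟩
      left
      simp [Pos.src, Pos.tgt, hc.symm]
  rcases lt_or_gt_of_ne h with h | h
  · obtain ⟨d, h1, h2⟩ := key p p' h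
    exact E.separated_sign h1 (by simpa using h2)
  · obtain ⟨d, h1, h2⟩ := key p' p h
    exact E.separated_sign h1 (by simpa using h2.symm.imp And.symm And.symm)

theorem blockDiag₁ (h : Matrix (Idx k m) (Idx k m) ℝ)
    (hh : h ∈ {h | ∃ x ∈ specialOrthogonalGroup (Fin k) ℝ, ∃ y ∈ specialOrthogonalGroup (Fin m) ℝ,
      ∃ z ∈ specialOrthogonalGroup (Fin m) ℝ, h = diag3 x y z}) (i j : Idx k m)
    (hij : blk k m i ≠ blk k m j) : h i j = 0 := by
  obtain ⟨x, -, y, -, z, -, rfl⟩ := hh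
  exact diag3_eq_zero x y z i j hij

theorem exists_wallachData₁ (hk : 0 < k) (hm : 0 < m) (hkm : 2 < k + 2 * m)
    (hm' : ∀ j j' : Fin m, j ≠ j' → ∃ c, c ≠ j ∧ c ≠ j') {b c : ℝ}
    (hb : b = m / (2 * (k + 2 * m - 2))) (hc : c = k / (2 * (k + 2 * m - 2))) :
    ∃ e : Basis (Pos k m × Unit) ℝ (tangent (k₁ k m)),
      IsFlagFrame unitsR e ∧ WallachData (k₁ k m) (Ad₁ k m) (p₁ k m) e
        (fun q => q.1.sec) (2 * killConst (Idx k m) Unit) b c := by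
  have h1 : killConst (Idx k m) Unit = k + 2 * m - 2 := by
    rw [killConst_idx]
    simp
    ring
  have h2 : (2 : ℝ) < k + 2 * m := by exact_mod_cast hkm
  refine exists_flagData skewModel_so starFrame_real (by rw [h1]; linarith) hk hm blockDiag₁
    hasTurns₁ (fun p a a' h => absurd (Subsingleton.elim a a') h)
    (fun e E q q' => separated₁_of_sec_eq E hm' q q') ?_ ?_
  · rw [h1, hb]; simp
  · rw [h1, hc]; simp

theorem exists_ne_ne (hm : 3 ≤ m) (j j' : Fin m) : ∃ c, c ≠ j ∧ c ≠ j' := by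
  obtain ⟨c, hc⟩ := Finset.exists_mem_notMem_of_card_lt_card (s := {j, j'}) (t := Finset.univ)
    (lt_of_le_of_lt Finset.card_le_two (by simp; omega))
  exact ⟨c, by simpa using hc⟩

theorem isSchur₁ (E : IsFlagFrame unitsR e)
    (hm : 3 ≤ m) : IsSchur (Ad₁ k m) e fun q => q.1.sec :=
  E.isSchur hasTurns₁ (fun p a a' h => absurd (Subsingleton.elim a a') h)
    (separated₁ E (fun j j' _ => exists_ne_ne hm j j') fun j => by
      have : Nontrivial (Fin m) := Fin.nontrivial_iff_two_le.2 (by omega)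
      exact exists_ne j)
end Real

/-! #### Complex flags -/

section Complex
theorem hasMono₂ {σ₀ : Perm (Fin k)} {σ₁ σ₂ : Perm (Fin m)} {d₀ : Fin k → ℂ}
    {d₁ d₂ : Fin m → ℂ} (h₀ : ∀ i, star (d₀ i) * d₀ i = 1) (h₁ : ∀ i, star (d₁ i) * d₁ i = 1)
    (h₂ : ∀ i, star (d₂ i) * d₂ i = 1)
    (h : (((Perm.sign σ₀ : ℤ) : ℂ) * ∏ i, d₀ i) * (((Perm.sign σ₁ : ℤ) : ℂ) * ∏ i, d₁ i) *
      (((Perm.sign σ₂ : ℤ) : ℂ) * ∏ i, d₂ i) = 1) :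
    HasMono (g₂ k m) (Ad₂ k m) (Perm.sumCongr σ₀ (Perm.sumCongr σ₁ σ₂))
      (Sum.elim d₀ (Sum.elim d₁ d₂)) := by
  have hu : ∀ {n : ℕ} {σ : Perm (Fin n)} {d : Fin n → ℂ}, (∀ i, star (d i) * d i = 1) →
      mono σ d ∈ Matrix.unitaryGroup (Fin n) ℂ := fun h =>
    Matrix.mem_unitaryGroup_iff'.2 (conjTranspose_mono_mul h)
  refine skewModel_su.hasMono ⟨_, hu h₀, _, hu h₁, _, hu h₂, ?_, (diag3_mono _ _ _ _ _ _).symm⟩ ?_ ?_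
  · exact (congrArg₂ _ (congrArg₂ _ (det_mono _ _) (det_mono _ _)) (det_mono _ _)).trans h
  · rintro (i | i | i)
    exacts [h₀ i, h₁ i, h₂ i]
  · rintro (i | i | i)
    exacts [(mul_comm _ _).trans (h₀ i), (mul_comm _ _).trans (h₁ i), (mul_comm _ _).trans (h₂ i)]

theorem hasTurns₂ : HasTurns (g₂ k m) (Ad₂ k m) := by
  intro σ₀ σ₁ σ₂ d₀ d₁ d₂ h₀ h₁ h₂
  refine hasMono₂ (fun i => (h₀.star_mul_self i).1) (fun i => (h₁.star_mul_self i).1)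
    (fun i => (h₂.star_mul_self i).1) ?_
  rw [h₀.sign_mul_prod, h₁.sign_mul_prod, h₂.sign_mul_prod, one_mul, one_mul]

/-- Diagonal matrices with inverse units in two places. -/
theorem hasMono₂_phase {v t : Idx k m} (hvt : v ≠ t) {c : ℂ} (hc : star c * c = 1) :
    HasMono (g₂ k m) (Ad₂ k m) 1 (update (update 1 v c) t (star c)) := by
  set d := update (update (1 : Idx k m → ℂ) v c) t (star c) with hd
  have h1 : ∀ i, star (d i) * d i = 1 := by
    intro i
    by_cases hi : i = t
    · simp only [hd, hi, update_self, star_star]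
      rw [mul_comm, hc]
    · by_cases hi' : i = v
      · rw [hd, hi', update_of_ne (hi' ▸ hi), update_self, hc]
      · simp [hd, update_of_ne hi, update_of_ne hi']
  have h2 : ∏ i, d i = 1 := by
    rw [hd, Finset.prod_update_of_mem (mem_univ t), Finset.sdiff_singleton_eq_erase,
      ← Finset.mul_prod_erase (Finset.univ.erase t) _ (a := v) (by simp [hvt]),
      update_self, Finset.prod_congr rfl fun i hi => by
        rw [update_of_ne (Finset.mem_erase.1 hi).1, Pi.one_apply], Finset.prod_const_one,
      mul_one, hc]
  have := hasMono₂ (k := k) (m := m) (σ₀ := 1) (σ₁ := 1) (σ₂ := 1) (d₀ := fun i => d (.inl i))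
    (d₁ := fun i => d (.inr (.inl i))) (d₂ := fun i => d (.inr (.inr i))) (fun i => h1 _)
    (fun i => h1 _) (fun i => h1 _) (by
      rw [Fintype.prod_sum_type, Fintype.prod_sum_type] at h2
      simpa [mul_assoc] using h2)
  rw [Equiv.Perm.sumCongr_one, Equiv.Perm.sumCongr_one] at this
  convert this using 1
  funext i
  rcases i with i | i | i <;> rfl

theorem exists_third (hk : 0 < k) (hm : 0 < m) (p : Pos k m) : ∃ t, t ≠ p.src ∧ t ≠ p.tgt := by
  rcases p with p | p | p
  · exact ⟨.inr (.inr ⟨0, hm⟩), by simp [Pos.src, Pos.tgt]⟩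
  · exact ⟨.inr (.inl ⟨0, hm⟩), by simp [Pos.src, Pos.tgt]⟩
  · exact ⟨.inl ⟨0, hk⟩, by simp [Pos.src, Pos.tgt]⟩

theorem exists_unit₂ (hk : 0 < k) (hm : 0 < m) (p : Pos k m) (a a' : Fin 2) :
    ∃ d, HasMono (g₂ k m) (Ad₂ k m) 1 d ∧ d p.src = unitsC a' * star (unitsC a) ∧ d p.tgt = 1 := by
  obtain ⟨t, h1, h2⟩ := exists_third hk hm p
  have S := starFrame_complex
  refine ⟨_, hasMono₂_phase (v := p.src) h1.symm (c := unitsC a' * star (unitsC a)) ?_, ?_, ?_⟩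
  · rw [star_mul, star_star, mul_assoc, ← mul_assoc (star (unitsC a')), S.inv_left, one_mul,
      S.inv_right]
  · rw [update_of_ne h1.symm, update_self]
  · rw [update_of_ne h2.symm, update_of_ne p.ne.symm, Pi.one_apply]
variable {e : Basis (Pos k m × Fin 2) ℝ (tangent (k₂ k m))}

theorem separated₂ (E : IsFlagFrame unitsC e) (hk : 0 < k) (hm : 0 < m) (q q' : Pos k m × Fin 2)
    (hq : q ≠ q') : Separated (Ad₂ k m) e q q' := by
  obtain ⟨p, a⟩ := q
  obtain ⟨p', a'⟩ := q'
  by_cases hp : p = p'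
  · subst hp
    obtain ⟨d, h1, h2, h3⟩ := exists_unit₂ hk hm p a a'
    exact E.separated_unit starFrame_complex p (fun h => hq (by rw [h])) h1 h2 h3
  have hI : ∀ z : ℂ, Complex.I * z * star (star Complex.I) = -z := fun z => by
    rw [star_star, mul_right_comm, Complex.I_mul_I, neg_one_mul]
  have hd : ∀ (c : ℂ) (i : Idx k m), i ≠ p.src → i ≠ p.tgt →
      update (update (1 : Idx k m → ℂ) p.src c) p.tgt (star c) i = 1 := by
    intro c i h1 h2
    rw [update_of_ne h2, update_of_ne h1, Pi.one_apply]
  have hs : ∀ c : ℂ,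
      update (update (1 : Idx k m → ℂ) p.src c) p.tgt (star c) p.src = c := by
    intro c
    rw [update_of_ne p.ne, update_self]
  have h1 : (p'.src = p.src ∨ p'.src = p.tgt) → ¬(p'.tgt = p.src ∨ p'.tgt = p.tgt) :=
    fun h h' => hp (Pos.eq_of_mem h h').symm
  by_cases hsrc : p'.src = p.src ∨ p'.src = p.tgt
  · have h2 := h1 hsrc
    rw [not_or] at h2
    refine E.separated_sign (hasMono₂_phase p.ne (c := -1) (by simp)) (Or.inl ⟨?_, ?_⟩)
    · simp [update_of_ne p.ne]
    · simp only [hd _ _ h2.1 h2.2]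
      rcases hsrc with h | h
      · rw [h, hs]; simp
      · rw [h]; simp
  · rw [not_or] at hsrc
    by_cases htgt : p'.tgt = p.src ∨ p'.tgt = p.tgt
    · refine E.separated_sign (hasMono₂_phase p.ne (c := -1) (by simp)) (Or.inl ⟨?_, ?_⟩)
      · simp [update_of_ne p.ne]
      · simp only [hd _ _ hsrc.1 hsrc.2]
        rcases htgt with h | h
        · rw [h, hs]; simp
        · rw [h]; simp
    · rw [not_or] at htgt
      refine E.separated_sign (hasMono₂_phase p.ne (c := Complex.I) (by simp)) (Or.inr ⟨?_, ?_⟩)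
      · rw [hs, update_self]
        exact hI _
      · rw [hd _ _ hsrc.1 hsrc.2, hd _ _ htgt.1 htgt.2, one_mul, star_one, mul_one]

theorem exists_turn₂ (hk : 0 < k) (hm : 0 < m) (p : Pos k m) (a a' : Fin 2) (_ : a ≠ a') :
    ∃ d, HasMono (g₂ k m) (Ad₂ k m) 1 d ∧ d p.src * unitsC a * star (d p.tgt) = unitsC a' := by
  obtain ⟨d, h1, h2, h3⟩ := exists_unit₂ hk hm p a a'
  refine ⟨d, h1, ?_⟩
  rw [h2, h3, star_one, mul_one, mul_assoc, starFrame_complex.inv_left, mul_one]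

theorem exists_wallachData₂ (hk : 0 < k) (hm : 0 < m) {b c : ℝ}
    (hb : b = m / (2 * (k + 2 * m))) (hc : c = k / (2 * (k + 2 * m))) :
    ∃ e : Basis (Pos k m × Fin 2) ℝ (tangent (k₂ k m)), IsSchur (Ad₂ k m) e (fun q => q.1.sec) ∧
      WallachData (k₂ k m) (Ad₂ k m) (p₂ k m) e (fun q => q.1.sec)
        (2 * killConst (Idx k m) (Fin 2)) b c := by
  have h1 : killConst (Idx k m) (Fin 2) = 2 * (k + 2 * m) := by
    rw [killConst_idx]
    simp
    ring
  have h2 : (0 : ℝ) < k := Nat.cast_pos.2 hk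
  obtain ⟨e, E, D⟩ := exists_flagData (b := b) (c := c) skewModel_su starFrame_complex
    (by rw [h1]; positivity) hk hm
    (fun h hh i j hij => by
      obtain ⟨x, -, y, -, z, -, -, rfl⟩ := hh
      exact diag3_eq_zero x y z i j hij)
    hasTurns₂ (exists_turn₂ hk hm) (fun e E q q' hq _ => separated₂ E hk hm q q' hq)
    (by rw [h1, hb]; simp; field_simp) (by rw [h1, hc]; simp; field_simp)
  exact ⟨e, E.isSchur hasTurns₂ (exists_turn₂ hk hm) (separated₂ E hk hm), D⟩
end Complex

/-! #### Quaternionic flags -/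

section Quaternion
theorem hasMono₃ {σ₀ : Perm (Fin k)} {σ₁ σ₂ : Perm (Fin m)} {d₀ : Fin k → Quaternion ℝ}
    {d₁ d₂ : Fin m → Quaternion ℝ} (h₀ : ∀ i, star (d₀ i) * d₀ i = 1 ∧ d₀ i * star (d₀ i) = 1)
    (h₁ : ∀ i, star (d₁ i) * d₁ i = 1 ∧ d₁ i * star (d₁ i) = 1)
    (h₂ : ∀ i, star (d₂ i) * d₂ i = 1 ∧ d₂ i * star (d₂ i) = 1) :
    HasMono (g₃ k m) (Ad₃ k m) (Perm.sumCongr σ₀ (Perm.sumCongr σ₁ σ₂))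
      (Sum.elim d₀ (Sum.elim d₁ d₂)) := by
  have hu : ∀ {n : ℕ} {σ : Perm (Fin n)} {d : Fin n → Quaternion ℝ},
      (∀ i, star (d i) * d i = 1 ∧ d i * star (d i) = 1) →
      mono σ d ∈ unitary (Matrix (Fin n) (Fin n) (Quaternion ℝ)) := fun h =>
    Unitary.mem_iff.2 ⟨conjTranspose_mono_mul fun i => (h i).1, mono_mul_conjTranspose fun i => (h i).2⟩
  refine skewModel_sp.hasMono ⟨_, hu h₀, _, hu h₁, _, hu h₂, (diag3_mono _ _ _ _ _ _).symm⟩ ?_ ?_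
  · rintro (i | i | i)
    exacts [(h₀ i).1, (h₁ i).1, (h₂ i).1]
  · rintro (i | i | i)
    exacts [(h₀ i).2, (h₁ i).2, (h₂ i).2]

theorem hasTurns₃ : HasTurns (g₃ k m) (Ad₃ k m) := fun _ _ _ _ _ _ h₀ h₁ h₂ =>
  hasMono₃ h₀.star_mul_self h₁.star_mul_self h₂.star_mul_self

theorem hasMono₃_diag {v : Idx k m} {c : Quaternion ℝ} (hc : star c * c = 1) (hc' : c * star c = 1) :
    HasMono (g₃ k m) (Ad₃ k m) 1 (update 1 v c) := by
  set d := update (1 : Idx k m → Quaternion ℝ) v c with hd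
  have h1 : ∀ i, star (d i) * d i = 1 ∧ d i * star (d i) = 1 := by
    intro i
    by_cases hi : i = v
    · simp only [hd, hi, update_self]
      exact ⟨hc, hc'⟩
    · simp [hd, update_of_ne hi]
  have := hasMono₃ (k := k) (m := m) (σ₀ := 1) (σ₁ := 1) (σ₂ := 1) (d₀ := fun i => d (.inl i))
    (d₁ := fun i => d (.inr (.inl i))) (d₂ := fun i => d (.inr (.inr i))) (fun i => h1 _)
    (fun i => h1 _) (fun i => h1 _)
  rw [Equiv.Perm.sumCongr_one, Equiv.Perm.sumCongr_one] at this
  convert this using 1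
  funext i
  rcases i with i | i | i <;> rfl

theorem exists_unit₃ (p : Pos k m) (a a' : Fin 4) : ∃ d, HasMono (g₃ k m) (Ad₃ k m) 1 d ∧
    d p.src = unitsH a' * star (unitsH a) ∧ d p.tgt = 1 := by
  have S := starFrame_quaternion
  refine ⟨_, hasMono₃_diag (v := p.src) (c := unitsH a' * star (unitsH a)) ?_ ?_, ?_, ?_⟩
  · rw [star_mul, star_star, mul_assoc, ← mul_assoc (star (unitsH a')), S.inv_left, one_mul,
      S.inv_right]
  · rw [star_mul, star_star, mul_assoc, ← mul_assoc (star (unitsH a)), S.inv_left, one_mul,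
      S.inv_right]
  · rw [update_self]
  · rw [update_of_ne p.ne.symm, Pi.one_apply]

theorem exists_turn₃ (p : Pos k m) (a a' : Fin 4) (_ : a ≠ a') :
    ∃ d, HasMono (g₃ k m) (Ad₃ k m) 1 d ∧ d p.src * unitsH a * star (d p.tgt) = unitsH a' := by
  obtain ⟨d, h1, h2, h3⟩ := exists_unit₃ p a a'
  refine ⟨d, h1, ?_⟩
  rw [h2, h3, star_one, mul_one, mul_assoc, starFrame_quaternion.inv_left, mul_one]
variable {e : Basis (Pos k m × Fin 4) ℝ (tangent (k₃ k m))}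

theorem separated₃ (E : IsFlagFrame unitsH e) (q q' : Pos k m × Fin 4)
    (hq : q ≠ q') : Separated (Ad₃ k m) e q q' := by
  obtain ⟨p, a⟩ := q
  obtain ⟨p', a'⟩ := q'
  by_cases hp : p = p'
  · subst hp
    obtain ⟨d, h1, h2, h3⟩ := exists_unit₃ p a a'
    exact E.separated_unit starFrame_quaternion p (fun h => hq (by rw [h])) h1 h2 h3
  have key : ∀ v, (v = p.src ∨ v = p.tgt) → p'.src ≠ v → p'.tgt ≠ v →
      Separated (Ad₃ k m) e (p, a) (p', a') := by
    intro v h1 h2 h3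
    refine E.separated_sign (hasMono₃_diag (v := v) (c := -1) (by simp) (by simp)) (Or.inr ⟨?_, ?_⟩)
    · rcases h1 with rfl | rfl
      · simp [update_of_ne p.ne.symm]
      · simp [update_of_ne p.ne]
    · simp [update_of_ne h2, update_of_ne h3]
  by_cases hsrc : p.src = p'.src ∨ p.src = p'.tgt
  · have h2 : ¬(p.tgt = p'.src ∨ p.tgt = p'.tgt) := fun h' => hp (Pos.eq_of_mem hsrc h')
    rw [not_or] at h2
    exact key p.tgt (Or.inr rfl) (Ne.symm h2.1) (Ne.symm h2.2)
  · rw [not_or] at hsrc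
    exact key p.src (Or.inl rfl) (Ne.symm hsrc.1) (Ne.symm hsrc.2)

theorem exists_wallachData₃ (hk : 0 < k) (hm : 0 < m) {b c : ℝ}
    (hb : b = m / (2 * (k + 2 * m + 1))) (hc : c = k / (2 * (k + 2 * m + 1))) :
    ∃ e : Basis (Pos k m × Fin 4) ℝ (tangent (k₃ k m)), IsSchur (Ad₃ k m) e (fun q => q.1.sec) ∧
      WallachData (k₃ k m) (Ad₃ k m) (p₃ k m) e (fun q => q.1.sec)
        (2 * killConst (Idx k m) (Fin 4)) b c := by
  have h1 : killConst (Idx k m) (Fin 4) = 4 * (k + 2 * m + 1) := by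
    rw [killConst_idx]
    simp
    ring
  obtain ⟨e, E, D⟩ := exists_flagData (b := b) (c := c) skewModel_sp starFrame_quaternion
    (by rw [h1]; positivity) hk hm
    (fun h hh i j hij => by
      obtain ⟨x, -, y, -, z, -, rfl⟩ := hh
      exact diag3_eq_zero x y z i j hij)
    hasTurns₃ exists_turn₃ (fun e E q q' hq _ => separated₃ E q q' hq)
    (by rw [h1, hb]; simp; field_simp) (by rw [h1, hc]; simp; field_simp)
  exact ⟨e, E.isSchur hasTurns₃ exists_turn₃ (separated₃ E), D⟩
end Quaternion

/-! ### The Einstein metrics of the families -/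

section HalfRows
variable {b c k m : ℝ}

section
variable (hk : 0 < k)
include hk

theorem discQ_half (hm : 0 < m) (hb : b = m / (2 * (k + 2 * m)))
    (hc : c = k / (2 * (k + 2 * m))) : √(discQ b c) = k / (k + 2 * m) := by
  rw [Real.sqrt_eq_iff_mul_self_eq_of_pos (by positivity), discQ, hb, hc]
  field_simp
  ring

theorem discP_half (hm : 0 < m) (hb : b = m / (2 * (k + 2 * m)))
    (hc : c = k / (2 * (k + 2 * m))) :
    √(discP b c) = 2 * m * (k + m) / (k + 2 * m) ^ 2 := by
  rw [Real.sqrt_eq_iff_mul_self_eq_of_pos (by positivity), discP, hb, hc]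
  field_simp
  ring

theorem qPlus_half (hm : 0 < m) (hb : b = m / (2 * (k + 2 * m)))
    (hc : c = k / (2 * (k + 2 * m))) : qPlus b c = 2 := by
  rw [qPlus, discQ_half hk hm hb hc, hb, hc]
  field_simp
  ring

theorem qMinus_half (hm : 0 < m) (hb : b = m / (2 * (k + 2 * m)))
    (hc : c = k / (2 * (k + 2 * m))) : qMinus b c = 2 * m / (k + m) := by
  rw [qMinus, discQ_half hk hm hb hc, hb, hc]
  field_simp
  ring

theorem one_sub_half (hm : 0 < m) (hb : b = m / (2 * (k + 2 * m))) :
    1 - 4 * b ^ 2 = (k + m) * (k + 3 * m) / (k + 2 * m) ^ 2 := by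
  rw [hb]
  field_simp
  ring

theorem pPlus_half (hm : 0 < m) (hb : b = m / (2 * (k + 2 * m)))
    (hc : c = k / (2 * (k + 2 * m))) : pPlus b c = (k + 3 * m) / (k + m) := by
  rw [pPlus, discP_half hk hm hb hc, one_sub_half hk hm hb, hb, hc]
  field_simp
  ring

theorem pMinus_half (hm : 0 < m) (hb : b = m / (2 * (k + 2 * m)))
    (hc : c = k / (2 * (k + 2 * m))) : pMinus b c = (k + m) / (k + 3 * m) := by
  rw [pMinus, discP_half hk hm hb hc, one_sub_half hk hm hb, hb, hc]
  field_simp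
  ring
end

namespace WallachData
variable {q t l u r : ℝ}

theorem half_bounds (hk : 0 < k) (hm : 0 < m) (hb : b = m / (2 * (k + 2 * m)))
    (hc : c = k / (2 * (k + 2 * m))) : 8 * b * (b + c) < 1 ∧ 0 < discQ b c ∧ 2 * c < 1 ∧
      2 * b < 1 ∧ 0 < wallachT b c := by
  refine ⟨?_, ?_, ?_, ?_, ?_⟩
  · rw [show 8 * b * (b + c) = 2 * m * (m + k) / (k + 2 * m) ^ 2 by rw [hb, hc]; field_simp; ring,
      div_lt_one (by positivity)]
    nlinarith [mul_pos hk hm, mul_pos hm hm, mul_pos hk hk]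
  · refine Real.sqrt_pos.1 ?_
    rw [discQ_half hk hm hb hc]
    positivity
  · rw [show 2 * c = k / (k + 2 * m) by rw [hc]; field_simp, div_lt_one (by positivity)]
    linarith
  · rw [show 2 * b = m / (k + 2 * m) by rw [hb]; field_simp, div_lt_one (by positivity)]
    linarith
  · rw [show wallachT b c = 2 * m ^ 2 * (m + k) / (k + 2 * m) ^ 3 by
      rw [wallachT, hb, hc]; field_simp; ring]
    positivity

section
variable (D : WallachData K Ad p e s w b c)
include D

theorem half_qPlus (hS : IsSchur Ad e s) (hk : 0 < k) (hm : 0 < m)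
    (hb : b = m / (2 * (k + 2 * m))) (hc : c = k / (2 * (k + 2 * m))) (hq : q = qPlus b c)
    (hu : u = (2 * k + m) / (k + 2 * m)) (hr : r = (k + m) / (k + 2 * m)) :
    q = 2 ∧ EinsteinRow K Ad (diagMetric K p (gq q)) {0, u} 0 u r ∧
      IsSaddle K Ad (diagMetric K p (gq q)) ∧ HasCoindex K Ad (diagMetric K p (gq q)) 1 := by
  obtain ⟨h8, hd, -⟩ := half_bounds hk hm hb hc
  have hq2 := hq.trans (qPlus_half hk hm hb hc)
  have h := D.row_qPlus hS h8 hd hq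
  have h1 : lamQ₁ b q = 0 := by
    rw [lamQ₁, hq2]
    norm_num
  have h2 : lamQ₂ b c q = u := by
    rw [lamQ₂, hq2, hu, hb, hc]
    field_simp
    ring
  have h3 : rhoQ b q = r := by
    rw [rhoQ, hq2, hr, hb]
    field_simp
    ring
  rw [h1, h2, h3] at h
  exact ⟨hq2, h⟩

theorem half_qMinus (hS : IsSchur Ad e s) (hk : 0 < k)
    (hm : 0 < m) (hkm : k ≠ m) (hb : b = m / (2 * (k + 2 * m))) (hc : c = k / (2 * (k + 2 * m)))
    (hq : q = qMinus b c) (hl : l = k / (k + m))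
    (hu : u = m * (2 * k + m) / ((k + 2 * m) * (k + m)))
    (hr : r = (k ^ 2 + m ^ 2 + 3 * k * m) / ((k + m) * (k + 2 * m))) :
    q = 2 * m / (k + m) ∧ (k < m → EinsteinRow K Ad (diagMetric K p (gq q)) {l, u} l u r) ∧
      (m < k → EinsteinRow K Ad (diagMetric K p (gq q)) {u, l} u l r) ∧
      IsLocMin K Ad (diagMetric K p (gq q)) ∧ HasCoindex K Ad (diagMetric K p (gq q)) 2 := by
  obtain ⟨h8, hd, hc2, -, hT⟩ := half_bounds hk hm hb hc
  have hq2 := hq.trans (qMinus_half hk hm hb hc)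
  have hN : 0 < 2 * (k + 2 * m) := by positivity
  have hbc : ∀ {x y : ℝ}, x < y → x / (2 * (k + 2 * m)) < y / (2 * (k + 2 * m)) := fun h =>
    div_lt_div_of_pos_right h hN
  have hcb : c < b → k < m := fun h => by
    rw [hb, hc] at h
    exact (div_lt_div_iff_of_pos_right hN).1 h
  have h := D.row_qMinus hS hc2 h8 hd hT hq (by
      rw [show 4 * (b + c) * (1 + b - c) = (m + k) * (2 * (k + 2 * m) + m - k) / (k + 2 * m) ^ 2 by
        rw [hb, hc]; field_simp; ring, one_lt_div (by positivity)]
      nlinarith [mul_pos hk hm, mul_pos hm hm])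
    (fun h => by
      rw [show 2 * (b + c) * (1 + 2 * (b - c)) = (m + k) * (3 * m) / (k + 2 * m) ^ 2 by
        rw [hb, hc]; field_simp; ring, div_le_one (by positivity)]
      nlinarith [mul_pos hk hm, mul_pos hm hm, mul_pos hk hk])
    (by
      rw [hb, hc]
      intro h
      rw [div_left_inj' hN.ne'] at h
      exact hkm h.symm)
  have h1 : lamQ₁ b q = l := by
    rw [lamQ₁, hq2, hl, hb]
    field_simp
    ring
  have h2 : lamQ₂ b c q = u := by
    rw [lamQ₂, hq2, hu, hb, hc]
    field_simp
    ring
  have h3 : rhoQ b q = r := by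
    rw [rhoQ, hq2, hr, hb]
    field_simp
    ring
  rw [h1, h2, h3] at h
  refine ⟨hq2, fun h' => h.1 ?_, fun h' => h.2.1 ?_, h.2.2⟩
  · rw [hb, hc]
    exact hbc h'
  · rw [hb, hc]
    exact hbc h'

theorem half_pPlus (hS : IsSchur Ad e s) (hk : 0 < k) (hm : 0 < m)
    (hb : b = m / (2 * (k + 2 * m))) (hc : c = k / (2 * (k + 2 * m))) (ht : t = pPlus b c)
    (hu : u = (k + 5 * m) * (k + m) / ((2 * m + k) * (k + 3 * m)))
    (hr : r = (m + k) / (k + 2 * m)) :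
    t = (k + 3 * m) / (k + m) ∧ EinsteinRow K Ad (diagMetric K p (gp b t)) {0, u} 0 u r ∧
      IsSaddle K Ad (diagMetric K p (gp b t)) ∧ HasCoindex K Ad (diagMetric K p (gp b t)) 1 := by
  obtain ⟨-, -, -, hb2, hT⟩ := half_bounds hk hm hb hc
  have ht2 := ht.trans (pPlus_half hk hm hb hc)
  have h3 : rhoP b t = r := by
    rw [rhoP, one_sub_half hk hm hb, ht2, hr]
    field_simp
    ring
  have h1 : t + 1 = 2 * (k + 2 * m) / (k + m) := by
    rw [ht2]
    field_simp
    ring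
  have h2 : gp b t 2 = 2 * m / (k + m) := by
    change 2 * b * (t + 1) = _
    rw [h1, hb]
    field_simp
  have h4 : gp b t 0 = (k + 3 * m) / (k + m) := ht2
  have h5 : gp b t 1 = 1 := rfl
  have h := D.row_p hS hb2 hT (Or.inl ht) (l := 0) (u := u) (by
      rw [eigSum, h2, h4, h5, hu, hb, hc]
      field_simp
      ring) (by
      simp only [eigProd]
      rw [h2, h4, h5, hb, hc]
      field_simp
      ring) (by rw [hu]; positivity)
  rw [h3] at h
  exact ⟨ht2, h⟩

theorem half_pMinus (hS : IsSchur Ad e s) (hk : 0 < k)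
    (hm : 0 < m) (hb : b = m / (2 * (k + 2 * m))) (hc : c = k / (2 * (k + 2 * m)))
    (ht : t = pMinus b c) (hu : u = (k + 5 * m) / (k + 2 * m))
    (hr : r = (k + 3 * m) / (k + 2 * m)) :
    t = (k + m) / (k + 3 * m) ∧ EinsteinRow K Ad (diagMetric K p (gp b t)) {0, u} 0 u r ∧
      IsSaddle K Ad (diagMetric K p (gp b t)) ∧ HasCoindex K Ad (diagMetric K p (gp b t)) 1 := by
  obtain ⟨-, -, -, hb2, hT⟩ := half_bounds hk hm hb hc
  have ht2 := ht.trans (pMinus_half hk hm hb hc)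
  have h3 : rhoP b t = r := by
    rw [rhoP, one_sub_half hk hm hb, ht2, hr]
    field_simp
    ring
  have h1 : t + 1 = 2 * (k + 2 * m) / (k + 3 * m) := by
    rw [ht2]
    field_simp
    ring
  have h2 : gp b t 2 = 2 * m / (k + 3 * m) := by
    change 2 * b * (t + 1) = _
    rw [h1, hb]
    field_simp
  have h4 : gp b t 0 = (k + m) / (k + 3 * m) := ht2
  have h5 : gp b t 1 = 1 := rfl
  have h := D.row_p hS hb2 hT (Or.inr ht) (l := 0) (u := u) (by
      rw [eigSum, h2, h4, h5, hu, hb, hc]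
      field_simp
      ring) (by
      simp only [eigProd]
      rw [h2, h4, h5, hb, hc]
      field_simp
      ring) (by rw [hu]; positivity)
  rw [h3] at h
  exact ⟨ht2, h⟩
end
end WallachData
end HalfRows

section FlagRows
variable {b c : ℝ}

theorem real_bounds (hk : 1 ≤ k) (hm : 3 ≤ m) (hb : b = m / (2 * (k + 2 * m - 2)))
    (hc : c = k / (2 * (k + 2 * m - 2))) : 8 * b * (b + c) < 1 ∧ 2 * c < 1 ∧ 2 * b < 1 ∧
      (4 * m < k ^ 2 + 4 → 0 < discQ b c) ∧ 1 < 4 * (b + c) * (1 + b - c) ∧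
      (4 * m < k ^ 2 + 4 → 2 * (b + c) * (1 + 2 * (b - c)) ≤ 1) := by
  have hk' : (1 : ℝ) ≤ k := by exact_mod_cast hk
  have hm' : (3 : ℝ) ≤ m := by exact_mod_cast hm
  obtain ⟨N, hN⟩ : ∃ N : ℝ, N = k + 2 * m - 2 := ⟨_, rfl⟩
  have hN0 : 0 < N := by rw [hN]; linarith
  rw [← hN] at hb hc
  refine ⟨?_, ?_, ?_, fun h => ?_, ?_, fun h => ?_⟩
  · rw [show 8 * b * (b + c) = 2 * m * (m + k) / N ^ 2 by rw [hb, hc]; field_simp; ring,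
      div_lt_one (by positivity), hN]
    nlinarith [mul_nonneg (sub_nonneg.2 hk') (sub_nonneg.2 hm')]
  · rw [show 2 * c = k / N by rw [hc]; field_simp, div_lt_one hN0, hN]
    linarith
  · rw [show 2 * b = m / N by rw [hb]; field_simp, div_lt_one hN0, hN]
    linarith
  · have h' : (4 * m : ℝ) < k ^ 2 + 4 := by exact_mod_cast h
    rw [show discQ b c = (N ^ 2 - 2 * (m + k) * (N - k)) / N ^ 2 by
      rw [discQ, hb, hc]; field_simp; ring]
    refine div_pos ?_ (by positivity)
    rw [hN]
    nlinarith
  · rw [show 4 * (b + c) * (1 + b - c) = (m + k) * (2 * N + m - k) / N ^ 2 by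
      rw [hb, hc]; field_simp; ring, one_lt_div (by positivity), hN]
    nlinarith [mul_nonneg (sub_nonneg.2 hk') (sub_nonneg.2 hm')]
  · have h' : (4 * m : ℝ) < k ^ 2 + 4 := by exact_mod_cast h
    rw [show 2 * (b + c) * (1 + 2 * (b - c)) = (m + k) * (N + m - k) / N ^ 2 by
      rw [hb, hc]; field_simp; ring, div_le_one (by positivity), hN]
    nlinarith [mul_nonneg (sub_nonneg.2 hk') (sub_nonneg.2 hm')]

theorem wallachT_ne_zero (hk : 1 ≤ k) (hm : 3 ≤ m) (hb : b = m / (2 * (k + 2 * m - 2)))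
    (hc : c = k / (2 * (k + 2 * m - 2))) : wallachT b c ≠ 0 := by
  have hk' : (1 : ℝ) ≤ k := by exact_mod_cast hk
  have hm' : (3 : ℝ) ≤ m := by exact_mod_cast hm
  have hN0 : (0 : ℝ) < k + 2 * m - 2 := by linarith
  intro h
  rw [wallachT, hb, hc] at h
  field_simp at h
  have h1 : ((k : ℤ) + 2 * m - 2) ^ 2 = (m : ℤ) ^ 2 * (m + k) := by
    have : ((k : ℝ) + 2 * m - 2) ^ 2 = (m : ℝ) ^ 2 * (m + k) := by linarith
    exact_mod_cast this
  obtain ⟨s, hs⟩ : (m : ℤ) ∣ (k + 2 * m - 2) := by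
    rw [← Int.pow_dvd_pow_iff two_ne_zero, h1]
    exact Dvd.intro _ rfl
  have hm0 : (m : ℤ) ≠ 0 := by omega
  have h2 : s ^ 2 = m + k := by
    rw [hs, mul_pow] at h1
    exact mul_left_cancel₀ (pow_ne_zero 2 hm0) h1
  have h3 : (s - 1) * (s + 1 - m) = 1 := by linear_combination h2 + hs
  rcases Int.eq_one_or_neg_one_of_mul_eq_one h3 with h4 | h4
  · rw [h4, one_mul] at h3
    omega
  · rw [h4] at h3
    omega

theorem quaternion_bounds (hk : 1 ≤ k) (hm : 1 ≤ m) (hkm : k ≠ m)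
    (hb : b = m / (2 * (k + 2 * m + 1))) (hc : c = k / (2 * (k + 2 * m + 1))) :
    8 * b * (b + c) < 1 ∧ 2 * c < 1 ∧ 2 * b < 1 ∧ 0 < discQ b c ∧ 1 < 4 * (b + c) * (1 + b - c) ∧
      2 * (b + c) * (1 + 2 * (b - c)) ≤ 1 ∧ 0 < wallachT b c := by
  have hk' : (1 : ℝ) ≤ k := by exact_mod_cast hk
  have hm' : (1 : ℝ) ≤ m := by exact_mod_cast hm
  obtain ⟨N, hN⟩ : ∃ N : ℝ, N = k + 2 * m + 1 := ⟨_, rfl⟩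
  have hN0 : 0 < N := by rw [hN]; linarith
  rw [← hN] at hb hc
  refine ⟨?_, ?_, ?_, ?_, ?_, ?_, ?_⟩
  · rw [show 8 * b * (b + c) = 2 * m * (m + k) / N ^ 2 by rw [hb, hc]; field_simp; ring,
      div_lt_one (by positivity), hN]
    nlinarith
  · rw [show 2 * c = k / N by rw [hc]; field_simp, div_lt_one hN0, hN]
    linarith
  · rw [show 2 * b = m / N by rw [hb]; field_simp, div_lt_one hN0, hN]
    linarith
  · rw [show discQ b c = (N ^ 2 - 2 * (m + k) * (N - k)) / N ^ 2 by
      rw [discQ, hb, hc]; field_simp; ring]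
    refine div_pos ?_ (by positivity)
    rw [hN]
    nlinarith
  · rw [show 4 * (b + c) * (1 + b - c) = (m + k) * (2 * N + m - k) / N ^ 2 by
      rw [hb, hc]; field_simp; ring, one_lt_div (by positivity), hN]
    rcases Nat.lt_or_ge 1 k with h | h
    · have : (2 : ℝ) ≤ k := by exact_mod_cast h
      nlinarith
    · have h1 : k = 1 := le_antisymm h hk
      have : (2 : ℝ) ≤ m := by
        have : 2 ≤ m := by omega
        exact_mod_cast this
      rw [h1, Nat.cast_one]
      nlinarith
  · rw [show 2 * (b + c) * (1 + 2 * (b - c)) = (m + k) * (N + m - k) / N ^ 2 by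
      rw [hb, hc]; field_simp; ring, div_le_one (by positivity), hN]
    nlinarith
  · rw [show wallachT b c = (N ^ 3 - (2 * m + k) * N ^ 2 + 2 * m ^ 2 * (m + k)) / N ^ 3 by
      rw [wallachT, hb, hc]; field_simp; ring]
    refine div_pos ?_ (by positivity)
    rw [show N ^ 3 - (2 * m + k) * N ^ 2 + 2 * m ^ 2 * (m + k) = N ^ 2 + 2 * m ^ 2 * (m + k) by
      rw [hN]; ring]
    positivity

theorem lt_iff_div_lt {x y N : ℝ} (hN : 0 < N) (hb : b = y / N) (hc : c = x / N) :
    c < b ↔ x < y := by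
  rw [hb, hc, div_lt_div_iff_of_pos_right hN]
end FlagRows

/-! ### The spaces `SO(2l)/U(1)×U(l-1)` -/

section Hermitian
variable {l : ℕ}

/-- The complex coordinate that a real coordinate belongs to. -/
def cidx : Fin l ⊕ Fin l → Fin l := Sum.elim id id

/-- The permutation of the real coordinates underlying the complex structure. -/
def cj : Perm (Fin l ⊕ Fin l) := Equiv.sumComm _ _

/-- The signs of the complex structure. -/
def cs : Fin l ⊕ Fin l → ℝ := Sum.elim 1 (-1)

@[simp] theorem cj_inl (i : Fin l) : cj (inl i) = inr i := rfl
@[simp] theorem cj_inr (i : Fin l) : cj (inr i) = inl i := rfl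
@[simp] theorem cs_inl (i : Fin l) : cs (inl i) = 1 := rfl
@[simp] theorem cs_inr (i : Fin l) : cs (inr i) = -1 := rfl
@[simp] theorem cidx_inl (i : Fin l) : cidx (inl i) = i := rfl
@[simp] theorem cidx_inr (i : Fin l) : cidx (inr i) = i := rfl

@[simp] theorem cj_cj (x : Fin l ⊕ Fin l) : cj (cj x) = x := by rcases x with x | x <;> rfl

@[simp] theorem cs_cj (x : Fin l ⊕ Fin l) : cs (cj x) = -cs x := by rcases x with x | x <;> simp

@[simp] theorem cidx_cj (x : Fin l ⊕ Fin l) : cidx (cj x) = cidx x := by rcases x with x | x <;> rfl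

@[simp] theorem cs_mul_self (x : Fin l ⊕ Fin l) : cs x * cs x = 1 := by rcases x with x | x <;> simp

theorem cj_ne (x : Fin l ⊕ Fin l) : cj x ≠ x := by rcases x with x | x <;> simp

theorem eq_or_eq_cj {x y : Fin l ⊕ Fin l} (h : cidx x = cidx y) : x = y ∨ x = cj y := by
  rcases x with x | x <;> rcases y with y | y <;> simp_all

theorem blk₅_eq (x : Fin l ⊕ Fin l) : blk₅ l x = if (cidx x).val = 0 then 0 else 1 := by
  rcases x with x | x <;> rfl

theorem blk₅_cj (x : Fin l ⊕ Fin l) : blk₅ l (cj x) = blk₅ l x := by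
  rw [blk₅_eq, blk₅_eq, cidx_cj]

theorem J₅_eq : J₅ l = mono cj cs := by
  ext (x | x) (y | y) <;> simp [J₅, mono_apply, Matrix.one_apply, Matrix.neg_apply, apply_ite]

theorem mul_J₅_apply (X : Matrix (Fin l ⊕ Fin l) (Fin l ⊕ Fin l) ℝ) (x y : Fin l ⊕ Fin l) :
    (X * J₅ l) x y = X x (cj y) * cs y := by
  rw [J₅_eq, mul_apply, sum_eq_single (cj y) (fun z _ hz => by
    rw [mono_apply, if_neg hz, mul_zero]) (by simp), mono_apply, if_pos rfl]

theorem J₅_mul_apply (X : Matrix (Fin l ⊕ Fin l) (Fin l ⊕ Fin l) ℝ) (x y : Fin l ⊕ Fin l) :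
    (J₅ l * X) x y = -cs x * X (cj x) y := by
  rw [J₅_eq, mul_apply, sum_eq_single (cj x) (fun z _ hz => by
    rw [mono_apply, if_neg (fun h => hz (by rw [h, cj_cj])), zero_mul]) (by simp), mono_apply,
    cj_cj, if_pos rfl, cs_cj]

theorem mem_jPart {t : ℝ} {X : g₅ l} : X ∈ jPart l t ↔ ∀ x y,
    X.1 (cj x) (cj y) = t * (cs x * cs y) * X.1 x y := by
  change X.1 * J₅ l = t • (J₅ l * X.1) ↔ _
  obtain ⟨X, hX⟩ := X
  simp only [← Matrix.ext_iff, Matrix.smul_apply, mul_J₅_apply, J₅_mul_apply, smul_eq_mul]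
  constructor
  · intro h x y
    have h1 := h (cj x) y
    rw [cs_cj, cj_cj] at h1
    linear_combination cs y * h1 - X (cj x) (cj y) * cs_mul_self y
  · intro h x y
    have h1 := h (cj x) y
    rw [cs_cj, cj_cj] at h1
    linear_combination cs y * h1 - t * cs x * X (cj x) y * cs_mul_self y

theorem Q_eq_zero_of_jPart {t t' : ℝ} (h : t * t' = -1) {X Y : g₅ l} (hX : X ∈ jPart l t)
    (hY : Y ∈ jPart l t') : Q (g₅ l) X Y = 0 := by
  rw [skewModel_so.Q_eq starFrame_real]
  refine mul_eq_zero_of_right _ ?_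
  obtain ⟨S, hS⟩ : ∃ S, S = ∑ i, ∑ j, LinearMap.id (R := ℝ)
    (star (X.1 i j) * Y.1 i j) := ⟨_, rfl⟩
  have h1 : S = -S := by
    conv_lhs => rw [hS, ← Equiv.sum_comp cj, sum_congr rfl fun x _ => (Equiv.sum_comp cj _).symm]
    rw [hS, ← sum_neg_distrib]
    refine sum_congr rfl fun x _ => ?_
    rw [← sum_neg_distrib]
    refine sum_congr rfl fun y _ => ?_
    rw [mem_jPart.1 hX, mem_jPart.1 hY]
    simp only [LinearMap.id_apply, star_trivial]
    linear_combination (cs x * cs x) * (cs y * cs y) * X.1 x y *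
      Y.1 x y * h - X.1 x y * Y.1 x y *
      (cs x * cs x * cs_mul_self y + cs_mul_self x)
  rw [← hS]
  linarith

theorem lie_mem_jPart {t t' r : ℝ} (h : t * t' = r) {X Y : g₅ l} (hX : X ∈ jPart l t)
    (hY : Y ∈ jPart l t') : ⁅X, Y⁆ ∈ jPart l r := by
  obtain ⟨X, hX'⟩ := X
  obtain ⟨Y, hY'⟩ := Y
  change X * J₅ l = t • (J₅ l * X) at hX
  change Y * J₅ l = t' • (J₅ l * Y) at hY
  change (X * Y - Y * X) * J₅ l = r • (J₅ l * (X * Y - Y * X))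
  rw [sub_mul, mul_sub, mul_assoc, hY, mul_smul_comm, ← mul_assoc, hX, mul_assoc Y, hX,
    mul_smul_comm, ← mul_assoc Y, hY]
  simp only [smul_mul_assoc, smul_smul, mul_assoc, smul_sub, mul_comm t', h]

theorem mem_k₅ {X : g₅ l} : X ∈ k₅ l ↔ X ∈ blockSub (g₅ l) (blk₅ l) ∧ X ∈ jPart l 1 := Iff.rfl

theorem blockMod_stable {F I : Type*} [Ring F] [StarRing F] [Algebra ℝ F] [Fintype I]
    [DecidableEq I] {G : LieSubalgebra ℝ (Matrix I I F)} {b : I → Fin 3} {T : Set (Matrix I I F)}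
    (hT : ∀ h ∈ T, ∀ i j, b i ≠ b j → h i j = 0) (r r' : Fin 3) (φ : G ≃ₗ⁅ℝ⁆ G)
    (hφ : φ ∈ adSet G T) (X : G) (hX : X ∈ blockMod G b r r') : φ X ∈ blockMod G b r r' := by
  obtain ⟨h, hh, h1⟩ := hφ
  intro i j hij
  rw [h1, mul_apply]
  refine sum_eq_zero fun t _ => ?_
  rw [mul_apply, sum_mul]
  refine sum_eq_zero fun t' _ => ?_
  by_cases hi : b i = b t'
  · by_cases hj : b j = b t
    · rw [hX t' t (by rwa [hi, hj] at hij), mul_zero, zero_mul]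
    · rw [conjTranspose_apply, hT h hh j t hj, star_zero, mul_zero]
  · rw [hT h hh i t' hi, zero_mul, zero_mul]

theorem jPart_stable (t : ℝ) (φ : g₅ l ≃ₗ⁅ℝ⁆ g₅ l) (hφ : φ ∈ Ad₅ l) (X : g₅ l)
    (hX : X ∈ jPart l t) : φ X ∈ jPart l t := by
  obtain ⟨h, ⟨ho, hJ, -⟩, h1⟩ := hφ
  change (φ X).1 * J₅ l = t • (J₅ l * (φ X).1)
  have h2 : hᴴ * h = 1 := (Matrix.mem_orthogonalGroup_iff' _ _).1 ho
  have h3 : h * hᴴ = 1 := (Matrix.mem_orthogonalGroup_iff _ _).1 ho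
  have h4 : hᴴ * J₅ l = J₅ l * hᴴ := by
    rw [← mul_one (hᴴ * J₅ l), ← h3, mul_assoc, ← mul_assoc (J₅ l), ← hJ,
      ← mul_assoc, ← mul_assoc, h2, one_mul]
  rw [h1, mul_assoc, h4, ← mul_assoc, mul_assoc h, show X.1 * J₅ l = t • (J₅ l * _)
    from hX, mul_smul_comm, smul_mul_assoc, ← mul_assoc, hJ]
  simp only [mul_assoc]

theorem p₅_stable (r : Fin 3) (φ : g₅ l ≃ₗ⁅ℝ⁆ g₅ l) (hφ : φ ∈ Ad₅ l) (X : g₅ l)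
    (hX : X ∈ p₅ l r) : φ X ∈ p₅ l r := by
  have h := fun r r' => blockMod_stable (G := g₅ l) (b := blk₅ l) (fun h hh => hh.2.2) r r' φ hφ X
  fin_cases r <;> exact ⟨h _ _ hX.1, jPart_stable _ φ hφ X hX.2⟩

theorem p₅_orthogonal (r r' : Fin 3) (hr : r ≠ r') (X : g₅ l) (hX : X ∈ p₅ l r) (Y : g₅ l)
    (hY : Y ∈ p₅ l r') : Q (g₅ l) X Y = 0 := by
  have hb : ∀ X Y : g₅ l, X ∈ blockMod (g₅ l) (blk₅ l) 0 1 → Y ∈ blockMod (g₅ l) (blk₅ l) 1 1 →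
      Q (g₅ l) X Y = 0 := fun X Y hX hY => skewModel_so.Q_eq_zero starFrame_real fun i j => by
    by_cases h : (blk₅ l i = 0 ∧ blk₅ l j = 1) ∨ (blk₅ l i = 1 ∧ blk₅ l j = 0)
    · refine Or.inr (hY i j ?_)
      rcases h with h | h <;> simp [h.1, h.2]
    · exact Or.inl (hX i j h)
  fin_cases r <;> fin_cases r' <;> first | exact absurd rfl hr | skip
  · exact Q_eq_zero_of_jPart (t := 1) (t' := -1) (by norm_num) hX.2 hY.2
  · exact hb X Y hX.1 hY.1
  · exact Q_eq_zero_of_jPart (t := -1) (t' := 1) (by norm_num) hX.2 hY.2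
  · exact hb X Y hX.1 hY.1
  · exact (Q_comm X Y).trans (hb Y X hY.1 hX.1)
  · exact (Q_comm X Y).trans (hb Y X hY.1 hX.1)

theorem p₅_bracket (r : Fin 3) (X : g₅ l) (hX : X ∈ p₅ l r) (Y : g₅ l) (hY : Y ∈ p₅ l r) :
    ⁅X, Y⁆ ∈ k₅ l := by
  have h2 : ∀ X Y : g₅ l, X ∈ blockMod (g₅ l) (blk₅ l) 1 1 → Y ∈ blockMod (g₅ l) (blk₅ l) 1 1 →
      ⁅X, Y⁆ ∈ blockSub (g₅ l) (blk₅ l) := by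
    intro X Y hX hY
    refine LieSubalgebra.lie_mem _ ?_ ?_
    · exact fun i j hij => hX i j (by rintro (h | h) <;> exact hij (h.1.trans h.2.symm))
    · exact fun i j hij => hY i j (by rintro (h | h) <;> exact hij (h.1.trans h.2.symm))
  fin_cases r
  · exact ⟨blockMods_bracket 0 X hX.1 Y hY.1, lie_mem_jPart (by norm_num) hX.2 hY.2⟩
  · exact ⟨blockMods_bracket 0 X hX.1 Y hY.1, lie_mem_jPart (by norm_num) hX.2 hY.2⟩
  · exact ⟨h2 X Y hX.1 hY.1, lie_mem_jPart (by norm_num) hX.2 hY.2⟩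

theorem p₅_le (r : Fin 3) : p₅ l r ≤ tangent (k₅ l) := by
  intro X hX
  rw [mem_tangent]
  intro Y hY
  have h0 : X ∈ blockMods (g₅ l) (blk₅ l) 0 → Q (g₅ l) Y X = 0 := fun h =>
    mem_tangent.1 (blockMods_le skewModel_so starFrame_real 0 h) Y hY.1
  fin_cases r
  · exact h0 hX.1
  · exact h0 hX.1
  · exact Q_eq_zero_of_jPart (t := 1) (t' := -1) (by norm_num) hY.2 hX.2

/-! #### The frame -/

theorem cs_mul_skewE (i j x y : Fin l ⊕ Fin l) :
    cs x * cs y * skewE i j (1 : ℝ) x y = cs i * cs j * skewE i j (1 : ℝ) x y := by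
  rw [skewE_apply]
  by_cases h1 : i = x ∧ j = y
  · rw [h1.1, h1.2]
  · by_cases h2 : j = x ∧ i = y
    · rw [h2.1, h2.2, mul_comm (cs x)]
    · simp [h1, h2]

theorem skewE_cj (i j x y : Fin l ⊕ Fin l) :
    skewE i j (1 : ℝ) (cj x) (cj y) = skewE (cj i) (cj j) (1 : ℝ) x y := by
  have h : ∀ i x : Fin l ⊕ Fin l, i = cj x ↔ cj i = x := fun i x =>
    ⟨fun h => by rw [h, cj_cj], fun h => by rw [← h, cj_cj]⟩
  simp only [skewE_apply, h]

/-- The elementary skew matrices that commute or anticommute with the complex structure. -/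
def cE (i : Fin l) (y : Fin l ⊕ Fin l) (t : ℝ) :
    Matrix (Fin l ⊕ Fin l) (Fin l ⊕ Fin l) ℝ :=
  skewE (inl i) y 1 + (t * cs y) • skewE (inr i) (cj y) 1

theorem cE_apply_cj (i : Fin l) (y : Fin l ⊕ Fin l) {t : ℝ} (ht : t * t = 1) (x z : Fin l ⊕ Fin l) :
    cE i y t (cj x) (cj z) = t * (cs x * cs z) * cE i y t x z := by
  have h1 := cs_mul_skewE (inl i) y x z
  have h2 := cs_mul_skewE (inr i) (cj y) x z
  simp only [cE, Matrix.add_apply, Matrix.smul_apply, skewE_cj, cj_inl, cj_inr, cj_cj, smul_eq_mul,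
    cs_inl, cs_inr, cs_cj, one_mul, neg_mul_neg] at h1 h2 ⊢
  linear_combination (-t) * h1 - t * t * cs y * h2 -
    (skewE (inr i) (cj y) (1 : ℝ) x z) * (t * t * cs_mul_self y + ht)

theorem mono_conj_cE {σ : Perm (Fin l ⊕ Fin l)} {d : Fin l ⊕ Fin l → ℝ}
    (hσ : ∀ x, σ (cj x) = cj (σ x)) (hd : ∀ x, d (cj x) * cs x = cs (σ x) * d x)
    {i i' : Fin l} (hi : σ (inl i) = inl i') (y : Fin l ⊕ Fin l) (t : ℝ) :
    mono σ d * cE i y t * (mono σ d)ᴴ = (d (inl i) * d y) • cE i' (σ y) t := by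
  have h1 : ∀ (x y : Fin l ⊕ Fin l) (z : ℝ), skewE x y z = z • skewE x y 1 := fun x y z => by
    ext p q
    simp only [skewE_apply, Matrix.smul_apply, smul_eq_mul, star_trivial]
    split_ifs <;> ring
  have h2 : σ (inr i) = inr i' := by rw [← cj_inl, hσ, hi, cj_inl]
  have h3 : d (inr i) = d (inl i) := by
    have := hd (inl i)
    rw [hi] at this
    simpa using this
  have h4 : d (cj y) = cs (σ y) * d y * cs y := by rw [← hd y, mul_assoc, cs_mul_self, mul_one]
  rw [cE, mul_add, add_mul, mono_conj_skewE, mul_smul_comm, smul_mul_assoc, mono_conj_skewE, hi, h2,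
    hσ, h1, h1 _ _ (d _ * _ * _), cE, smul_add, smul_smul, smul_smul, h3, h4]
  congr 2
  · simp
  · simp only [mul_one, star_trivial]
    linear_combination (t * d (inl i) * cs (σ y) * d y) * cs_mul_self y

theorem exists_mono₅ {σ : Perm (Fin l ⊕ Fin l)} {d : Fin l ⊕ Fin l → ℝ}
    (hσ : ∀ x, σ (cj x) = cj (σ x)) (hd : ∀ x, d (cj x) * cs x = cs (σ x) * d x)
    (hb : ∀ x, blk₅ l (σ x) = blk₅ l x) (h1 : ∀ x, d x * d x = 1) :
    ∃ φ ∈ Ad₅ l, ∀ X : g₅ l, (φ X).1 = mono σ d * X.1 * (mono σ d)ᴴ := by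
  refine skewModel_so.exists_adSet ⟨?_, ?_, ?_⟩ (conjTranspose_mono_mul h1)
    (mono_mul_conjTranspose h1)
  · exact (Matrix.mem_orthogonalGroup_iff _ _).2 (mono_mul_conjTranspose h1)
  · rw [J₅_eq, mono_mul_mono, mono_mul_mono]
    congr 1
    · exact Equiv.ext hσ
    · exact funext hd
  · intro i j hij
    rw [mono_apply, if_neg]
    rintro rfl
    exact hij (hb j)
end Hermitian

/-- Indices of the real coordinates of `ℂⁿ⁺¹`. -/
abbrev CI (n : ℕ) : Type := Fin (n + 1) ⊕ Fin (n + 1)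

/-- Indices of the frame of `SO(2n+2)/U(1)×U(n)`. -/
abbrev CPos (n : ℕ) : Type :=
  (Fin n ⊕ Fin n) ⊕ ((Fin n ⊕ Fin n) ⊕ {x : Fin n × (Fin n ⊕ Fin n) // x.1 < cidx x.2})

namespace CPos
variable {n : ℕ}

/-- The complex coordinate of the row. -/
def src : CPos n → Fin (n + 1) := Sum.elim (fun _ => 0) (Sum.elim (fun _ => 0) fun x => x.1.1.succ)

/-- The real coordinate of the column. -/
def tgt : CPos n → CI n :=
  Sum.elim (Sum.map Fin.succ Fin.succ)
    (Sum.elim (Sum.map Fin.succ Fin.succ) fun x => Sum.map Fin.succ Fin.succ x.1.2)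

/-- The sign of the commutation with the complex structure. -/
def sgn : CPos n → ℝ := Sum.elim 1 (Sum.elim (-1) (-1))

/-- The module. -/
def sec : CPos n → Fin 3 := Sum.elim (fun _ => 0) (Sum.elim (fun _ => 1) fun _ => 2)

theorem cidx_map (y : Fin n ⊕ Fin n) : cidx (Sum.map Fin.succ Fin.succ y) = (cidx y).succ := by
  rcases y with y | y <;> rfl

theorem src_lt (q : CPos n) : q.src < cidx q.tgt := by
  rcases q with y | y | ⟨⟨i, y⟩, h⟩
  · simp [src, tgt, cidx_map]
  · simp [src, tgt, cidx_map]
  · simpa [src, tgt, cidx_map] using h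

theorem map_succ_injective : Function.Injective (Sum.map (Fin.succ (n := n)) (Fin.succ (n := n))) :=
  Sum.map_injective.2 ⟨Fin.succ_injective _, Fin.succ_injective _⟩

theorem ext_iff {q q' : CPos n} : q = q' ↔ q.sgn = q'.sgn ∧ q.src = q'.src ∧ q.tgt = q'.tgt := by
  refine ⟨by rintro rfl; exact ⟨rfl, rfl, rfl⟩, ?_⟩
  rcases q with y | y | ⟨⟨i, y⟩, h⟩ <;> rcases q' with y' | y' | ⟨⟨i', y'⟩, h'⟩ <;>
    simp only [sgn, src, tgt, elim_inl, elim_inr, Pi.one_apply, Pi.neg_apply,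
      map_succ_injective.eq_iff] <;> rintro ⟨h1, h2, h3⟩
  · rw [h3]
  · norm_num at h1
  · norm_num at h1
  · norm_num at h1
  · rw [h3]
  · exact absurd h2.symm (Fin.succ_ne_zero _)
  · norm_num at h1
  · exact absurd h2 (Fin.succ_ne_zero _)
  · simp [Fin.succ_injective _ h2, h3]

theorem sgn_mul_self (q : CPos n) : q.sgn * q.sgn = 1 := by
  rcases q with y | y | y <;> simp [sgn]

theorem sgn_eq_or (q : CPos n) : q.sgn = 1 ∨ q.sgn = -1 := by
  rcases q with y | y | y <;> simp [sgn]

theorem exists_map_succ {y : CI n} (h : 0 < cidx y) :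
    ∃ z, Sum.map Fin.succ Fin.succ z = y := by
  rcases y with y | y
  · obtain ⟨z, rfl⟩ := Fin.exists_succ_eq.2 (Fin.pos_iff_ne_zero.1 h)
    exact ⟨inl z, rfl⟩
  · obtain ⟨z, rfl⟩ := Fin.exists_succ_eq.2 (Fin.pos_iff_ne_zero.1 h)
    exact ⟨inr z, rfl⟩

/-- The vectors of the frame. -/
def vec (q : CPos n) : g₅ (n + 1) :=
  ⟨cE q.src q.tgt q.sgn, (g₅ (n + 1)).add_mem
    (skewModel_so.skewE_mem _ _ _ fun h => q.src_lt.ne (by rw [← h]; rfl))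
    ((g₅ (n + 1)).smul_mem _ (skewModel_so.skewE_mem _ _ _ fun h =>
      q.src_lt.ne (by rw [← cidx_cj q.tgt, ← h]; rfl)))⟩

theorem Q_vec' (X : g₅ (n + 1)) (q : CPos n) : Q (g₅ (n + 1)) X q.vec =
    2 * killConst (CI n) Unit * (X.1 (inl q.src) q.tgt +
      q.sgn * cs q.tgt * X.1 (inr q.src) (cj q.tgt)) := by
  have h1 : inl q.src ≠ q.tgt := fun h => q.src_lt.ne (by rw [← h]; rfl)
  have h2 : inr q.src ≠ cj q.tgt := fun h => q.src_lt.ne (by rw [← cidx_cj q.tgt, ← h]; rfl)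
  have h : q.vec = (⟨_, skewModel_so.skewE_mem _ _ 1 h1⟩ : g₅ (n + 1)) +
      (q.sgn * cs q.tgt) • (⟨_, skewModel_so.skewE_mem _ _ 1 h2⟩ : g₅ (n + 1)) := rfl
  rw [h, map_add, map_smul, skewModel_so.Q_skewE starFrame_real X rfl,
    skewModel_so.Q_skewE starFrame_real X rfl]
  simp only [star_one, one_mul, LinearMap.id_apply, smul_eq_mul]
  ring

theorem vec_mem_jPart (q : CPos n) : q.vec ∈ jPart (n + 1) q.sgn :=
  mem_jPart.2 (cE_apply_cj _ _ q.sgn_mul_self)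

theorem Q_vec {t : ℝ} {X : g₅ (n + 1)} (hX : X ∈ jPart (n + 1) t) (q : CPos n) :
    Q (g₅ (n + 1)) X q.vec = 2 * killConst (CI n) Unit * ((1 + t * q.sgn) * X.1
        (inl q.src) q.tgt) := by
  have h := mem_jPart.1 hX (inl q.src) q.tgt
  rw [cj_inl, cs_inl] at h
  rw [Q_vec', h]
  linear_combination (2 * killConst (CI n) Unit * q.sgn * t * X.1
        (inl q.src) q.tgt) * cs_mul_self q.tgt

theorem killConst_eq : killConst (CI n) Unit = 2 * n := by
  simp only [killConst, Fintype.card_sum, card_fin, Fintype.card_unit]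
  push_cast
  ring

theorem vec_apply_eq_zero (q : CPos n) {x y : CI n}
    (h : ¬ (cidx x = q.src ∧ cidx y = cidx q.tgt)) (h' : ¬ (cidx x = cidx q.tgt ∧ cidx y = q.src)) :
    q.vec.1 x y = 0 := by
  change cE _ _ _ x y = 0
  rw [cE, Matrix.add_apply, Matrix.smul_apply, skewE_apply, skewE_apply, if_neg, if_neg, if_neg,
    if_neg]
  · simp
  · rintro ⟨rfl, rfl⟩
    exact h' (by simp)
  · rintro ⟨rfl, rfl⟩
    exact h (by simp)
  · rintro ⟨rfl, rfl⟩
    exact h' (by simp)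
  · rintro ⟨rfl, rfl⟩
    exact h (by simp)

theorem vec_mem (q : CPos n) : q.vec ∈ p₅ (n + 1) q.sec := by
  have hb : ∀ y : Fin n ⊕ Fin n, blk₅ (n + 1) (Sum.map Fin.succ Fin.succ y) = 1 := fun y => by
    rw [blk₅_eq, cidx_map, if_neg (by simp)]
  have key : ∀ x y : CI n, cidx x = cidx y → blk₅ (n + 1) x = blk₅ (n + 1) y :=
    fun x y h => by rw [blk₅_eq, blk₅_eq, h]
  have hmem : ∀ r r' : Fin 3, blk₅ (n + 1) (inl q.src) = r → blk₅ (n + 1) q.tgt = r' →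
      q.vec ∈ blockMod (g₅ (n + 1)) (blk₅ (n + 1)) r r' := by
    rintro _ _ rfl rfl x y hxy
    refine q.vec_apply_eq_zero (fun h => hxy (Or.inl ⟨?_, ?_⟩)) (fun h => hxy (Or.inr ⟨?_, ?_⟩))
    · exact key _ _ h.1
    · exact key _ _ h.2
    · exact key _ _ h.1
    · exact key _ _ h.2
  have hj := q.vec_mem_jPart
  rcases q with y | y | ⟨⟨i, y⟩, h⟩
  · exact ⟨hmem _ _ rfl (hb y), hj⟩
  · exact ⟨hmem _ _ rfl (hb y), hj⟩
  · exact ⟨hmem _ _ (hb (inl i)) (hb y), hj⟩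

theorem Q_vec_vec (q q' : CPos n) : Q (g₅ (n + 1)) q.vec q'.vec =
    if q = q' then 4 * killConst (CI n) Unit else 0 := by
  rw [Q_vec q.vec_mem_jPart]
  by_cases hs : q.sgn = q'.sgn
  · have h1 : q.sgn * q'.sgn = 1 := by rw [← hs, sgn_mul_self]
    have h2 : q.vec.1
        (inl q'.src) q'.tgt = if q = q' then 1 else 0 := by
      change cE _ _ _ _ _ = _
      have h3 : ¬ (cidx q.tgt = q'.src ∧ q.src = cidx q'.tgt) := fun h => by
        have h4 := q.src_lt
        have h5 := q'.src_lt
        rw [h.1, h.2] at h4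
        exact h4.asymm h5
      rw [cE, Matrix.add_apply, Matrix.smul_apply, skewE_apply, skewE_apply,
        if_neg (fun h : q.tgt = inl q'.src ∧ inl q.src = q'.tgt =>
          h3 ⟨by rw [h.1]; rfl, by rw [← h.2]; rfl⟩),
        if_neg (fun h : inr q.src = inl q'.src ∧ _ => by cases h.1),
        if_neg (fun h : cj q.tgt = inl q'.src ∧ inr q.src = q'.tgt =>
          h3 ⟨by rw [← cidx_cj, h.1]; rfl, by rw [← h.2]; rfl⟩)]
      simp [ext_iff, hs]
    rw [h1, h2]
    split_ifs <;> ring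
  · have h1 : 1 + q.sgn * q'.sgn = 0 := by
      rcases q.sgn_eq_or with h | h <;> rcases q'.sgn_eq_or with h' | h' <;> rw [h, h'] at hs ⊢ <;>
        first | exact absurd rfl hs | norm_num
    rw [h1, if_neg (fun h => hs (by rw [h]))]
    ring

theorem eq_zero_of_forall (hn : 0 < n) {X : g₅ (n + 1)} (hX : X ∈ tangent (k₅ (n + 1)))
    (h : ∀ q : CPos n, Q (g₅ (n + 1)) X q.vec = 0) : X = 0 := by
  have hK : 0 < killConst (CI n) Unit := by
    rw [killConst_eq]
    have : (0 : ℝ) < n := Nat.cast_pos.2 hn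
    positivity
  obtain ⟨Y, hY⟩ : ∃ Y, Y = X.1 := ⟨_, rfl⟩
  have hskew : ∀ x y, Y y x = -Y x y := fun x y => by
    have h1 := congrFun (congrFun (skewModel_so.skew X X.2) x) y
    rw [conjTranspose_apply, star_trivial, Matrix.neg_apply] at h1
    rw [hY, h1]
  have h1 : ∀ q : CPos n, Y (inl q.src) q.tgt + q.sgn * cs q.tgt *
      Y (inr q.src) (cj q.tgt) = 0 := fun q => by
    have := h q
    rw [Q_vec', ← hY] at this
    exact (mul_eq_zero.1 this).resolve_left (by positivity)
  have h2 : ∀ x y, cidx x = 0 → 0 < cidx y → Y x y = 0 := by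
    have : ∀ y, 0 < cidx y → Y (inl 0) y = 0 ∧ Y (inr 0) (cj y) = 0 := by
      intro y hy
      obtain ⟨z, rfl⟩ := exists_map_succ hy
      have h3 := h1 (inl z)
      have h4 := h1 (inr (inl z))
      simp only [src, tgt, sgn, elim_inl, elim_inr, Pi.one_apply, Pi.neg_apply] at h3 h4
      refine ⟨by linarith, ?_⟩
      have h5 := cs_mul_self (Sum.map (Fin.succ (n := n)) (Fin.succ (n := n)) z)
      have h6 : cs (Sum.map (Fin.succ (n := n)) (Fin.succ (n := n)) z) ≠ 0 := fun h => by
        rw [h] at h5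
        norm_num at h5
      exact (mul_eq_zero.1 (by linarith : cs (Sum.map Fin.succ Fin.succ z) *
        Y (inr 0) (cj (Sum.map Fin.succ Fin.succ z)) = 0)).resolve_left h6
    intro x y hx hy
    rcases x with x | x
    · exact (show x = 0 from hx) ▸ (this y hy).1
    · have := (this (cj y) (by rwa [cidx_cj])).2
      rw [cj_cj] at this
      exact (show x = 0 from hx) ▸ this
  have h3 : ∀ x y, 0 < cidx x → cidx x < cidx y → Y (cj x) (cj y) = cs x * cs y * Y x y := by
    have : ∀ i y, 0 < i → i < cidx y → Y (inr i) (cj y) = cs y * Y (inl i) y := by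
      intro i y hi hy
      obtain ⟨z, rfl⟩ := exists_map_succ (hi.trans hy)
      obtain ⟨j, rfl⟩ := Fin.exists_succ_eq.2 (Fin.pos_iff_ne_zero.1 hi)
      rw [cidx_map, Fin.succ_lt_succ_iff] at hy
      have h3 := h1 (inr (inr ⟨(j, z), hy⟩))
      simp only [src, tgt, sgn, elim_inr, Pi.one_apply, Pi.neg_apply] at h3
      linear_combination (-cs (Sum.map Fin.succ Fin.succ z)) * h3 -
        Y (inr j.succ) (cj (Sum.map Fin.succ Fin.succ z)) * cs_mul_self _
    intro x y hx hy
    rcases x with x | x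
    · rw [cj_inl, cs_inl, one_mul]
      exact this x y hx hy
    · have h3 := this x (cj y) hx (by rwa [cidx_cj])
      rw [cj_cj, cs_cj] at h3
      rw [cj_inr, cs_inr]
      linear_combination cs y * h3 - Y (inl x) (cj y) * cs_mul_self y
  have hmem : X ∈ k₅ (n + 1) := by
    refine mem_k₅.2 ⟨fun x y hxy => ?_, mem_jPart.2 fun x y => ?_⟩
    · rw [← hY]
      by_cases hx : cidx x = 0
      · refine h2 x y hx (Fin.pos_iff_ne_zero.2 fun hy => hxy ?_)
        rw [blk₅_eq, blk₅_eq, hx, hy]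
      · by_cases hy : cidx y = 0
        · rw [hskew, h2 y x hy (Fin.pos_iff_ne_zero.2 hx), neg_zero]
        · refine absurd ?_ hxy
          rw [blk₅_eq, blk₅_eq, if_neg (Fin.val_ne_zero_iff.2 hx), if_neg (Fin.val_ne_zero_iff.2 hy)]
    · rw [← hY, one_mul]
      rcases lt_trichotomy (cidx x) (cidx y) with h4 | h4 | h4
      · by_cases hx : cidx x = 0
        · rw [h2 x y hx (hx ▸ h4), h2 _ _ ((cidx_cj x).trans hx) (by rw [cidx_cj]; exact hx ▸ h4),
            mul_zero]
        · exact h3 x y (Fin.pos_iff_ne_zero.2 hx) h4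
      · have h5 : ∀ x, Y x x = 0 := fun x => by linarith [hskew x x]
        rcases eq_or_eq_cj h4 with rfl | rfl
        · rw [h5, h5, mul_zero]
        · rw [cj_cj, cs_cj, hskew]
          linear_combination Y (cj y) y * cs_mul_self y
      · rw [hskew, hskew y x]
        by_cases hy : cidx y = 0
        · rw [h2 y x hy (hy ▸ h4), h2 _ _ ((cidx_cj y).trans hy) (by rw [cidx_cj]; exact hy ▸ h4)]
          ring
        · rw [h3 y x (Fin.pos_iff_ne_zero.2 hy) h4]
          ring
  by_contra hne
  exact (Q_self_pos (skewModel_so.compact starFrame_real hK) hne).ne' (mem_tangent.1 hX X hmem)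

theorem exists_frame (hn : 2 ≤ n) : ∃ e : Basis (CPos n) ℝ (tangent (k₅ (n + 1))),
    (∀ q, (e q : g₅ (n + 1)) = q.vec) ∧ WallachFrame (k₅ (n + 1)) (p₅ (n + 1)) e sec
      (4 * killConst (CI n) Unit) := by
  have hK : 0 < killConst (CI n) Unit := by
    rw [killConst_eq]
    have : (0 : ℝ) < n := Nat.cast_pos.2 (by omega)
    positivity
  obtain ⟨e, he⟩ := exists_basis_of_orthogonal (K := k₅ (n + 1)) vec
    (w := 4 * killConst (CI n) Unit) (by positivity)
    (fun q => p₅_le _ q.vec_mem) Q_vec_vec fun X hX h => eq_zero_of_forall (by omega) hX h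
  refine ⟨e, he, skewModel_so.compact starFrame_real hK, p₅_orthogonal, p₅_bracket, by positivity,
    fun q q' => by rw [he, he, Q_vec_vec], fun q => by rw [he]; exact q.vec_mem, p₅_le, fun r => ?_⟩
  fin_cases r
  · exact ⟨inl (inl ⟨0, by omega⟩), rfl⟩
  · exact ⟨inr (inl (inl ⟨0, by omega⟩)), rfl⟩
  · exact ⟨inr (inr ⟨(⟨0, by omega⟩, inl ⟨1, by omega⟩), by simp [Fin.lt_def]⟩), rfl⟩

/-! #### Isometries -/
variable {e : Basis (CPos n) ℝ (tangent (k₅ (n + 1)))}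

section
variable (he : ∀ q, (e q : g₅ (n + 1)) = q.vec)
include he

theorem exists_map
    {σ : Perm (CI n)} {d : CI n → ℝ}
    (hσ : ∀ x, σ (cj x) = cj (σ x)) (hd : ∀ x, d (cj x) * cs x = cs (σ x) * d x)
    (hb : ∀ x, blk₅ (n + 1) (σ x) = blk₅ (n + 1) x) (h1 : ∀ x, d x * d x = 1) :
    ∃ φ ∈ Ad₅ (n + 1), ∀ q q' : CPos n, σ (inl q.src) = inl q'.src → σ q.tgt = q'.tgt →
      q.sgn = q'.sgn → φ (e q) = (d (inl q.src) * d q.tgt) • (e q' : g₅ (n + 1)) := by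
  obtain ⟨φ, hφ, h⟩ := exists_mono₅ hσ hd hb h1
  refine ⟨φ, hφ, fun q q' h2 h3 h4 => Subtype.ext ?_⟩
  rw [h, he, he]
  change mono σ d * cE _ _ _ * _ = _ • cE _ _ _
  rw [mono_conj_cE hσ hd h2, h3, h4]

theorem separated_of_sgn_ne {q q' : CPos n}
    (h : q.sgn ≠ q'.sgn) : Separated (Ad₅ (n + 1)) e q q' := by
  have h1 : ∀ x : CI n, cs x * cs x = 1 := cs_mul_self
  obtain ⟨φ, hφ, h2⟩ := exists_mono₅ (σ := cj) (d := cs) (fun _ => rfl) (fun _ => rfl) blk₅_cj h1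
  have key : ∀ q : CPos n, φ (e q) = q.sgn • (e q : g₅ (n + 1)) := by
    intro q
    refine Subtype.ext ?_
    have h3 := q.vec_mem_jPart
    rw [h2, he]
    generalize q.vec = X at h3 ⊢
    obtain ⟨X, hX⟩ := X
    change X * J₅ (n + 1) = q.sgn • (J₅ (n + 1) * X) at h3
    change mono cj cs * X * (mono cj cs)ᴴ = q.sgn • X
    have h4 : mono cj cs * X = q.sgn • (X * mono cj cs) := by
      rw [← J₅_eq, h3, smul_smul, q.sgn_mul_self, one_smul]
    rw [h4, smul_mul_assoc, mul_assoc, mono_mul_conjTranspose h1, mul_one]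
  refine ⟨φ, hφ, ?_⟩
  rw [key, key]
  rcases q.sgn_eq_or with h5 | h5 <;> rcases q'.sgn_eq_or with h6 | h6
  · exact absurd (h5.trans h6.symm) h
  · exact Or.inl ⟨by rw [h5, one_smul], by rw [h6, neg_smul, one_smul]⟩
  · exact Or.inr (Or.inl ⟨by rw [h5, neg_smul, one_smul], by rw [h6, one_smul]⟩)
  · exact absurd (h5.trans h6.symm) h

theorem exists_turn {q q' : CPos n} (hs : q.sgn = q'.sgn)
    (hsrc : q.src = q'.src) (htgt : q'.tgt = cj q.tgt) :
    ∃ φ ∈ Ad₅ (n + 1), φ (e q) = e q' ∧ φ (e q') = -(e q : g₅ (n + 1)) := by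
  obtain ⟨y, hy⟩ : ∃ y, y = q.tgt := ⟨_, rfl⟩
  have h1 := q.src_lt
  rw [← hy] at htgt h1
  have hne := cj_ne y
  obtain ⟨φ, hφ, h⟩ := exists_map he (σ := swap y (cj y))
    (d := update 1 (cj y) (-1)) (fun x => by
      by_cases hx : x = y
      · rw [hx, swap_apply_right, swap_apply_left, cj_cj]
      · by_cases hx' : x = cj y
        · rw [hx', cj_cj, swap_apply_right, swap_apply_left]
        · rw [swap_apply_of_ne_of_ne hx hx', swap_apply_of_ne_of_ne]
          · exact fun h => hx' (by rw [← h, cj_cj])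
          · exact fun h => hx (cj.injective h))
    (fun x => by
      by_cases hx : x = y
      · rw [hx, swap_apply_left, update_self, update_of_ne hne.symm, cs_cj]
        simp
      · by_cases hx' : x = cj y
        · rw [hx', cj_cj, swap_apply_right, update_self, update_of_ne hne.symm, cs_cj]
          simp
        · rw [swap_apply_of_ne_of_ne hx hx', update_of_ne hx',
            update_of_ne fun h => hx (cj.injective h)]
          simp)
    (fun x => by
      by_cases hx : x = y
      · rw [hx, swap_apply_left, blk₅_cj]
      · by_cases hx' : x = cj y
        · rw [hx', swap_apply_right, blk₅_cj]
        · rw [swap_apply_of_ne_of_ne hx hx'])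
    (fun x => by
      by_cases hx : x = cj y
      · rw [hx, update_self]; norm_num
      · rw [update_of_ne hx]; simp)
  have h4 : inl q.src ≠ y := fun h => h1.ne (by rw [← h]; rfl)
  have h5 : inl q.src ≠ cj y := fun h => h1.ne (by rw [← cidx_cj, ← h]; rfl)
  refine ⟨φ, hφ, ?_, ?_⟩
  · rw [h q q' (by rw [swap_apply_of_ne_of_ne h4 h5, hsrc])
      (by rw [← hy, swap_apply_left, htgt]) hs, update_of_ne h5, ← hy,
      update_of_ne hne.symm]
    simp
  · rw [h q' q (by rw [← hsrc, swap_apply_of_ne_of_ne h4 h5])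
      (by rw [htgt, swap_apply_right, hy]) hs.symm, ← hsrc, update_of_ne h5, htgt,
      update_self]
    simp

theorem separated {q q' : CPos n} (hq : q ≠ q') :
    Separated (Ad₅ (n + 1)) e q q' := by
  by_cases hs : q.sgn = q'.sgn
  swap
  · exact separated_of_sgn_ne he hs
  have hflip : ∀ v : Fin (n + 1), (v = q.src ∨ v = cidx q.tgt) ∧ ¬ (v = q'.src ∨ v = cidx q'.tgt) ∨
      (v = q'.src ∨ v = cidx q'.tgt) ∧ ¬ (v = q.src ∨ v = cidx q.tgt) →
      Separated (Ad₅ (n + 1)) e q q' := by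
    intro v hv
    obtain ⟨φ, hφ, h⟩ := exists_map he (σ := 1) (d := fun x => if cidx x = v then -1 else 1)
      (fun _ => rfl) (fun x => by simp [mul_comm]) (fun _ => rfl)
      (fun x => by split_ifs <;> norm_num)
    have hin : ∀ q : CPos n, (v = q.src ∨ v = cidx q.tgt) → φ (e q) = -(e q : g₅ (n + 1)) := by
      intro q hq
      rw [h q q rfl rfl rfl]
      have := q.src_lt.ne
      rcases hq with rfl | rfl
      · simp [this.symm]
      · simp [this]
    have hout : ∀ q : CPos n, ¬ (v = q.src ∨ v = cidx q.tgt) → φ (e q) = (e q : g₅ (n + 1)) := by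
      intro q hq
      rw [not_or] at hq
      rw [h q q rfl rfl rfl]
      simp [Ne.symm hq.1, Ne.symm hq.2]
    exact ⟨φ, hφ, hv.symm.imp (fun h => ⟨hout q h.2, hin q' h.1⟩)
      fun h => Or.inl ⟨hin q h.1, hout q' h.2⟩⟩
  have h1 := q.src_lt
  have h2 := q'.src_lt
  by_cases hsrc : q.src = q'.src
  · by_cases htgt : cidx q.tgt = cidx q'.tgt
    · have h3 : q'.tgt = cj q.tgt := by
        rcases eq_or_eq_cj htgt.symm with h | h
        · exact absurd (ext_iff.2 ⟨hs, hsrc, h.symm⟩) hq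
        · exact h
      obtain ⟨φ, hφ, h4⟩ := exists_turn he hs hsrc h3
      exact ⟨φ, hφ, Or.inr (Or.inr h4)⟩
    · refine hflip (cidx q.tgt) (Or.inl ⟨Or.inr rfl, ?_⟩)
      rintro (h | h)
      · exact h1.ne (hsrc.trans h.symm)
      · exact htgt h
  · by_cases h3 : q.src = cidx q'.tgt
    · refine hflip q'.src (Or.inr ⟨Or.inl rfl, ?_⟩)
      rintro (h | h)
      · exact hsrc h.symm
      · rw [h3] at h1
        rw [h] at h2
        exact h1.asymm h2
    · exact hflip q.src (Or.inl ⟨Or.inl rfl, not_or.2 ⟨hsrc, h3⟩⟩)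

theorem related {q q' : CPos n} (hs : q.sgn = q'.sgn)
    {a b : Fin (n + 1)} (ha : a ≠ 0) (hb : b ≠ 0) (h1 : swap a b q.src = q'.src)
    (h2 : Sum.map (swap a b) (swap a b) q.tgt = q'.tgt) :
    Related (Ad₅ (n + 1)) e q q' := by
  obtain ⟨φ, hφ, h⟩ := exists_map he
    (σ := Perm.sumCongr (swap a b) (swap a b)) (d := 1)
    (by rintro (x | x) <;> rfl) (by rintro (x | x) <;> simp)
    (fun x => by
      have : ∀ z, (swap a b z : Fin (n + 1)).val = 0 ↔ z.val = 0 := fun z => by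
        simp only [← Fin.val_zero (n + 1), Fin.val_inj]
        rw [← swap_apply_of_ne_of_ne ha.symm hb.symm]
        simp [swap_apply_of_ne_of_ne ha.symm hb.symm, Equiv.swap_apply_eq_iff]
      rcases x with x | x <;> simp [blk₅_eq, this])
    (by simp)
  refine ⟨φ, hφ, Or.inl ?_⟩
  rw [h q q' (congrArg inl h1) h2 hs]
  simp
end

theorem tgt_ne_zero (q : CPos n) : cidx q.tgt ≠ 0 := fun h => by
  have := q.src_lt
  rw [h] at this
  exact absurd this (Fin.not_lt_zero _)

theorem exists_flip (q : CPos n) : ∃ q' : CPos n, q'.sgn = q.sgn ∧ q'.src = q.src ∧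
    q'.tgt = cj q.tgt := by
  have h : ∀ y : Fin n ⊕ Fin n, Sum.map Fin.succ Fin.succ (cj y) = cj (Sum.map Fin.succ Fin.succ y) := by
    rintro (y | y) <;> rfl
  rcases q with y | y | ⟨⟨i, y⟩, hy⟩
  · exact ⟨inl (cj y), rfl, rfl, h y⟩
  · exact ⟨inr (inl (cj y)), rfl, rfl, h y⟩
  · exact ⟨inr (inr ⟨(i, cj y), by simpa using hy⟩), rfl, rfl, h y⟩

section
variable (he : ∀ q, (e q : g₅ (n + 1)) = q.vec)
include he

theorem eqvGen_tgt {q q' : CPos n} (hs : q.sgn = q'.sgn)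
    (h1 : q.src = q'.src) : EqvGen (Related (Ad₅ (n + 1)) e) q q' := by
  have key : ∀ q' : CPos n, q.sgn = q'.sgn → q.src = q'.src → cs q.tgt = cs q'.tgt →
      Related (Ad₅ (n + 1)) e q q' := by
    intro q' hs h1 h
    refine related he hs q.tgt_ne_zero q'.tgt_ne_zero ?_ ?_
    · rw [swap_apply_of_ne_of_ne q.src_lt.ne (h1 ▸ q'.src_lt.ne), h1]
    · rcases hy : q.tgt with y | y <;> rcases hy' : q'.tgt with y' | y' <;> rw [hy, hy'] at h <;>
        simp at h ⊢
      · norm_num at h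
      · norm_num at h
  by_cases h : cs q.tgt = cs q'.tgt
  · exact .rel _ _ (key q' hs h1 h)
  · obtain ⟨q'', h2, h3, h4⟩ := q'.exists_flip
    obtain ⟨φ, hφ, h5, -⟩ := exists_turn he h2.symm h3.symm h4
    refine (Relation.EqvGen.rel _ _ (key q'' (hs.trans h2.symm) (h1.trans h3.symm) ?_)).trans _ _ _
      (.symm _ _ (.rel _ _ ⟨φ, hφ, Or.inl h5⟩))
    rw [h4, cs_cj]
    have h6 := mul_self_eq_mul_self_iff.1 ((cs_mul_self q.tgt).trans (cs_mul_self q'.tgt).symm)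
    exact h6.resolve_left h

theorem eqvGen {q q' : CPos n} (h : q.sec = q'.sec) :
    EqvGen (Related (Ad₅ (n + 1)) e) q q' := by
  rcases q with y | y | ⟨⟨i, y⟩, hy⟩ <;> rcases q' with y' | y' | ⟨⟨i', y'⟩, hy'⟩ <;>
    simp [sec] at h
  · exact eqvGen_tgt he rfl rfl
  · exact eqvGen_tgt he rfl rfl
  · obtain ⟨j, hj, hj'⟩ : ∃ j, i < j ∧ i' < j :=
      ⟨max (cidx y) (cidx y'), lt_max_of_lt_left hy, lt_max_of_lt_right hy'⟩
    refine Relation.EqvGen.trans _ (inr (inr ⟨(i, inl j), hj⟩)) _ (eqvGen_tgt he rfl rfl) ?_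
    refine Relation.EqvGen.trans _ (inr (inr ⟨(i', inl j), hj'⟩)) _ (.rel _ _ ?_)
      (eqvGen_tgt he rfl rfl)
    refine related he rfl (Fin.succ_ne_zero i) (Fin.succ_ne_zero i') (swap_apply_left _ _) ?_
    refine congrArg inl (swap_apply_of_ne_of_ne ?_ ?_)
    · exact fun h => hj.ne' (Fin.succ_injective _ h)
    · exact fun h => hj'.ne' (Fin.succ_injective _ h)

theorem isSchur : IsSchur (Ad₅ (n + 1)) e sec :=
  isSchur_of_separated (fun _ _ h => separated he h) fun _ _ h => eqvGen he h
end

/-! #### The structure constants -/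

theorem card_sec (r : Fin 3) : (card {q : CPos n // q.sec = r} : ℝ) =
    ![2 * (n : ℝ), 2 * n, n * (n - 1)] r := by
  have h3 : ((card {x : Fin n × (Fin n ⊕ Fin n) // x.1 < cidx x.2} : ℕ) : ℝ) =
      n * (n - 1) := by
    have h1 : ∑ i : Fin n, ∑ j : Fin n, (if i < j then (1 : ℝ) else 0) =
        ∑ i : Fin n, ∑ j : Fin n, if j < i then (1 : ℝ) else 0 := sum_comm
    have h2 : ∑ i : Fin n, ∑ j : Fin n, ((if i < j then (1 : ℝ) else 0) + if j < i then 1 else 0) =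
        ∑ i : Fin n, ∑ j : Fin n, (1 - if i = j then (1 : ℝ) else 0) :=
      sum_congr rfl fun i _ => sum_congr rfl fun j _ => by
        rcases lt_trichotomy i j with h | h | h
        · simp [h, h.not_gt, h.ne]
        · simp [h]
        · simp [h, h.not_gt, h.ne']
    simp only [sum_add_distrib, sum_sub_distrib, ← h1, sum_const,
      Finset.card_univ, card_fin, sum_ite_eq, mem_univ, if_true, nsmul_eq_mul,
      mul_one] at h2
    rw [card_subtype, Finset.card_filter, sum_prod_type]
    simp only [sum_sum_type]
    push_cast
    rw [sum_add_distrib]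
    refine Eq.trans ?_ (h2.trans (by ring))
    congr 1
  have h : card {q : CPos n // q.sec = r} = ![n + n, n + n,
      card {x : Fin n × (Fin n ⊕ Fin n) // x.1 < cidx x.2}] r := by
    rw [card_subtype, Finset.card_filter]
    simp only [sum_sum_type, sec, elim_inl, elim_inr]
    fin_cases r <;> simp
  rw [h]
  fin_cases r
  · simp [two_mul]
  · simp [two_mul]
  · exact h3

theorem sconst_eq (he : ∀ q, (e q : g₅ (n + 1)) = q.vec)
    (W : WallachFrame (k₅ (n + 1)) (p₅ (n + 1)) e sec
      (4 * killConst (CI n) Unit)) (y y' : Fin n ⊕ Fin n) (i j : Fin n)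
    (hi : i < j) : sconst e (inl y) (inr (inl y'))
        (inr (inr ⟨(i, inl j), hi⟩)) =
      Sum.elim (fun a => Sum.elim (fun b => (if b = i ∧ a = j then 1 else 0) -
        if a = i ∧ b = j then 1 else 0) 0 y') (fun a => Sum.elim 0
        (fun b => (if a = i ∧ b = j then 1 else 0) - if b = i ∧ a = j then 1 else 0) y') y := by
  have hw := W.wne
  rw [W.sconst_eq, he, he, he, Q_vec (lie_mem_jPart (by simp [sgn]) (vec_mem_jPart _)
    (vec_mem_jPart _) : _ ∈ jPart _ (-1)), div_eq_iff hw]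
  have key : ∀ X Y : g₅ (n + 1), ((⁅X, Y⁆ : g₅ (n + 1)) :
      Matrix (CI n) (CI n) ℝ) =
      X.1 * Y - Y * X :=
    fun X Y => rfl
  rw [key]
  change _ * (_ * (cE _ _ _ * cE _ _ _ - cE _ _ _ * cE _ _ _ : Matrix (CI n)
    (CI n) ℝ) _ _) = _
  rcases y with a | a <;> rcases y' with b | b <;>
    simp [cE, skewE_apply, mul_apply, src, tgt, sgn, (Fin.succ_ne_zero _).symm, ite_and]
  all_goals split_ifs <;> ring

theorem isotropy (he : ∀ q, (e q : g₅ (n + 1)) = q.vec) (hn : 2 ≤ n)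
    (W : WallachFrame (k₅ (n + 1)) (p₅ (n + 1)) e sec
      (4 * killConst (CI n) Unit)) {a : Fin 3 → ℝ}
    (hI : IsIsotropic e sec (4 * killConst (CI n) Unit) a) :
    a = ![((n : ℝ) - 1) / (4 * n), ((n : ℝ) - 1) / (4 * n), 1 / (2 * (n : ℝ))] := by
  have hn' : (0 : ℝ) < n := Nat.cast_pos.2 (by omega)
  have h2 : a 2 = 1 / (2 * n) := by
    let i : Fin n := ⟨0, by omega⟩
    let j : Fin n := ⟨1, by omega⟩
    have hij : i < j := by simp [i, j, Fin.lt_def]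
    have h1 := W.contract hI (fun r r' => if r = 0 ∧ r' = 1 then 1 else 0)
      (inr (inr ⟨(i, inl j), hij⟩)) (inr (inr ⟨(i, inl j), hij⟩))
    simp only [← W.sconst_cycle _ _ (inr (inr ⟨(i, inl j), hij⟩))] at h1
    simp only [sum_sum_type (α₁ := Fin n ⊕ Fin n), sec, elim_inl, elim_inr,
      sconst_eq he W, Fin.isValue, one_ne_zero, zero_ne_one, Fin.reduceEq, false_and, and_false,
      if_false, zero_mul, sum_const_zero, and_self, if_true, one_mul, zero_add, add_zero,
      Fin.reduceAdd, mul_one] at h1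
    rw [killConst_eq] at h1
    have h3 : ∑ x : Fin n, ∑ y : Fin n, (((if x = i ∧ y = j then (1 : ℝ) else 0) -
        if y = i ∧ x = j then 1 else 0) * ((if x = i ∧ y = j then (1 : ℝ) else 0) -
        if y = i ∧ x = j then 1 else 0)) = 2 := by
      have h4 : ∀ x y : Fin n, (((if x = i ∧ y = j then (1 : ℝ) else 0) -
          if y = i ∧ x = j then 1 else 0) * ((if x = i ∧ y = j then (1 : ℝ) else 0) -
          if y = i ∧ x = j then 1 else 0)) =
          (if x = i then if y = j then 1 else 0 else 0) +
            if x = j then if y = i then 1 else 0 else 0 := by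
        intro x y
        by_cases h5 : x = i
        · by_cases h6 : y = j <;> simp [h5, h6, hij.ne]
        · by_cases h6 : x = j <;> by_cases h7 : y = i <;> simp [h5, h6, h7, hij.ne']
      simp only [h4, sum_add_distrib, Finset.sum_ite_irrel, sum_ite_eq',
        mem_univ, if_true, sum_const_zero]
      norm_num
    simp only [sum_sum_type, elim_inl, elim_inr, Pi.zero_apply, mul_zero,
      sum_const_zero, add_zero, zero_add, h3] at h1
    rw [sum_comm, h3] at h1
    rw [eq_div_iff (by positivity)]
    linear_combination -h1 / 4
  have hc := fun r r' (h : r ≠ r') => W.card_mul_eq hI h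
  have h0 := hc 0 1 (by decide)
  have h1 := hc 0 2 (by decide)
  rw [card_sec, card_sec] at h0 h1
  simp only [cons_val] at h0 h1
  have h3 : a 0 = (n - 1) / (4 * n) := by
    rw [h2] at h1
    field_simp at h1 ⊢
    linear_combination h1
  funext r
  fin_cases r
  · exact h3
  · exact (mul_left_cancel₀ (by positivity) h0).symm.trans h3
  · exact h2

theorem exists_wallachData (hn : 2 ≤ n) : ∃ e : Basis (CPos n) ℝ (tangent (k₅ (n + 1))),
    IsSchur (Ad₅ (n + 1)) e sec ∧ WallachData (k₅ (n + 1)) (Ad₅ (n + 1)) (p₅ (n + 1)) e sec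
      (4 * killConst (CI n) Unit) ((n - 1) / (4 * n)) (1 / (2 * n)) := by
  obtain ⟨e, he, W⟩ := exists_frame hn
  obtain ⟨a, hI⟩ := W.exists_isIsotropic p₅_stable (isSchur he).isBlockSchur
  rw [isotropy he hn W hI] at hI
  have hn' : (2 : ℝ) ≤ n := by exact_mod_cast hn
  refine ⟨e, isSchur he, W, p₅_stable, hI, by apply div_pos <;> linarith, by positivity, ?_⟩
  have h0 := card_sec (n := n) 0
  have h1 := card_sec (n := n) 1
  exact_mod_cast h0.trans h1.symm
end CPos

section Rows
variable {b c : ℝ}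

/-- The Einstein metrics of `SO(2l)/U(1)×U(l-1)`. -/
theorem WallachData.hermitian_rows {l : ℝ} (D : WallachData K Ad p e s w b c) (hS : IsSchur Ad e s)
    (hl : 4 < l) (hb : b = (l - 2) / (4 * (l - 1))) (hc : c = 1 / (2 * (l - 1))) :
    (∀ q u : ℝ, q = qPlus b c → u = (l + 2) / (2 * (l - 1)) →
      q = 2 ∧ EinsteinRow K Ad (diagMetric K p (gq q)) {0, u} 0 u (l / (2 * (l - 1))) ∧
      IsSaddle K Ad (diagMetric K p (gq q)) ∧ HasCoindex K Ad (diagMetric K p (gq q)) 1) ∧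
    (∀ q u : ℝ, q = qMinus b c → u = (l ^ 2 - 4) / (2 * l * (l - 1)) →
      q = 2 * (l - 2) / l ∧ EinsteinRow K Ad (diagMetric K p (gq q)) {2 / l, u} (2 / l) u
        ((l ^ 2 + 2 * l - 4) / (2 * l * (l - 1))) ∧
      IsLocMin K Ad (diagMetric K p (gq q)) ∧ HasCoindex K Ad (diagMetric K p (gq q)) 2) ∧
    (∀ t u : ℝ, t = pPlus b c → u = l * (5 * l - 8) / (2 * (3 * l ^ 2 - 7 * l + 4)) →
      t = (3 * l - 4) / l ∧
      EinsteinRow K Ad (diagMetric K p (gp b t)) {0, u} 0 u (l / (2 * (l - 1))) ∧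
      IsSaddle K Ad (diagMetric K p (gp b t)) ∧ HasCoindex K Ad (diagMetric K p (gp b t)) 1) ∧
    (∀ t u : ℝ, t = pMinus b c → u = (5 * l - 8) / (2 * (l - 1)) → t = l / (3 * l - 4) ∧
      EinsteinRow K Ad (diagMetric K p (gp b t)) {0, u} 0 u ((3 * l - 4) / (2 * (l - 1))) ∧
      IsSaddle K Ad (diagMetric K p (gp b t)) ∧ HasCoindex K Ad (diagMetric K p (gp b t)) 1) := by
  obtain ⟨m, rfl⟩ : ∃ m, l = m + 2 := ⟨l - 2, by ring⟩
  have hm : 0 < m := by linarith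
  have e1 : m + 2 - 1 = m + 1 := by ring
  have e2 : m + 2 - 2 = m := by ring
  have e3 : 3 * (m + 2) - 4 = 3 * m + 2 := by ring
  have e4 : 5 * (m + 2) - 8 = 5 * m + 2 := by ring
  have e5 : 3 * (m + 2) ^ 2 - 7 * (m + 2) + 4 = (m + 1) * (3 * m + 2) := by ring
  rw [e1] at hb hc
  rw [e2] at hb
  have hb' : b = m / (2 * (2 + 2 * m)) := by rw [hb]; field_simp; ring
  have hc' : c = 2 / (2 * (2 + 2 * m)) := by rw [hc]; field_simp; ring
  rw [e1, e2, e3, e4, e5]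
  refine ⟨fun q u hq hu => ?_, fun q u hq hu => ?_, fun t u ht hu => ?_, fun t u ht hu => ?_⟩
  · refine D.half_qPlus hS two_pos hm hb' hc' hq ?_ ?_
    · rw [hu]; field_simp; ring
    · field_simp; ring
  · obtain ⟨h1, h2, -, h3, h4⟩ := D.half_qMinus hS two_pos hm (by linarith) hb' hc' hq
      (l := 2 / (m + 2)) (u := u) (r := ((m + 2) ^ 2 + 2 * (m + 2) - 4) / (2 * (m + 2) * (m + 1)))
      (by rw [add_comm]) (by rw [hu]; field_simp; ring) (by field_simp; ring)
    exact ⟨by rw [h1, add_comm], h2 (by linarith), h3, h4⟩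
  · obtain ⟨h1, h2⟩ := D.half_pPlus hS two_pos hm hb' hc' ht (u := u) (r := (m + 2) / (2 * (m + 1)))
      (by rw [hu]; field_simp; ring) (by field_simp; ring)
    exact ⟨by rw [h1]; ring, h2⟩
  · obtain ⟨h1, h2⟩ := D.half_pMinus hS two_pos hm hb' hc' ht (u := u)
      (r := (3 * m + 2) / (2 * (m + 1))) (by rw [hu]; field_simp; ring) (by field_simp; ring)
    exact ⟨by rw [h1]; ring, h2⟩
end Rows

/-! ### The curvature in terms of structure constants -/

section TableDefs
variable {R ι : Type*} [Field R] [Fintype ι]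

/-- The components of `θ(A)μ`, where `A` has the matrix `a` and `μ` the structure constants `c`. -/
def tabTheta (c : ι → ι → ι → R) (a : ι → ι → R) (i j k : ι) : R :=
  ∑ l, (c i j l * a k l - a l i * c l j k - a l j * c i l k)

/-- The components of the moment map in an orthogonal basis with square lengths `W`. -/
def tabMoment (c : ι → ι → ι → R) (W : ι → R) (i j : ι) : R :=
  -(1 / 2) * ∑ u, (W u)⁻¹ * ∑ k, W k * (c i u k * c j u k) +
    (1 / 4) * ∑ u, (W u)⁻¹ * ∑ v, (W v)⁻¹ * (W i * c u v i * (W j * c u v j))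

/-- The value of `⟨L_𝔭 A, E⟩` for the elementary matrix `E` with entry `1` at `(k, l)`. -/
def tabLich (c : ι → ι → ι → R) (W : ι → R) (a : ι → ι → R) (k l : ι) : R :=
  (1 / 2) * (∑ i, (W i)⁻¹ * ∑ j, (W j)⁻¹ * (W k * tabTheta c a i j k * c i j l) -
    ∑ j, (W l)⁻¹ * ∑ i, (W j)⁻¹ * (W i * tabTheta c a l j i * c k j i) -
    ∑ i, (W i)⁻¹ * ∑ j, (W l)⁻¹ * (W j * tabTheta c a i l j * c i k j)) +
    2 * ((W l)⁻¹ * ∑ n, a n k * tabMoment c W n l)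

/-- The components of the divergence. -/
def tabDiv (c : ι → ι → ι → R) (W : ι → R) (a : ι → ι → R) (x : ι) : R :=
  ∑ i, (∑ l, a l x * c l i i + (1 / 2) * (W i)⁻¹ *
    ∑ l, a l i * (W l * c i x l + W x * c l i x + W i * c l x i))

section
variable (c : ι → ι → ι → ℚ)
include c

theorem tabMoment_cast (W : ι → ℚ) (i j : ι) :
    tabMoment (fun i j k => (c i j k : ℝ)) (fun i => (W i : ℝ)) i j = (tabMoment c W i j : ℚ) := by
  simp [tabMoment]

theorem tabLich_cast (W : ι → ℚ) (a : ι → ι → ℚ) (k l : ι) :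
    tabLich (fun i j k => (c i j k : ℝ)) (fun i => (W i : ℝ)) (fun i j => (a i j : ℝ)) k l =
      (tabLich c W a k l : ℚ) := by
  simp [tabLich, tabTheta, tabMoment_cast]

theorem tabDiv_cast (W : ι → ℚ) (a : ι → ι → ℚ) (x : ι) :
    tabDiv (fun i j k => (c i j k : ℝ)) (fun i => (W i : ℝ)) (fun i j => (a i j : ℝ)) x =
      (tabDiv c W a x : ℚ) := by
  simp [tabDiv]
end
end TableDefs

/-- The matrix entries of an endomorphism. -/
def coef (e : Basis ι ℝ (tangent K)) (A : End ℝ (tangent K)) (k l : ι) : ℝ :=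
  e.repr (A (e l)) k

theorem apply_eq_sum_coef (A : End ℝ (tangent K)) (l : ι) : A (e l) = ∑ k, coef e A k l • e k :=
  (e.sum_repr _).symm

theorem bracketP_eq_sum (i j : ι) : bracketP K (e i) (e j) = ∑ k, sconst e i j k • e k :=
  (e.sum_repr _).symm

theorem trace_mul_eq_sum (A B : End ℝ (tangent K)) :
    trace ℝ _ (A * B) = ∑ k, ∑ l, coef e B k l * coef e A l k := by
  rw [LinearMap.trace_eq_matrix_trace ℝ e, Matrix.trace, sum_comm]
  refine sum_congr rfl fun l _ => ?_
  rw [Matrix.diag_apply, LinearMap.toMatrix_apply, End.mul_apply, apply_eq_sum_coef B,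
    map_sum, map_sum, Finsupp.coe_finsetSum, Finset.sum_apply]
  exact sum_congr rfl fun k _ => by
    rw [map_smul, map_smul, Finsupp.smul_apply, smul_eq_mul, coef, coef]

namespace OrthBasis

section
variable (h : OrthBasis g e W)
include h

theorem moment_tab (i j : ι) :
    moment g (bracketP K) (e i) (e j) = tabMoment (sconst e) W i j := by
  rw [h.moment_eq (isBilin_bracketP K), tabMoment]
  simp only [h.apply_right, h.apply (bracketP K _ _)]
  rfl

theorem isEinstein_tab {ρ : ℝ}
    (hρ : ∀ i j, tabMoment (sconst e) W i j + 1 / 2 * Q L (e i) (e j) =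
      ρ * if i = j then W i else 0) : IsEinstein K g ρ := by
  have hM := h.isBilin_moment (isBilin_bracketP K)
  have hR : IsBilin fun X Y => ricci K g X Y := by
    refine ⟨fun X Y Z => ?_, fun r X Z => ?_, fun X Y Z => ?_, fun r X Z => ?_⟩ <;>
    · simp only [ricci, hM.add_left, hM.add_right, hM.smul_left, hM.smul_right, Submodule.coe_add,
        Submodule.coe_smul, map_add, map_smul, LinearMap.add_apply, LinearMap.smul_apply,
        smul_eq_mul]
      ring
  have hg : IsBilin fun X Y => ρ * g X Y := by
    refine ⟨fun X Y Z => ?_, fun r X Z => ?_, fun X Y Z => ?_, fun r X Z => ?_⟩ <;>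
    · simp only [map_add, map_smul, LinearMap.add_apply, LinearMap.smul_apply, smul_eq_mul]
      ring
  refine hR.ext_basis hg e fun i j => ?_
  rw [h.gram, ← hρ i j, ricci, h.moment_tab, Q, LinearMap.neg_apply, LinearMap.neg_apply]
  ring

theorem lichForm_single (A : End ℝ (tangent K)) (k l : ι) :
    lichForm g (bracketP K) A ((e.coord l).smulRight (e k)) =
      tabLich (sconst e) W (coef e A) k l := by
  have hM := h.isBilin_moment (isBilin_bracketP K)
  have h1 : ∀ i j n, e.repr (theta ((e.coord l).smulRight (e k)) (bracketP K) (e i) (e j)) n =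
      (if k = n then sconst e i j l else 0) - (if i = l then sconst e k j n else 0) -
        if j = l then sconst e i k n else 0 := by
    intro i j n
    simp only [theta, map_sub, LinearMap.smulRight_apply, Basis.coord_apply, Basis.repr_self,
      (isBilin_bracketP K).smul_left, (isBilin_bracketP K).smul_right, map_smul,
      Finsupp.sub_apply, Finsupp.smul_apply, smul_eq_mul, Finsupp.single_apply, mul_ite, mul_one,
      mul_zero, ite_mul, one_mul, zero_mul]
    rfl
  have h2 : ∀ i j n, e.repr (theta A (bracketP K) (e i) (e j)) n =
      tabTheta (sconst e) (coef e A) i j n := fun i j n => WallachFrame.repr_theta_basis A i j n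
  have h3 : ∀ i, moment g (bracketP K) (A (((e.coord l).smulRight (e k)) (e i))) (e i) =
      if i = l then ∑ n, coef e A n k * tabMoment (sconst e) W n i else 0 := by
    intro i
    rw [LinearMap.smulRight_apply, Basis.coord_apply, Basis.repr_self, map_smul, hM.smul_left,
      apply_eq_sum_coef A, hM.sum_left, Finsupp.single_apply]
    simp only [hM.smul_left, h.moment_tab, smul_eq_mul, ite_mul, one_mul, zero_mul]
  rw [h.lichForm_eq (isBilin_bracketP K), tabLich]
  simp only [h.apply, h1, h2, h3, mul_sub, mul_ite, mul_zero, sum_sub_distrib,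
    sum_ite_eq, Finset.sum_ite_irrel, sum_const_zero, sum_ite_eq',
    mem_univ, if_true]
  simp only [mul_sum, mul_assoc]

theorem lichForm_tab (A B : End ℝ (tangent K)) : lichForm g (bracketP K) A B =
      ∑ k, ∑ l, coef e B k l * tabLich (sconst e) W (coef e A) k l := by
  have h1 : B = ∑ k, ∑ l, coef e B k l • (e.coord l).smulRight (e k) := by
    refine e.ext fun j => ?_
    rw [apply_eq_sum_coef B]
    simp [LinearMap.sum_apply, Finsupp.single_apply]
  have hl := h.isBilin_lichForm (isBilin_bracketP K)
  conv_lhs => rw [h1]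
  simp only [hl.sum_right, hl.smul_right, h.lichForm_single, smul_eq_mul]

/-- A matrix identity that makes `A` an eigentensor of the Lichnerowicz Laplacian. -/
theorem lichForm_eigen_tab {A : End ℝ (tangent K)} {t : ℝ}
    (ht : ∀ k l, W l * tabLich (sconst e) W (coef e A) k l +
      W k * tabLich (sconst e) W (coef e A) l k = t * (W l * coef e A l k + W k * coef e A k l))
    {B : End ℝ (tangent K)} (hB : B ∈ symEnd g) :
    lichForm g (bracketP K) A B = t * trace ℝ _ (A * B) := by
  have h1 : ∀ k l, W k * coef e B k l = W l * coef e B l k := fun k l => by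
    have := hB (e l) (e k)
    rwa [h.apply_right, h.apply_left] at this
  rw [h.lichForm_tab, trace_mul_eq_sum (e := e), mul_sum, ← sub_eq_zero, ← sum_sub_distrib]
  simp only [mul_sum, ← sum_sub_distrib]
  set S : ι → ι → ℝ := fun k l => coef e B k l * tabLich (sconst e) W (coef e A) k l -
    t * (coef e B k l * coef e A l k) with hS
  have h2 : ∀ k l, S k l = -S l k := fun k l => by
    refine mul_left_cancel₀ (h.ne l) ?_
    simp only [hS]
    linear_combination coef e B k l * ht k l + (-tabLich (sconst e) W (coef e A) l k +
      t * coef e A k l) * h1 k l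
  have h3 : ∑ k, ∑ l, S k l = -∑ k, ∑ l, S k l := by
    conv_lhs => rw [sum_comm]
    rw [← sum_neg_distrib]
    refine sum_congr rfl fun k _ => ?_
    rw [← sum_neg_distrib]
    exact sum_congr rfl fun l _ => h2 l k
  linarith

theorem divergence_tab (A : End ℝ (tangent K)) (x : ι) :
    divergence g (bracketP K) A (e x) = tabDiv (sconst e) W (coef e A) x := by
  have hμ := isBilin_bracketP K
  unfold divergence
  rw [h.gtr_eq, tabDiv]
  · refine sum_congr rfl fun i _ => ?_
    have h0 : bracketP K (e i) (e i) = 0 := by simp [bracketP]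
    have h1 : ∀ l y, bracketP K (A (e l)) y = ∑ k, coef e A k l • bracketP K (e k) y := fun l y => by
      rw [apply_eq_sum_coef A, hμ.sum_left]
      simp only [hμ.smul_left]
    have h2 : ∀ y l z, g (bracketP K (A (e l)) y) (e z) =
        ∑ k, coef e A k l * (W z * e.repr (bracketP K (e k) y) z) := fun y l z => by
      rw [h1]
      simp only [map_sum, map_smul, LinearMap.sum_apply, LinearMap.smul_apply, h.apply_right, smul_eq_mul]
    have h3 : ∀ z l, g z (A (e l)) = ∑ k, coef e A k l * (W k * e.repr z k) := fun z l => by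
      rw [apply_eq_sum_coef A]
      simp only [map_sum, map_smul, h.apply_right, smul_eq_mul]
    have hW := h.ne i
    simp only [leviCivita, h0, map_zero, LinearMap.zero_apply, zero_add,
      h.symm (e i) (bracketP K _ _), h2, h3, mul_add, sum_add_distrib, sconst]
    have h4 : ∀ f : ι → ℝ, ∑ k, coef e A k x * (W i * f k) = W i * ∑ k, coef e A k x * f k :=
      fun f => by rw [mul_sum]; exact sum_congr rfl fun _ _ => by ring
    rw [h4]
    linear_combination (∑ k, coef e A k x * e.repr (bracketP K (e k) (e i)) i) *
      inv_mul_cancel₀ hW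
  · constructor <;> intros <;>
    simp only [leviCivita, map_add, map_smul, hμ.add_left, hμ.add_right, hμ.smul_left,
      hμ.smul_right, LinearMap.add_apply, LinearMap.smul_apply, smul_eq_mul] <;> ring

theorem divergence_eq_sum (A : End ℝ (tangent K)) (X : tangent K) :
    divergence g (bracketP K) A X = ∑ x, e.repr X x * tabDiv (sconst e) W (coef e A) x := by
  have hμ := isBilin_bracketP K
  have hb : ∀ X, IsBilin fun u v => leviCivita g (bracketP K) u v (A X) +
      leviCivita g (bracketP K) u X (A v) := fun X => by
    constructor <;> intros <;>
    simp only [leviCivita, map_add, map_smul, hμ.add_left, hμ.add_right, hμ.smul_left,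
      hμ.smul_right, LinearMap.add_apply, LinearMap.smul_apply, smul_eq_mul] <;> ring
  have hd : ∀ X, divergence g (bracketP K) A X = ∑ i, (W i)⁻¹ *
      (leviCivita g (bracketP K) (e i) (e i) (A X) +
        leviCivita g (bracketP K) (e i) X (A (e i))) := fun X => h.gtr_eq (hb X)
  have hl : IsLinearMap ℝ (divergence g (bracketP K) A) := by
    constructor <;> intros <;>
    · simp only [hd, leviCivita, map_add, map_smul, hμ.add_left,
        hμ.add_right, hμ.smul_left, hμ.smul_right, LinearMap.add_apply, LinearMap.smul_apply,
        smul_eq_mul, ← sum_add_distrib, mul_sum]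
      exact sum_congr rfl fun _ _ => by ring
  have h1 := congrArg (hl.mk' _) (e.sum_repr X)
  rw [map_sum] at h1
  simp only [map_smul, IsLinearMap.mk'_apply, h.divergence_tab, smul_eq_mul] at h1
  exact h1.symm
end
end OrthBasis

/-! ### Five-dimensional spaces with isotropy `SO(2)` -/

section RotTables
variable {R : Type*} [Field R]

/-- The matrix of a rotation in the first two planes. -/
def turnMat (p r : R) : Fin 5 → Fin 5 → R :=
  ![![p, -r, 0, 0, 0], ![r, p, 0, 0, 0], ![0, 0, p, -r, 0], ![0, 0, r, p, 0], ![0, 0, 0, 0, 1]]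

/-- The general symmetric matrix which commutes with the rotations. -/
def rotMat (W θ : Fin 5 → R) : Fin 5 → Fin 5 → R :=
  ![![θ 0, 0, θ 3 / W 0, θ 4 / W 0, 0], ![0, θ 0, -θ 4 / W 0, θ 3 / W 0, 0],
    ![θ 3 / W 2, -θ 4 / W 2, θ 1, 0, 0], ![θ 4 / W 2, θ 3 / W 2, 0, θ 1, 0], ![0, 0, 0, 0, θ 2]]

theorem rotMat_cast (W θ : Fin 5 → ℚ) (k l : Fin 5) :
    rotMat (fun i => (W i : ℝ)) (fun i => (θ i : ℝ)) k l = (rotMat W θ k l : ℚ) := by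
  fin_cases k <;> fin_cases l <;> simp [rotMat]

theorem isLinearMap_rotMat (W : Fin 5 → R) : IsLinearMap R (rotMat W) := by
  constructor
  · intro θ θ'
    funext k l
    fin_cases k <;> fin_cases l <;> simp [rotMat, add_div, neg_div] <;> ring
  · intro y θ
    funext k l
    fin_cases k <;> fin_cases l <;> simp [rotMat, mul_div_assoc] <;> ring

theorem isLinearMap_tabDiv {ι : Type*} [Fintype ι] (c : ι → ι → ι → R) (W : ι → R) (x : ι) :
    IsLinearMap R fun a => tabDiv c W a x := by
  constructor
  · intro a b
    simp only [tabDiv, Pi.add_apply, add_mul, sum_add_distrib, mul_add]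
    ring
  · intro y a
    simp only [tabDiv, Pi.smul_apply, smul_eq_mul, mul_sum, sum_add_distrib, mul_add]
    refine congrArg₂ _ ?_ (congrArg₂ _ (congrArg₂ _ ?_ ?_) ?_) <;>
    exact sum_congr rfl fun _ _ => sum_congr rfl fun _ _ => by ring

theorem tabDiv_rotMat (c : Fin 5 → Fin 5 → Fin 5 → ℚ) (W : Fin 5 → ℚ) (θ : Fin 5 → ℝ) (x : Fin 5) :
    tabDiv (fun i j k => (c i j k : ℝ)) (fun i => (W i : ℝ)) (rotMat (fun i => (W i : ℝ)) θ) x =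
      ∑ j, θ j * (tabDiv c W (rotMat W (Pi.single j 1)) x : ℚ) := by
  have h1 := map_sum (((isLinearMap_tabDiv (fun i j k => (c i j k : ℝ))
    (fun i => (W i : ℝ)) x).mk' _).comp ((isLinearMap_rotMat fun i => (W i : ℝ)).mk' _))
    (fun j => θ j • fun i => ((Pi.single j 1 : Fin 5 → ℚ) i : ℝ)) Finset.univ
  simp only [map_smul, LinearMap.comp_apply, IsLinearMap.mk'_apply] at h1
  rw [show ∑ j, θ j • (fun i => ((Pi.single j 1 : Fin 5 → ℚ) i : ℝ)) = θ by
    funext i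
    simp [Finset.sum_apply, Pi.single_apply, apply_ite (Rat.cast : ℚ → ℝ)]] at h1
  rw [h1]
  refine sum_congr rfl fun j _ => ?_
  rw [smul_eq_mul, ← tabDiv_cast]
  congr 2
  exact funext fun k => funext fun l => rotMat_cast W _ k l
end RotTables

section RotFrames
variable {v : Basis (Fin 5) ℝ (tangent K)} {c : Fin 5 → Fin 5 → Fin 5 → ℚ} {W : Fin 5 → ℚ} {ρ : ℝ}

/-- The endomorphism with a given matrix. -/
def opMat (v : Basis (Fin 5) ℝ (tangent K)) (a : Fin 5 → Fin 5 → ℝ) :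
    End ℝ (tangent K) := v.constr ℝ fun l => ∑ k, a k l • v k

theorem opMat_apply (a : Fin 5 → Fin 5 → ℝ) (l : Fin 5) :
    opMat v a (v l) = ∑ k, a k l • v k := v.constr_basis ℝ _ l

theorem coef_opMat (a : Fin 5 → Fin 5 → ℝ) : coef v (opMat v a) = a := by
  funext k l
  rw [coef, opMat_apply, v.repr_sum_self]

theorem coef_injective : Function.Injective (coef v) := fun A B h =>
  v.ext fun l => by rw [apply_eq_sum_coef A, apply_eq_sum_coef B, h]

theorem coef_mul (A B : End ℝ (tangent K)) (k l : Fin 5) :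
    coef v (A * B) k l = ∑ n, coef v A k n * coef v B n l := by
  rw [coef, End.mul_apply, apply_eq_sum_coef B, map_sum, map_sum, Finsupp.coe_finsetSum,
    Finset.sum_apply]
  exact sum_congr rfl fun n _ => by
    rw [map_smul, map_smul, Finsupp.smul_apply, smul_eq_mul, mul_comm, coef, coef]

/-- The isotropy group acts by simultaneous rotations of the planes of `v_0, v_1` and of
`v_2, v_3`, and the structure constants are `c`. -/
structure RotFrame (K : LieSubalgebra ℝ L) (Ad : Set (L ≃ₗ⁅ℝ⁆ L)) (v : Basis (Fin 5) ℝ (tangent K))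
    (c : Fin 5 → Fin 5 → Fin 5 → ℚ) : Prop where
  sconst_eq : sconst v = fun i j k => (c i j k : ℝ)
  turn : ∀ φ ∈ Ad, ∃ p r : ℝ, p ^ 2 + r ^ 2 = 1 ∧
    ∀ X : tangent K, (opMat v (turnMat p r) X : L) = φ X
  quarter : ∃ φ ∈ Ad, ∀ X : tangent K, (opMat v (turnMat 0 1) X : L) = φ X

/-- The invariant symmetric endomorphism with parameters `θ`. -/
def rotOp (v : Basis (Fin 5) ℝ (tangent K)) (W : Fin 5 → ℚ) (θ : Fin 5 → ℝ) :
    End ℝ (tangent K) := opMat v (rotMat (fun i => (W i : ℝ)) θ)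

theorem coef_rotOp (θ : Fin 5 → ℝ) : coef v (rotOp v W θ) = rotMat (fun i => (W i : ℝ)) θ :=
  coef_opMat _

theorem sum_rotOp {κ : Type*} [Fintype κ] (θ : κ → Fin 5 → ℝ) (y : κ → ℝ) :
    ∑ i, y i • rotOp v W (θ i) = rotOp v W (∑ i, y i • θ i) := by
  have h1 := map_sum ((isLinearMap_rotMat fun i => (W i : ℝ)).mk' _) (fun i => y i • θ i) Finset.univ
  simp only [map_smul, IsLinearMap.mk'_apply] at h1
  refine coef_injective (v := v) ?_
  rw [coef_rotOp, h1]
  funext k l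
  simp only [Finset.sum_apply, Pi.smul_apply, smul_eq_mul, coef, LinearMap.sum_apply,
    LinearMap.smul_apply, map_sum, map_smul, Finsupp.coe_finsetSum, Finsupp.smul_apply]
  exact sum_congr rfl fun i _ => by
    rw [← coef_rotOp (v := v) (W := W), coef]

theorem trace_rotOp (θ : Fin 5 → ℝ) : trace ℝ _ (rotOp v W θ) = 2 * θ 0 + 2 * θ 1 + θ 2 := by
  rw [LinearMap.trace_eq_matrix_trace ℝ v, Matrix.trace]
  simp only [Matrix.diag_apply, LinearMap.toMatrix_apply]
  change ∑ i, coef v (rotOp v W θ) i i = _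
  rw [coef_rotOp, Fin.sum_univ_five]
  simp [rotMat]
  ring

namespace RotFrame

section
variable (H : RotFrame K Ad v c)
include H

theorem isInvMetric (h : OrthBasis g v fun i => (W i : ℝ))
    (h01 : W 0 = W 1) (h23 : W 2 = W 3) : IsInvMetric K Ad g := by
  refine ⟨h.symm, h.self_pos, fun φ hφ X Y X' Y' hX hY => ?_⟩
  obtain ⟨p, r, hpr, hΦ⟩ := H.turn φ hφ
  rw [Subtype.ext (hX.trans (hΦ X).symm), Subtype.ext (hY.trans (hΦ Y).symm)]
  refine IsBilin.ext_basis (β := fun X Y => g (opMat v (turnMat p r) X) (opMat v (turnMat p r) Y))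
    (γ := fun X Y => g X Y) ⟨by simp, by simp, by simp, by simp⟩ (isBilin_bilinForm g) v
    (fun i j => ?_) X Y
  have h1 : ∀ k l, v.repr (opMat v (turnMat p r) (v l)) k = turnMat p r k l := fun k l =>
    congrFun (congrFun (coef_opMat _) k) l
  simp only [h.apply (opMat _ _ _), h1, h.gram, Fin.sum_univ_five, ← h01, ← h23]
  fin_cases i <;> fin_cases j <;> simp [turnMat, ← h01, ← h23] <;>
    first
    | ring1
    | linear_combination (W 0 : ℝ) * hpr
    | linear_combination (W 2 : ℝ) * hpr

theorem rotOp_mem_symEndK (h : OrthBasis g v fun i => (W i : ℝ))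
    (h01 : W 0 = W 1) (h23 : W 2 = W 3) (θ : Fin 5 → ℝ) : rotOp v W θ ∈ symEndK K Ad g := by
  have h0 := h.ne 0
  have h2 := h.ne 2
  refine ⟨h.mem_symEnd fun i j => ?_, fun φ hφ X Y hXY => ?_⟩
  · rw [h.apply_right, h.apply_left]
    change (W j : ℝ) * coef v (rotOp v W θ) j i = W i * coef v (rotOp v W θ) i j
    rw [coef_rotOp]
    fin_cases i <;> fin_cases j <;> simp [rotMat, ← h01, ← h23] <;> field_simp
  · obtain ⟨p, r, hpr, hΦ⟩ := H.turn φ hφ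
    rw [← hΦ, Subtype.ext (hXY.trans (hΦ X).symm), ← End.mul_apply, ← End.mul_apply]
    congr 2
    refine coef_injective (v := v) (funext fun k => funext fun l => ?_)
    rw [coef_mul, coef_mul, coef_rotOp, coef_opMat, Fin.sum_univ_five, Fin.sum_univ_five]
    fin_cases k <;> fin_cases l <;> simp [rotMat, turnMat] <;> ring

theorem exists_rotOp (h : OrthBasis g v fun i => (W i : ℝ))
    (h01 : W 0 = W 1) (h23 : W 2 = W 3) {A : End ℝ (tangent K)} (hA : A ∈ symEndK K Ad g) :
    ∃ θ, A = rotOp v W θ := by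
  have h0 := h.ne 0
  have h2 := h.ne 2
  obtain ⟨φ, hφ, hΦ⟩ := H.quarter
  have h3 : A * opMat v (turnMat 0 1) = opMat v (turnMat 0 1) * A := LinearMap.ext fun X =>
    Subtype.ext ((hA.2 φ hφ X _ (hΦ X)).trans (hΦ _).symm)
  have h4 : ∀ k l, ∑ n, coef v A k n * turnMat 0 1 n l = ∑ n, turnMat 0 1 k n * coef v A n l :=
    fun k l => by
      rw [← coef_opMat (v := v) (turnMat 0 1), ← coef_mul, h3, coef_mul]
  have h5 : ∀ k l, (W k : ℝ) * coef v A k l = W l * coef v A l k := fun k l => by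
    have := hA.1 (v l) (v k)
    rwa [h.apply_right, h.apply_left] at this
  simp only [Fin.sum_univ_five] at h4
  have h6 := h5 0 1
  have h7 := h5 2 3
  have h8 := h5 0 2
  have h9 := h5 0 3
  rw [← h01, mul_right_inj' h0] at h6
  rw [← h23, mul_right_inj' h2] at h7
  rw [← h23] at h9
  have e20 : coef v A 2 0 = W 0 * coef v A 0 2 / W 2 := by rw [eq_div_iff h2, h8, mul_comm]
  have e30 : coef v A 3 0 = W 0 * coef v A 0 3 / W 2 := by rw [eq_div_iff h2, h9, mul_comm]
  refine ⟨![coef v A 0 0, coef v A 2 2, coef v A 4 4, W 0 * coef v A 0 2, W 0 * coef v A 0 3],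
    coef_injective (v := v) (funext fun k => funext fun l => ?_)⟩
  have i00 := h4 0 0
  have i10 := h4 1 0
  have i20 := h4 2 0
  have i30 := h4 3 0
  have i40 := h4 4 0
  have i41 := h4 4 1
  have i02 := h4 0 2
  have i12 := h4 1 2
  have i22 := h4 2 2
  have i32 := h4 3 2
  have i42 := h4 4 2
  have i43 := h4 4 3
  have i04 := h4 0 4
  have i14 := h4 1 4
  have i24 := h4 2 4
  have i34 := h4 3 4
  simp [turnMat] at i00 i10 i20 i30 i40 i41 i02 i12 i22 i32 i42 i43 i04 i14 i24 i34
  rw [coef_rotOp]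
  fin_cases k <;> fin_cases l <;> simp [rotMat, neg_div, mul_div_cancel_left₀ _ h0, ← e20, ← e30] <;>
    linarith

theorem rotOp_mem_TT (h : OrthBasis g v fun i => (W i : ℝ))
    (h01 : W 0 = W 1) (h23 : W 2 = W 3) (θ : Fin 5 → ℝ) : rotOp v W θ ∈ TT K Ad g ↔
      2 * θ 0 + 2 * θ 1 + θ 2 = 0 ∧ ∀ x, tabDiv (fun i j k => (c i j k : ℝ))
        (fun i => (W i : ℝ)) (rotMat (fun i => (W i : ℝ)) θ) x = 0 := by
  constructor
  · rintro ⟨-, h2, h3⟩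
    refine ⟨by rw [← trace_rotOp (v := v) (W := W), h2], fun x => ?_⟩
    rw [← h3 (v x), h.divergence_tab, coef_rotOp, H.sconst_eq]
  · rintro ⟨h2, h3⟩
    refine ⟨H.rotOp_mem_symEndK h h01 h23 θ, by rw [trace_rotOp, h2], fun X => ?_⟩
    rw [h.divergence_eq_sum, coef_rotOp, H.sconst_eq]
    exact sum_eq_zero fun x _ => by rw [h3, mul_zero]

/-- An eigenbasis from a table. -/
theorem eigenFrame (h : OrthBasis g v fun i => (W i : ℝ))
    (h01 : W 0 = W 1) (h23 : W 2 = W 3) (hρ : IsEinstein K g ρ) {κ : Type*} [Fintype κ]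
    {τ : κ → Fin 5 → ℚ} {t : κ → ℚ}
    (heig : ∀ i k l, W l * tabLich c W (rotMat W (τ i)) k l +
      W k * tabLich c W (rotMat W (τ i)) l k =
        t i * (W l * rotMat W (τ i) l k + W k * rotMat W (τ i) k l))
    (hne : ∀ i, τ i ≠ 0)
    (horth : ∀ i j, i ≠ j → ∑ k, ∑ l, rotMat W (τ j) k l * rotMat W (τ i) l k = 0)
    (htr : ∀ i, 2 * τ i 0 + 2 * τ i 1 + τ i 2 = 0)
    (hdiv : ∀ i x, tabDiv c W (rotMat W (τ i)) x = 0)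
    (hspan : ∀ θ : Fin 5 → ℝ, rotOp v W θ ∈ TT K Ad g →
      ∃ y : κ → ℝ, θ = ∑ i, y i • fun j => (τ i j : ℝ)) :
    EigenFrame K Ad g (fun i => rotOp v W fun j => (τ i j : ℝ)) (fun i => (t i : ℝ)) ρ := by
  have hcast : ∀ i, rotMat (fun i => (W i : ℝ)) (fun j => (τ i j : ℝ)) =
      fun k l => ((rotMat W (τ i) k l : ℚ) : ℝ) := fun i =>
    funext fun k => funext fun l => rotMat_cast W (τ i) k l
  refine ⟨H.isInvMetric h h01 h23, hρ, fun i B hB => h.lichForm_eigen_tab (fun k l => ?_) hB,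
    fun i h0 => hne i (funext fun j => ?_), fun i j hij => ?_, fun y => ?_, fun B hB => ?_⟩
  · rw [coef_rotOp, H.sconst_eq, hcast, tabLich_cast, tabLich_cast]
    beta_reduce
    exact_mod_cast heig i k l
  · have h1 : ∀ k l, rotMat (fun i => (W i : ℝ)) (fun j => (τ i j : ℝ)) k l = 0 := fun k l => by
      rw [← coef_rotOp (v := v), h0]
      simp [coef]
    have hW := h.ne 0
    have e0 := h1 0 0
    have e1 := h1 2 2
    have e2 := h1 4 4
    have e3 := h1 0 2
    have e4 := h1 0 3
    simp [rotMat] at e0 e1 e2 e3 e4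
    fin_cases j
    · exact e0
    · exact e1
    · exact e2
    · exact e3.resolve_right (by exact_mod_cast hW)
    · exact e4.resolve_right (by exact_mod_cast hW)
  · rw [trace_mul_eq_sum (e := v), coef_rotOp, coef_rotOp, hcast, hcast]
    beta_reduce
    exact_mod_cast horth i j hij
  · rw [sum_rotOp, H.rotOp_mem_TT h h01 h23]
    constructor
    · have h1 : ∀ i, y i * (2 * (τ i 0 : ℝ) + 2 * τ i 1 + τ i 2) = 0 := fun i => by
        rw [show 2 * (τ i 0 : ℝ) + 2 * τ i 1 + τ i 2 = 0 by exact_mod_cast htr i, mul_zero]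
      have h2 := sum_eq_zero fun i (_ : i ∈ Finset.univ) => h1 i
      simp only [Finset.sum_apply, Pi.smul_apply, smul_eq_mul, mul_sum, ← sum_add_distrib]
      rw [← h2]
      exact sum_congr rfl fun i _ => by ring
    · intro x
      have h1 := map_sum (((isLinearMap_tabDiv (fun i j k => (c i j k : ℝ))
        (fun i => (W i : ℝ)) x).mk' _).comp ((isLinearMap_rotMat fun i => (W i : ℝ)).mk' _))
        (fun i => y i • fun j => (τ i j : ℝ)) Finset.univ
      simp only [map_smul, LinearMap.comp_apply, IsLinearMap.mk'_apply, hcast, tabDiv_cast, hdiv,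
        Rat.cast_zero, smul_zero, sum_const_zero] at h1
      exact h1
  · obtain ⟨θ, rfl⟩ := H.exists_rotOp h h01 h23 hB.1
    obtain ⟨y, hy⟩ := hspan θ hB
    exact ⟨y, by rw [sum_rotOp, hy]⟩
end
end RotFrame
end RotFrames

/-! ### Frames of `SO(k + 2)/SO(k)` -/

theorem eq_one_of_specialOrthogonal {x : Matrix (Fin 1) (Fin 1) ℝ}
    (h : x ∈ specialOrthogonalGroup (Fin 1) ℝ) : x = 1 := by
  have h1 := (Matrix.mem_specialOrthogonalGroup_iff.1 h).2
  rw [Matrix.det_fin_one] at h1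
  ext i j
  rw [Subsingleton.elim i 0, Subsingleton.elim j 0, h1, Matrix.one_apply_eq]

theorem exists_of_mem_Ad₁ {k : ℕ} {φ : g₁ k 1 ≃ₗ⁅ℝ⁆ g₁ k 1} (h : φ ∈ Ad₁ k 1) :
    ∃ x ∈ specialOrthogonalGroup (Fin k) ℝ, ∀ X : g₁ k 1, (φ X).1 =
        diag3 x 1 1 * X.1 * (diag3 x 1 1)ᴴ := by
  obtain ⟨_, ⟨x, hx, y, hy, z, hz, rfl⟩, h1⟩ := h
  rw [eq_one_of_specialOrthogonal hy, eq_one_of_specialOrthogonal hz] at h1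
  exact ⟨x, hx, h1⟩

theorem conj_skewE_apply {I : Type*} [Fintype I] [DecidableEq I] (h : Matrix I I ℝ) (i j : I)
    (z : ℝ) (p q : I) : (h * skewE i j z * hᴴ) p q =
      z * (h p i * h q j - h p j * h q i) := by
  have h1 : ∀ i j, (h * single i j z * hᴴ) p q = z * (h p i * h q j) := by
    intro i j
    rw [mul_apply, sum_eq_single j (fun t _ ht => by
      rw [Matrix.mul_single_apply_of_ne _ _ _ _ _ ht, zero_mul]) (by simp),
      Matrix.mul_single_apply_same, conjTranspose_apply, star_trivial]
    ring
  rw [skewE, mul_sub, sub_mul, Matrix.sub_apply, star_trivial, h1, h1]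
  ring

section RotFrameMap
variable {v : Basis (Fin 5) ℝ (tangent K)} {c c' : Fin 5 → Fin 5 → Fin 5 → ℚ}
  {P P' : Fin 5 → Fin 5 → ℚ}

/-- A change of frame which commutes with the isotropy group. -/
theorem RotFrame.exists_map (F : RotFrame K Ad v c)
    (hP : ∀ k l, ∑ n, P k n * P' n l = if k = l then 1 else 0)
    (hP' : ∀ k l, ∑ n, P' k n * P n l = if k = l then 1 else 0)
    (hturn : ∀ (p r : ℝ) k l, ∑ n, (P k n : ℝ) * turnMat p r n l = ∑ n, turnMat p r k n * P n l)
    (hc : ∀ i j k, c' i j k = ∑ l, ∑ m, ∑ n, P l i * (P m j * (c l m n * P' k n))) :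
    ∃ f : Basis (Fin 5) ℝ (tangent K), (∀ l, f l = ∑ k, (P k l : ℝ) • v k) ∧
      RotFrame K Ad f c' := by
  have hone : ∀ {P P' : Fin 5 → Fin 5 → ℚ},
      (∀ k l, ∑ n, P k n * P' n l = if k = l then 1 else 0) →
      opMat v (fun k l => (P k l : ℝ)) * opMat v (fun k l => (P' k l : ℝ)) = 1 := by
    intro P P' h
    refine coef_injective (v := v) (funext fun k => funext fun l => ?_)
    rw [coef_mul, coef_opMat, coef_opMat]
    have : coef v (1 : End ℝ (tangent K)) k l = if k = l then 1 else 0 := by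
      simp [coef, Finsupp.single_apply, eq_comm]
    rw [this]
    have h1 := congrArg (fun y : ℚ => (y : ℝ)) (h k l)
    push_cast at h1
    refine h1.trans ?_
    split_ifs <;> simp
  let Ψ : tangent K ≃ₗ[ℝ] tangent K := LinearEquiv.ofLinearMap (opMat v fun k l => (P k l : ℝ))
    (opMat v fun k l => (P' k l : ℝ)) (hone hP) (hone hP')
  have hΨ : ∀ X, Ψ X = opMat v (fun k l => (P k l : ℝ)) X := fun _ => rfl
  have hf : ∀ l, v.map Ψ l = ∑ k, (P k l : ℝ) • v k := fun l => by
    rw [Basis.map_apply, hΨ, opMat_apply]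
  have hop : ∀ p r, opMat (v.map Ψ) (turnMat p r) = opMat v (turnMat p r) := fun p r => by
    refine (v.map Ψ).ext fun l => ?_
    have h1 : opMat v (turnMat p r) * opMat v (fun k l => (P k l : ℝ)) =
        opMat v (fun k l => (P k l : ℝ)) * opMat v (turnMat p r) :=
      coef_injective (v := v) (funext fun k => funext fun l => by
        rw [coef_mul, coef_mul, coef_opMat, coef_opMat, ← hturn])
    have h2 := LinearMap.congr_fun h1 (v l)
    rw [End.mul_apply, End.mul_apply, opMat_apply (turnMat p r), map_sum] at h2
    rw [opMat_apply, Basis.map_apply, hΨ, h2]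
    exact sum_congr rfl fun k _ => by rw [map_smul, Basis.map_apply, hΨ]
  refine ⟨v.map Ψ, hf, ?_, fun φ hφ => ?_, ?_⟩
  · have hμ := isBilin_bracketP K
    have h1 : ∀ n k, (v.map Ψ).repr (v n) k = P' k n := fun n k => by
      rw [Basis.map_repr, LinearEquiv.trans_apply]
      exact congrFun (congrFun (coef_opMat (v := v) _) k) n
    funext i j k
    rw [sconst, hf, hf, hμ.sum_left]
    simp only [hμ.smul_left, hμ.sum_right, hμ.smul_right, bracketP_eq_sum (e := v), F.sconst_eq,
      map_sum, map_smul, Finsupp.coe_finsetSum, Finset.sum_apply, Finsupp.smul_apply, h1,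
      smul_eq_mul, hc, mul_sum]
    push_cast
    rfl
  · obtain ⟨p, r, h, h'⟩ := F.turn φ hφ
    exact ⟨p, r, h, fun X => by rw [hop, h']⟩
  · obtain ⟨φ, hφ, h⟩ := F.quarter
    exact ⟨φ, hφ, fun X => by rw [hop, h]⟩
end RotFrameMap

/-! ### `SO(4)/SO(2)` -/

section UnitTangent

/-- The positions of the entries above the block diagonal in `so(4)`. -/
def idx₄ : Fin 5 → Pos 2 1 × Unit :=
  ![(inl (0, 0), ()), (inl (1, 0), ()), (inr (inl (0, 0)), ()),
    (inr (inl (1, 0)), ()), (inr (inr (0, 0)), ())]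

theorem idx₄_bijective : Function.Bijective idx₄ := by decide

/-- The structure constants of `SO(4)/SO(2)` in the frame of the elementary matrices. -/
def unitTab : Fin 5 → Fin 5 → Fin 5 → ℚ :=
  ![![0, 0, ![0, 0, 0, 0, -1], 0, ![0, 0, 1, 0, 0]],
    ![0, 0, 0, ![0, 0, 0, 0, -1], ![0, 0, 0, 1, 0]],
    ![![0, 0, 0, 0, 1], 0, 0, 0, ![-1, 0, 0, 0, 0]],
    ![0, ![0, 0, 0, 0, 1], 0, 0, ![0, -1, 0, 0, 0]],
    ![![0, 0, -1, 0, 0], ![0, 0, 0, -1, 0], ![1, 0, 0, 0, 0], ![0, 1, 0, 0, 0], 0]]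
variable {e : Basis (Pos 2 1 × Unit) ℝ (tangent (k₁ 2 1))}

/-- The frame of the elementary matrices. -/
def frame₄ (e : Basis (Pos 2 1 × Unit) ℝ (tangent (k₁ 2 1))) :
    Basis (Fin 5) ℝ (tangent (k₁ 2 1)) :=
  e.reindex (Equiv.ofBijective idx₄ idx₄_bijective).symm

theorem frame₄_apply (i : Fin 5) : frame₄ e i = e (idx₄ i) := by
  rw [frame₄, Basis.reindex_apply]
  rfl

theorem sconst_frame₄ (i j k : Fin 5) :
    sconst (frame₄ e) i j k = sconst e (idx₄ i) (idx₄ j) (idx₄ k) := by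
  rw [sconst, frame₄_apply, frame₄_apply, frame₄, Basis.repr_reindex, Finsupp.mapDomain_equiv_apply]
  rfl

theorem coe_sum_frame₄ (E : IsFlagFrame unitsR e) (y : Fin 5 → ℝ) :
    (∑ k, y k • frame₄ e k : tangent (k₁ 2 1)).1.1 =
      ∑ k, y k • skewE (idx₄ k).1.src (idx₄ k).1.tgt 1 := by
  have h := map_sum ((g₁ 2 1).toSubmodule.subtype ∘ₗ (tangent (k₁ 2 1)).subtype)
    (fun k => y k • frame₄ e k) Finset.univ
  simp only [map_smul] at h
  refine h.trans (sum_congr rfl fun k _ => ?_)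
  rw [frame₄_apply]
  exact congrArg (y k • ·) (E.coe (idx₄ k))

theorem turn_skewE (p r : ℝ) (l : Fin 5) :
    ∑ k, turnMat p r k l • skewE (idx₄ k).1.src (idx₄ k).1.tgt (1 : ℝ) =
      diag3 !![p, -r; r, p] 1 1 * skewE (idx₄ l).1.src (idx₄ l).1.tgt 1 *
        (diag3 (m := 1) !![p, -r; r, p] 1 1)ᴴ := by
  ext a b
  rw [conj_skewE_apply, Matrix.sum_apply]
  simp only [Fin.sum_univ_five, Matrix.smul_apply, skewE_apply, diag3]
  revert a b
  fin_cases l <;> simp [turnMat, idx₄, Pos.src, Pos.tgt, Fin.forall_fin_two]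

theorem turn_frame₄ (E : IsFlagFrame unitsR e) {p r : ℝ}
    {φ : g₁ 2 1 ≃ₗ⁅ℝ⁆ g₁ 2 1} (h : ∀ X : g₁ 2 1, (φ X).1 = diag3 !![p, -r; r, p] 1 1 * X.1 *
        (diag3 !![p, -r; r, p] 1 1)ᴴ) (X : tangent (k₁ 2 1)) :
    (opMat (frame₄ e) (turnMat p r) X : g₁ 2 1) = φ X := by
  have key : (tangent (k₁ 2 1)).subtype ∘ₗ opMat (frame₄ e) (turnMat p r) =
      (φ : g₁ 2 1 →ₗ[ℝ] g₁ 2 1) ∘ₗ (tangent (k₁ 2 1)).subtype := by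
    refine (frame₄ e).ext fun l => Subtype.ext ?_
    change (opMat (frame₄ e) (turnMat p r) (frame₄ e l)).1.1 = (φ (frame₄ e l)).1
    rw [h, opMat_apply, coe_sum_frame₄ E, frame₄_apply, E.coe, turn_skewE]
    rfl
  exact LinearMap.congr_fun key X

theorem eq_unitTab {c : Fin 5 → Fin 5 → Fin 5 → ℝ} {s : Fin 5 → Fin 3} (hs : s = ![0, 0, 1, 1, 2])
    (h0 : ∀ i j k, s i = s j → c i j k = 0) (hskew : ∀ i j k, c i j k = -c i k j)
    (hcyc : ∀ i j k, c i j k = c k i j) (h1 : c 0 2 4 = -1) (h2 : c 0 3 4 = 0) (h3 : c 1 2 4 = 0)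
    (h4 : c 1 3 4 = -1) : c = fun i j k => (unitTab i j k : ℝ) := by
  have h5 : ∀ i j k, s i = s j ∨ s i = s k ∨ s j = s k → c i j k = 0 := by
    rintro i j k (h | h | h)
    · exact h0 i j k h
    · rw [hskew, h0 i k j h, neg_zero]
    · rw [hcyc, hskew, h0 k j i h.symm, neg_zero]
  subst hs
  have h6 : ∀ i j, c i j 4 = unitTab i j 4 := by
    have h7 : ∀ i j, c j i 4 = -c i j 4 := fun i j => by rw [hcyc, hskew, ← hcyc]
    intro i j
    fin_cases i <;> fin_cases j <;>
      first
      | (refine (h5 _ _ _ (by decide)).trans ?_; simp [unitTab])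
      | (simp [unitTab, h1, h2, h3, h4]; done)
      | (refine (h7 _ _).trans ?_; simp [unitTab, h1, h2, h3, h4])
  funext i j k
  by_cases h : ![0, 0, 1, 1, 2] i = (![0, 0, 1, 1, 2] j : Fin 3) ∨
    ![0, 0, 1, 1, 2] i = (![0, 0, 1, 1, 2] k : Fin 3) ∨
    ![0, 0, 1, 1, 2] j = (![0, 0, 1, 1, 2] k : Fin 3)
  · rw [h5 i j k h, show unitTab i j k = 0 by revert i j k; decide +kernel, Rat.cast_zero]
  · have h8 : k = 4 ∨ i = 4 ∨ j = 4 := by revert i j k; decide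
    rcases h8 with rfl | rfl | rfl
    · exact h6 i j
    · rw [hcyc, hcyc, h6, show unitTab j k 4 = unitTab 4 j k by revert j k; decide +kernel]
    · rw [hskew, h6, show unitTab i 4 k = -unitTab i k 4 by revert i k; decide +kernel, Rat.cast_neg]

theorem rotFrame_unitTab (E : IsFlagFrame unitsR e)
    (W : WallachFrame (k₁ 2 1) (p₁ 2 1) e (fun q => q.1.sec) (2 * killConst (Idx 2 1) Unit)) :
    RotFrame (k₁ 2 1) (Ad₁ 2 1) (frame₄ e) unitTab := by
  refine ⟨?_, fun φ hφ => ?_, ?_⟩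
  · have h := E.sconst_zero_one_two skewModel_so starFrame_real W
    refine eq_unitTab (s := fun i => (idx₄ i).1.sec) (by decide)
      (fun i j k h => (sconst_frame₄ i j k).trans (W.sconst_eq_zero h))
      (fun i j k => by rw [sconst_frame₄, sconst_frame₄, W.sconst_skew_right])
      (fun i j k => by rw [sconst_frame₄, sconst_frame₄, W.sconst_cycle]) ?_ ?_ ?_ ?_ <;>
    refine (sconst_frame₄ _ _ _).trans ((h _ _ _ _ _ _ _ _ _).trans ?_) <;> simp
  · obtain ⟨x, hx, h⟩ := exists_of_mem_Ad₁ hφ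
    obtain ⟨h1, h2, h3⟩ := Matrix.mem_specialOrthogonalGroup_fin_two_iff.1 hx
    have h4 : x = !![x 0 0, -x 1 0; x 1 0, x 0 0] := by
      have h4 := Matrix.eta_fin_two x
      rwa [h2, ← h1] at h4
    refine ⟨x 0 0, x 1 0, by rw [← h3, h2, neg_sq], turn_frame₄ E ?_⟩
    rw [← h4]
    exact h
  · have hx : !![(0 : ℝ), -1; 1, 0] ∈ specialOrthogonalGroup (Fin 2) ℝ := by
      rw [Matrix.of_mem_specialOrthogonalGroup_fin_two_iff]
      norm_num
    have h1 : !![(0 : ℝ), -1; 1, 0]ᴴ * !![(0 : ℝ), -1; 1, 0] = 1 := by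
      ext i j
      fin_cases i <;> fin_cases j <;> simp [mul_apply]
    have h2 : !![(0 : ℝ), -1; 1, 0] * !![(0 : ℝ), -1; 1, 0]ᴴ = 1 := by
      ext i j
      fin_cases i <;> fin_cases j <;> simp [mul_apply]
    obtain ⟨φ, hφ, h⟩ := skewModel_so.exists_adSet (T := {h | ∃ x ∈ specialOrthogonalGroup
      (Fin 2) ℝ, ∃ y ∈ specialOrthogonalGroup (Fin 1) ℝ,
      ∃ z ∈ specialOrthogonalGroup (Fin 1) ℝ, h = diag3 x y z})
      (h := diag3 !![(0 : ℝ), -1; 1, 0] 1 1) ⟨_, hx, 1, one_mem _, 1, one_mem _, rfl⟩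
      (by simp only [diag3, Matrix.fromBlocks_conjTranspose, Matrix.fromBlocks_multiply, h1]; simp)
      (by simp only [diag3, Matrix.fromBlocks_conjTranspose, Matrix.fromBlocks_multiply, h2]; simp)
    exact ⟨φ, hφ, turn_frame₄ E h⟩
end UnitTangent

theorem card_cast_lt {κ : Type*} [Fintype κ] (t : κ → ℚ) (ρ : ℚ) :
    Nat.card {i // (t i : ℝ) < 2 * (ρ : ℝ)} = card {i // t i < 2 * ρ} := by
  rw [← Nat.card_eq_fintype_card]
  congr
  funext i
  rw [eq_iff_iff]
  exact_mod_cast Iff.rfl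

/-- The parameters of the eigentensors of `g_q`. -/
def diagTau : Fin 4 → Fin 5 → ℚ :=
  ![![1, -1, 0, 0, 0], ![1, 1, -4, 0, 0], ![0, 0, 0, 1, 0], ![0, 0, 0, 0, 1]]

/-- The eigenvalues of `g_q`. -/
def diagEig : Fin 4 → ℚ := ![5 / 12, 5 / 3, 5 / 12, 1 / 3]

/-- The square lengths for `g_q`. -/
def diagWt : Fin 5 → ℚ := ![4, 4, 4, 4, 16 / 3]

theorem tabLich_diagTau : ∀ i k l, diagWt l * tabLich unitTab diagWt (rotMat diagWt (diagTau i)) k l +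
    diagWt k * tabLich unitTab diagWt (rotMat diagWt (diagTau i)) l k = diagEig i *
      (diagWt l * rotMat diagWt (diagTau i) l k + diagWt k * rotMat diagWt (diagTau i) k l) := by
  decide +kernel

theorem tabDiv_unitTab : ∀ j x, tabDiv unitTab diagWt (rotMat diagWt (Pi.single j 1)) x = 0 := by
  decide +kernel

theorem trace_diagTau : ∀ i j, i ≠ j →
    ∑ k, ∑ l, rotMat diagWt (diagTau j) k l * rotMat diagWt (diagTau i) l k = 0 := by
  decide +kernel

theorem tabDiv_diagTau : ∀ i x, tabDiv unitTab diagWt (rotMat diagWt (diagTau i)) x = 0 := by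
  decide +kernel

theorem unitTangent_row {b c q : ℝ} (hb : b = 1 / 4) (hc : c = 1 / 2) (hq : q = qPlus b c) :
    q = 4 / 3 ∧
    EinsteinRow (k₁ 2 1) (Ad₁ 2 1) (diagMetric (k₁ 2 1) (p₁ 2 1) (gq q))
      {1 / 3, 5 / 12, 5 / 3} (1 / 3) (5 / 3) (2 / 3) ∧
    lichSpec (k₁ 2 1) (diagMetric (k₁ 2 1) (p₁ 2 1) (gq q)) (diagEnd (k₁ 2 1) (p₁ 2 1)) =
      {0, 5 / 12, 5 / 3} ∧
    IsSaddle (k₁ 2 1) (Ad₁ 2 1) (diagMetric (k₁ 2 1) (p₁ 2 1) (gq q)) ∧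
    HasCoindex (k₁ 2 1) (Ad₁ 2 1) (diagMetric (k₁ 2 1) (p₁ 2 1) (gq q)) 3 := by
  obtain ⟨e, E, D⟩ := exists_wallachData₁ (k := 2) (m := 1) (b := b) (c := c) (by norm_num)
    (by norm_num) (by norm_num) (fun j j' h => absurd (Subsingleton.elim j j') h)
    (by rw [hb]; norm_num) (by rw [hc]; norm_num)
  have hdisc : discQ b c = 1 := by rw [discQ, hb, hc]; norm_num
  have hq' : q = 4 / 3 := by
    rw [hq, qPlus, hdisc, Real.sqrt_one, hb, hc]
    norm_num
  have hq0 : 0 < q := by rw [hq']; norm_num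
  have hbc := (add_pos D.b_pos D.c_pos).ne'
  have hl₁ : lamQ₁ b q = 5 / 12 := by rw [lamQ₁, hb, hq']; norm_num
  have hl₂ : lamQ₂ b c q = 5 / 3 := by rw [lamQ₂, hb, hc, hq']; norm_num
  have hw : 2 * killConst (Idx 2 1) Unit = 4 := by rw [killConst_idx]; norm_num
  have hE := D.isEinstein D.isotropic (gq_pos hq0)
    (gq_einstein hq0 (gq_quadratic hbc (by rw [hdisc]; norm_num) (Or.inl hq)))
  rw [show rhoQ b q / 2 = ((1 / 3 : ℚ) : ℝ) by rw [rhoQ, hb, hq']; norm_num] at hE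
  have F := rotFrame_unitTab E D.toWallachFrame
  have h : OrthBasis (diagMetric (k₁ 2 1) (p₁ 2 1) (gq q)) (frame₄ e) fun i => (diagWt i : ℝ) := by
    refine ⟨fun i j => ?_, fun i => by fin_cases i <;> norm_num [diagWt]⟩
    rw [frame₄_apply, frame₄_apply, (D.orthBasis (gq_pos hq0)).gram, hw, hq']
    simp only [idx₄_bijective.1.eq_iff]
    congr 1
    fin_cases i <;> norm_num [idx₄, Pos.sec, gq, diagWt]
    change 4 * (4 / 3 : ℝ) = _
    norm_num
  have hTT : ∀ θ : Fin 5 → ℝ, 2 * θ 0 + 2 * θ 1 + θ 2 = 0 →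
      rotOp (frame₄ e) diagWt θ ∈ TT (k₁ 2 1) (Ad₁ 2 1) _ := fun θ hθ =>
    (F.rotOp_mem_TT h rfl rfl θ).2 ⟨hθ, fun x => by
      rw [tabDiv_rotMat]
      exact sum_eq_zero fun j _ => by rw [tabDiv_unitTab, Rat.cast_zero, mul_zero]⟩
  have hF := F.eigenFrame h rfl rfl hE (τ := diagTau) (t := diagEig) tabLich_diagTau
    (by decide +kernel) trace_diagTau (by decide +kernel) tabDiv_diagTau fun θ hθ => by
      have h1 := ((F.rotOp_mem_TT h rfl rfl θ).1 hθ).1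
      refine ⟨![(θ 0 - θ 1) / 2, (θ 0 + θ 1) / 2, θ 3, θ 4], funext fun j => ?_⟩
      fin_cases j <;> simp [Fin.sum_univ_four, diagTau] <;> linarith
  have hrange : Set.range (fun i => (diagEig i : ℝ)) = {1 / 3, 5 / 12, 5 / 3} := by
    ext y
    simp only [Set.mem_range, Fin.exists_fin_succ, Set.mem_insert_iff, Set.mem_singleton_iff]
    simp [diagEig, eq_comm]
    tauto
  refine ⟨hq', ⟨hF.metric, by convert hF.einstein using 1; norm_num, ?_, ?_, ?_, ?_,
    hF.isUnstable (i := 0) ?_, hF.isNondegenerate fun i => ?_⟩, ?_,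
    hF.isSaddle (i := 0) (j := 1) ?_ ?_, hF.hasCoindex ?_⟩
  · rw [hF.lichSpec_symEndK ⟨frame₄ e 0, frame₄ e 1, (frame₄ e).injective.ne (by decide)⟩, hrange]
    intro B hB hB'
    obtain ⟨θ, rfl⟩ := F.exists_rotOp h rfl rfl hB
    exact hTT θ (by rw [← hB', trace_rotOp])
  · rw [hF.lichSpec_TT, hrange]
  · constructor
    · simp
    · rintro y (rfl | rfl | rfl) <;> norm_num
  · constructor
    · simp
    · rintro y (rfl | rfl | rfl) <;> norm_num
  · norm_num [diagEig]
  · fin_cases i <;> norm_num [diagEig]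
  · rw [D.lichSpec_diagEnd (gq_pos hq0) (gq_sum hq0.ne') (gq_prod hq0.ne'), hl₁, hl₂]
  · norm_num [diagEig]
  · norm_num [diagEig]
  · rw [card_cast_lt]
    decide +kernel

/-- The columns are a frame of `SO(4)/SO(2)` which is orthogonal for the product metric. -/
def prodFrame : Fin 5 → Fin 5 → ℚ :=
  ![![0, 1, 1, 0, 0], ![-1, 0, 0, 1, 0], ![1, 0, 0, 0, 0], ![0, 1, 0, 0, 0], ![0, 0, 0, 0, 1]]

/-- The inverse of the matrix `prodFrame`. -/
def prodInv : Fin 5 → Fin 5 → ℚ :=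
  ![![0, 0, 1, 0, 0], ![0, 0, 0, 1, 0], ![1, 0, 0, -1, 0], ![0, 1, 1, 0, 0], ![0, 0, 0, 0, 1]]

/-- The structure constants in the frame `prodFrame`. -/
def prodTab : Fin 5 → Fin 5 → Fin 5 → ℚ :=
  ![![0, ![0, 0, 0, 0, 2], ![0, 0, 0, 0, 1], 0, ![0, -1, 0, 0, 0]],
    ![![0, 0, 0, 0, -2], 0, 0, ![0, 0, 0, 0, 1], ![1, 0, 0, 0, 0]],
    ![![0, 0, 0, 0, -1], 0, 0, 0, ![1, 0, 0, 1, 0]],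
    ![0, ![0, 0, 0, 0, -1], 0, 0, ![0, 1, -1, 0, 0]],
    ![![0, 1, 0, 0, 0], ![-1, 0, 0, 0, 0], ![-1, 0, 0, -1, 0], ![0, -1, 1, 0, 0], 0]]

/-- The square lengths for the product metric. -/
def prodWt : Fin 5 → ℚ := ![2, 2, 1, 1, 2]

/-- The parameters of the eigentensors of the product metric. -/
def prodTau : Fin 3 → Fin 5 → ℚ := ![![2, -3, 2, 0, 0], ![1, 0, -2, 0, 0], ![0, 0, 0, 0, 1]]

/-- The eigenvalues of the product metric. -/
def prodEig : Fin 3 → ℚ := ![0, 12, 4]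

theorem tabLich_prodTau : ∀ i k l, prodWt l * tabLich prodTab prodWt (rotMat prodWt (prodTau i)) k l +
    prodWt k * tabLich prodTab prodWt (rotMat prodWt (prodTau i)) l k = prodEig i *
      (prodWt l * rotMat prodWt (prodTau i) l k + prodWt k * rotMat prodWt (prodTau i) k l) := by
  decide +kernel

theorem trace_prodTau : ∀ i j, i ≠ j →
    ∑ k, ∑ l, rotMat prodWt (prodTau j) k l * rotMat prodWt (prodTau i) l k = 0 := by
  decide +kernel

theorem tabDiv_prodTau : ∀ i x, tabDiv prodTab prodWt (rotMat prodWt (prodTau i)) x = 0 := by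
  decide +kernel

theorem tabDiv_prodTab : ∀ j, tabDiv prodTab prodWt (rotMat prodWt (Pi.single j 1)) 4 =
    if j = 3 then 2 else 0 := by
  decide +kernel

theorem tabMoment_prodTab : ∀ i j, tabMoment prodTab prodWt i j +
    1 / 2 * (4 * ∑ k, prodFrame k i * prodFrame k j) = if i = j then prodWt i else 0 := by
  decide +kernel

theorem gProd_facts : IsInvMetric (k₁ 2 1) (Ad₁ 2 1) gProd ∧ (∃ ρ, IsEinstein (k₁ 2 1) gProd ρ) ∧
    IsUnstable (k₁ 2 1) (Ad₁ 2 1) gProd ∧ IsNondegenerate (k₁ 2 1) (Ad₁ 2 1) gProd ∧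
    IsSaddle (k₁ 2 1) (Ad₁ 2 1) gProd ∧ HasCoindex (k₁ 2 1) (Ad₁ 2 1) gProd 1 := by
  obtain ⟨e, E, D⟩ := exists_wallachData₁ (k := 2) (m := 1) (by norm_num) (by norm_num)
    (by norm_num) (fun j j' h => absurd (Subsingleton.elim j j') h) rfl rfl
  have hw : 2 * killConst (Idx 2 1) Unit = 4 := by rw [killConst_idx]; norm_num
  obtain ⟨f, hf, F⟩ := (rotFrame_unitTab E D.toWallachFrame).exists_map (P := prodFrame)
    (P' := prodInv) (c' := prodTab) (by decide +kernel) (by decide +kernel)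
    (fun p r k l => by
      fin_cases k <;> fin_cases l <;> simp [Fin.sum_univ_five, prodFrame, turnMat])
    (by decide +kernel)
  have hQ : ∀ i j, Q (g₁ 2 1) (f i) (f j) = (4 * ∑ k, prodFrame k i * prodFrame k j : ℚ) := by
    intro i j
    have h1 : ∀ X Y : tangent (k₁ 2 1), (Q (g₁ 2 1)).comp (tangent (k₁ 2 1)).subtype
        (tangent (k₁ 2 1)).subtype X Y = Q (g₁ 2 1) X Y := fun _ _ => rfl
    have h2 : ∀ k l, Q (g₁ 2 1) (frame₄ e k) (frame₄ e l) = if k = l then 4 else 0 := fun k l => by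
      rw [frame₄_apply, frame₄_apply, D.gram, hw]
      simp only [idx₄_bijective.1.eq_iff]
    rw [← h1, hf, hf]
    simp only [map_sum, map_smul, LinearMap.sum_apply, LinearMap.smul_apply, h1, h2, smul_eq_mul,
      mul_ite, mul_zero, sum_ite_eq', mem_univ, if_true]
    push_cast
    rw [mul_sum]
    exact sum_congr rfl fun k _ => by ring
  have hx : ∀ n l, (((f l : tangent (k₁ 2 1)) : g₁ 2 1) : Matrix (Idx 2 1) (Idx 2 1) ℝ)
      (idx₄ n).1.src (idx₄ n).1.tgt = prodFrame n l := by
    intro n l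
    rw [hf, coe_sum_frame₄ E, Matrix.sum_apply]
    simp only [Matrix.smul_apply, skewE_apply, smul_eq_mul]
    have h3 : ∀ k n : Fin 5, ¬((idx₄ k).1.tgt = (idx₄ n).1.src ∧ (idx₄ k).1.src = (idx₄ n).1.tgt) ∧
        (((idx₄ k).1.src = (idx₄ n).1.src ∧ (idx₄ k).1.tgt = (idx₄ n).1.tgt) ↔ k = n) := by
      decide
    simp only [(h3 _ _).1, (h3 _ _).2]
    simp
  have h : OrthBasis gProd f fun i => (prodWt i : ℝ) := by
    refine ⟨fun i j => ?_, fun i => by fin_cases i <;> norm_num [prodWt]⟩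
    have h0 := hx 0
    have h1 := hx 1
    have h2 := hx 2
    have h3 := hx 3
    have h4 := hx 4
    simp only [idx₄, Pos.src, Pos.tgt, cons_val, elim_inl, elim_inr] at h0 h1 h2 h3 h4
    have hg : gProd (f i) (f j) = (2 * (prodFrame 2 i * prodFrame 2 j +
        prodFrame 3 i * prodFrame 3 j + prodFrame 4 i * prodFrame 4 j) +
        (prodFrame 0 i - prodFrame 3 i) * (prodFrame 0 j - prodFrame 3 j) +
        (prodFrame 1 i + prodFrame 2 i) * (prodFrame 1 j + prodFrame 2 j) : ℚ) := by
      push_cast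
      simp only [← h0, ← h1, ← h2, ← h3, ← h4]
      rfl
    have hd : ∀ i j, 2 * (prodFrame 2 i * prodFrame 2 j +
        prodFrame 3 i * prodFrame 3 j + prodFrame 4 i * prodFrame 4 j) +
        (prodFrame 0 i - prodFrame 3 i) * (prodFrame 0 j - prodFrame 3 j) +
        (prodFrame 1 i + prodFrame 2 i) * (prodFrame 1 j + prodFrame 2 j) =
        if i = j then prodWt i else 0 := by decide +kernel
    rw [hg, hd]
    split_ifs <;> simp
  have hE : IsEinstein (k₁ 2 1) gProd ((1 : ℚ) : ℝ) := h.isEinstein_tab fun i j => by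
    rw [F.sconst_eq, tabMoment_cast, hQ, Rat.cast_one, one_mul]
    have h1 := congrArg (fun y : ℚ => (y : ℝ)) (tabMoment_prodTab i j)
    push_cast at h1 ⊢
    rw [h1]
    split_ifs <;> simp
  have hF := F.eigenFrame h rfl rfl hE (τ := prodTau) (t := prodEig) tabLich_prodTau
    (by decide +kernel) trace_prodTau (by decide +kernel) tabDiv_prodTau fun θ hθ => by
      obtain ⟨h1, h2⟩ := (F.rotOp_mem_TT h rfl rfl θ).1 hθ
      have h3 := h2 4
      rw [tabDiv_rotMat] at h3
      simp only [tabDiv_prodTab] at h3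
      simp [apply_ite (Rat.cast : ℚ → ℝ)] at h3
      refine ⟨![-θ 1 / 3, θ 0 + 2 * θ 1 / 3, θ 4], funext fun j => ?_⟩
      fin_cases j <;> simp [Fin.sum_univ_three, prodTau] <;> linarith
  refine ⟨hF.metric, ⟨_, hE⟩, hF.isUnstable (i := 0) ?_, hF.isNondegenerate fun i => ?_,
    hF.isSaddle (i := 0) (j := 1) ?_ ?_, hF.hasCoindex ?_⟩
  · norm_num [prodEig]
  · fin_cases i <;> norm_num [prodEig]
  · norm_num [prodEig]
  · norm_num [prodEig]
  · rw [card_cast_lt]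
    decide +kernel

/-- The image of a frame under an automorphism which preserves `K`. -/
theorem WallachFrame.map (F : WallachFrame K p e s w) {φ : L ≃ₗ⁅ℝ⁆ L} (hK : ∀ X ∈ K, φ X ∈ K)
    {Φ : tangent K ≃ₗ[ℝ] tangent K} (hΦ : ∀ X, (Φ X : L) = φ X) :
    WallachFrame K (fun r => (p r).map (φ : L →ₗ[ℝ] L)) (e.map Φ) s w where
  compact := F.compact
  orthogonal := by
    rintro i j hij _ ⟨X, hX, rfl⟩ _ ⟨Y, hY, rfl⟩
    exact (Q_equiv φ X Y).trans (F.orthogonal i j hij X hX Y hY)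
  bracket := by
    rintro i _ ⟨X, hX, rfl⟩ _ ⟨Y, hY, rfl⟩
    have := hK _ (F.bracket i X hX Y hY)
    rwa [LieEquiv.map_lie] at this
  wpos := F.wpos
  gram i j := by rw [Basis.map_apply, Basis.map_apply, hΦ, hΦ, Q_equiv, F.gram]
  mem i := ⟨e i, F.mem i, by rw [Basis.map_apply, hΦ]; rfl⟩
  le := by
    rintro r _ ⟨X, hX, rfl⟩
    have := (Φ ⟨X, F.le r hX⟩).2
    rwa [hΦ] at this
  surj := F.surj

theorem WallachFrame.sconst_map (F : WallachFrame K p e s w) {φ : L ≃ₗ⁅ℝ⁆ L}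
    {Φ : tangent K ≃ₗ[ℝ] tangent K} (hΦ : ∀ X, (Φ X : L) = φ X) : sconst (e.map Φ) = sconst e := by
  funext i j k
  rw [sconst, sconst, Basis.map_apply, Basis.map_apply, F.bracketP_equiv hΦ, Basis.map_repr,
    LinearEquiv.trans_apply, LinearEquiv.symm_apply_apply]

theorem OrthBasis.add_smul_mem_TT (h : OrthBasis g e W) {A B : End ℝ (tangent K)}
    (hA : A ∈ TT K Ad g) (hB : B ∈ TT K Ad g) (y : ℝ) : A + y • B ∈ TT K Ad g := by
  refine ⟨⟨fun X Y => ?_, fun φ hφ X Y hXY => ?_⟩, ?_, fun X => ?_⟩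
  · simp only [LinearMap.add_apply, LinearMap.smul_apply, map_add, map_smul, hA.1.1 X Y, hB.1.1 X Y]
  · simp only [LinearMap.add_apply, LinearMap.smul_apply, Submodule.coe_add, Submodule.coe_smul,
      map_add, map_smul, hA.1.2 φ hφ X Y hXY, hB.1.2 φ hφ X Y hXY]
  · rw [map_add, map_smul, hA.2.1, hB.2.1, smul_zero, add_zero]
  · have h1 : coef e (A + y • B) = coef e A + y • coef e B := by
      funext k l
      simp [coef]
    have h2 := fun x => isLinearMap_tabDiv (sconst e) W x
    have h3 := hA.2.2 X
    have h4 := hB.2.2 X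
    rw [h.divergence_eq_sum] at h3 h4 ⊢
    simp only [h1, (h2 _).map_add, (h2 _).map_smul, mul_add, sum_add_distrib, h3, zero_add,
      smul_eq_mul, mul_left_comm _ y, ← mul_sum, h4, mul_zero]

section Swap

open WallachFrame
variable {e : Basis (Pos k 1 × Unit) ℝ (tangent (k₁ k 1))} {r : ℝ}

/-- The exchange of the first two modules. -/
def swapPos : Pos k 1 × Unit → Pos k 1 × Unit :=
  Sum.elim (fun x => (inr (inl x), ()))
    (Sum.elim (fun x => (inl x, ())) fun x => (inr (inr x), ())) ∘ Prod.fst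

/-- The endomorphism which exchanges the first two modules. -/
def swapOp (e : Basis (Pos k 1 × Unit) ℝ (tangent (k₁ k 1))) :
    End ℝ (tangent (k₁ k 1)) :=
  e.constr ℝ fun q => (![1, 1, 0] q.1.sec : ℝ) • e (swapPos q)

theorem swapOp_apply (q : Pos k 1 × Unit) :
    swapOp e (e q) = (![1, 1, 0] q.1.sec : ℝ) • e (swapPos q) := e.constr_basis ℝ _ q

/-- The reflection which diagonalizes the exchange. -/
def reflOp (r : ℝ) (e : Basis (Pos k 1 × Unit) ℝ (tangent (k₁ k 1))) :
    End ℝ (tangent (k₁ k 1)) := diagOp e (fun q => q.1.sec) ![r, -r, -1] + r • swapOp e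

theorem reflOp_apply (q : Pos k 1 × Unit) : reflOp r e (e q) =
    (![r, -r, -1] q.1.sec : ℝ) • e q + (![r, r, 0] q.1.sec : ℝ) • e (swapPos q) := by
  rw [reflOp, LinearMap.add_apply, LinearMap.smul_apply, diagOp_apply, swapOp_apply, smul_smul]
  congr 2
  rcases q with ⟨q | q | q, ⟨⟩⟩ <;> simp [Pos.sec]

theorem reflOp_mul_self (hr : r * r = 1 / 2) : reflOp r e * reflOp r e = 1 := by
  refine e.ext fun q => ?_
  rw [End.mul_apply, End.one_apply, reflOp_apply, map_add, map_smul, map_smul,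
    reflOp_apply, reflOp_apply]
  have h : r * r + r * r = 1 := by rw [hr]; norm_num
  rcases q with ⟨q | q | q, ⟨⟩⟩ <;> simp [Pos.sec, swapPos, smul_smul]
  all_goals rw [← add_smul, h, one_smul]

theorem swapOp_reflOp (q : Pos k 1 × Unit) : swapOp e (reflOp r e (e q)) =
    (![1, -1, 0] q.1.sec : ℝ) • reflOp r e (e q) := by
  rw [reflOp_apply, map_add, map_smul, map_smul, swapOp_apply, swapOp_apply]
  rcases q with ⟨q | q | q, ⟨⟩⟩
  · simp [Pos.sec, swapPos]
    rw [add_comm]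
  · simp [Pos.sec, swapPos]
    rw [add_comm]
  · simp [Pos.sec, swapPos]

/-- The matrix of the reflection. -/
def reflMat (k : ℕ) (r : ℝ) : Matrix (Idx k 1) (Idx k 1) ℝ :=
  Matrix.fromBlocks 1 0 0 (Matrix.fromBlocks (r • 1) (r • 1) (r • 1) (-(r • 1)))

theorem reflMat_conjTranspose : (reflMat k r)ᴴ = reflMat k r := by
  simp [reflMat, Matrix.fromBlocks_transpose]

theorem reflMat_mul_self (hr : r * r = 1 / 2) : reflMat k r * reflMat k r = 1 := by
  have h : (r * r) • (1 : Matrix (Fin 1) (Fin 1) ℝ) + (r * r) • 1 = 1 := by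
    rw [← add_smul, hr]
    norm_num
  simp [reflMat, Matrix.fromBlocks_multiply, smul_smul, h]

theorem reflMat_comm (x : Matrix (Fin k) (Fin k) ℝ) :
    reflMat k r * diag3 x 1 1 = diag3 x 1 1 * reflMat k r := by
  simp [reflMat, diag3, Matrix.fromBlocks_multiply]

theorem reflMat_conj_mem {X : g₁ k 1} (hX : X ∈ k₁ k 1) : reflMat k r *
    X.1 * (reflMat k r)ᴴ = X := by
  have hskew : ∀ i j, X.1 j i =
      -X.1 i j := fun i j =>
    congrFun (congrFun ((LieAlgebra.Orthogonal.mem_so _ _ _).1 X.2) i) j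
  have h0 : ∀ i (j : Fin 1 ⊕ Fin 1), X.1 i (inr j) = 0 := by
    intro i j
    by_cases h : blk k 1 i = blk k 1 (inr j)
    · have h1 : i = inr j := by
        rcases i with i | i | i <;> rcases j with j | j <;> simp [blk] at h <;>
          rw [Subsingleton.elim i j]
      have := hskew (inr j) (inr j)
      rw [h1]
      linarith
    · exact hX _ _ h
  have h1 : X.1 =
      Matrix.fromBlocks X.1.toBlocks₁₁ 0 0 0 := by
    ext i j
    rcases j with j | j
    · rcases i with i | i
      · rfl
      · rw [hskew, h0, neg_zero]
        rfl
    · rw [h0]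
      rcases i with i | i <;> rfl
  rw [h1, reflMat_conjTranspose]
  simp [reflMat, Matrix.fromBlocks_multiply]

set_option maxHeartbeats 1000000 in
theorem coe_reflOp (E : IsFlagFrame unitsR e) {φ : g₁ k 1 ≃ₗ⁅ℝ⁆ g₁ k 1}
    (hr : r * r = 1 / 2)
    (h : ∀ X : g₁ k 1, (φ X).1 = reflMat k r * X.1 * (reflMat k r)ᴴ)
    (X : tangent (k₁ k 1)) : (reflOp r e X : g₁ k 1) = φ X := by
  have key : (tangent (k₁ k 1)).subtype ∘ₗ reflOp r e =
      (φ : g₁ k 1 →ₗ[ℝ] g₁ k 1) ∘ₗ (tangent (k₁ k 1)).subtype := by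
    refine e.ext fun q => Subtype.ext ?_
    have h1 : ∀ y z : ℝ, ∀ q q', (y • e q + z • e q' : tangent (k₁ k 1)).1.1 = y • skewE q.1.src q.1.tgt 1 +
          z • skewE q'.1.src q'.1.tgt 1 := fun y z q q' =>
      congrArg₂ (y • · + z • ·) (E.coe q) (E.coe q')
    change (reflOp r e (e q)).1.1 = (φ (e q)).1
    rw [h, E.coe, reflOp_apply, h1]
    ext a b
    rw [conj_skewE_apply]
    simp only [Matrix.add_apply, Matrix.smul_apply, skewE_apply, unitsR]
    have hone : ∀ a i : Fin k, (1 : Matrix (Fin k) (Fin k) ℝ) a i = if i = a then 1 else 0 :=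
      fun a i => by simp only [Matrix.one_apply, eq_comm]
    obtain ⟨⟨i, j⟩ | ⟨i, j⟩ | ⟨i, j⟩, _⟩ := q <;>
      rcases a with a | a | a <;> rcases b with b | b | b <;>
      (try obtain rfl : a = 0 := Subsingleton.elim _ _) <;>
      (try obtain rfl : b = 0 := Subsingleton.elim _ _) <;>
      (try obtain rfl : i = 0 := Subsingleton.elim _ _) <;>
      obtain rfl : j = 0 := Subsingleton.elim _ _ <;>
      simp [Pos.sec, Pos.src, Pos.tgt, swapPos, reflMat, hone] <;>
      first
      | linarith
      | (split_ifs <;> simp)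
  exact LinearMap.congr_fun key X
end Swap

section Stiefel

open WallachFrame
variable {e : Basis (Pos k 1 × Unit) ℝ (tangent (k₁ k 1))} {r : ℝ}

theorem exists_reflection (hr : r * r = 1 / 2) : ∃ φ : g₁ k 1 ≃ₗ⁅ℝ⁆ g₁ k 1, ∀ X : g₁ k 1, (φ X).1 =
      reflMat k r * X.1 * (reflMat k r)ᴴ := by
  obtain ⟨φ, -, h⟩ := skewModel_so.exists_adSet (T := {reflMat k r}) (h := reflMat k r) rfl
    (by rw [reflMat_conjTranspose, reflMat_mul_self hr])
    (by rw [reflMat_conjTranspose, reflMat_mul_self hr])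
  exact ⟨φ, h⟩

theorem separated_stiefel (hk : 3 ≤ k) (E : IsFlagFrame unitsR e)
    {q q' : Pos k 1 × Unit} (h : q ≠ q') (h' : q' ≠ swapPos q) (h'' : q ≠ swapPos q') :
    Separated (Ad₁ k 1) e q q' := by
  by_cases hs : q.1.sec = q'.1.sec
  · exact separated₁_of_sec_eq E (fun j j' h => absurd (Subsingleton.elim j j') h) q q' h hs
  have key : ∀ p p' : Pos k 1, p.sec < p'.sec → (p', ()) ≠ swapPos (p, ()) →
      (∃ d, HasMono (g₁ k 1) (Ad₁ k 1) 1 d ∧ (d p.src * d p.tgt = 1 ∧ d p'.src * d p'.tgt = -1 ∨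
        d p.src * d p.tgt = -1 ∧ d p'.src * d p'.tgt = 1)) := by
    rintro (⟨i, j⟩ | ⟨i, j⟩ | ⟨i, j⟩) (⟨i', j'⟩ | ⟨i', j'⟩ | ⟨i', j'⟩) h hne <;> simp [Pos.sec] at h
    · obtain ⟨l, h1, h2⟩ := exists_ne_ne hk i i'
      have h3 : i ≠ i' := fun h3 => hne (by rw [h3, Subsingleton.elim j j']; rfl)
      refine ⟨_, hasTurns₁.half (.inl i) (.inl l) (by simpa using h1.symm) rfl, ?_⟩
      right
      simp [Pos.src, Pos.tgt, h1.symm, h2.symm, h3.symm]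
    · obtain ⟨l, h1, -⟩ := exists_ne_ne hk i i
      refine ⟨_, hasTurns₁.half (.inl i) (.inl l) (by simpa using h1.symm) rfl, ?_⟩
      right
      simp [Pos.src, Pos.tgt, h1.symm]
    · obtain ⟨l, h1, -⟩ := exists_ne_ne hk i i
      refine ⟨_, hasTurns₁.half (.inl i) (.inl l) (by simpa using h1.symm) rfl, ?_⟩
      right
      simp [Pos.src, Pos.tgt, h1.symm]
  obtain ⟨p, ⟨⟩⟩ := q
  obtain ⟨p', ⟨⟩⟩ := q'
  rcases lt_or_gt_of_ne hs with h1 | h1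
  · obtain ⟨d, h1, h2⟩ := key p p' h1 h'
    exact E.separated_sign h1 (by simpa using h2)
  · obtain ⟨d, h1, h2⟩ := key p' p h1 h''
    exact E.separated_sign h1 (by simpa using h2.symm.imp And.symm And.symm)

theorem swapPos_swapPos (q : Pos k 1 × Unit) : swapPos (swapPos q) = q := by
  rcases q with ⟨q | q | q, ⟨⟩⟩ <;> rfl

/-- The invariant symmetric forms on a Stiefel manifold. -/
theorem exists_form_stiefel (hk : 3 ≤ k) (E : IsFlagFrame unitsR e)
    {β : BilinForm ℝ (tangent (k₁ k 1))} (hβ : IsInvForm (Ad₁ k 1) β) :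
    ∃ (y : Fin 3 → ℝ) (z : ℝ), ∀ q q', β (e q) (e q') =
      if q = q' then y q.1.sec else if q' = swapPos q then z else 0 := by
  obtain ⟨y, hy⟩ := exists_diag (e := e) (s := fun q => q.1.sec) hβ fun i j h =>
    E.eqvGen hasTurns₁.quarter (fun p a a' h => absurd (Subsingleton.elim a a') h) h
  have h1 : ∀ i j : Fin k, β (e (inl (i, 0), ())) (e (inr (inl (i, 0)), ())) =
      β (e (inl (j, 0), ())) (e (inr (inl (j, 0)), ())) := by
    intro i j
    by_cases hij : i = j
    · rw [hij]
    · have hij' : (inl i : Idx k 1) ≠ inl j := by simpa using hij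
      obtain ⟨φ, hφ, h⟩ := hasTurns₁.quarter (inl i : Idx k 1) (inl j) hij' rfl
      refine (hβ.inv φ hφ _ _ _ _ (E.map_eq h ?_ ?_ ?_).symm (E.map_eq h ?_ ?_ ?_).symm).symm <;>
        simp [Pos.src, Pos.tgt, hij, swap_apply_of_ne_of_ne]
  refine ⟨y, β (e (inl (⟨0, by omega⟩, 0), ())) (e (inr (inl (⟨0, by omega⟩, 0)), ())),
    fun q q' => ?_⟩
  split_ifs with h2 h3
  · rw [← h2, hy]
  · subst h3
    rcases q with ⟨⟨i, j⟩ | ⟨i, j⟩ | ⟨i, j⟩, ⟨⟩⟩ <;> obtain rfl : j = 0 := Subsingleton.elim _ _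
    · exact h1 _ _
    · exact (hβ.symm _ _).trans (h1 _ _)
    · exact absurd rfl h2
  · exact (separated_stiefel hk E h2 h3 fun h => h3 (by rw [h, swapPos_swapPos])).apply_eq_zero hβ
variable {b c q : ℝ}

theorem exists_of_mem_symEndK_stiefel (hk : 3 ≤ k) (E : IsFlagFrame unitsR e)
    (D : WallachData (k₁ k 1) (Ad₁ k 1) (p₁ k 1) e (fun q => q.1.sec) w b c) (hq : 0 < q)
    {A : End ℝ (tangent (k₁ k 1))}
    (hA : A ∈ symEndK (k₁ k 1) (Ad₁ k 1) (diagMetric (k₁ k 1) (p₁ k 1) (gq q))) :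
    ∃ (α : Fin 3 → ℝ) (z : ℝ), A = diagOp e (fun q => q.1.sec) α + z • swapOp e := by
  have h := D.orthBasis (gq_pos hq)
  have hm := D.isInvMetric D.stable (gq_pos hq)
  obtain ⟨y, z, hy⟩ := exists_form_stiefel hk E
    (β := (diagMetric (k₁ k 1) (p₁ k 1) (gq q)).compLeft A) ⟨fun X Y => by
      rw [BilinForm.compLeft_apply, BilinForm.compLeft_apply, hA.1, hm.symm],
    fun φ hφ X Y X' Y' hX hY => by
      rw [BilinForm.compLeft_apply, BilinForm.compLeft_apply]
      exact hm.inv φ hφ _ _ _ _ (hA.2 φ hφ X X' hX) hY⟩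
  refine ⟨fun r => y r / (w * gq q r), z / w, e.ext fun i => e.ext_elem fun j => ?_⟩
  have h1 := hy i j
  rw [BilinForm.compLeft_apply, h.apply_right] at h1
  have hw := h.ne j
  rw [LinearMap.add_apply, LinearMap.smul_apply, diagOp_apply, swapOp_apply, map_add, map_smul,
    map_smul, map_smul, Finsupp.add_apply, Finsupp.smul_apply, Finsupp.smul_apply,
    Finsupp.smul_apply, Basis.repr_self, Basis.repr_self, Finsupp.single_apply,
    Finsupp.single_apply, smul_eq_mul, smul_eq_mul, smul_eq_mul]
  rw [← mul_right_inj' hw, h1]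
  have hw' := D.wne
  have hg := fun r => (gq_pos hq r).ne'
  have hg2 := hg 2
  have hgi := hg i.1.sec
  split_ifs with h2 h3 h4 h5 h6
  · subst h2
    rcases i with ⟨i | i | i, ⟨⟩⟩
    · simp [swapPos] at h3
    · simp [swapPos] at h3
    · simp only [Pos.sec, elim_inr, cons_val]
      field_simp
      ring
  · subst h2
    field_simp
    ring
  · subst h4
    rcases i with ⟨i | i | i, ⟨⟩⟩
    · simp [Pos.sec, swapPos, gq]
      field_simp
    · simp [Pos.sec, swapPos, gq]
      field_simp
    · exact absurd rfl h2
  · exact absurd h4.symm h5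
  · exact absurd h6.symm h4
  · ring

theorem kap_swap (hq : q ≠ 0) (r : Fin 3) :
    kap ![b, b, c] (gq q) ![1, -1, 0] r = lamQ₁ b q * ![1, -1, 0] r := by
  fin_cases r
  · simp only [kap, wt, gq, lamQ₁, Fin.zero_eta, cons_val, Fin.reduceAdd, zero_add]
    field_simp
    ring
  · simp only [kap, wt, gq, lamQ₁, Fin.mk_one, cons_val, Fin.reduceAdd]
    field_simp
    ring
  · simp only [kap, wt, gq, lamQ₁, Fin.reduceFinMk, cons_val, Fin.reduceAdd]
    ring

/-- The exchange of the first two modules is an eigentensor. -/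
theorem swapOp_eigen (E : IsFlagFrame unitsR e)
    (D : WallachData (k₁ k 1) (Ad₁ k 1) (p₁ k 1) e (fun q => q.1.sec) w b c) (hq : 0 < q) :
    swapOp e ≠ 0 ∧ swapOp e ∈ TT (k₁ k 1) (Ad₁ k 1) (diagMetric (k₁ k 1) (p₁ k 1) (gq q)) ∧
      ∀ B, lichForm (diagMetric (k₁ k 1) (p₁ k 1) (gq q)) (bracketP (k₁ k 1)) (swapOp e) B =
        lamQ₁ b q * trace ℝ _ (swapOp e * B) := by
  obtain ⟨r, hr⟩ : ∃ r : ℝ, r * r = 1 / 2 := ⟨√(1 / 2), Real.mul_self_sqrt (by norm_num)⟩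
  obtain ⟨φ, hφ⟩ := exists_reflection (k := k) hr
  let Φ : tangent (k₁ k 1) ≃ₗ[ℝ] tangent (k₁ k 1) :=
    LinearEquiv.ofLinearMap (reflOp r e) (reflOp r e) (reflOp_mul_self hr) (reflOp_mul_self hr)
  have hΦr : ∀ X, Φ X = reflOp r e X := fun _ => rfl
  have hΦ : ∀ X, (Φ X : g₁ k 1) = φ X := fun X => by rw [hΦr, coe_reflOp E hr hφ]
  have F := D.toWallachFrame.map (φ := φ) (fun X hX => by
    rw [show φ X = X from Subtype.ext ((hφ X).trans (reflMat_conj_mem hX))]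
    exact hX) hΦ
  have hI : IsIsotropic (e.map Φ) (fun q => q.1.sec) w ![b, b, c] := by
    have := D.isotropic
    unfold IsIsotropic at this ⊢
    rwa [D.sconst_map hΦ]
  have hst : ∀ i, ∀ ψ ∈ Ad₁ k 1, ∀ X ∈ (p₁ k 1 i).map (φ : g₁ k 1 →ₗ[ℝ] g₁ k 1),
      ψ X ∈ (p₁ k 1 i).map (φ : g₁ k 1 →ₗ[ℝ] g₁ k 1) := by
    rintro i ψ hψ _ ⟨X, hX, rfl⟩
    refine ⟨ψ X, D.stable i ψ hψ X hX, ?_⟩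
    obtain ⟨x, -, h⟩ := exists_of_mem_Ad₁ hψ
    change φ (ψ X) = ψ (φ X)
    refine Subtype.ext ?_
    rw [hφ, h, h, hφ]
    have h1 := congrArg Matrix.conjTranspose (reflMat_comm (r := r) x)
    rw [conjTranspose_mul, conjTranspose_mul] at h1
    rw [← mul_assoc, ← mul_assoc, ← mul_assoc, ← mul_assoc, reflMat_comm,
      mul_assoc _ _ (reflMat k r)ᴴ, h1, ← mul_assoc]
  have hg : diagMetric (k₁ k 1) (fun r => (p₁ k 1 r).map (φ : g₁ k 1 →ₗ[ℝ] g₁ k 1)) (gq q) =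
      diagMetric (k₁ k 1) (p₁ k 1) (gq q) := by
    refine LinearMap.ext fun X => LinearMap.ext fun Y =>
      IsBilin.ext_basis (isBilin_bilinForm _) (isBilin_bilinForm _) (e.map Φ) (fun i j => ?_) X Y
    rw [F.diagMetric_apply, Basis.map_apply, Basis.map_apply, hΦr, hΦr, reflOp_apply, reflOp_apply]
    simp only [map_add, map_smul, LinearMap.add_apply, LinearMap.smul_apply, D.diagMetric_apply, smul_eq_mul]
    rcases i with ⟨i | i | i, ⟨⟩⟩ <;> rcases j with ⟨j | j | j, ⟨⟩⟩ <;>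
      first
      | (by_cases h : i = j <;> simp [Pos.sec, swapPos, gq, h] <;>
          first
          | ring1
          | linear_combination (-2 * w) * hr)
      | simp [Pos.sec, swapPos]
  have hS : swapOp e = diagOp (e.map Φ) (fun q => q.1.sec) ![1, -1, 0] := eq_diagOp fun i => by
    rw [Basis.map_apply, hΦr, swapOp_reflOp]
  have hx := gq_pos hq
  refine ⟨?_, ?_, fun B => ?_⟩
  · rw [hS]
    refine F.diagOp_ne_zero fun h => ?_
    simpa using congrFun h 0
  · rw [hS, ← hg]
    refine F.diagOp_mem_TT hst hx ?_
    rw [D.pair_one_eq_zero_iff]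
    simp
  · rw [hS, ← hg]
    exact F.lichForm_eigen hI hx (kap_swap hq.ne') B

theorem trace_diagOp_mul_swapOp (α : Fin 3 → ℝ) :
    trace ℝ _ (diagOp e (fun q => q.1.sec) α * swapOp e) = 0 := by
  rw [trace_diagOp_mul]
  refine sum_eq_zero fun i _ => ?_
  rw [swapOp_apply, map_smul, Finsupp.smul_apply, Basis.repr_self, Finsupp.single_apply]
  rcases i with ⟨i | i | i, ⟨⟩⟩ <;> simp [Pos.sec, swapPos]

/-- The eigentensors on a Stiefel manifold. -/
theorem exists_eigenFrame_stiefel (hk : 3 ≤ k) (E : IsFlagFrame unitsR e)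
    (D : WallachData (k₁ k 1) (Ad₁ k 1) (p₁ k 1) e (fun q => q.1.sec) w b c) (hq : 0 < q)
    (hquad : (b + c) * q ^ 2 - q + 1 - 2 * c = 0) :
    (∃ A, EigenFrame (k₁ k 1) (Ad₁ k 1) (diagMetric (k₁ k 1) (p₁ k 1) (gq q)) A
      ![lamQ₁ b q, lamQ₂ b c q, lamQ₁ b q] (rhoQ b q / 2)) ∧
      ∀ B ∈ symEndK (k₁ k 1) (Ad₁ k 1) (diagMetric (k₁ k 1) (p₁ k 1) (gq q)), trace ℝ _ B = 0 →
          B ∈ TT (k₁ k 1) (Ad₁ k 1) (diagMetric (k₁ k 1) (p₁ k 1) (gq q)) := by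
  have hx := gq_pos hq
  obtain ⟨h0, hTT, hS⟩ := swapOp_eigen E D hq
  obtain ⟨α, hα, hα0, htr, horth, hspan⟩ := D.exists_eigenvectors (gq_sum hq.ne') (gq_prod hq.ne')
  have hmem : ∀ (β : Fin 3 → ℝ) (z : ℝ), pair (fun q : Pos k 1 × Unit => q.1.sec) β 1 = 0 →
      diagOp e (fun q => q.1.sec) β + z • swapOp e ∈
        TT (k₁ k 1) (Ad₁ k 1) (diagMetric (k₁ k 1) (p₁ k 1) (gq q)) := fun β z hβ =>
    (D.orthBasis hx).add_smul_mem_TT (D.diagOp_mem_TT D.stable hx hβ) hTT z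
  have hpair : ∀ (β : Fin 3 → ℝ) (z : ℝ),
      trace ℝ _ (diagOp e (fun q => q.1.sec) β + z • swapOp e) = 0 →
        pair (fun q : Pos k 1 × Unit => q.1.sec) β 1 = 0 := fun β z h => by
    rwa [map_add, map_smul, hTT.2.1, smul_zero, add_zero, trace_diagOp] at h
  have hsum : ∀ y : Fin 3 → ℝ, ∑ i, y i • (![diagOp e (fun q => q.1.sec) (α 0),
      diagOp e (fun q => q.1.sec) (α 1), swapOp e] : Fin 3 → End ℝ (tangent (k₁ k 1))) i =
      diagOp e (fun q => q.1.sec) (∑ i, ![y 0, y 1] i • α i) + y 2 • swapOp e := fun y => by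
    rw [← WallachData.sum_smul_diagOp, Fin.sum_univ_three, Fin.sum_univ_two]
    rfl
  refine ⟨⟨![diagOp e (fun q => q.1.sec) (α 0), diagOp e (fun q => q.1.sec) (α 1), swapOp e],
    D.isInvMetric D.stable hx, D.isEinstein D.isotropic hx (gq_einstein hq hquad), fun i B _ => ?_,
    fun i => ?_, fun i j hij => ?_, fun y => ?_, fun B hB => ?_⟩, fun B hB hB' => ?_⟩
  · fin_cases i
    · exact D.lichForm_eigen D.isotropic hx (hα 0) B
    · exact D.lichForm_eigen D.isotropic hx (hα 1) B
    · exact hS B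
  · fin_cases i
    · exact D.diagOp_ne_zero (hα0 0)
    · exact D.diagOp_ne_zero (hα0 1)
    · exact h0
  · have h1 : trace ℝ _ (diagOp e (fun q => q.1.sec) (α 0) *
        diagOp e (fun q => q.1.sec) (α 1)) = 0 := by
      rw [trace_diagOp_diagOp, horth]
    fin_cases i <;> fin_cases j
    · exact absurd rfl hij
    · exact h1
    · exact trace_diagOp_mul_swapOp _
    · exact (LinearMap.trace_mul_comm _ _ _).trans h1
    · exact absurd rfl hij
    · exact trace_diagOp_mul_swapOp _
    · exact (LinearMap.trace_mul_comm _ _ _).trans (trace_diagOp_mul_swapOp _)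
    · exact (LinearMap.trace_mul_comm _ _ _).trans (trace_diagOp_mul_swapOp _)
    · exact absurd rfl hij
  · rw [hsum]
    refine hmem _ _ ?_
    rw [WallachData.pair_sum]
    simp [htr]
  · obtain ⟨β, z, rfl⟩ := exists_of_mem_symEndK_stiefel hk E D hq hB.1
    obtain ⟨y, rfl⟩ := hspan β (hpair β z hB.2.1)
    refine ⟨![y 0, y 1, z], ?_⟩
    rw [hsum]
    congr 2
  · obtain ⟨β, z, rfl⟩ := exists_of_mem_symEndK_stiefel hk E D hq hB
    exact hmem β z (hpair β z hB')

/-- The Einstein metrics of the Stiefel manifolds `SO(k + 2)/SO(k)`. -/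
theorem stiefel_row (hk : 3 ≤ k) {l u : ℝ} (hb : b = 1 / (2 * k)) (hc : c = 1 / 2)
    (hq : q = qPlus b c) (hl : l = (2 * k + 1) / (k ^ 2 * (k + 1))) (hu : u = (2 * k + 1) / (k + 1)) :
    q = 2 * k / (k + 1) ∧
      EinsteinRow (k₁ k 1) (Ad₁ k 1) (diagMetric (k₁ k 1) (p₁ k 1) (gq q)) {l, u} l u (k / (k + 1)) ∧
      IsSaddle (k₁ k 1) (Ad₁ k 1) (diagMetric (k₁ k 1) (p₁ k 1) (gq q)) ∧
      HasCoindex (k₁ k 1) (Ad₁ k 1) (diagMetric (k₁ k 1) (p₁ k 1) (gq q)) 2 := by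
  have hk' : (3 : ℝ) ≤ k := by exact_mod_cast hk
  have hk0 : (0 : ℝ) < k := by linarith
  obtain ⟨e, E, D⟩ := exists_wallachData₁ (k := k) (m := 1) (b := b) (c := c) (by omega)
    (by norm_num) (by omega) (fun j j' h => absurd (Subsingleton.elim j j') h)
    (by rw [hb, Nat.cast_one, show (k : ℝ) + 2 * 1 - 2 = k by ring])
    (by rw [hc, Nat.cast_one, show (k : ℝ) + 2 * 1 - 2 = k by ring]; field_simp)
  have hdisc : discQ b c = 1 := by rw [discQ, hc]; ring
  have hq' : q = 2 * k / (k + 1) := by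
    rw [hq, qPlus, hdisc, Real.sqrt_one, hb, hc]
    field_simp
    ring
  have hq0 : 0 < q := by rw [hq']; positivity
  have hbc := (add_pos D.b_pos D.c_pos).ne'
  have hl₁ : lamQ₁ b q = l := by
    rw [lamQ₁, hb, hq', hl]
    field_simp
    ring
  have hl₂ : lamQ₂ b c q = u := by
    rw [lamQ₂, hb, hc, hq', hu]
    field_simp
    ring
  have hρ : rhoQ b q = k / (k + 1) := by
    rw [rhoQ, hb, hq']
    field_simp
    ring
  obtain ⟨⟨A, hA⟩, hspan⟩ := exists_eigenFrame_stiefel hk E D hq0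
    (gq_quadratic hbc (by rw [hdisc]; norm_num) (Or.inl hq))
  rw [hl₁, hl₂, hρ] at hA
  have h2 : 2 * ((k : ℝ) / (k + 1) / 2) = k / (k + 1) := by ring
  have hlr : l < k / (k + 1) := by
    rw [hl, ← div_div, div_lt_div_iff_of_pos_right (by positivity), div_lt_iff₀ (by positivity)]
    nlinarith [mul_pos hk0 hk0]
  have hru : k / (k + 1) < u := by
    rw [hu, div_lt_div_iff_of_pos_right (by positivity)]
    linarith
  have hrange : Set.range ![l, u, l] = {l, u} := by
    ext y
    simp only [Set.mem_range, Fin.exists_fin_succ, Set.mem_insert_iff, Set.mem_singleton_iff]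
    simp [eq_comm]
    tauto
  refine ⟨hq', ⟨hA.metric, hA.einstein, ?_, ?_, ?_, ?_, hA.isUnstable (i := 0) ?_,
    hA.isNondegenerate fun i => ?_⟩, hA.isSaddle (i := 0) (j := 1) ?_ ?_, hA.hasCoindex ?_⟩
  · rw [hA.lichSpec_symEndK D.nontrivial hspan, hrange]
  · rw [hA.lichSpec_TT, hrange]
  · refine ⟨by simp, ?_⟩
    rintro y (rfl | rfl)
    exacts [le_rfl, (hlr.trans hru).le]
  · refine ⟨by simp, ?_⟩
    rintro y (rfl | rfl)
    exacts [(hlr.trans hru).le, le_rfl]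
  · rw [h2]
    exact hlr
  · rw [h2]
    fin_cases i
    exacts [hlr.ne, hru.ne', hlr.ne]
  · rw [h2]
    exact hlr
  · rw [h2]
    exact hru
  · rw [h2]
    have : {i | ![l, u, l] i < k / (k + 1)} = ({0, 2} : Set (Fin 3)) := by
      ext i
      fin_cases i <;> simp [hlr, hru.le]
    change Nat.card {i | ![l, u, l] i < k / (k + 1)} = 2
    rw [this, Nat.card_coe_set_eq, Set.ncard_pair (by decide)]
end Stiefel
end
end InvGeom

theorem mainTheorem4 :
    -- the spectrum in closed form, on every generalized Wallach space with `d_1 = d_2 ≠ d_3`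
    (∀ (L : Type*) [LieRing L] [LieAlgebra ℝ L] [FiniteDimensional ℝ L] (𝔨 : LieSubalgebra ℝ L)
      (Ad : Set (L ≃ₗ⁅ℝ⁆ L)) (p : Fin 3 → Submodule ℝ L), IsGenWallach 𝔨 Ad p →
      Module.finrank ℝ (p 0) = Module.finrank ℝ (p 1) →
      Module.finrank ℝ (p 0) ≠ Module.finrank ℝ (p 2) →
      ∀ b c : ℝ, b = strConst (p 0) (p 1) (p 2) / Module.finrank ℝ (p 0) →
      c = strConst (p 0) (p 1) (p 2) / Module.finrank ℝ (p 2) →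
      (∀ q : ℝ, q = qPlus b c ∨ q = qMinus b c → 0 ≤ discQ b c → 0 < q →
        EinsteinSpec 𝔨 Ad p (diagMetric 𝔨 p (gq q)) (lamQ₁ b q) (lamQ₂ b c q) (rhoQ b q)) ∧
      (∀ t : ℝ, t = pPlus b c ∨ t = pMinus b c → 0 ≤ discP b c → 0 < b → 0 < t →
        EinsteinSpec 𝔨 Ad p (diagMetric 𝔨 p (gp b t)) (lamPMin b c t) (lamPMax b c t)
          (rhoP b t))) ∧
    -- `SO(4)/SO(2)`
    ((∀ b c q : ℝ, b = 1 / 4 → c = 1 / 2 → q = qPlus b c →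
        q = 4 / 3 ∧
        EinsteinRow (k₁ 2 1) (Ad₁ 2 1) (diagMetric (k₁ 2 1) (p₁ 2 1) (gq q))
          {1 / 3, 5 / 12, 5 / 3} (1 / 3) (5 / 3) (2 / 3) ∧
        lichSpec (k₁ 2 1) (diagMetric (k₁ 2 1) (p₁ 2 1) (gq q)) (diagEnd (k₁ 2 1) (p₁ 2 1)) =
          {0, 5 / 12, 5 / 3} ∧
        IsSaddle (k₁ 2 1) (Ad₁ 2 1) (diagMetric (k₁ 2 1) (p₁ 2 1) (gq q)) ∧
        HasCoindex (k₁ 2 1) (Ad₁ 2 1) (diagMetric (k₁ 2 1) (p₁ 2 1) (gq q)) 3) ∧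
      IsInvMetric (k₁ 2 1) (Ad₁ 2 1) gProd ∧ (∃ ρ, IsEinstein (k₁ 2 1) gProd ρ) ∧
      IsUnstable (k₁ 2 1) (Ad₁ 2 1) gProd ∧ IsNondegenerate (k₁ 2 1) (Ad₁ 2 1) gProd ∧
      IsSaddle (k₁ 2 1) (Ad₁ 2 1) gProd ∧ HasCoindex (k₁ 2 1) (Ad₁ 2 1) gProd 1) ∧
    -- `SO(k+2)/SO(k)`, `k ≥ 3`
    (∀ k : ℕ, 3 ≤ k → ∀ b c q l u : ℝ, b = 1 / (2 * k) → c = 1 / 2 → q = qPlus b c →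
      l = (2 * k + 1) / (k ^ 2 * (k + 1)) → u = (2 * k + 1) / (k + 1) →
      q = 2 * k / (k + 1) ∧
      EinsteinRow (k₁ k 1) (Ad₁ k 1) (diagMetric (k₁ k 1) (p₁ k 1) (gq q))
        {l, u} l u (k / (k + 1)) ∧
      IsSaddle (k₁ k 1) (Ad₁ k 1) (diagMetric (k₁ k 1) (p₁ k 1) (gq q)) ∧
      HasCoindex (k₁ k 1) (Ad₁ k 1) (diagMetric (k₁ k 1) (p₁ k 1) (gq q)) 2) ∧
    -- `W₁ = SO(k+2m)/SO(k)×SO(m)×SO(m)`, `m ≥ 3`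
    (∀ k m : ℕ, 1 ≤ k → 3 ≤ m → k ≠ m → ∀ b c : ℝ, b = m / (2 * (k + 2 * m - 2)) →
      c = k / (2 * (k + 2 * m - 2)) →
      (∀ q : ℝ, 4 * m < k ^ 2 + 4 → q = qPlus b c →
        EinsteinRow (k₁ k m) (Ad₁ k m) (diagMetric (k₁ k m) (p₁ k m) (gq q))
          {lamQ₁ b q, lamQ₂ b c q} (lamQ₁ b q) (lamQ₂ b c q) (rhoQ b q) ∧
        IsSaddle (k₁ k m) (Ad₁ k m) (diagMetric (k₁ k m) (p₁ k m) (gq q)) ∧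
        HasCoindex (k₁ k m) (Ad₁ k m) (diagMetric (k₁ k m) (p₁ k m) (gq q)) 1) ∧
      (∀ q : ℝ, 4 * m < k ^ 2 + 4 → q = qMinus b c → 0 < wallachT b c →
        (k < m → EinsteinRow (k₁ k m) (Ad₁ k m) (diagMetric (k₁ k m) (p₁ k m) (gq q))
          {lamQ₁ b q, lamQ₂ b c q} (lamQ₁ b q) (lamQ₂ b c q) (rhoQ b q)) ∧
        (m < k → EinsteinRow (k₁ k m) (Ad₁ k m) (diagMetric (k₁ k m) (p₁ k m) (gq q))
          {lamQ₂ b c q, lamQ₁ b q} (lamQ₂ b c q) (lamQ₁ b q) (rhoQ b q)) ∧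
        IsLocMin (k₁ k m) (Ad₁ k m) (diagMetric (k₁ k m) (p₁ k m) (gq q)) ∧
        HasCoindex (k₁ k m) (Ad₁ k m) (diagMetric (k₁ k m) (p₁ k m) (gq q)) 2) ∧
      (∀ q : ℝ, 4 * m < k ^ 2 + 4 → q = qMinus b c → wallachT b c < 0 →
        EinsteinRow (k₁ k m) (Ad₁ k m) (diagMetric (k₁ k m) (p₁ k m) (gq q))
          {lamQ₂ b c q, lamQ₁ b q} (lamQ₂ b c q) (lamQ₁ b q) (rhoQ b q) ∧
        IsSaddle (k₁ k m) (Ad₁ k m) (diagMetric (k₁ k m) (p₁ k m) (gq q)) ∧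
        HasCoindex (k₁ k m) (Ad₁ k m) (diagMetric (k₁ k m) (p₁ k m) (gq q)) 1) ∧
      wallachT b c ≠ 0 ∧
      (∀ t : ℝ, 0 < wallachT b c → t = pPlus b c ∨ t = pMinus b c →
        EinsteinRow (k₁ k m) (Ad₁ k m) (diagMetric (k₁ k m) (p₁ k m) (gp b t))
          {lamPMin b c t, lamPMax b c t} (lamPMin b c t) (lamPMax b c t) (rhoP b t) ∧
        IsSaddle (k₁ k m) (Ad₁ k m) (diagMetric (k₁ k m) (p₁ k m) (gp b t)) ∧
        HasCoindex (k₁ k m) (Ad₁ k m) (diagMetric (k₁ k m) (p₁ k m) (gp b t)) 1)) ∧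
    -- `W₂ = SU(k+2m)/S(U(k)×U(m)×U(m))`
    (∀ k m : ℕ, 1 ≤ k → 1 ≤ m → k ≠ m → ∀ b c : ℝ, b = m / (2 * (k + 2 * m)) →
      c = k / (2 * (k + 2 * m)) →
      (∀ q u : ℝ, q = qPlus b c → u = (2 * k + m) / (k + 2 * m) →
        q = 2 ∧
        EinsteinRow (k₂ k m) (Ad₂ k m) (diagMetric (k₂ k m) (p₂ k m) (gq q))
          {0, u} 0 u ((k + m) / (k + 2 * m)) ∧
        IsSaddle (k₂ k m) (Ad₂ k m) (diagMetric (k₂ k m) (p₂ k m) (gq q)) ∧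
        HasCoindex (k₂ k m) (Ad₂ k m) (diagMetric (k₂ k m) (p₂ k m) (gq q)) 1) ∧
      (∀ q l u r : ℝ, q = qMinus b c → l = k / (k + m) →
        u = m * (2 * k + m) / ((k + 2 * m) * (k + m)) →
        r = (k ^ 2 + m ^ 2 + 3 * k * m) / ((k + m) * (k + 2 * m)) →
        q = 2 * m / (k + m) ∧
        (k < m → EinsteinRow (k₂ k m) (Ad₂ k m) (diagMetric (k₂ k m) (p₂ k m) (gq q))
          {l, u} l u r) ∧
        (m < k → EinsteinRow (k₂ k m) (Ad₂ k m) (diagMetric (k₂ k m) (p₂ k m) (gq q))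
          {u, l} u l r) ∧
        IsLocMin (k₂ k m) (Ad₂ k m) (diagMetric (k₂ k m) (p₂ k m) (gq q)) ∧
        HasCoindex (k₂ k m) (Ad₂ k m) (diagMetric (k₂ k m) (p₂ k m) (gq q)) 2) ∧
      (∀ t u : ℝ, t = pPlus b c → u = (k + 5 * m) * (k + m) / ((2 * m + k) * (k + 3 * m)) →
        t = (k + 3 * m) / (k + m) ∧
        EinsteinRow (k₂ k m) (Ad₂ k m) (diagMetric (k₂ k m) (p₂ k m) (gp b t))
          {0, u} 0 u ((m + k) / (k + 2 * m)) ∧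
        IsSaddle (k₂ k m) (Ad₂ k m) (diagMetric (k₂ k m) (p₂ k m) (gp b t)) ∧
        HasCoindex (k₂ k m) (Ad₂ k m) (diagMetric (k₂ k m) (p₂ k m) (gp b t)) 1) ∧
      (∀ t u : ℝ, t = pMinus b c → u = (k + 5 * m) / (k + 2 * m) →
        t = (k + m) / (k + 3 * m) ∧
        EinsteinRow (k₂ k m) (Ad₂ k m) (diagMetric (k₂ k m) (p₂ k m) (gp b t))
          {0, u} 0 u ((k + 3 * m) / (k + 2 * m)) ∧
        IsSaddle (k₂ k m) (Ad₂ k m) (diagMetric (k₂ k m) (p₂ k m) (gp b t)) ∧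
        HasCoindex (k₂ k m) (Ad₂ k m) (diagMetric (k₂ k m) (p₂ k m) (gp b t)) 1)) ∧
    -- `W₃ = Sp(k+2m)/Sp(k)×Sp(m)×Sp(m)`
    (∀ k m : ℕ, 1 ≤ k → 1 ≤ m → k ≠ m → ∀ b c : ℝ, b = m / (2 * (k + 2 * m + 1)) →
      c = k / (2 * (k + 2 * m + 1)) →
      (∀ q : ℝ, q = qPlus b c →
        EinsteinRow (k₃ k m) (Ad₃ k m) (diagMetric (k₃ k m) (p₃ k m) (gq q))
          {lamQ₁ b q, lamQ₂ b c q} (lamQ₁ b q) (lamQ₂ b c q) (rhoQ b q) ∧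
        IsSaddle (k₃ k m) (Ad₃ k m) (diagMetric (k₃ k m) (p₃ k m) (gq q)) ∧
        HasCoindex (k₃ k m) (Ad₃ k m) (diagMetric (k₃ k m) (p₃ k m) (gq q)) 1) ∧
      (∀ q : ℝ, q = qMinus b c →
        (k < m → EinsteinRow (k₃ k m) (Ad₃ k m) (diagMetric (k₃ k m) (p₃ k m) (gq q))
          {lamQ₁ b q, lamQ₂ b c q} (lamQ₁ b q) (lamQ₂ b c q) (rhoQ b q)) ∧
        (m < k → EinsteinRow (k₃ k m) (Ad₃ k m) (diagMetric (k₃ k m) (p₃ k m) (gq q))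
          {lamQ₂ b c q, lamQ₁ b q} (lamQ₂ b c q) (lamQ₁ b q) (rhoQ b q)) ∧
        IsLocMin (k₃ k m) (Ad₃ k m) (diagMetric (k₃ k m) (p₃ k m) (gq q)) ∧
        HasCoindex (k₃ k m) (Ad₃ k m) (diagMetric (k₃ k m) (p₃ k m) (gq q)) 2) ∧
      (∀ t : ℝ, t = pPlus b c ∨ t = pMinus b c →
        EinsteinRow (k₃ k m) (Ad₃ k m) (diagMetric (k₃ k m) (p₃ k m) (gp b t))
          {lamPMin b c t, lamPMax b c t} (lamPMin b c t) (lamPMax b c t) (rhoP b t) ∧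
        IsSaddle (k₃ k m) (Ad₃ k m) (diagMetric (k₃ k m) (p₃ k m) (gp b t)) ∧
        HasCoindex (k₃ k m) (Ad₃ k m) (diagMetric (k₃ k m) (p₃ k m) (gp b t)) 1)) ∧
    -- `W₅ = SO(2l)/U(1)×U(l-1)`
    (∀ l : ℕ, 5 ≤ l → ∀ b c : ℝ, b = (l - 2) / (4 * (l - 1)) → c = 1 / (2 * (l - 1)) →
      (∀ q u : ℝ, q = qPlus b c → u = (l + 2) / (2 * (l - 1)) →
        q = 2 ∧
        EinsteinRow (k₅ l) (Ad₅ l) (diagMetric (k₅ l) (p₅ l) (gq q))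
          {0, u} 0 u (l / (2 * (l - 1))) ∧
        IsSaddle (k₅ l) (Ad₅ l) (diagMetric (k₅ l) (p₅ l) (gq q)) ∧
        HasCoindex (k₅ l) (Ad₅ l) (diagMetric (k₅ l) (p₅ l) (gq q)) 1) ∧
      (∀ q u : ℝ, q = qMinus b c → u = (l ^ 2 - 4) / (2 * l * (l - 1)) →
        q = 2 * (l - 2) / l ∧
        EinsteinRow (k₅ l) (Ad₅ l) (diagMetric (k₅ l) (p₅ l) (gq q))
          {2 / (l : ℝ), u} (2 / l) u ((l ^ 2 + 2 * l - 4) / (2 * l * (l - 1))) ∧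
        IsLocMin (k₅ l) (Ad₅ l) (diagMetric (k₅ l) (p₅ l) (gq q)) ∧
        HasCoindex (k₅ l) (Ad₅ l) (diagMetric (k₅ l) (p₅ l) (gq q)) 2) ∧
      (∀ t u : ℝ, t = pPlus b c → u = l * (5 * l - 8) / (2 * (3 * l ^ 2 - 7 * l + 4)) →
        t = (3 * l - 4) / l ∧
        EinsteinRow (k₅ l) (Ad₅ l) (diagMetric (k₅ l) (p₅ l) (gp b t))
          {0, u} 0 u (l / (2 * (l - 1))) ∧
        IsSaddle (k₅ l) (Ad₅ l) (diagMetric (k₅ l) (p₅ l) (gp b t)) ∧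
        HasCoindex (k₅ l) (Ad₅ l) (diagMetric (k₅ l) (p₅ l) (gp b t)) 1) ∧
      (∀ t u : ℝ, t = pMinus b c → u = (5 * l - 8) / (2 * (l - 1)) →
        t = l / (3 * l - 4) ∧
        EinsteinRow (k₅ l) (Ad₅ l) (diagMetric (k₅ l) (p₅ l) (gp b t))
          {0, u} 0 u ((3 * l - 4) / (2 * (l - 1))) ∧
        IsSaddle (k₅ l) (Ad₅ l) (diagMetric (k₅ l) (p₅ l) (gp b t)) ∧
        HasCoindex (k₅ l) (Ad₅ l) (diagMetric (k₅ l) (p₅ l) (gp b t)) 1)) := by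
  refine ⟨?_, ?_, ?_, ?_, ?_, ?_, ?_⟩
  · intro L _ _ _ 𝔨 Ad p h hd hd' b c hb hc
    exact ⟨fun q hq hdisc hq0 => h.einsteinSpec_q hd hb hc hq hdisc hq0,
      fun t ht hdisc hb0 ht0 => h.einsteinSpec_p hd hb hc ht hdisc hb0 ht0⟩
  · exact ⟨fun b c q hb hc hq => unitTangent_row hb hc hq, gProd_facts⟩
  · exact fun k hk b c q l u hb hc hq hl hu => stiefel_row hk hb hc hq hl hu
  · intro k m hk hm hkm b c hb hc
    obtain ⟨e, E, D⟩ := exists_wallachData₁ (k := k) (m := m) (by omega) (by omega) (by omega)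
      (fun j j' _ => exists_ne_ne hm j j') hb hc
    have hS := isSchur₁ E hm
    obtain ⟨h8, hc2, hb2, hd, ho, ho'⟩ := real_bounds hk hm hb hc
    have hN : (0 : ℝ) < 2 * (k + 2 * m - 2) := by
      have : (3 : ℝ) ≤ m := by exact_mod_cast hm
      have : (0 : ℝ) ≤ k := Nat.cast_nonneg k
      linarith
    have hcb : c < b ↔ k < m := (lt_iff_div_lt hN hb hc).trans Nat.cast_lt
    have hbc : b < c ↔ m < k := (lt_iff_div_lt hN hc hb).trans Nat.cast_lt
    have hne : b ≠ c := fun h => by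
      rcases lt_or_gt_of_ne hkm with h' | h'
      · exact (hcb.2 h').ne' h
      · exact (hbc.2 h').ne h
    refine ⟨fun q h hq => D.row_qPlus hS h8 (hd h) hq, fun q h hq hT => ?_,
      fun q h hq hT => D.row_qMinus' hS hc2 h8 (hd h) hT hq, wallachT_ne_zero hk hm hb hc,
      fun t hT ht => D.row_lamP hS hb2 hT ht⟩
    rw [← hcb, ← hbc]
    exact D.row_qMinus hS hc2 h8 (hd h) hT hq ho (fun _ => ho' h) hne
  · intro k m hk hm hkm b c hb hc
    obtain ⟨e, hS, D⟩ := exists_wallachData₂ (k := k) (m := m) hk hm hb hc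
    have hk' : (0 : ℝ) < k := Nat.cast_pos.2 hk
    have hm' : (0 : ℝ) < m := Nat.cast_pos.2 hm
    refine ⟨fun q u hq hu => D.half_qPlus hS hk' hm' hb hc hq hu rfl, fun q l u r hq hl hu hr => ?_,
      fun t u ht hu => D.half_pPlus hS hk' hm' hb hc ht hu rfl,
      fun t u ht hu => D.half_pMinus hS hk' hm' hb hc ht hu rfl⟩
    have := D.half_qMinus hS hk' hm' (Nat.cast_injective.ne hkm) hb hc hq hl hu hr
    rwa [Nat.cast_lt, Nat.cast_lt] at this
  · intro k m hk hm hkm b c hb hc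
    obtain ⟨e, hS, D⟩ := exists_wallachData₃ (k := k) (m := m) hk hm hb hc
    obtain ⟨h8, hc2, hb2, hd, ho, ho', hT⟩ := quaternion_bounds hk hm hkm hb hc
    have hN : (0 : ℝ) < 2 * (k + 2 * m + 1) := by positivity
    have hcb : c < b ↔ k < m := (lt_iff_div_lt hN hb hc).trans Nat.cast_lt
    have hbc : b < c ↔ m < k := (lt_iff_div_lt hN hc hb).trans Nat.cast_lt
    have hne : b ≠ c := fun h => by
      rcases lt_or_gt_of_ne hkm with h' | h'
      · exact (hcb.2 h').ne' h
      · exact (hbc.2 h').ne h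
    refine ⟨fun q hq => D.row_qPlus hS h8 hd hq, fun q hq => ?_, fun t ht => D.row_lamP hS hb2 hT ht⟩
    rw [← hcb, ← hbc]
    exact D.row_qMinus hS hc2 h8 hd hT hq ho (fun _ => ho') hne
  · intro l hl b c hb hc
    obtain ⟨n, rfl⟩ : ∃ n, l = n + 1 := ⟨l - 1, by omega⟩
    have hl' : ((n + 1 : ℕ) : ℝ) = n + 1 := Nat.cast_succ n
    obtain ⟨e, hS, D⟩ := CPos.exists_wallachData (n := n) (by omega)
    refine WallachData.hermitian_rows (e := e) (s := CPos.sec)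
      (w := 4 * killConst (Fin (n + 1) ⊕ Fin (n + 1)) Unit) ?_ hS
      (by exact_mod_cast (by omega : 4 < n + 1)) hb hc
    convert D using 1
    · rw [hb, hl']; ring
    · rw [hc, hl']; ring
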